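/- Let $n\ge 3$, let $M$ be a smooth $n$-dimensional manifold and let $g$ be a pseudo-Riemannian metric on $M$ with Levi-Civita connection $\nabla$, Ricci tensor $R_{ij}$, scalar curvature $\mathrm{Scal}$ and curvature tensor $R_{ijkl}$, where $\nabla_i\nabla_jv_k-\nabla_j\nabla_iv_k=R_{ijk}{}^{l}v_l$ and $R_{ij}=R_{ikj}{}^{k}$. Put $m=\infty$ if $n$ is odd and $m=\frac n2-1$ if $n$ is even. Assume that $g$ is a *null Ricci Walker metric*: there is a smooth distribution $\mathcal N\subset TM$ of some rank $p>0$ which is totally null, parallel for $\nabla$, and contains the image of the Schouten tensor $\mathsf P=\frac1{n-2}\big(\mathrm{Ric}-\frac{\mathrm{Scal}}{2(n-1)}g\big)$. Assume moreover that $p=1$ or that $X\lrcorner R=0$ for all $X\in\mathcal N$. For a smooth family $h=h(x,\rho)$, $|\rho|<\varepsilon$, of symmetric bilinear forms on $M$ with $h|_{\rho=0}=0$, consider on $(0,\infty)\times M\times(-\varepsilon,\varepsilon)$ $$\widetilde g=2\,dt\,d(\rho t)+t^2\big(g+h(\rho)\big).$$ It is called an *ambient metric for $[g]$ in normal form with respect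 to $g$* (given by $h$) if $g+h(\rho)$ is nondegenerate for $|\rho|<\varepsilon$, $\mathrm{Ric}(\widetilde g)=O(\rho^m)$, and, when $n$ is even, $\mathrm{tr}_g\big(\rho^{1-n/2}\,\mathrm{Ric}(\widetilde g)|_{TM\otimes TM}\big)=0$ at $\rho=0$. For $n$ even, the *obstruction tensor* of $g$ is $\mathcal O=\kappa_n\,\big(\rho^{1-n/2}\,\mathrm{Ric}(\widetilde g)|_{TM\otimes TM}\big)|_{\rho=0}$ for any such ambient metric $\widetilde g$, where $\kappa_n\neq0$ is a fixed normalising constant depending only on $n$. Indices are raised with $g$, $\Box=\nabla^k\nabla_k$ is the tensor Laplacian of $g$, the image of a bilinear form is that of the associated endomorphism, a dot denotes $\partial_\rho$, and $$\mathcal A_{ij}(h)=2\rho\,\ddot h_{ij}+(2-n)\,\dot h_{ij}+2R_{kijl}h^{kl}-\Box h_{ij}.$$ Then: 1. There are $\varepsilon>0$ and a family $h$ as above that, for every $\rho$, is divergence free and satisfies $\mathrm{Im}(h)\subset\mathcal N$ and $\mathcal L_Xh=0$ for all (local) sections $X$ of $\mathcal N$, which solves the linear system $$\mathcal A_{ij}(h)+2R_{ij}=O(\rho^m),$$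 and which gives an ambient metric. 2. For every family $h$ as above (any $\varepsilon>0$) that, for every $\rho$, is divergence free and satisfies $\mathrm{Im}(h)\subset\mathcal N$ and $\mathcal L_Xh=0$ for all sections $X$ of $\mathcal N$, the curvature term $R_{kijl}h^{kl}$ vanishes, and $h$ gives an ambient metric if and only if it solves the linear system $\mathcal A_{ij}(h)+2R_{ij}=O(\rho^m)$. 3. If $n$ is even, the obstruction tensor exists, does not depend on the ambient metric used to compute it, and is given by $$\mathcal O_{ij}=c_n\,\Box^{\frac n2-1}R_{ij},$$ where $c_n$ is a nonzero constant depending only on $n$ (and on the normalisation $\kappa_n$). Moreover $\mathrm{Im}(\mathcal O)\subset\mathcal N$, and $\nabla_X\mathcal O=0$ and $\mathcal L_X\mathcal O=0$ for all $X\in\mathcal N$. -/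

import Mathlib

open scoped Manifold ContDiff

noncomputable section

namespace NullRicciWalker

/-! ### Tensor calculus in coordinates

`ι` is a finite index set, `y` a point of the coordinate space `EuclideanSpace ℝ ι`; a metric or a
`(0,2)`-tensor is given by its matrix of components, a function of `y`. -/

section Coordinates

variable {ι : Type*} [Fintype ι] [DecidableEq ι]

/-- The partial derivative `∂ᵢ f`. -/
def pd (i : ι) (f : EuclideanSpace ℝ ι → ℝ) (y : EuclideanSpace ℝ ι) : ℝ :=
  fderiv ℝ f y (EuclideanSpace.single i 1)

/-- Christoffel symbols `Γᵏᵢⱼ` of the Levi-Civita connection of the metric `G`. -/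
def christoffel (G : EuclideanSpace ℝ ι → Matrix ι ι ℝ) (k i j : ι)
    (y : EuclideanSpace ℝ ι) : ℝ :=
  (1 / 2) * ∑ l, (G y)⁻¹ k l *
    (pd i (fun z => G z j l) y + pd j (fun z => G z i l) y - pd l (fun z => G z i j) y)

/-- The component `Rˡ` of the curvature `R(∂ᵢ, ∂ⱼ) ∂ₖ = ∇ᵢ∇ⱼ∂ₖ - ∇ⱼ∇ᵢ∂ₖ`. -/
def riemUp (G : EuclideanSpace ℝ ι → Matrix ι ι ℝ) (l k i j : ι)
    (y : EuclideanSpace ℝ ι) : ℝ :=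
  pd i (christoffel G l j k) y - pd j (christoffel G l i k) y +
    ∑ m, (christoffel G l i m y * christoffel G m j k y -
      christoffel G l j m y * christoffel G m i k y)

/-- The curvature tensor `Rᵢⱼₖₗ = G(R(∂ᵢ, ∂ⱼ) ∂ₗ, ∂ₖ)`. Equivalently
`∇ᵢ∇ⱼ vₖ - ∇ⱼ∇ᵢ vₖ = Rᵢⱼₖˡ vₗ` for one-forms `v`. -/
def riem (G : EuclideanSpace ℝ ι → Matrix ι ι ℝ) (i j k l : ι)
    (y : EuclideanSpace ℝ ι) : ℝ :=
  ∑ m, G y k m * riemUp G m l i j y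

/-- The Ricci tensor `Rᵢⱼ = Rᵢₖⱼᵏ`, the trace of `Z ↦ R(Z, ∂ᵢ) ∂ⱼ`. -/
def ric (G : EuclideanSpace ℝ ι → Matrix ι ι ℝ) (y : EuclideanSpace ℝ ι) : Matrix ι ι ℝ :=
  Matrix.of fun i j => ∑ k, riemUp G k j k i y

/-- The scalar curvature. -/
def scal (G : EuclideanSpace ℝ ι → Matrix ι ι ℝ) (y : EuclideanSpace ℝ ι) : ℝ :=
  ∑ i, ∑ j, (G y)⁻¹ i j * ric G y i j

/-- The Schouten tensor `P = (Ric - Scal / (2 (n - 1)) G) / (n - 2)`, where `n = |ι|`. -/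
def schouten (G : EuclideanSpace ℝ ι → Matrix ι ι ℝ) (y : EuclideanSpace ℝ ι) : Matrix ι ι ℝ :=
  (1 / ((Fintype.card ι : ℝ) - 2)) •
    (ric G y - (scal G y / (2 * ((Fintype.card ι : ℝ) - 1))) • G y)

/-- The components `∇ᵢ Yᵏ` of the covariant derivative of a vector field, as a vector
(`i` is the direction of differentiation). -/
def covVec (G : EuclideanSpace ℝ ι → Matrix ι ι ℝ)
    (Y : EuclideanSpace ℝ ι → EuclideanSpace ℝ ι) (i : ι) (y : EuclideanSpace ℝ ι) :
    EuclideanSpace ℝ ι :=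
  WithLp.toLp 2 fun k => pd i (fun z => Y z k) y + ∑ l, christoffel G k i l y * Y y l

/-- The covariant derivative `∇ₖ Sᵢⱼ` of a `(0,2)`-tensor. -/
def cov2 (G S : EuclideanSpace ℝ ι → Matrix ι ι ℝ) (k i j : ι)
    (y : EuclideanSpace ℝ ι) : ℝ :=
  pd k (fun z => S z i j) y -
    ∑ l, (christoffel G l k i y * S y l j + christoffel G l k j y * S y i l)

/-- The second covariant derivative `∇ₗ∇ₖ Sᵢⱼ`. -/
def cov2cov2 (G S : EuclideanSpace ℝ ι → Matrix ι ι ℝ) (l k i j : ι)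
    (y : EuclideanSpace ℝ ι) : ℝ :=
  pd l (cov2 G S k i j) y -
    ∑ m, (christoffel G m l k y * cov2 G S m i j y + christoffel G m l i y * cov2 G S k m j y +
      christoffel G m l j y * cov2 G S k i m y)

/-- The tensor Laplacian `□ Sᵢⱼ = ∇ᵏ∇ₖ Sᵢⱼ`. -/
def box (G S : EuclideanSpace ℝ ι → Matrix ι ι ℝ) (y : EuclideanSpace ℝ ι) : Matrix ι ι ℝ :=
  Matrix.of fun i j => ∑ l, ∑ k, (G y)⁻¹ l k * cov2cov2 G S l k i j y

/-- The divergence `∇ᵏ Sₖⱼ`. -/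
def divergence (G S : EuclideanSpace ℝ ι → Matrix ι ι ℝ) (j : ι)
    (y : EuclideanSpace ℝ ι) : ℝ :=
  ∑ k, ∑ l, (G y)⁻¹ l k * cov2 G S l k j y

/-- The Lie derivative `(ℒ_X S)ᵢⱼ`. -/
def lieDer (X : EuclideanSpace ℝ ι → EuclideanSpace ℝ ι)
    (S : EuclideanSpace ℝ ι → Matrix ι ι ℝ) (i j : ι) (y : EuclideanSpace ℝ ι) : ℝ :=
  ∑ k, (X y k * pd k (fun z => S z i j) y + pd i (fun z => X z k) y * S y k j +
    pd j (fun z => X z k) y * S y i k)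

/-- The vector `S♯ v`, where `G(S♯ v, w) = S(v, w)` for the symmetric tensor `S`. -/
def sharp (G S : Matrix ι ι ℝ) (v : EuclideanSpace ℝ ι) : EuclideanSpace ℝ ι :=
  WithLp.toLp 2 (G⁻¹.mulVec (S.mulVec v))

/-- The curvature term `Rᵏᵢⱼˡ Sₖₗ = Rₖᵢⱼₗ Sᵏˡ`, indices raised with `G`. -/
def curvTerm (G S : EuclideanSpace ℝ ι → Matrix ι ι ℝ) (i j : ι)
    (y : EuclideanSpace ℝ ι) : ℝ :=
  ∑ k, ∑ l, riem G k i j l y * ((G y)⁻¹ * S y * (G y)⁻¹) k l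

/-- The linear operator
`𝒜ᵢⱼ(h) = 2 ρ ∂ρ²hᵢⱼ + (2 - n) ∂ρhᵢⱼ + 2 Rᵏᵢⱼˡ hₖₗ - □ hᵢⱼ`
on a `ρ`-dependent `(0,2)`-tensor `h`, where `n = |ι|`. -/
def opA (G : EuclideanSpace ℝ ι → Matrix ι ι ℝ) (h : ℝ → EuclideanSpace ℝ ι → Matrix ι ι ℝ)
    (i j : ι) (ρ : ℝ) (y : EuclideanSpace ℝ ι) : ℝ :=
  2 * ρ * iteratedDeriv 2 (fun r => h r y i j) ρ +
    (2 - (Fintype.card ι : ℝ)) * deriv (fun r => h r y i j) ρ +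
    2 * curvTerm G (h ρ) i j y - box G (h ρ) y i j

end Coordinates

/-! ### Orders of vanishing -/

/-- `f = O(ρᵐ)` for a function `f` smooth near `ρ = 0`: all derivatives of order less than `m`
vanish at `0`. For `m = ⊤` this is vanishing to infinite order. -/
def VanishesToOrder (m : ℕ∞) (f : ℝ → ℝ) : Prop :=
  ∀ k : ℕ, (k : ℕ∞) < m → iteratedDeriv k f 0 = 0

/-- The `m`-th Taylor coefficient at `0`, which is the value of `ρ⁻ᵐ f(ρ)` at `ρ = 0` when
`f` is smooth and `f = O(ρᵐ)`. -/
def leadingCoeff (m : ℕ) (f : ℝ → ℝ) : ℝ :=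
  iteratedDeriv m f 0 / (m.factorial : ℝ)

/-- The order in the Fefferman-Graham equations in dimension `n`: infinite for odd `n`,
and `n / 2 - 1` for even `n`. -/
def fgOrder (n : ℕ) : ℕ∞ :=
  if Even n then ((n / 2 - 1 : ℕ) : ℕ∞) else ⊤

/-! ### The ambient space in coordinates -/

/-- Indices of the coordinates `(t, xⁱ, ρ)`. -/
abbrev AmbIdx (n : ℕ) : Type := Fin 1 ⊕ (Fin n ⊕ Fin 1)

/-- The point with coordinates `(t, x, ρ)`. -/
def ambPoint {n : ℕ} (t : ℝ) (x : EuclideanSpace ℝ (Fin n)) (ρ : ℝ) :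
    EuclideanSpace ℝ (AmbIdx n) :=
  WithLp.toLp 2 (Sum.elim (fun _ => t) (Sum.elim (fun i => x i) (fun _ => ρ)))

/-- The components of `2 dt d(ρt) + t² G(ρ) = 2ρ dt² + 2t dt dρ + t² Gᵢⱼ(x, ρ) dxⁱ dxʲ`
in the coordinates `(t, xⁱ, ρ)`. -/
def ambMetric {n : ℕ} (G : ℝ → EuclideanSpace ℝ (Fin n) → Matrix (Fin n) (Fin n) ℝ)
    (z : EuclideanSpace ℝ (AmbIdx n)) : Matrix (AmbIdx n) (AmbIdx n) ℝ :=
  Matrix.of fun a b =>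
    match a, b with
    | Sum.inl _, Sum.inl _ => 2 * z (Sum.inr (Sum.inr 0))
    | Sum.inl _, Sum.inr (Sum.inr _) => z (Sum.inl 0)
    | Sum.inr (Sum.inr _), Sum.inl _ => z (Sum.inl 0)
    | Sum.inr (Sum.inl i), Sum.inr (Sum.inl j) =>
        z (Sum.inl 0) ^ 2 *
          G (z (Sum.inr (Sum.inr 0))) (WithLp.toLp 2 fun k => z (Sum.inr (Sum.inl k))) i j
    | _, _ => 0

/-! ### Tensors and distributions on a manifold -/

section Manifold

universe u

variable {n : ℕ} {M : Type u} [TopologicalSpace M] [ChartedSpace (EuclideanSpace ℝ (Fin n)) M]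

/-- A field of bilinear forms on the tangent spaces of the `n`-manifold `M`. -/
abbrev BilinField (n : ℕ) (M : Type u) [TopologicalSpace M]
    [ChartedSpace (EuclideanSpace ℝ (Fin n)) M] : Type u :=
  (x : M) → TangentSpace (𝓡 n) x →L[ℝ] TangentSpace (𝓡 n) x →L[ℝ] ℝ

/-- A field of subspaces of the tangent spaces of the `n`-manifold `M`. -/
abbrev SubspaceField (n : ℕ) (M : Type u) [TopologicalSpace M]
    [ChartedSpace (EuclideanSpace ℝ (Fin n)) M] : Type u :=
  (x : M) → Submodule ℝ (TangentSpace (𝓡 n) x)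

/-- The smooth charts of `M` (the maximal atlas). -/
abbrev charts (n : ℕ) (M : Type u) [TopologicalSpace M]
    [ChartedSpace (EuclideanSpace ℝ (Fin n)) M] :
    Set (OpenPartialHomeomorph M (EuclideanSpace ℝ (Fin n))) :=
  IsManifold.maximalAtlas (𝓡 n) ∞ M

/-- The components `b(∂ᵢ, ∂ⱼ)` of `b` in the chart `e`, as functions on `e.target`. -/
def comp (e : OpenPartialHomeomorph M (EuclideanSpace ℝ (Fin n))) (b : BilinField n M)
    (y : EuclideanSpace ℝ (Fin n)) : Matrix (Fin n) (Fin n) ℝ :=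
  Matrix.of fun i j =>
    b (e.symm y) (mfderiv (𝓡 n) (𝓡 n) e.symm y (EuclideanSpace.single i (1 : ℝ)))
      (mfderiv (𝓡 n) (𝓡 n) e.symm y (EuclideanSpace.single j (1 : ℝ)))

/-- The subspaces of the coordinate space that correspond to `N` in the chart `e`. -/
def compSub (e : OpenPartialHomeomorph M (EuclideanSpace ℝ (Fin n))) (N : SubspaceField n M)
    (y : EuclideanSpace ℝ (Fin n)) : Submodule ℝ (EuclideanSpace ℝ (Fin n)) :=
  Submodule.comap (mfderiv (𝓡 n) (𝓡 n) e.symm y).toLinearMap (N (e.symm y))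

/-- `X` is, in the chart `e`, a smooth section of `N` over the open set `U`. -/
def IsLocalSection (e : OpenPartialHomeomorph M (EuclideanSpace ℝ (Fin n)))
    (N : SubspaceField n M) (U : Set (EuclideanSpace ℝ (Fin n)))
    (X : EuclideanSpace ℝ (Fin n) → EuclideanSpace ℝ (Fin n)) : Prop :=
  IsOpen U ∧ U ⊆ e.target ∧ ContDiffOn ℝ ∞ X U ∧ ∀ y ∈ U, X y ∈ compSub e N y

/-- `g` is a (smooth) pseudo-Riemannian metric. -/
structure IsPseudoRiemannian (g : BilinField n M) : Prop where
  smooth : ∀ e ∈ charts n M, ∀ i j, ContDiffOn ℝ ∞ (fun y => comp e g y i j) e.target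
  symm : ∀ x v w, g x v w = g x w v
  nondegenerate : ∀ x v, (∀ w, g x v w = 0) → v = 0

/-- `N` is a smooth distribution of rank `p`. -/
def IsDistribution (p : ℕ) (N : SubspaceField n M) : Prop :=
  ∀ x : M, ∃ e ∈ charts n M, x ∈ e.source ∧
    ∃ Y : Fin p → EuclideanSpace ℝ (Fin n) → EuclideanSpace ℝ (Fin n),
      (∀ a, ContDiffOn ℝ ∞ (Y a) e.target) ∧
      ∀ y ∈ e.target, LinearIndependent ℝ (fun a => Y a y) ∧
        Submodule.span ℝ (Set.range fun a => Y a y) = compSub e N y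

/-- `N` is parallel for the Levi-Civita connection of `g`: covariant derivatives of sections of
`N` are sections of `N`. -/
def IsParallel (g : BilinField n M) (N : SubspaceField n M) : Prop :=
  ∀ e ∈ charts n M, ∀ U Y, IsLocalSection e N U Y →
    ∀ y ∈ U, ∀ i, covVec (comp e g) Y i y ∈ compSub e N y

/-- `g` is a null Ricci Walker metric: `N` is a parallel, totally null distribution of positive
rank `p` that contains the image of the Schouten tensor of `g`. -/
structure IsNullRicciWalker (p : ℕ) (g : BilinField n M) (N : SubspaceField n M) : Prop where
  metric : IsPseudoRiemannian g
  rank_pos : 0 < p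
  distribution : IsDistribution p N
  null : ∀ x, ∀ v ∈ N x, ∀ w ∈ N x, g x v w = 0
  parallel : IsParallel g N
  schouten_image : ∀ e ∈ charts n M, ∀ y ∈ e.target, ∀ v,
    sharp (comp e g y) (schouten (comp e g) y) v ∈ compSub e N y

/-- `N ⌟ R = 0`: the curvature tensor vanishes when a vector of `N` is inserted. -/
def CurvatureAnnihilated (g : BilinField n M) (N : SubspaceField n M) : Prop :=
  ∀ e ∈ charts n M, ∀ y ∈ e.target, ∀ v ∈ compSub e N y, ∀ j k l,
    ∑ i, v i * riem (comp e g) i j k l y = 0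

/-- `Im(b) ⊆ N`. -/
def ImageIn (g : BilinField n M) (N : SubspaceField n M) (b : BilinField n M) : Prop :=
  ∀ e ∈ charts n M, ∀ y ∈ e.target, ∀ v, sharp (comp e g y) (comp e b y) v ∈ compSub e N y

/-- `b` is divergence free with respect to `g`. -/
def DivergenceFree (g b : BilinField n M) : Prop :=
  ∀ e ∈ charts n M, ∀ y ∈ e.target, ∀ j, divergence (comp e g) (comp e b) j y = 0

/-- `ℒ_X b = 0` for all (local) sections `X` of `N`. -/
def LieInvariant (N : SubspaceField n M) (b : BilinField n M) : Prop :=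
  ∀ e ∈ charts n M, ∀ U X, IsLocalSection e N U X →
    ∀ y ∈ U, ∀ i j, lieDer X (comp e b) i j y = 0

/-- `∇_X b = 0` for all `X` in `N`. -/
def ParallelAlong (g : BilinField n M) (N : SubspaceField n M) (b : BilinField n M) : Prop :=
  ∀ e ∈ charts n M, ∀ y ∈ e.target, ∀ v ∈ compSub e N y, ∀ i j,
    ∑ k, v k * cov2 (comp e g) (comp e b) k i j y = 0

/-- `h` is a smooth family, with parameter `ρ ∈ (-ε, ε)`, of symmetric bilinear forms on `M`
with `h = 0` at `ρ = 0`. -/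
structure IsPerturbation (ε : ℝ) (h : ℝ → BilinField n M) : Prop where
  eps_pos : 0 < ε
  smooth : ∀ e ∈ charts n M, ∀ i j,
    ContDiffOn ℝ ∞ (fun q : ℝ × EuclideanSpace ℝ (Fin n) => comp e (h q.1) q.2 i j)
      (Set.Ioo (-ε) ε ×ˢ e.target)
  symm : ∀ ρ ∈ Set.Ioo (-ε) ε, ∀ x v w, h ρ x v w = h ρ x w v
  zero : h 0 = 0

/-- The Ricci tensor, at the point `(t, y, ρ)`, of `2 dt d(ρt) + t² (g + h)` in the coordinates
`(t, xⁱ, ρ)` obtained from the chart `e`. -/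
def ambRic (g : BilinField n M) (h : ℝ → BilinField n M)
    (e : OpenPartialHomeomorph M (EuclideanSpace ℝ (Fin n))) (t : ℝ)
    (y : EuclideanSpace ℝ (Fin n)) (ρ : ℝ) : Matrix (AmbIdx n) (AmbIdx n) ℝ :=
  ric (ambMetric fun r z => comp e g z + comp e (h r) z) (ambPoint t y ρ)

/-- The value at `ρ = 0` of `ρ ^ (1 - n/2) Ricᵢⱼ`, for `Ric` the Ricci tensor of
`2 dt d(ρt) + t² (g + h)` and `i, j` indices on `M` (for `n` even). -/
def ambRicCoeff (g : BilinField n M) (h : ℝ → BilinField n M)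
    (e : OpenPartialHomeomorph M (EuclideanSpace ℝ (Fin n))) (t : ℝ)
    (y : EuclideanSpace ℝ (Fin n)) (i j : Fin n) : ℝ :=
  leadingCoeff (n / 2 - 1)
    (fun ρ => ambRic g h e t y ρ (Sum.inr (Sum.inl i)) (Sum.inr (Sum.inl j)))

/-- `2 dt d(ρt) + t² (g + h)` is an ambient metric on `(0, ∞) × M × (-ε, ε)` for the conformal
class of `g`, in normal form with respect to `g`. -/
structure IsAmbientMetric (g : BilinField n M) (ε : ℝ) (h : ℝ → BilinField n M) : Prop where
  perturbation : IsPerturbation ε h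
  nondegenerate : ∀ ρ ∈ Set.Ioo (-ε) ε, ∀ x v, (∀ w, g x v w + h ρ x v w = 0) → v = 0
  ricci : ∀ e ∈ charts n M, ∀ y ∈ e.target, ∀ t > 0, ∀ a b,
    VanishesToOrder (fgOrder n) (fun ρ => ambRic g h e t y ρ a b)
  trace : Even n → ∀ e ∈ charts n M, ∀ y ∈ e.target, ∀ t > 0,
    ∑ i, ∑ j, (comp e g y)⁻¹ i j * ambRicCoeff g h e t y i j = 0

/-- `O` is the obstruction tensor of `g`, with normalising constant `κ`, computed from some
ambient metric in normal form with respect to `g` (for `n` even). -/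
def IsObstructionTensor (κ : ℝ) (g O : BilinField n M) : Prop :=
  ∃ (ε : ℝ) (h : ℝ → BilinField n M), IsAmbientMetric g ε h ∧
    ∀ e ∈ charts n M, ∀ y ∈ e.target, ∀ t > 0, ∀ i j,
      comp e O y i j = κ * ambRicCoeff g h e t y i j

/-- `h` is divergence free, `Im(h) ⊆ N`, and `ℒ_X h = 0` for `X` in `N`, for every
`ρ ∈ (-ε, ε)`. -/
def IsAdapted (g : BilinField n M) (N : SubspaceField n M) (ε : ℝ) (h : ℝ → BilinField n M) :
    Prop :=
  ∀ ρ ∈ Set.Ioo (-ε) ε, DivergenceFree g (h ρ) ∧ ImageIn g N (h ρ) ∧ LieInvariant N (h ρ)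

/-- `h` solves `𝒜(h) + 2 Ric = O(ρᵐ)` with `m = fgOrder n`. -/
def SolvesLinearSystem (g : BilinField n M) (h : ℝ → BilinField n M) : Prop :=
  ∀ e ∈ charts n M, ∀ y ∈ e.target, ∀ i j,
    VanishesToOrder (fgOrder n) (fun ρ =>
      opA (comp e g) (fun r => comp e (h r)) i j ρ y + 2 * ric (comp e g) y i j)

/-- The curvature term `Rᵏᵢⱼˡ hₖₗ` of `𝒜(h)` vanishes identically. -/
def CurvatureTermVanishes (g : BilinField n M) (ε : ℝ) (h : ℝ → BilinField n M) : Prop :=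
  ∀ ρ ∈ Set.Ioo (-ε) ε, ∀ e ∈ charts n M, ∀ y ∈ e.target, ∀ i j,
    curvTerm (comp e g) (comp e (h ρ)) i j y = 0

end Manifold

end NullRicciWalker

end

open scoped Manifold ContDiff
open scoped Matrix
set_option linter.unusedSectionVars false
set_option linter.unusedSimpArgs false
set_option linter.unusedVariables false

noncomputable section

namespace NullRicciWalker

/-! ### Connections over a ring with derivations -/

section Algebra

variable {ι κ μ R : Type*} [Fintype ι] [DecidableEq ι] [Fintype κ] [DecidableEq κ] [Fintype μ]
  [CommRing R] [Algebra ℝ R]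

section MatrixDerivation

variable (δ : Derivation ℝ R R)

/-! Tensor calculus is done over a commutative ring with derivations, which is later the ring of
smooth functions on an open set of a chart or of the ambient space. Tensors are then matrices, and
every identity is matrix algebra. Let the columns of X be a local frame of 𝒩, with ∇X = Xθ. A
symmetric tensor with image in 𝒩 has the form S = GX f (GX)ᵀ. It is called adapted when f is also
parallel along 𝒩 for the connection induced by θ (`FrameTensor`). Because ∇X stays in 𝒩 and S kills
𝒩, this is the same as Lie invariance along 𝒩. It also implies that S is divergence free, since the
index contracted in the divergence lies in 𝒩.

Nullity makes the equations linear. As (GX)ᵀX = 0, the inverse of G + S is affine in f, and the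
difference of the two Levi-Civita connections strictly lowers the flag 𝒩 ⊂ 𝒩^⊥ ⊂ TM. Its traces and
the traces of its products vanish, which leaves Ric(g + h) = Ric(g) - ½□h
(`NullFrame.perturbed_ric`). In the Ricci tensor of the metric in normal form the terms tr(g⁻¹ġ) and
ġg⁻¹ġ vanish for the same reason. The tangential part is therefore ½(𝒜(h) + 2Ric), and all other
components are zero (`AdaptedAmbient.ric_xx`, `AdaptedAmbient.ric_other`).

The alternative p = 1 or 𝒩 ⌟ R = 0 enters through one fact: the curvature of θ vanishes when a
vector of 𝒩 is inserted. If 𝒩 ⌟ R = 0 this is immediate. In rank one that contraction is Ric(X),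
which is zero. The fact kills the term R_{kijl}h^{kl}, and it lets differentiation along 𝒩 pass
through □, so that □ preserves adapted tensors (`laplacian_parallel`). The Ricci tensor itself is
adapted: the trace of the Schouten tensor vanishes, hence Scal = 0 and Ric = (n - 2)P, and the
Bianchi identity gives ∇_X Ric = 0. So every □ᵏRic is adapted.

The linear system is then solved by the series Σ c_k ρᵏ □^{k-1}Ric with k(2k - n)c_k = c_{k-1} and
c_0 = -2. Borel summation realises it by a smooth family that is, for each ρ, a finite combination
of the □ᵏRic, and hence adapted. For n even the recursion fails exactly at k = n/2. The defect there
is a nonzero multiple of □^{n/2-1}Ric, and this is the obstruction tensor.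

That another ambient metric gives the same tensor is shown order by order in ρ, for arbitrary
metrics in normal form (`fg_linearization`, `fg_unique`). Below order n/2 the linearised equation
determines the next coefficient. At order n/2 it involves only the trace of that coefficient, and
the trace condition fixes this trace. -/

theorem map_mul_derivation (M : Matrix ι κ R) (N : Matrix κ μ R) :
    (M * N).map δ = M.map δ * N + M * N.map δ := by
  ext i j
  simp [Matrix.mul_apply, Finset.sum_add_distrib, mul_comm, add_comm]

theorem map_add_derivation (M N : Matrix ι κ R) : (M + N).map δ = M.map δ + N.map δ := by
  ext; simp

theorem map_sub_derivation (M N : Matrix ι κ R) : (M - N).map δ = M.map δ - N.map δ := by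
  ext; simp

theorem map_neg_derivation (M : Matrix ι κ R) : (-M).map δ = -M.map δ := by
  ext; simp

theorem map_transpose_derivation (M : Matrix ι κ R) : Mᵀ.map δ = (M.map δ)ᵀ := rfl

theorem map_smul_derivation (r : R) (M : Matrix ι κ R) :
    (r • M).map δ = δ r • M + r • M.map δ := by
  ext; simp [mul_comm, add_comm]

theorem map_real_smul_derivation (r : ℝ) (M : Matrix ι κ R) :
    (r • M).map δ = r • M.map δ := by
  ext; simp

theorem map_sum_derivation {σ : Type*} (s : Finset σ) (M : σ → Matrix ι κ R) :
    (∑ a ∈ s, M a).map δ = ∑ a ∈ s, (M a).map δ := by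
  ext; simp [Matrix.sum_apply]

theorem map_zero_derivation : (0 : Matrix ι κ R).map δ = 0 := by
  ext; simp

theorem map_one_derivation : (1 : Matrix ι ι R).map δ = 0 := by
  ext i j; by_cases h : i = j <;> simp [Matrix.one_apply, h]

end MatrixDerivation

variable (d : ι → Derivation ℝ R R)

/-- The matrices `(Aᵢ)ᵏⱼ = Γᵏᵢⱼ` of the Levi-Civita connection of `G`, where `G'` is the inverse
of `G`. -/
def conn (G G' : Matrix ι ι R) (i : ι) : Matrix ι ι R :=
  Matrix.of fun k j =>
    (1 / 2 : ℝ) • ∑ l, G' k l * (d i (G j l) + d j (G i l) - d l (G i j))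

/-- The curvature matrices of a connection with connection matrices `A`. -/
def curv (A : ι → Matrix κ κ R) (i j : ι) : Matrix κ κ R :=
  (A j).map (d i) - (A i).map (d j) + A i * A j - A j * A i

/-- The Ricci matrix of a connection. -/
def ricMat (A : ι → Matrix ι ι R) : Matrix ι ι R :=
  Matrix.of fun i j => ∑ k, curv d A k i k j

/-- The covariant derivative of a matrix of components of a `(0,2)`-tensor. -/
def cov (A : ι → Matrix ι ι R) (S : Matrix ι ι R) (k : ι) : Matrix ι ι R :=
  S.map (d k) - (A k)ᵀ * S - S * A k

/-- The covariant derivative of a `(0,3)`-tensor, the first index written as a parameter. -/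
def cov3 (A : ι → Matrix ι ι R) (T : ι → Matrix ι ι R) (l k : ι) : Matrix ι ι R :=
  (T k).map (d l) - ∑ m, A l m k • T m - (A l)ᵀ * T k - T k * A l

/-- The tensor Laplacian. -/
def boxMat (A : ι → Matrix ι ι R) (G' S : Matrix ι ι R) : Matrix ι ι R :=
  ∑ l, ∑ k, G' l k • cov3 d A (cov d A S) l k

/-- `A` is torsion-free. -/
def TorsionFree (A : ι → Matrix ι ι R) : Prop := ∀ i j k, A i k j = A j k i

/-- `G` is parallel for `A`. -/
def MetricCompat (A : ι → Matrix ι ι R) (G : Matrix ι ι R) : Prop :=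
  ∀ k, G.map (d k) = (A k)ᵀ * G + G * A k

theorem conn_torsionFree {G : Matrix ι ι R} (G' : Matrix ι ι R) (hG : Gᵀ = G) :
    TorsionFree (conn d G G') := by
  intro i j k
  have h : ∀ a b, G a b = G b a := fun a b => congrFun (congrFun hG b) a
  simp only [conn, Matrix.of_apply]
  congr 1
  refine Finset.sum_congr rfl fun l _ => ?_
  rw [h i j]; ring

theorem mul_conn {G G' : Matrix ι ι R} (h : G * G' = 1) (k i j : ι) :
    (G * conn d G G' k) i j = (1 / 2 : ℝ) • (d k (G j i) + d j (G k i) - d i (G k j)) := by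
  have : conn d G G' k = (1 / 2 : ℝ) • (G' * Matrix.of fun l j =>
      (d k (G j l) + d j (G k l) - d l (G k j))) := by
    ext a b; simp [conn, Matrix.mul_apply]
  rw [this, Matrix.mul_smul, ← Matrix.mul_assoc, h, Matrix.one_mul]
  simp

theorem conn_metricCompat {G G' : Matrix ι ι R} (hG : Gᵀ = G) (h : G * G' = 1) :
    MetricCompat d (conn d G G') G := by
  intro k
  have hs : ∀ a b, G a b = G b a := fun a b => congrFun (congrFun hG b) a
  have : (conn d G G' k)ᵀ * G = (G * conn d G G' k)ᵀ := by
    rw [Matrix.transpose_mul, hG]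
  rw [this]
  ext i j
  rw [Matrix.add_apply, Matrix.transpose_apply, mul_conn d h, mul_conn d h, Matrix.map_apply,
    ← smul_add, hs j i]
  have : d k (G i j) + d i (G k j) - d j (G k i) + (d k (G i j) + d j (G k i) - d i (G k j)) =
      (2 : ℝ) • d k (G i j) := by rw [two_smul]; ring
  rw [this, smul_smul]; norm_num

/-- The Koszul formula. Every Levi-Civita connection below is obtained from it: a candidate is
written down, and only torsion-freeness and metric compatibility are checked. -/
theorem conn_unique {A : ι → Matrix ι ι R} {G G' : Matrix ι ι R} (hG : Gᵀ = G)
    (h : G' * G = 1) (hA : TorsionFree A) (hc : MetricCompat d A G) : conn d G G' = A := by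
  have hs : ∀ a b, G a b = G b a := fun a b => congrFun (congrFun hG b) a
  have key : ∀ i j l, d i (G j l) + d j (G i l) - d l (G i j) = (2 : ℝ) • (G * A i) l j := by
    intro i j l
    have e : ∀ k a b, d k (G a b) = (G * A k) b a + (G * A k) a b := by
      intro k a b
      have := congrFun (congrFun (hc k) a) b
      have h2 : (A k)ᵀ * G = (G * A k)ᵀ := by rw [Matrix.transpose_mul, hG]
      rwa [h2] at this
    have s : ∀ k a b, (G * A k) a b = (G * A b) a k := by
      intro k a b
      simp only [Matrix.mul_apply]
      exact Finset.sum_congr rfl fun m _ => by rw [hA]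
    rw [e, e, e, s j i l, s l i j, s l j i, s j l i, two_smul]
    ring
  funext i
  ext k j
  simp only [conn, Matrix.of_apply, key]
  have : ∑ l, G' k l * (2 : ℝ) • (G * A i) l j = (2 : ℝ) • (G' * (G * A i)) k j := by
    rw [Matrix.mul_apply, Finset.smul_sum]
    exact Finset.sum_congr rfl fun l _ => mul_smul_comm _ _ _
  rw [this, ← Matrix.mul_assoc, h, Matrix.one_mul, smul_smul]; norm_num

theorem curv_swap (A : ι → Matrix κ κ R) (i j : ι) : curv d A i j = -curv d A j i := by
  simp only [curv]; abel

variable {d}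

theorem map_derivation_comm (hd : ∀ i j f, d i (d j f) = d j (d i f)) (i j : ι)
    (M : Matrix κ μ R) : (M.map (d j)).map (d i) = (M.map (d i)).map (d j) := by
  ext; simp [hd i j]

/-- The two mixed second derivatives of `G` agree. Expanded twice by metric compatibility, their
difference is the left-hand side. -/
theorem curv_metric (hd : ∀ i j f, d i (d j f) = d j (d i f)) {A : ι → Matrix ι ι R}
    {G : Matrix ι ι R} (hc : MetricCompat d A G) (i j : ι) :
    (curv d A i j)ᵀ * G + G * curv d A i j = 0 := by
  have h1 := map_derivation_comm hd i j G
  rw [hc i, hc j] at h1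
  simp only [map_add_derivation, map_mul_derivation, map_transpose_derivation, hc i, hc j] at h1
  simp only [curv, Matrix.transpose_add, Matrix.transpose_sub, Matrix.transpose_mul]
  rw [← sub_eq_zero] at h1
  rw [← h1]
  noncomm_ring

theorem curv_bianchi {A : ι → Matrix ι ι R} (hA : TorsionFree A) (i j k l : ι) :
    curv d A i j l k + curv d A j k l i + curv d A k i l j = 0 := by
  have e : ∀ a b c, (A a * A b) l c = (A a * A c) l b := by
    intro a b c
    simp only [Matrix.mul_apply]
    exact Finset.sum_congr rfl fun m _ => by rw [hA b c]
  simp only [curv, Matrix.add_apply, Matrix.sub_apply, Matrix.map_apply]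
  rw [e i j k, e j k i, e k i j, hA j k, hA i k, hA i j]
  ring

theorem trace_curv (hd : ∀ i j f, d i (d j f) = d j (d i f)) {A : ι → Matrix ι ι R}
    {G G' : Matrix ι ι R} (hc : MetricCompat d A G) (h : G * G' = 1) (i j : ι) :
    (curv d A i j).trace = 0 := by
  have h1 := congrArg (fun M => (M * G').trace) (curv_metric hd hc i j)
  simp only [Matrix.add_mul, Matrix.zero_mul, Matrix.trace_zero, Matrix.trace_add,
    Matrix.mul_assoc, h, Matrix.mul_one, Matrix.trace_transpose] at h1
  rw [Matrix.trace_mul_comm G, Matrix.mul_assoc, mul_eq_one_comm.mp h, Matrix.mul_one,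
    ← two_smul ℝ, smul_eq_zero_iff_right (by norm_num)] at h1
  exact h1

/-- Traced over `k`, the first Bianchi identity expresses the skew part of the Ricci matrix by the
trace of a curvature endomorphism, which is zero by `trace_curv`. -/
theorem ricMat_symm (hd : ∀ i j f, d i (d j f) = d j (d i f)) {A : ι → Matrix ι ι R}
    {G G' : Matrix ι ι R} (hA : TorsionFree A) (hc : MetricCompat d A G) (h : G * G' = 1) :
    (ricMat d A)ᵀ = ricMat d A := by
  ext i j
  simp only [ricMat, Matrix.transpose_apply, Matrix.of_apply]
  rw [← sub_eq_zero, ← Finset.sum_sub_distrib]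
  have h1 := trace_curv hd hc h j i
  rw [Matrix.trace] at h1
  have : ∀ k, curv d A k j k i - curv d A k i k j = - curv d A j i k k := by
    intro k
    have := curv_bianchi (d := d) hA j i k k
    have h2 : curv d A k j k i = - curv d A j k k i := by rw [curv_swap]; rfl
    have h3 : curv d A k i k j = - curv d A i k k j := by rw [curv_swap]; rfl
    rw [h3] at *
    linear_combination this
  simp only [this, Finset.sum_neg_distrib]
  rw [neg_eq_zero]; exact h1

/-- The covariant derivative of the curvature. -/
def covCurv (d : ι → Derivation ℝ R R) (A : ι → Matrix ι ι R) (u v w : ι) : Matrix ι ι R :=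
  (curv d A v w).map (d u) + A u * curv d A v w - curv d A v w * A u -
    ∑ s, A u s v • curv d A s w - ∑ s, A u s w • curv d A v s

/-- The Christoffel terms acting on the form indices cancel cyclically because `A` is torsion-free.
What remains is the Jacobi identity for the operators `d u + A u`. -/
theorem covCurv_bianchi (hd : ∀ i j f, d i (d j f) = d j (d i f)) {A : ι → Matrix ι ι R}
    (hA : TorsionFree A) (u v w : ι) :
    covCurv d A u v w + covCurv d A v w u + covCurv d A w u v = 0 := by
  have e1 : ∀ a b c, ∑ s, A a s b • curv d A c s = - ∑ s, A b s a • curv d A s c := by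
    intro a b c
    rw [← Finset.sum_neg_distrib]
    exact Finset.sum_congr rfl fun s _ => by rw [curv_swap, hA, smul_neg]
  simp only [covCurv, e1]
  have e2 : (curv d A v w).map (d u) + A u * curv d A v w - curv d A v w * A u +
      ((curv d A w u).map (d v) + A v * curv d A w u - curv d A w u * A v) +
      ((curv d A u v).map (d w) + A w * curv d A u v - curv d A u v * A w) = 0 := by
    simp only [curv, map_add_derivation, map_sub_derivation, map_mul_derivation]
    rw [map_derivation_comm hd v u, map_derivation_comm hd w u, map_derivation_comm hd w v]
    noncomm_ring
  rw [← e2]; abel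

end Algebra

/-! ### Covariant derivatives along a parallel distribution -/

section Parallel

variable {ι κ R V : Type*} [Fintype ι] [DecidableEq ι] [Fintype κ] [DecidableEq κ]
  [CommRing R] [Algebra ℝ R] [AddCommGroup V] [Module R V]
  {d : ι → Derivation ℝ R R} {A : ι → Matrix ι ι R} {D : ι → V →+ V}

/-- The covariant derivative of the `V`-valued one-form `φ`, where `D` is a connection on `V`. -/
def covForm (A : ι → Matrix ι ι R) (D : ι → V →+ V) (φ : ι → V) (l k : ι) : V :=
  D l (φ k) - ∑ m, A l m k • φ m

/-- Differentiate φ(X_a) = 0. The derivative of the frame is again a combination of the frame, on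
which φ vanishes, so (∇φ)(X_a) = 0 remains. -/
theorem sum_smul_covForm_right (hD : ∀ i (r : R) v, D i (r • v) = d i r • v + r • D i v)
    {X : Matrix ι κ R} {θ : ι → Matrix κ κ R}
    (hX : ∀ i, X.map (d i) + A i * X = X * θ i) {φ : ι → V}
    (hφ : ∀ a, ∑ k, X k a • φ k = 0) (a : κ) (k : ι) :
    ∑ l, X l a • covForm A D φ k l = 0 := by
  have h1 : ∀ l, X l a • D k (φ l) = D k (X l a • φ l) - d k (X l a) • φ l := by
    intro l; rw [hD]; abel
  have h2 : ∑ l, X l a • ∑ m, A k m l • φ m = ∑ l, (A k * X) l a • φ l := by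
    simp only [Finset.smul_sum, Matrix.mul_apply, Finset.sum_smul, smul_smul]
    rw [Finset.sum_comm]
    exact Finset.sum_congr rfl fun l _ => Finset.sum_congr rfl fun m _ => by rw [mul_comm]
  simp only [covForm, smul_sub, Finset.sum_sub_distrib, h1, h2]
  rw [← map_sum, hφ, map_zero, zero_sub, ← neg_add', neg_eq_zero, ← Finset.sum_add_distrib]
  have h3 : ∀ l, d k (X l a) • φ l + (A k * X) l a • φ l = ∑ b, θ k b a • X l b • φ l := by
    intro l
    rw [← add_smul]
    have := congrFun (congrFun (hX k) l) a
    simp only [Matrix.add_apply, Matrix.map_apply] at this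
    rw [this, Matrix.mul_apply, Finset.sum_smul]
    exact Finset.sum_congr rfl fun b _ => by rw [smul_smul, mul_comm]
  simp only [h3]
  rw [Finset.sum_comm]
  simp only [← Finset.smul_sum, hφ, smul_zero, Finset.sum_const_zero]

/-- Without torsion the two slots of ∇φ differ by the exterior derivative of φ for `D`. The
hypothesis `hc` says that this vanishes along the frame. -/
theorem sum_smul_covForm_left (hD : ∀ i (r : R) v, D i (r • v) = d i r • v + r • D i v)
    (hA : TorsionFree A) {X : Matrix ι κ R} {θ : ι → Matrix κ κ R}
    (hX : ∀ i, X.map (d i) + A i * X = X * θ i) {φ : ι → V}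
    (hφ : ∀ a, ∑ k, X k a • φ k = 0)
    (hc : ∀ a k, ∑ l, X l a • (D l (φ k) - D k (φ l)) = 0) (a : κ) (k : ι) :
    ∑ l, X l a • covForm A D φ l k = 0 := by
  have h : ∀ l, covForm A D φ l k = covForm A D φ k l + (D l (φ k) - D k (φ l)) := by
    intro l
    have : ∑ m, A l m k • φ m = ∑ m, A k m l • φ m :=
      Finset.sum_congr rfl fun m _ => by rw [hA]
    simp only [covForm, this]; abel
  simp only [h, smul_add, Finset.sum_add_distrib, hc, sum_smul_covForm_right hD hX hφ, add_zero]

/-- The covariant derivative of a `V`-valued tensor with two lower indices. -/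
def covForm2 (A : ι → Matrix ι ι R) (D : ι → V →+ V) (φ : ι → ι → V) (m l k : ι) : V :=
  D m (φ l k) - ∑ s, A m s l • φ s k - ∑ s, A m s k • φ l s

/-- The Ricci identity: the curvature of `D` acts on the values in `V`, and the curvature of `A`
acts on the form index. -/
theorem covForm2_swap (hD : ∀ i (r : R) v, D i (r • v) = d i r • v + r • D i v)
    (hA : TorsionFree A) (φ : ι → V) (m l k : ι) :
    covForm2 A D (covForm A D φ) m l k - covForm2 A D (covForm A D φ) l m k =
      D m (D l (φ k)) - D l (D m (φ k)) - ∑ s, curv d A m l s k • φ s := by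
  have e1 : ∑ s, A m s l • covForm A D φ s k = ∑ s, A l s m • covForm A D φ s k :=
    Finset.sum_congr rfl fun s _ => by rw [hA]
  have e2 : ∀ m l, ∑ s, A m s k • covForm A D φ l s =
      ∑ s, A m s k • D l (φ s) - ∑ s, (A l * A m) s k • φ s := by
    intro m l
    simp only [covForm, smul_sub, Finset.sum_sub_distrib, Finset.smul_sum, Matrix.mul_apply,
      Finset.sum_smul, smul_smul]
    congr 1
    rw [Finset.sum_comm]
    exact Finset.sum_congr rfl fun l _ => Finset.sum_congr rfl fun m _ => by rw [mul_comm]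
  have e3 : ∀ m l, D m (covForm A D φ l k) = D m (D l (φ k)) -
      (∑ s, d m (A l s k) • φ s + ∑ s, A l s k • D m (φ s)) := by
    intro m l
    simp only [covForm, map_sub, map_sum, hD, Finset.sum_add_distrib]
  have e4 : ∑ s, curv d A m l s k • φ s = ∑ s, d m (A l s k) • φ s - ∑ s, d l (A m s k) • φ s +
      ∑ s, (A m * A l) s k • φ s - ∑ s, (A l * A m) s k • φ s := by
    simp only [← Finset.sum_sub_distrib, ← Finset.sum_add_distrib, ← sub_smul, ← add_smul]
    rfl
  simp only [covForm2, e1, e2, e3, e4]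
  abel

theorem map_inv_of_metricCompat {G G' : Matrix ι ι R} (hc : MetricCompat d A G) (h : G * G' = 1)
    (m : ι) : G'.map (d m) = -(A m * G') - G' * (A m)ᵀ := by
  have h' := mul_eq_one_comm.mp h
  have h1 := congrArg (fun M : Matrix ι ι R => M.map (d m)) h
  simp only [map_mul_derivation, map_one_derivation, hc m] at h1
  have h2 : G' * (((A m)ᵀ * G + G * A m) * G' + G * G'.map (d m)) = 0 := by
    rw [h1, Matrix.mul_zero]
  simp only [Matrix.mul_add, Matrix.add_mul, Matrix.mul_assoc, h, Matrix.mul_one] at h2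
  rw [← Matrix.mul_assoc G' G (A m * G'), ← Matrix.mul_assoc G' G, h', Matrix.one_mul,
    Matrix.one_mul] at h2
  rw [← sub_eq_zero, ← h2]; abel

theorem inv_transpose {G G' : Matrix ι ι R} (hG : Gᵀ = G) (hG' : G * G' = 1) : G'ᵀ = G' := by
  have h2 : G'ᵀ = G'ᵀ * (G * G') := by rw [hG', Matrix.mul_one]
  rw [h2, ← Matrix.mul_assoc]
  nth_rewrite 1 [← hG]
  rw [← Matrix.transpose_mul, hG', Matrix.transpose_one, Matrix.one_mul]

/-- An endomorphism that is skew for `G` becomes an antisymmetric bivector when its index is raised.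
It is applied both to the curvature and to its covariant derivative. -/
theorem skew_mul_inv {G G' M : Matrix ι ι R} (hG : Gᵀ = G) (hG' : G * G' = 1)
    (h1 : Mᵀ * G + G * M = 0) (s t : ι) : (M * G') s t = -(M * G') t s := by
  have h2 : (M * G')ᵀ + M * G' = 0 := by
    have : G' * (Mᵀ * G + G * M) * G' = 0 := by
      rw [h1, Matrix.mul_zero, Matrix.zero_mul]
    rw [← this, Matrix.transpose_mul, inv_transpose hG hG']
    simp only [Matrix.mul_add, Matrix.add_mul, Matrix.mul_assoc, hG', Matrix.mul_one]
    rw [← Matrix.mul_assoc G' G, mul_eq_one_comm.mp hG', Matrix.one_mul]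
  have := congrFun (congrFun h2 t) s
  rw [Matrix.add_apply, Matrix.transpose_apply] at this
  exact eq_neg_of_add_eq_zero_left this

/-- Here X-differentiation is moved past the Laplacian. Exchanging the two outermost derivatives in
∇_m∇_l∇_k v costs two curvature terms. The one of `D` vanishes along the frame by `hF`, and the one
of `A` is traced to Ric(X) = 0. After the exchange the frame meets the inner Hessian, where it gives
zero. -/
theorem laplacian_parallel (hd : ∀ i j f, d i (d j f) = d j (d i f))
    (hD : ∀ i (r : R) v, D i (r • v) = d i r • v + r • D i v)
    {G G' : Matrix ι ι R} (hG : Gᵀ = G) (hG' : G * G' = 1) (hA : TorsionFree A)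
    (hc : MetricCompat d A G) {X : Matrix ι κ R} {θ : ι → Matrix κ κ R}
    (hX : ∀ i, X.map (d i) + A i * X = X * θ i)
    (hF : ∀ a k v, ∑ l, X l a • (D l (D k v) - D k (D l v)) = 0)
    (hR : ricMat d A * X = 0) {v : V} (hv : ∀ a, ∑ k, X k a • D k v = 0) (a : κ) :
    ∑ m, X m a • D m (∑ l, ∑ k, G' l k • covForm A D (fun i => D i v) l k) = 0 := by
  set φ : ι → V := fun i => D i v with hφ
  set ψ := covForm A D φ with hψ
  have hinv := map_inv_of_metricCompat hc hG'
  -- The inverse metric is parallel, so the derivative may be taken inside the trace.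
  have e1 : ∀ m, D m (∑ l, ∑ k, G' l k • ψ l k) =
      ∑ l, ∑ k, G' l k • covForm2 A D ψ m l k := by
    intro m
    have t1 : ∑ l, ∑ k, (A m * G') l k • ψ l k =
        ∑ l, ∑ k, G' l k • ∑ s, A m s l • ψ s k := by
      simp only [Matrix.mul_apply, Finset.sum_smul, Finset.smul_sum, smul_smul]
      calc ∑ l, ∑ k, ∑ s, (A m l s * G' s k) • ψ l k
          = ∑ l, ∑ s, ∑ k, (A m l s * G' s k) • ψ l k :=
            Finset.sum_congr rfl fun l _ => Finset.sum_comm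
        _ = ∑ s, ∑ l, ∑ k, (A m l s * G' s k) • ψ l k := Finset.sum_comm
        _ = _ := Finset.sum_congr rfl fun s _ => by
            rw [Finset.sum_comm]
            exact Finset.sum_congr rfl fun l _ => Finset.sum_congr rfl fun m _ => by rw [mul_comm]
    have t2 : ∑ l, ∑ k, (G' * (A m)ᵀ) l k • ψ l k =
        ∑ l, ∑ k, G' l k • ∑ s, A m s k • ψ l s := by
      simp only [Matrix.mul_apply, Finset.sum_smul, Finset.smul_sum, smul_smul,
        Matrix.transpose_apply]
      exact Finset.sum_congr rfl fun l _ => Finset.sum_comm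
    have t3 : ∀ l k, d m (G' l k) = -(A m * G') l k - (G' * (A m)ᵀ) l k := fun l k =>
      congrFun (congrFun (hinv m) l) k
    simp only [map_sum, hD, t3, sub_smul, neg_smul, Finset.sum_add_distrib,
      Finset.sum_sub_distrib, Finset.sum_neg_distrib, t1, t2, covForm2, smul_sub]
    abel
  have e2 : ∀ m l k, covForm2 A D ψ m l k = covForm2 A D ψ l m k +
      (D m (D l (φ k)) - D l (D m (φ k))) - ∑ s, curv d A m l s k • φ s := by
    intro m l k
    have := covForm2_swap (d := d) hD hA φ m l k
    rw [← hψ] at this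
    rw [add_sub_assoc, ← this]; abel
  have hφ0 : ∀ a k, ∑ l, X l a • ψ l k = 0 :=
    sum_smul_covForm_left hD hA hX hv fun a k => hF a k v
  -- The Hessian vanishes in its first slot along the frame, and so does its covariant derivative,
  -- because the frame is parallel.
  have e3 : ∀ l k, ∑ m, X m a • covForm2 A D ψ l m k = 0 := by
    intro l k
    have h1 : ∀ m, covForm2 A D ψ l m k =
        covForm A D (fun s => ψ s k) l m - ∑ s, A l s k • ψ m s := fun m => rfl
    simp only [h1, smul_sub, Finset.sum_sub_distrib]
    rw [sum_smul_covForm_right (φ := fun s => ψ s k) hD hX (fun a => hφ0 a k)]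
    simp only [Finset.smul_sum, smul_comm (X _ a)]
    rw [Finset.sum_comm]
    simp only [← Finset.smul_sum, hφ0, smul_zero, Finset.sum_const_zero, sub_zero]
  have hskew := fun m l => skew_mul_inv hG hG' (curv_metric hd hc m l)
  -- By skewness the contraction of the curvature with the inverse metric is the Ricci tensor, here
  -- evaluated on a vector of the frame.
  have e4 : ∑ m, X m a • ∑ l, ∑ k, G' l k • ∑ s, curv d A m l s k • φ s = 0 := by
    have h1 : ∀ m, ∑ l, ∑ k, G' l k • ∑ s, curv d A m l s k • φ s =
        ∑ s, (∑ l, (curv d A m l * G') s l) • φ s := by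
      intro m
      have hG'' : ∀ l k, G' l k = G' k l := fun l k =>
        congrFun (congrFun (inv_transpose hG hG') k) l
      simp only [Finset.smul_sum, smul_smul, Matrix.mul_apply, Finset.sum_smul]
      calc ∑ l, ∑ k, ∑ s, (G' l k * curv d A m l s k) • φ s
          = ∑ l, ∑ s, ∑ k, (G' l k * curv d A m l s k) • φ s :=
            Finset.sum_congr rfl fun l _ => Finset.sum_comm
        _ = ∑ s, ∑ l, ∑ k, (G' l k * curv d A m l s k) • φ s := Finset.sum_comm
        _ = _ := Finset.sum_congr rfl fun s _ => Finset.sum_congr rfl fun l _ =>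
            Finset.sum_congr rfl fun k _ => by rw [mul_comm, hG'' l k]
    have h2 : ∀ m s, ∑ l, (curv d A m l * G') s l = ∑ t, ricMat d A m t * G' t s := by
      intro m s
      simp only [ricMat, Matrix.of_apply, Finset.sum_mul]
      rw [Finset.sum_comm]
      refine Finset.sum_congr rfl fun l _ => ?_
      rw [hskew, Matrix.mul_apply, ← Finset.sum_neg_distrib]
      refine Finset.sum_congr rfl fun t _ => ?_
      rw [curv_swap, Matrix.neg_apply, neg_mul, neg_neg]
    simp only [h1, h2]
    simp only [Finset.smul_sum, Finset.sum_smul, smul_smul]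
    rw [Finset.sum_comm]
    refine Finset.sum_eq_zero fun s _ => ?_
    rw [Finset.sum_comm]
    refine Finset.sum_eq_zero fun t _ => ?_
    rw [← Finset.sum_smul]
    have : ∑ m, X m a * (ricMat d A m t * G' t s) = ((ricMat d A)ᵀ * X) t a * G' t s := by
      simp only [Matrix.mul_apply, Finset.sum_mul, Matrix.transpose_apply]
      exact Finset.sum_congr rfl fun m _ => by ring
    rw [this, ricMat_symm hd hA hc hG', hR]; simp
  simp only [e1]
  have e5 : ∀ m, X m a • ∑ l, ∑ k, G' l k • covForm2 A D ψ m l k =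
      ∑ l, ∑ k, G' l k • (X m a • covForm2 A D ψ l m k) +
      ∑ l, ∑ k, G' l k • (X m a • (D m (D l (φ k)) - D l (D m (φ k)))) -
      X m a • ∑ l, ∑ k, G' l k • ∑ s, curv d A m l s k • φ s := by
    intro m
    simp only [e2 m, smul_add, smul_sub, Finset.sum_add_distrib, Finset.sum_sub_distrib,
      Finset.smul_sum, smul_comm (X m a)]
  simp only [e5, Finset.sum_add_distrib, Finset.sum_sub_distrib, e4, sub_zero]
  have e6 : ∀ f : ι → ι → ι → V, (∀ l k, ∑ m, X m a • f m l k = 0) →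
      ∑ m, ∑ l, ∑ k, G' l k • (X m a • f m l k) = 0 := by
    intro f hf
    rw [Finset.sum_comm]
    refine Finset.sum_eq_zero fun l _ => ?_
    rw [Finset.sum_comm]
    refine Finset.sum_eq_zero fun k _ => ?_
    rw [← Finset.smul_sum, hf, smul_zero]
  rw [e6 _ (fun l k => e3 l k), e6 (fun m l k => D m (D l (φ k)) - D l (D m (φ k)))
    (fun l k => hF a l (φ k)), add_zero]

end Parallel

/-! ### Frames of a totally null parallel distribution -/

section NullFrame

variable {ι κ R : Type*} [Fintype ι] [DecidableEq ι] [Fintype κ] [DecidableEq κ]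
  [CommRing R] [Algebra ℝ R]

/-- `X` intertwines the operators `d i + θ i` and `d i + A i`, hence also their commutators. It
serves twice: for a frame of a parallel distribution, and for the Jacobian matrix of a change of
coordinates. -/
theorem curv_intertwine {μ : Type*} [Fintype μ] [DecidableEq μ] {d : ι → Derivation ℝ R R}
    (hd : ∀ i j f, d i (d j f) = d j (d i f)) {A : ι → Matrix μ μ R} {θ : ι → Matrix κ κ R}
    {X : Matrix μ κ R} (hX : ∀ i, X.map (d i) + A i * X = X * θ i) (i j : ι) :
    curv d A i j * X = X * curv d θ i j := by
  have h : ∀ i, X.map (d i) = X * θ i - A i * X := fun i => by rw [← hX i]; abel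
  have h1 := map_derivation_comm hd i j X
  rw [h i, h j] at h1
  simp only [map_sub_derivation, map_mul_derivation, h] at h1
  rw [← sub_eq_zero] at h1
  rw [← sub_eq_zero]
  have : curv d A i j * X - X * curv d θ i j = -((X * θ j - A j * X : Matrix μ κ R).map (d i) -
      (X * θ i - A i * X : Matrix μ κ R).map (d j)) := by
    simp only [map_sub_derivation, map_mul_derivation, h, curv]
    simp only [Matrix.mul_add, Matrix.add_mul, Matrix.mul_sub, Matrix.sub_mul, Matrix.mul_assoc]
    abel
  rw [this, map_sub_derivation, map_sub_derivation, map_mul_derivation, map_mul_derivation,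
    map_mul_derivation, map_mul_derivation, h, h, h1, neg_zero]

/-- The columns of `X` are a frame (with left inverse `L`) of a totally null distribution that is
parallel for the Levi-Civita connection `A` of `G`; `θ` is the induced connection. -/
structure NullFrame (d : ι → Derivation ℝ R R) (A : ι → Matrix ι ι R) (G G' : Matrix ι ι R)
    (X : Matrix ι κ R) (L : Matrix κ ι R) (θ : ι → Matrix κ κ R) : Prop where
  comm : ∀ i j f, d i (d j f) = d j (d i f)
  symm : Gᵀ = G
  inv : G * G' = 1
  torsion : TorsionFree A
  compat : MetricCompat d A G
  null : Xᵀ * G * X = 0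
  left : L * X = 1
  par : ∀ i, X.map (d i) + A i * X = X * θ i

/-- The connection on symmetric products of the distribution, in terms of a frame. -/
def frameConn (d : ι → Derivation ℝ R R) (θ : ι → Matrix κ κ R) (k : ι) :
    Matrix κ κ R →+ Matrix κ κ R where
  toFun f := f.map (d k) + θ k * f + f * (θ k)ᵀ
  map_zero' := by simp [map_zero_derivation]
  map_add' f g := by rw [map_add_derivation]; noncomm_ring

theorem frameConn_apply (d : ι → Derivation ℝ R R) (θ : ι → Matrix κ κ R) (k : ι)
    (f : Matrix κ κ R) : frameConn d θ k f = f.map (d k) + θ k * f + f * (θ k)ᵀ := rfl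

theorem frameConn_smul (d : ι → Derivation ℝ R R) (θ : ι → Matrix κ κ R) (k : ι) (r : R)
    (f : Matrix κ κ R) :
    frameConn d θ k (r • f) = d k r • f + r • frameConn d θ k f := by
  simp only [frameConn_apply, map_smul_derivation, Matrix.mul_smul, Matrix.smul_mul, smul_add]
  abel

theorem frameConn_transpose (d : ι → Derivation ℝ R R) (θ : ι → Matrix κ κ R) (k : ι)
    (f : Matrix κ κ R) : (frameConn d θ k f)ᵀ = frameConn d θ k fᵀ := by
  simp only [frameConn_apply, Matrix.transpose_add, Matrix.transpose_mul,
    Matrix.transpose_transpose, map_transpose_derivation]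
  abel

theorem frameConn_swap {d : ι → Derivation ℝ R R} (hd : ∀ i j f, d i (d j f) = d j (d i f))
    (θ : ι → Matrix κ κ R) (l k : ι) (f : Matrix κ κ R) :
    frameConn d θ l (frameConn d θ k f) - frameConn d θ k (frameConn d θ l f) =
      curv d θ l k * f + f * (curv d θ l k)ᵀ := by
  simp only [frameConn_apply, curv, map_add_derivation, map_mul_derivation,
    map_transpose_derivation, map_derivation_comm hd l k f, Matrix.transpose_add,
    Matrix.transpose_sub, Matrix.transpose_mul]
  noncomm_ring

/-- `S` is symmetric with image in the distribution: `f` is the matrix of `S` in the frame. -/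
structure FrameTensor (d : ι → Derivation ℝ R R) (G : Matrix ι ι R) (X : Matrix ι κ R)
    (θ : ι → Matrix κ κ R) (S : Matrix ι ι R) (f : Matrix κ κ R) : Prop where
  eq : S = G * X * f * (G * X)ᵀ
  symm : fᵀ = f
  par : ∀ a, ∑ k, X k a • frameConn d θ k f = 0

namespace NullFrame

variable {d : ι → Derivation ℝ R R} {A : ι → Matrix ι ι R} {G G' : Matrix ι ι R}
  {X : Matrix ι κ R} {L : Matrix κ ι R} {θ : ι → Matrix κ κ R}

theorem inv' (H : NullFrame d A G G' X L θ) : G' * G = 1 := mul_eq_one_comm.mp H.inv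

theorem inv_mul_lower (H : NullFrame d A G G' X L θ) : G' * (G * X) = X := by
  rw [← Matrix.mul_assoc, H.inv', Matrix.one_mul]

theorem lower_transpose_mul_inv (H : NullFrame d A G G' X L θ) : (G * X)ᵀ * G' = Xᵀ := by
  rw [Matrix.transpose_mul, H.symm, Matrix.mul_assoc, H.inv, Matrix.mul_one]

/-- The source of all cancellations that follow: a lowered section of the distribution kills the
distribution. -/
theorem lower_transpose_mul (H : NullFrame d A G G' X L θ) : (G * X)ᵀ * X = 0 := by
  rw [Matrix.transpose_mul, H.symm, H.null]

theorem left_lower (H : NullFrame d A G G' X L θ) : (L * G') * (G * X) = 1 := by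
  rw [Matrix.mul_assoc, H.inv_mul_lower, H.left]

theorem cancel_left (H : NullFrame d A G G' X L θ) {μ : Type*} {M : Matrix κ μ R}
    (h : X * M = 0) : M = 0 := by
  have : L * (X * M) = 0 := by rw [h, Matrix.mul_zero]
  rwa [← Matrix.mul_assoc, H.left, Matrix.one_mul] at this

theorem cancel_lower (H : NullFrame d A G G' X L θ) {μ : Type*} {M : Matrix κ μ R}
    (h : G * X * M = 0) : M = 0 := by
  have : L * G' * (G * X * M) = 0 := by rw [h, Matrix.mul_zero]
  rwa [← Matrix.mul_assoc, H.left_lower, Matrix.one_mul] at this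

theorem cancel_lower_right (H : NullFrame d A G G' X L θ) {μ : Type*} {M : Matrix μ κ R}
    (h : M * (G * X)ᵀ = 0) : M = 0 := by
  have h2 : (G * X) * Mᵀ = 0 := by
    rw [← Matrix.transpose_transpose (G * X), ← Matrix.transpose_mul, h, Matrix.transpose_zero]
  have := H.cancel_lower h2
  rw [← Matrix.transpose_transpose M, this, Matrix.transpose_zero]

theorem cancel_lower_both (H : NullFrame d A G G' X L θ) {M : Matrix κ κ R}
    (h : G * X * M * (G * X)ᵀ = 0) : M = 0 :=
  H.cancel_lower (H.cancel_lower_right h)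

theorem map_lower (H : NullFrame d A G G' X L θ) (i : ι) :
    (G * X).map (d i) = (A i)ᵀ * (G * X) + G * X * θ i := by
  rw [map_mul_derivation, H.compat i, Matrix.mul_assoc G X, ← H.par i]
  simp only [Matrix.mul_add, Matrix.add_mul, Matrix.mul_sub, Matrix.sub_mul, Matrix.mul_assoc]
  abel

/-- The lowered frame also satisfies ∇(GX) = GXθ, so only the coefficient matrix is differentiated.
Calculus with adapted tensors becomes calculus with the matrix-valued function `f`. -/
theorem cov_frame (H : NullFrame d A G G' X L θ) (f : Matrix κ κ R) (k : ι) :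
    cov d A (G * X * f * (G * X)ᵀ) k = G * X * frameConn d θ k f * (G * X)ᵀ := by
  rw [cov, frameConn_apply, map_mul_derivation, map_mul_derivation, map_transpose_derivation,
    H.map_lower]
  generalize G * X = Y
  simp only [Matrix.transpose_add, Matrix.transpose_mul, Matrix.transpose_transpose]
  simp only [Matrix.mul_add, Matrix.add_mul, Matrix.mul_sub, Matrix.sub_mul, Matrix.mul_assoc]
  abel

theorem cov3_frame (H : NullFrame d A G G' X L θ) (φ : ι → Matrix κ κ R) (l k : ι) :
    cov3 d A (fun k => G * X * φ k * (G * X)ᵀ) l k =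
      G * X * covForm A (frameConn d θ) φ l k * (G * X)ᵀ := by
  have h := H.cov_frame (φ k) l
  rw [cov] at h
  have : cov3 d A (fun k => G * X * φ k * (G * X)ᵀ) l k =
      ((G * X * φ k * (G * X)ᵀ).map (d l) - (A l)ᵀ * (G * X * φ k * (G * X)ᵀ) -
        (G * X * φ k * (G * X)ᵀ) * A l) - ∑ m, A l m k • (G * X * φ m * (G * X)ᵀ) := by
    rw [cov3]; abel
  rw [this, h, covForm, Matrix.mul_sub, Matrix.sub_mul, Matrix.mul_sum, Matrix.sum_mul]
  simp only [Matrix.mul_smul, Matrix.smul_mul]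

theorem boxMat_frame (H : NullFrame d A G G' X L θ) (f : Matrix κ κ R) :
    boxMat d A G' (G * X * f * (G * X)ᵀ) = G * X *
      (∑ l, ∑ k, G' l k • covForm A (frameConn d θ) (fun i => frameConn d θ i f) l k) *
      (G * X)ᵀ := by
  have : cov d A (G * X * f * (G * X)ᵀ) =
      fun k => G * X * frameConn d θ k f * (G * X)ᵀ := funext fun k => H.cov_frame f k
  simp only [boxMat, this, H.cov3_frame, Matrix.mul_sum, Matrix.sum_mul, Matrix.mul_smul,
    Matrix.smul_mul]

theorem curv_mul (H : NullFrame d A G G' X L θ) (i j : ι) :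
    curv d A i j * X = X * curv d θ i j := curv_intertwine H.comm H.par i j

theorem flat_of_curv (H : NullFrame d A G G' X L θ)
    (h : ∀ a j, ∑ i, X i a • curv d A i j = 0) (a : κ) (k : ι) :
    ∑ l, X l a • curv d θ l k = 0 := by
  apply H.cancel_left
  rw [Matrix.mul_sum]
  simp only [Matrix.mul_smul, ← H.curv_mul, ← Matrix.smul_mul, ← Matrix.sum_mul, h,
    Matrix.zero_mul]

/-- On a line bundle the curvature of `θ` is a scalar two-form F, with R(∂_l, ∂_k)X = F_{lk}X.
Tracing over l identifies F(X, ∂_k) with Ric(X)_k, which is zero. -/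
theorem flat_of_subsingleton [Subsingleton κ] (H : NullFrame d A G G' X L θ)
    (hR : ricMat d A * X = 0) (a : κ) (k : ι) : ∑ l, X l a • curv d θ l k = 0 := by
  ext b c
  obtain rfl := Subsingleton.elim a b
  have h1 := congrFun (congrFun hR k) c
  simp only [Matrix.mul_apply, ricMat, Matrix.of_apply, Finset.sum_mul] at h1
  rw [Finset.sum_comm] at h1
  simp only [Matrix.sum_apply, Matrix.smul_apply, smul_eq_mul, Matrix.zero_apply]
  rw [Matrix.zero_apply] at h1
  rw [← h1]
  refine Finset.sum_congr rfl fun l _ => ?_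
  rw [← Matrix.mul_apply, H.curv_mul, Matrix.mul_apply, Fintype.sum_subsingleton _ a]

theorem parallel_iff (H : NullFrame d A G G' X L θ) {S : Matrix ι ι R} {f : Matrix κ κ R}
    (hS : S = G * X * f * (G * X)ᵀ) (a : κ) :
    ∑ k, X k a • cov d A S k = 0 ↔ ∑ k, X k a • frameConn d θ k f = 0 := by
  have : ∑ k, X k a • cov d A S k =
      G * X * (∑ k, X k a • frameConn d θ k f) * (G * X)ᵀ := by
    rw [hS, Matrix.mul_sum, Matrix.sum_mul]
    simp only [H.cov_frame, Matrix.mul_smul, Matrix.smul_mul]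
  rw [this]
  exact ⟨fun h => H.cancel_lower_both h, fun h => by rw [h]; simp⟩

/-- The image condition factors `S` through the lowered frame on the left. Symmetry then gives the
same factor on the right, and the left inverse `L` isolates the coefficient. -/
theorem eq_frame (H : NullFrame d A G G' X L θ) {S : Matrix ι ι R} (hs : Sᵀ = S)
    {Z : Matrix κ ι R} (hZ : G' * S = X * Z) : S = G * X * (Z * G' * Lᵀ) * (G * X)ᵀ := by
  have h1 : S = G * X * Z := by
    rw [Matrix.mul_assoc, ← hZ, ← Matrix.mul_assoc, H.inv, Matrix.one_mul]
  have h2 : S = Zᵀ * (G * X)ᵀ := by rw [← Matrix.transpose_mul, ← h1, hs]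
  have h3 : S * (G' * Lᵀ) = Zᵀ := by
    have : (G * X)ᵀ * (G' * Lᵀ) = 1 := by
      rw [← Matrix.mul_assoc, H.lower_transpose_mul_inv, ← Matrix.transpose_mul, H.left,
        Matrix.transpose_one]
    rw [h2, Matrix.mul_assoc, this, Matrix.mul_one]
  rw [Matrix.mul_assoc Z, ← Matrix.mul_assoc (G * X), ← h1, h3, ← h2]

theorem frame_symm (H : NullFrame d A G G' X L θ) {S : Matrix ι ι R} {f : Matrix κ κ R}
    (hs : Sᵀ = S) (hS : S = G * X * f * (G * X)ᵀ) : fᵀ = f := by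
  rw [← sub_eq_zero]
  apply H.cancel_lower_both
  have : G * X * fᵀ * (G * X)ᵀ = Sᵀ := by
    rw [hS]; simp only [Matrix.transpose_mul, Matrix.transpose_transpose, Matrix.mul_assoc]
  rw [Matrix.mul_sub, Matrix.sub_mul, this, hs, ← hS, sub_self]

theorem trace_frame (H : NullFrame d A G G' X L θ) (f : Matrix κ κ R) :
    (G' * (G * X * f * (G * X)ᵀ)).trace = 0 := by
  have : G' * (G * X * f * (G * X)ᵀ) = X * (f * (G * X)ᵀ) := by
    simp only [← Matrix.mul_assoc, H.inv', Matrix.one_mul]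
  rw [this, Matrix.trace_mul_comm, Matrix.mul_assoc, H.lower_transpose_mul]; simp

theorem sum_smul_curv_action {F : ι → Matrix κ κ R} {a : κ}
    (h : ∑ l, X l a • F l = 0) (v : Matrix κ κ R) :
    ∑ l, X l a • (F l * v + v * (F l)ᵀ) = 0 := by
  have h1 : ∑ l, X l a • (F l * v) = (∑ l, X l a • F l) * v := by
    simp only [Matrix.sum_mul, Matrix.smul_mul]
  have h2 : ∑ l, X l a • (v * (F l)ᵀ) = v * (∑ l, X l a • F l)ᵀ := by
    simp only [Matrix.transpose_sum, Matrix.mul_sum, Matrix.transpose_smul, Matrix.mul_smul]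
  simp only [smul_add, Finset.sum_add_distrib, h1, h2, h]
  simp

/-- This is `laplacian_parallel` for the coefficient matrices with the connection `frameConn`. Its
curvature acts by v ↦ Fv + vFᵀ, with F the curvature of `θ`, so flatness along the frame is
inherited. All iterated Laplacians of the Ricci tensor are adapted by this lemma. -/
theorem box_frameTensor (H : NullFrame d A G G' X L θ)
    (hflat : ∀ a k, ∑ l, X l a • curv d θ l k = 0) (hR : ricMat d A * X = 0)
    {S : Matrix ι ι R} {f : Matrix κ κ R} (hS : FrameTensor d G X θ S f) :
    FrameTensor d G X θ (boxMat d A G' S)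
      (∑ l, ∑ k, G' l k • covForm A (frameConn d θ) (fun i => frameConn d θ i f) l k) where
  eq := by rw [hS.eq, H.boxMat_frame]
  symm := by
    simp only [Matrix.transpose_sum, Matrix.transpose_smul, covForm, Matrix.transpose_sub,
      frameConn_transpose, hS.symm]
  par := by
    refine laplacian_parallel H.comm (frameConn_smul d θ) H.symm H.inv H.torsion H.compat H.par
      ?_ hR hS.par
    intro a k v
    simp only [frameConn_swap H.comm]
    exact sum_smul_curv_action (hflat a k) v

/-- The second covariant derivatives of an adapted tensor vanish in the direction of the
distribution, in either slot. -/
theorem sum_smul_hess (H : NullFrame d A G G' X L θ)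
    (hflat : ∀ a k, ∑ l, X l a • curv d θ l k = 0)
    {S : Matrix ι ι R} {f : Matrix κ κ R} (hS : FrameTensor d G X θ S f) (a : κ) (k : ι) :
    ∑ l, X l a • covForm A (frameConn d θ) (fun i => frameConn d θ i f) l k = 0 := by
  refine sum_smul_covForm_left (frameConn_smul d θ) H.torsion H.par hS.par (fun a k => ?_) a k
  simp only [frameConn_swap H.comm]
  exact sum_smul_curv_action (hflat a k) f

/-- The index contracted in a divergence of an adapted tensor lies in the distribution, so the
divergence is a part of the derivative along the distribution. -/
theorem sum_div_frame (φ : ι → Matrix κ κ R) (h : ∀ a, ∑ k, X k a • φ k = 0) (b : κ) :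
    ∑ k, ∑ a, X k a * φ k a b = 0 := by
  rw [Finset.sum_comm]
  refine Finset.sum_eq_zero fun a _ => ?_
  have := congrFun (congrFun (h a) a) b
  simpa [Matrix.sum_apply] using this

end NullFrame

end NullFrame

/-! ### The Ricci tensor of a null Ricci Walker metric -/

section Ricci

variable {ι κ R : Type*} [Fintype ι] [DecidableEq ι] [Fintype κ] [DecidableEq κ]
  [CommRing R] [Algebra ℝ R] {d : ι → Derivation ℝ R R} {A : ι → Matrix ι ι R}
  {G G' : Matrix ι ι R} {X : Matrix ι κ R} {L : Matrix κ ι R} {θ : ι → Matrix κ κ R}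

/-- Obtained by differentiating `curv_metric`: the metric is parallel, and the correction terms are
themselves curvatures, hence skew. -/
theorem covCurv_metric (hd : ∀ i j f, d i (d j f) = d j (d i f)) (hc : MetricCompat d A G)
    (u v w : ι) : (covCurv d A u v w)ᵀ * G + G * covCurv d A u v w = 0 := by
  have h := curv_metric hd hc
  have h1 := congrArg (fun M : Matrix ι ι R => M.map (d u)) (h v w)
  simp only [map_add_derivation, map_mul_derivation, map_transpose_derivation, hc u,
    map_zero_derivation] at h1
  have h2 : ∀ (c : ι → R) (M : ι → Matrix ι ι R), (∀ s, (M s)ᵀ * G + G * M s = 0) →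
      (∑ s, c s • M s)ᵀ * G + G * ∑ s, c s • M s = 0 := by
    intro c M hM
    rw [Matrix.transpose_sum, Matrix.sum_mul, Matrix.mul_sum, ← Finset.sum_add_distrib]
    refine Finset.sum_eq_zero fun s _ => ?_
    rw [Matrix.transpose_smul, Matrix.smul_mul, Matrix.mul_smul, ← smul_add, hM, smul_zero]
  have h3 := h2 (fun s => A u s v) (fun s => curv d A s w) fun s => h s w
  have h4 := h2 (fun s => A u s w) (fun s => curv d A v s) fun s => h v s
  rw [covCurv]
  set N₁ := ∑ s, A u s v • curv d A s w
  set N₂ := ∑ s, A u s w • curv d A v s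
  set C := curv d A v w
  have h5 : (C.map (d u) + A u * C - C * A u - N₁ - N₂)ᵀ * G +
      G * (C.map (d u) + A u * C - C * A u - N₁ - N₂) =
      ((C.map (d u))ᵀ * G + Cᵀ * ((A u)ᵀ * G + G * A u) +
        (((A u)ᵀ * G + G * A u) * C + G * C.map (d u))) -
      (A u)ᵀ * (Cᵀ * G + G * C) - (Cᵀ * G + G * C) * A u -
      (N₁ᵀ * G + G * N₁) - (N₂ᵀ * G + G * N₂) := by
    simp only [Matrix.transpose_add, Matrix.transpose_sub, Matrix.transpose_mul]
    noncomm_ring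
  rw [h5, h1, h3, h4, h v w]; simp

theorem sum_covCurv (u i j : ι) :
    ∑ k, covCurv d A u k i k j = cov d A (ricMat d A) u i j := by
  have e1 : ∑ k, (A u * curv d A k i) k j = ∑ k, (∑ s, A u s k • curv d A s i) k j := by
    simp only [Matrix.mul_apply, Matrix.sum_apply, Matrix.smul_apply, smul_eq_mul]
    rw [Finset.sum_comm]
  have e2 : ∑ k, (curv d A k i * A u) k j = (ricMat d A * A u) i j := by
    simp only [Matrix.mul_apply, ricMat, Matrix.of_apply, Finset.sum_mul]
    rw [Finset.sum_comm]
  have e3 : ∑ k, (∑ s, A u s i • curv d A k s) k j = ((A u)ᵀ * ricMat d A) i j := by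
    simp only [Matrix.mul_apply, Matrix.sum_apply, Matrix.smul_apply, smul_eq_mul, ricMat,
      Matrix.of_apply, Matrix.transpose_apply, Finset.mul_sum]
    rw [Finset.sum_comm]
  have e4 : ∑ k, ((curv d A k i).map (d u)) k j = (ricMat d A).map (d u) i j := by
    simp [ricMat]
  simp only [covCurv, Matrix.sub_apply, Matrix.add_apply, Finset.sum_sub_distrib,
    Finset.sum_add_distrib, e1, e2, e3, e4, cov]
  ring

/-- In index notation: ∇_u Ric_{ij} - ∇_i Ric_{uj} plus the divergence of the curvature is zero.
Both cases of the parallelism of Ric along 𝒩 start from it. -/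
theorem contracted_bianchi (hd : ∀ i j f, d i (d j f) = d j (d i f)) (hA : TorsionFree A)
    (u i j : ι) : cov d A (ricMat d A) u i j - cov d A (ricMat d A) i u j +
      ∑ k, covCurv d A k i u k j = 0 := by
  have h : ∀ k, covCurv d A u k i k j - covCurv d A i k u k j + covCurv d A k i u k j = 0 := by
    intro k
    have h1 := congrFun (congrFun (covCurv_bianchi hd hA u k i) k) j
    have h2 : covCurv d A i u k = -covCurv d A i k u := by
      have e1 : ∀ a b, ∑ s, A i s a • curv d A s b = -∑ s, A i s a • curv d A b s := by
        intro a b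
        rw [← Finset.sum_neg_distrib]
        exact Finset.sum_congr rfl fun s _ => by rw [curv_swap, smul_neg]
      rw [covCurv, covCurv, curv_swap d A u k, map_neg_derivation, e1 k u, e1 u k]
      noncomm_ring
    rw [h2] at h1
    simp only [Matrix.add_apply, Matrix.neg_apply, Matrix.zero_apply] at h1
    linear_combination h1
  have := Finset.sum_congr rfl fun k (_ : k ∈ Finset.univ) => h k
  rw [Finset.sum_add_distrib, Finset.sum_sub_distrib, sum_covCurv, sum_covCurv] at this
  simpa using this

/-- The scalar curvature. -/
def scalMat (d : ι → Derivation ℝ R R) (A : ι → Matrix ι ι R) (G' : Matrix ι ι R) : R :=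
  ∑ i, ∑ j, G' i j * ricMat d A i j

/-- The Schouten tensor. -/
def schoutenMat (d : ι → Derivation ℝ R R) (A : ι → Matrix ι ι R) (G G' : Matrix ι ι R) :
    Matrix ι ι R :=
  (1 / ((Fintype.card ι : ℝ) - 2)) •
    (ricMat d A - ((1 / (2 * ((Fintype.card ι : ℝ) - 1))) • scalMat d A G') • G)

namespace NullFrame

theorem scal_eq_trace (H : NullFrame d A G G' X L θ) :
    scalMat d A G' = (G' * ricMat d A).trace := by
  have hs := ricMat_symm H.comm H.torsion H.compat H.inv
  rw [scalMat, Matrix.trace]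
  refine Finset.sum_congr rfl fun i _ => ?_
  rw [Matrix.diag_apply, Matrix.mul_apply]
  exact Finset.sum_congr rfl fun j _ => by
    conv_lhs => rw [← hs, Matrix.transpose_apply]

theorem mul_eq_zero_of_image (H : NullFrame d A G G' X L θ) {S : Matrix ι ι R} (hs : Sᵀ = S)
    {Z : Matrix κ ι R} (hZ : G' * S = X * Z) : S * X = 0 := by
  rw [H.eq_frame hs hZ, Matrix.mul_assoc _ _ X, H.lower_transpose_mul, Matrix.mul_zero]

/-- A symmetric tensor with image in a null distribution is trace free. The trace of the Schouten
tensor is Scal/(2(n - 1)), so Scal = 0 and Ric = (n - 2)P. -/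
theorem ric_of_schouten (H : NullFrame d A G G' X L θ) (hn : 3 ≤ Fintype.card ι)
    {Z : Matrix κ ι R} (hZ : G' * schoutenMat d A G G' = X * Z) :
    ∃ r : Matrix κ κ R, ricMat d A = G * X * r * (G * X)ᵀ := by
  have hs := ricMat_symm H.comm H.torsion H.compat H.inv
  have hP : (schoutenMat d A G G')ᵀ = schoutenMat d A G G' := by
    simp only [schoutenMat, Matrix.transpose_smul, Matrix.transpose_sub, hs, H.symm]
  have hn' : (3 : ℝ) ≤ Fintype.card ι := by exact_mod_cast hn
  have h0 : (Fintype.card ι : ℝ) - 2 ≠ 0 := by linarith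
  have h1 : (Fintype.card ι : ℝ) - 1 ≠ 0 := by linarith
  have hf := H.eq_frame hP hZ
  have ht := H.trace_frame (Z * G' * Lᵀ)
  rw [← hf] at ht
  have hscal : scalMat d A G' = 0 := by
    rw [schoutenMat, Matrix.mul_smul, Matrix.trace_smul, smul_eq_zero_iff_right (by
      simpa using h0), Matrix.mul_sub, Matrix.trace_sub, ← H.scal_eq_trace, Matrix.mul_smul,
      Matrix.trace_smul, H.inv', Matrix.trace_one, smul_eq_mul] at ht
    have : scalMat d A G' - (1 / (2 * ((Fintype.card ι : ℝ) - 1))) • scalMat d A G' *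
        (Fintype.card ι : R) =
        (1 - Fintype.card ι / (2 * ((Fintype.card ι : ℝ) - 1))) • scalMat d A G' := by
      simp only [Algebra.smul_def, map_sub, div_eq_mul_inv, map_mul, map_natCast, map_one]
      ring
    rw [this, smul_eq_zero_iff_right] at ht
    · exact ht
    · have : 1 - Fintype.card ι / (2 * ((Fintype.card ι : ℝ) - 1)) =
          ((Fintype.card ι : ℝ) - 2) / (2 * ((Fintype.card ι : ℝ) - 1)) := by
        field_simp; ring
      rw [this]
      exact div_ne_zero h0 (mul_ne_zero two_ne_zero h1)
  refine ⟨((Fintype.card ι : ℝ) - 2) • (Z * G' * Lᵀ), ?_⟩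
  rw [Matrix.mul_smul, Matrix.smul_mul, ← hf, schoutenMat, hscal, smul_smul]
  rw [mul_one_div, div_self h0]; simp

theorem ric_mul (H : NullFrame d A G G' X L θ) {r : Matrix κ κ R}
    (hr : ricMat d A = G * X * r * (G * X)ᵀ) : ricMat d A * X = 0 := by
  rw [hr, Matrix.mul_assoc, H.lower_transpose_mul, Matrix.mul_zero]

/-- Contract the Bianchi identity with X in the index u. The term ∇_i Ric(X, ·) vanishes because
∇Ric takes values in the null distribution. The divergence of R vanishes because X kills R and X is
parallel up to the frame. -/
theorem ric_frameTensor_of_curv (H : NullFrame d A G G' X L θ) {r : Matrix κ κ R}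
    (hr : ricMat d A = G * X * r * (G * X)ᵀ)
    (h : ∀ a j, ∑ i, X i a • curv d A i j = 0) : FrameTensor d G X θ (ricMat d A) r where
  eq := hr
  symm := H.frame_symm (ricMat_symm H.comm H.torsion H.compat H.inv) hr
  par := by
    intro a
    rw [← H.parallel_iff hr]
    ext i j
    have h1 := fun u => contracted_bianchi (d := d) H.comm H.torsion u i j
    have h2 : ∑ u, X u a * cov d A (ricMat d A) i u j = 0 := by
      have : Xᵀ * cov d A (ricMat d A) i = 0 := by
        rw [hr, H.cov_frame, Matrix.mul_assoc, Matrix.mul_assoc, ← Matrix.mul_assoc,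
          ← Matrix.mul_assoc, H.null, Matrix.zero_mul]
      have := congrFun (congrFun this a) j
      simpa [Matrix.mul_apply] using this
    -- The induced connection on endomorphisms. With it, `curv d A i` is a one-form with
    -- endomorphism values that kills the frame, and `sum_smul_covForm_right` applies.
    let D : ι → Matrix ι ι R →+ Matrix ι ι R := fun k =>
      { toFun := fun M => M.map (d k) + A k * M - M * A k
        map_zero' := by simp [map_zero_derivation]
        map_add' := fun M N => by rw [map_add_derivation]; noncomm_ring }
    have hD : ∀ i (r : R) v, D i (r • v) = d i r • v + r • D i v := by
      intro i r v
      simp only [D, AddMonoidHom.coe_mk, ZeroHom.coe_mk, map_smul_derivation, Matrix.mul_smul,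
        Matrix.smul_mul, smul_add, smul_sub]
      abel
    have h' : ∀ a s, ∑ k, X k a • curv d A s k = 0 := by
      intro a s
      rw [← neg_eq_zero, ← Finset.sum_neg_distrib, ← h a s]
      exact Finset.sum_congr rfl fun k _ => by rw [curv_swap d A k s, smul_neg]
    have h3 : ∀ k, ∑ u, X u a • covCurv d A k i u = 0 := by
      intro k
      have e : ∀ u, covCurv d A k i u =
          covForm A D (curv d A i) k u - ∑ s, A k s i • curv d A s u := by
        intro u
        simp only [covCurv, covForm, D, AddMonoidHom.coe_mk, ZeroHom.coe_mk]
        abel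
      simp only [e, smul_sub, Finset.sum_sub_distrib]
      rw [sum_smul_covForm_right hD H.par (fun a => h' a i)]
      simp only [Finset.smul_sum, smul_comm (X _ a)]
      rw [Finset.sum_comm]
      simp only [← Finset.smul_sum, h', smul_zero, Finset.sum_const_zero, sub_zero]
    have h4 : ∑ u, X u a * ∑ k, covCurv d A k i u k j = 0 := by
      simp only [Finset.mul_sum]
      rw [Finset.sum_comm]
      refine Finset.sum_eq_zero fun k _ => ?_
      have := congrFun (congrFun (h3 k) k) j
      simpa [Matrix.sum_apply] using this
    have h5 := Finset.sum_congr rfl fun u (_ : u ∈ Finset.univ) => congrArg (X u a * ·) (h1 u)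
    simp only [mul_add, mul_sub, Finset.sum_add_distrib, Finset.sum_sub_distrib, h2, h4,
      mul_zero, Finset.sum_const_zero, sub_zero, add_zero] at h5
    simpa [Matrix.sum_apply] using h5

theorem sum_div_eq (H : NullFrame d A G G' X L θ) {S : Matrix ι ι R} {f : Matrix κ κ R}
    (hS : S = G * X * f * (G * X)ᵀ) (u : ι) :
    ∑ i, ∑ k, G' i k * cov d A S i u k =
      ∑ a, (G * X) u a * ∑ i, ∑ b, frameConn d θ i f a b * X i b := by
  have h1 : ∀ i, ∑ k, G' i k * cov d A S i u k = (cov d A S i * G') u i := by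
    intro i
    rw [Matrix.mul_apply]
    exact Finset.sum_congr rfl fun k _ => by
      rw [mul_comm, ← inv_transpose H.symm H.inv, Matrix.transpose_apply,
        inv_transpose H.symm H.inv]
  rw [Finset.sum_congr rfl fun i _ => h1 i]
  simp only [hS, H.cov_frame]
  have h2 : ∀ i, (G * X * frameConn d θ i f * (G * X)ᵀ * G') u i =
      ∑ a, (G * X) u a * ∑ b, frameConn d θ i f a b * X i b := by
    intro i
    rw [Matrix.mul_assoc _ _ G', H.lower_transpose_mul_inv, Matrix.mul_assoc, Matrix.mul_apply]
    simp [Matrix.mul_apply]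
  rw [Finset.sum_congr rfl fun i _ => h2 i, Finset.sum_comm]
  simp only [Finset.mul_sum]

/-- The twice contracted Bianchi identity with Scal = 0 says that Ric is divergence free. In rank
one Ric = r X♭ ⊗ X♭, and its divergence is the derivative of r along X times X♭. -/
theorem ric_frameTensor_of_subsingleton [Subsingleton κ] (H : NullFrame d A G G' X L θ)
    {r : Matrix κ κ R} (hr : ricMat d A = G * X * r * (G * X)ᵀ) :
    FrameTensor d G X θ (ricMat d A) r where
  eq := hr
  symm := H.frame_symm (ricMat_symm H.comm H.torsion H.compat H.inv) hr
  par := by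
    have hdiv : ∀ u, ∑ i, ∑ k, G' i k * cov d A (ricMat d A) i u k = 0 := by
      intro u
      have h1 := fun i j => congrArg (G' j i * ·) (contracted_bianchi (d := d) H.comm H.torsion u i j)
      have h2 := Finset.sum_congr rfl fun i (_ : i ∈ Finset.univ) =>
        Finset.sum_congr rfl fun j (_ : j ∈ Finset.univ) => h1 i j
      simp only [mul_add, mul_sub, Finset.sum_add_distrib, Finset.sum_sub_distrib, mul_zero,
        Finset.sum_const_zero] at h2
      have hsymm : ∀ i j, G' i j = G' j i := fun i j =>
        congrFun (congrFun (inv_transpose H.symm H.inv) j) i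
      have t1 : ∑ i, ∑ j, G' j i * cov d A (ricMat d A) u i j = 0 := by
        have := H.trace_frame (frameConn d θ u r)
        rw [← H.cov_frame, ← hr, Matrix.trace] at this
        rw [← this, Finset.sum_comm]
        simp [Matrix.mul_apply]
      -- Skewness of ∇R in its endomorphism indices turns this contraction into a trace that yields
      -- ∇Ric. The result is a second copy of the divergence of Ric.
      have t2 : ∑ i, ∑ j, G' j i * ∑ k, covCurv d A k i u k j =
          -∑ i, ∑ j, G' j i * cov d A (ricMat d A) i u j := by
        have e1 : ∑ i, ∑ j, G' j i * ∑ k, covCurv d A k i u k j =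
            ∑ i, ∑ k, (covCurv d A k i u * G') k i := by
          refine Finset.sum_congr rfl fun i _ => ?_
          simp only [Finset.mul_sum, Matrix.mul_apply]
          rw [Finset.sum_comm]
          exact Finset.sum_congr rfl fun _ _ => Finset.sum_congr rfl fun _ _ => mul_comm _ _
        rw [e1]
        simp only [fun k i => skew_mul_inv H.symm H.inv (covCurv_metric H.comm H.compat k i u) k i,
          Finset.sum_neg_distrib]
        rw [neg_inj, Finset.sum_comm]
        refine Finset.sum_congr rfl fun k _ => ?_
        simp only [Matrix.mul_apply]
        rw [Finset.sum_comm]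
        refine Finset.sum_congr rfl fun t _ => ?_
        rw [← Finset.sum_mul, sum_covCurv, mul_comm]
      rw [t1, t2] at h2
      have h3 : (2 : ℝ) • ∑ i, ∑ j, G' j i * cov d A (ricMat d A) i u j = 0 := by
        rw [two_smul]; linear_combination -h2
      rw [smul_eq_zero_iff_right (by norm_num)] at h3
      rw [← h3]
      exact Finset.sum_congr rfl fun i _ => Finset.sum_congr rfl fun j _ => by rw [hsymm]
    intro a
    ext b c
    obtain rfl := Subsingleton.elim a b
    obtain rfl := Subsingleton.elim a c
    have h1 : (G * X) * (Matrix.of fun a (_ : κ) => ∑ i, ∑ b, frameConn d θ i r a b * X i b) = 0 := by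
      ext u _
      rw [Matrix.mul_apply]
      exact (H.sum_div_eq hr u).symm.trans (hdiv u)
    have h2 := congrFun (congrFun (H.cancel_lower h1) a) a
    simp only [Matrix.of_apply, Matrix.zero_apply] at h2
    simp only [Matrix.sum_apply, Matrix.smul_apply, smul_eq_mul, Matrix.zero_apply]
    rw [← h2]
    exact Finset.sum_congr rfl fun i _ => by rw [Fintype.sum_subsingleton _ a, mul_comm]

end NullFrame

end Ricci

/-! ### Perturbations by adapted tensors -/

section Perturbation

variable {ι κ R : Type*} [Fintype ι] [DecidableEq ι] [Fintype κ] [DecidableEq κ]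
  [CommRing R] [Algebra ℝ R] {d : ι → Derivation ℝ R R} {A : ι → Matrix ι ι R}
  {G G' : Matrix ι ι R} {X : Matrix ι κ R} {L : Matrix κ ι R} {θ : ι → Matrix κ κ R}

/-- The contraction of the first index of `∇S` with a coordinate vector field. -/
def frameContr (d : ι → Derivation ℝ R R) (Y : Matrix ι κ R) (θ : ι → Matrix κ κ R)
    (f : Matrix κ κ R) (i : ι) : Matrix κ ι R :=
  Matrix.of fun b j => ∑ a, Y i a * frameConn d θ j f a b

/-- The difference of the Levi-Civita connections of `G + S` and `G`. -/
def connDiff (d : ι → Derivation ℝ R R) (G G' : Matrix ι ι R) (X : Matrix ι κ R)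
    (θ : ι → Matrix κ κ R) (f : Matrix κ κ R) (i : ι) : Matrix ι ι R :=
  (1 / 2 : ℝ) • (X * (frameConn d θ i f * (G * X)ᵀ + frameContr d (G * X) θ f i) -
    G' * (frameContr d (G * X) θ f i)ᵀ * (G * X)ᵀ)

/-- If YᵀX = 0 as well, an endomorphism Xα + βYᵀ of this kind sends everything into ker Yᵀ, sends
ker Yᵀ into im X, and kills im X. With Y = GX these are 𝒩^⊥ and 𝒩. Such endomorphisms are nilpotent,
and so are products of two of them, so that all traces vanish. -/
theorem trace_eq_zero_of_filtered {X Y : Matrix ι κ R} {α : Matrix κ ι R} {β : Matrix ι κ R}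
    (hα : α * X = 0) (hβ : Yᵀ * β = 0) : (X * α + β * Yᵀ).trace = 0 := by
  rw [Matrix.trace_add, Matrix.trace_mul_comm, hα, Matrix.trace_mul_comm, hβ]; simp

theorem trace_mul_eq_zero_of_filtered {X Y : Matrix ι κ R} (hXY : Yᵀ * X = 0)
    {α α' : Matrix κ ι R} {β β' : Matrix ι κ R} (hα : α * X = 0) (hβ : Yᵀ * β' = 0) :
    ((X * α + β * Yᵀ) * (X * α' + β' * Yᵀ)).trace = 0 := by
  have : (X * α + β * Yᵀ) * (X * α' + β' * Yᵀ) = X * (α * X) * α' + X * (α * β' * Yᵀ) +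
      β * (Yᵀ * X) * α' + β * (Yᵀ * β') * Yᵀ := by
    simp only [Matrix.add_mul, Matrix.mul_add, Matrix.mul_assoc]; abel
  rw [this, hα, hXY, hβ]
  simp only [Matrix.mul_zero, Matrix.zero_mul, zero_add, add_zero]
  rw [Matrix.trace_mul_comm, Matrix.mul_assoc, hXY]; simp

namespace NullFrame

theorem frameContr_mul (f : Matrix κ κ R) (hp : ∀ a, ∑ k, X k a • frameConn d θ k f = 0)
    (Y : Matrix ι κ R) (i : ι) : frameContr d Y θ f i * X = 0 := by
  ext b c
  simp only [Matrix.mul_apply, frameContr, Matrix.of_apply, Finset.sum_mul, Matrix.zero_apply]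
  rw [Finset.sum_comm]
  refine Finset.sum_eq_zero fun a _ => ?_
  have := congrFun (congrFun (hp c) a) b
  simp only [Matrix.sum_apply, Matrix.smul_apply, smul_eq_mul, Matrix.zero_apply] at this
  calc _ = Y i a * ∑ j, X j c * frameConn d θ j f a b := by
        rw [Finset.mul_sum]; exact Finset.sum_congr rfl fun j _ => by ring
    _ = 0 := by rw [this, mul_zero]

/-- `connDiff` is strictly upper triangular for the filtration by the distribution and its
orthogonal complement. -/
theorem connDiff_filtered (H : NullFrame d A G G' X L θ) {f : Matrix κ κ R}
    (hp : ∀ a, ∑ k, X k a • frameConn d θ k f = 0) (i : ι) :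
    ∃ (α : Matrix κ ι R) (β : Matrix ι κ R),
      connDiff d G G' X θ f i = X * α + β * (G * X)ᵀ ∧ α * X = 0 ∧ (G * X)ᵀ * β = 0 := by
  refine ⟨(1 / 2 : ℝ) • (frameConn d θ i f * (G * X)ᵀ + frameContr d (G * X) θ f i),
    -((1 / 2 : ℝ) • (G' * (frameContr d (G * X) θ f i)ᵀ)), ?_, ?_, ?_⟩
  · rw [connDiff, smul_sub, Matrix.mul_smul, Matrix.neg_mul, Matrix.smul_mul, sub_eq_add_neg]
  · rw [Matrix.smul_mul, Matrix.add_mul, frameContr_mul f hp, Matrix.mul_assoc,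
      H.lower_transpose_mul]; simp
  · rw [Matrix.mul_neg, Matrix.mul_smul, ← Matrix.mul_assoc, H.lower_transpose_mul_inv,
      ← Matrix.transpose_mul, frameContr_mul f hp]; simp

theorem lower_mul_connDiff (H : NullFrame d A G G' X L θ) {f : Matrix κ κ R}
    (hp : ∀ a, ∑ k, X k a • frameConn d θ k f = 0) (i : ι) :
    (G * X)ᵀ * connDiff d G G' X θ f i = 0 := by
  obtain ⟨α, β, h, _, hβ⟩ := H.connDiff_filtered hp i
  rw [h, Matrix.mul_add, ← Matrix.mul_assoc, ← Matrix.mul_assoc, H.lower_transpose_mul, hβ]; simp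

theorem trace_connDiff (H : NullFrame d A G G' X L θ) {f : Matrix κ κ R}
    (hp : ∀ a, ∑ k, X k a • frameConn d θ k f = 0) (i : ι) :
    (connDiff d G G' X θ f i).trace = 0 := by
  obtain ⟨α, β, h, hα, hβ⟩ := H.connDiff_filtered hp i
  rw [h, trace_eq_zero_of_filtered hα hβ]

theorem trace_connDiff_mul (H : NullFrame d A G G' X L θ) {f : Matrix κ κ R}
    (hp : ∀ a, ∑ k, X k a • frameConn d θ k f = 0) (i j : ι) :
    (connDiff d G G' X θ f i * connDiff d G G' X θ f j).trace = 0 := by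
  obtain ⟨α, β, h, hα, _⟩ := H.connDiff_filtered hp i
  obtain ⟨α', β', h', _, hβ'⟩ := H.connDiff_filtered hp j
  rw [h, h', trace_mul_eq_zero_of_filtered H.lower_transpose_mul hα hβ']

theorem frame_entry_symm {Y : Matrix ι κ R} {f : Matrix κ κ R} (hf : fᵀ = f) (i j : ι) :
    (Y * f * Yᵀ) i j = (Y * f * Yᵀ) j i := by
  have : (Y * f * Yᵀ)ᵀ = Y * f * Yᵀ := by
    simp only [Matrix.transpose_mul, Matrix.transpose_transpose, hf, Matrix.mul_assoc]
  exact congrFun (congrFun this j) i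

theorem mul_connDiff (H : NullFrame d A G G' X L θ) {S : Matrix ι ι R} {f : Matrix κ κ R}
    (hS : FrameTensor d G X θ S f) (i k j : ι) :
    (G * connDiff d G G' X θ f i) k j =
      (1 / 2 : ℝ) • (cov d A S i k j + cov d A S j i k - cov d A S k i j) := by
  have hc : ∀ k, cov d A S k = G * X * frameConn d θ k f * (G * X)ᵀ := by
    intro k; rw [hS.eq, H.cov_frame]
  have h1 : ∀ k j, (G * X * frameContr d (G * X) θ f i) k j = cov d A S j i k := by
    intro k j
    rw [hc, frameContr]
    generalize G * X = Y
    simp only [Matrix.mul_apply, Matrix.of_apply, Matrix.transpose_apply, Finset.mul_sum,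
      Finset.sum_mul]
    exact Finset.sum_congr rfl fun _ _ => Finset.sum_congr rfl fun _ _ => by ring
  have h2 : G * connDiff d G G' X θ f i = (1 / 2 : ℝ) • (cov d A S i +
      G * X * frameContr d (G * X) θ f i - (G * X * frameContr d (G * X) θ f i)ᵀ) := by
    rw [connDiff, Matrix.mul_smul, Matrix.mul_sub, hc, Matrix.transpose_mul (G * X),
      ← Matrix.mul_assoc G X, Matrix.mul_add, ← Matrix.mul_assoc G, ← Matrix.mul_assoc G, H.inv,
      Matrix.one_mul]
    simp only [Matrix.mul_assoc]
  rw [h2]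
  simp only [Matrix.smul_apply, Matrix.sub_apply, Matrix.add_apply, Matrix.transpose_apply, h1]

theorem cov_entry_symm (H : NullFrame d A G G' X L θ) {S : Matrix ι ι R} {f : Matrix κ κ R}
    (hS : FrameTensor d G X θ S f) (k i j : ι) : cov d A S k i j = cov d A S k j i := by
  rw [hS.eq, H.cov_frame]
  exact frame_entry_symm (by rw [frameConn_transpose, hS.symm]) i j

theorem connDiff_torsionFree (H : NullFrame d A G G' X L θ) {S : Matrix ι ι R}
    {f : Matrix κ κ R} (hS : FrameTensor d G X θ S f) :
    TorsionFree (connDiff d G G' X θ f) := by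
  intro i j k
  have h : ∀ i, connDiff d G G' X θ f i = G' * (G * connDiff d G G' X θ f i) := fun i => by
    rw [← Matrix.mul_assoc, H.inv', Matrix.one_mul]
  rw [h i, h j, Matrix.mul_apply, Matrix.mul_apply]
  refine Finset.sum_congr rfl fun l _ => ?_
  rw [H.mul_connDiff hS, H.mul_connDiff hS, H.cov_entry_symm hS i l j, H.cov_entry_symm hS j i l,
    H.cov_entry_symm hS l i j, add_comm (cov d A S i j l)]

/-- The square of G⁻¹S is zero because the frame is null, so the Neumann series of (G + S)⁻¹ ends
after its linear term. -/
theorem perturbed_inv (H : NullFrame d A G G' X L θ) (f : Matrix κ κ R) :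
    (G + G * X * f * (G * X)ᵀ) * (G' - X * f * Xᵀ) = 1 := by
  have h1 : G * X * f * (G * X)ᵀ * G' = G * X * f * Xᵀ := by
    rw [Matrix.mul_assoc, H.lower_transpose_mul_inv]
  have h2 : G * X * f * (G * X)ᵀ * (X * f * Xᵀ) = 0 := by
    rw [Matrix.mul_assoc, ← Matrix.mul_assoc _ (X * f), ← Matrix.mul_assoc _ X,
      H.lower_transpose_mul]; simp
  rw [Matrix.add_mul, Matrix.mul_sub, Matrix.mul_sub, H.inv, h1, h2]
  simp only [Matrix.mul_assoc]; abel

/-- In the compatibility with `G + S`, the products of `S` with the difference tensor vanish: the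
latter has its image in 𝒩^⊥, which `S` kills. The connection is therefore exactly first order in `S`
and its derivatives. -/
theorem perturbed_conn (H : NullFrame d A G G' X L θ) {S : Matrix ι ι R} {f : Matrix κ κ R}
    (hS : FrameTensor d G X θ S f) :
    conn d (G + S) (G' - X * f * Xᵀ) = fun i => A i + connDiff d G G' X θ f i := by
  have hSt : Sᵀ = S := by
    rw [hS.eq]; simp only [Matrix.transpose_mul, Matrix.transpose_transpose, hS.symm,
      Matrix.mul_assoc]
  refine conn_unique d (by rw [Matrix.transpose_add, H.symm, hSt])
    (mul_eq_one_comm.mp (by rw [hS.eq]; exact H.perturbed_inv f)) ?_ ?_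
  · intro i j k
    show (A i + connDiff d G G' X θ f i) k j = (A j + connDiff d G G' X θ f j) k i
    rw [Matrix.add_apply, Matrix.add_apply, H.torsion, H.connDiff_torsionFree hS]
  · intro i
    have h1 : S * connDiff d G G' X θ f i = 0 := by
      rw [hS.eq, Matrix.mul_assoc, H.lower_mul_connDiff hS.par, Matrix.mul_zero]
    have h2 : (connDiff d G G' X θ f i)ᵀ * S = 0 := by
      rw [← hSt, ← Matrix.transpose_mul, h1, Matrix.transpose_zero]
    have h3 : S.map (d i) = cov d A S i + (A i)ᵀ * S + S * A i := by rw [cov]; abel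
    have h4 : (connDiff d G G' X θ f i)ᵀ * G + G * connDiff d G G' X θ f i = cov d A S i := by
      have : (connDiff d G G' X θ f i)ᵀ * G = (G * connDiff d G G' X θ f i)ᵀ := by
        rw [Matrix.transpose_mul, H.symm]
      rw [this]
      ext j k
      rw [Matrix.add_apply, Matrix.transpose_apply, H.mul_connDiff hS, H.mul_connDiff hS,
        ← smul_add, H.cov_entry_symm hS i k j]
      have : cov d A S i j k + cov d A S j i k - cov d A S k i j +
          (cov d A S i j k + cov d A S k i j - cov d A S j i k) = (2 : ℝ) • cov d A S i j k := by
        rw [two_smul]; ring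
      rw [this, smul_smul]; norm_num
    rw [map_add_derivation, H.compat i, h3, ← h4]
    have h5 : (A i + connDiff d G G' X θ f i)ᵀ * (G + S) +
        (G + S) * (A i + connDiff d G G' X θ f i) =
        (A i)ᵀ * G + G * A i + ((connDiff d G G' X θ f i)ᵀ * G + G * connDiff d G G' X θ f i +
        (A i)ᵀ * S + S * A i) + ((connDiff d G G' X θ f i)ᵀ * S) +
        S * connDiff d G G' X θ f i := by
      rw [Matrix.transpose_add]; noncomm_ring
    rw [h5, h1, h2, add_zero, add_zero]

/-- The contracted tensor index lies in 𝒩, so the outer derivative is taken along 𝒩, where the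
Hessian of the coefficient vanishes. -/
theorem sum_mul_cov3 (H : NullFrame d A G G' X L θ)
    (hflat : ∀ a k, ∑ l, X l a • curv d θ l k = 0) {S : Matrix ι ι R} {f : Matrix κ κ R}
    (hS : FrameTensor d G X θ S f) (i j : ι) :
    ∑ k, ∑ s, G' k s * cov3 d A (cov d A S) k i j s = 0 := by
  have hc : cov d A S = fun k => G * X * frameConn d θ k f * (G * X)ᵀ := by
    funext k; rw [hS.eq, H.cov_frame]
  set ψ := covForm A (frameConn d θ) (fun i => frameConn d θ i f)
  have h1 : ∀ k, ∑ s, G' k s * cov3 d A (cov d A S) k i j s = (G * X * ψ k i * Xᵀ) j k := by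
    intro k
    rw [hc, H.cov3_frame]
    have : G * X * ψ k i * Xᵀ = G * X * ψ k i * (G * X)ᵀ * G' := by
      rw [Matrix.mul_assoc _ _ G', H.lower_transpose_mul_inv]
    rw [this, Matrix.mul_apply]
    exact Finset.sum_congr rfl fun s _ => by
      rw [mul_comm, ← inv_transpose H.symm H.inv, Matrix.transpose_apply,
        inv_transpose H.symm H.inv]
  rw [Finset.sum_congr rfl fun k _ => h1 k]
  have h2 : ∀ k, (G * X * ψ k i * Xᵀ) j k = ∑ a, (G * X) j a * ∑ b, ψ k i a b * X k b := by
    intro k; rw [Matrix.mul_assoc, Matrix.mul_apply]; simp [Matrix.mul_apply]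
  rw [Finset.sum_congr rfl fun k _ => h2 k, Finset.sum_comm]
  refine Finset.sum_eq_zero fun a _ => ?_
  rw [← Finset.mul_sum, Finset.sum_comm]
  have h3 : ∀ b, ∑ k, ψ k i a b * X k b = 0 := by
    intro b
    have := congrFun (congrFun (H.sum_smul_hess hflat hS b i) a) b
    simp only [Matrix.sum_apply, Matrix.smul_apply, smul_eq_mul, Matrix.zero_apply] at this
    rw [← this]; exact Finset.sum_congr rfl fun k _ => mul_comm _ _
  simp [h3]

/-- With D the difference of the connections, Ric changes by ∇_k Dᵏ_{ij} - ∇_i Dᵏ_{kj} and by terms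
quadratic in D. The traces of D and of DD vanish by nilpotency. By the Koszul formula ∇_k Dᵏ_{ij} is
half of ∇ᵏ∇_i S_{jk} + ∇ᵏ∇_j S_{ik} - □S_{ij}, and the first two terms vanish by `sum_mul_cov3`. -/
theorem perturbed_ric (H : NullFrame d A G G' X L θ)
    (hflat : ∀ a k, ∑ l, X l a • curv d θ l k = 0) {S : Matrix ι ι R} {f : Matrix κ κ R}
    (hS : FrameTensor d G X θ S f) :
    ricMat d (fun i => A i + connDiff d G G' X θ f i) =
      ricMat d A - (1 / 2 : ℝ) • boxMat d A G' S := by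
  set D := connDiff d G G' X θ f with hD
  have hDt : TorsionFree D := H.connDiff_torsionFree hS
  have htr : ∀ i, ∑ k, D i k k = 0 := fun i => H.trace_connDiff hS.par i
  have htr' : ∀ i, ∑ k, D k k i = 0 := fun i => by
    rw [← htr i]; exact Finset.sum_congr rfl fun k _ => hDt _ _ _
  ext i j
  -- The sums over `s` are inserted so that both brackets become covariant derivatives of D. They
  -- cancel since `A` is torsion-free.
  have h1 : ∀ k, curv d (fun i => A i + D i) k i k j = curv d A k i k j +
      ((D i).map (d k) + A k * D i - D i * A k - ∑ s, A k s i • D s) k j -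
      ((D k).map (d i) + A i * D k - D k * A i - ∑ s, A i s k • D s) k j +
      ((D k * D i) k j - (D i * D k) k j) := by
    intro k
    have : ∑ s, A k s i • D s = ∑ s, A i s k • D s :=
      Finset.sum_congr rfl fun s _ => by rw [H.torsion]
    have hM : curv d (fun i => A i + D i) k i = curv d A k i +
        ((D i).map (d k) + A k * D i - D i * A k - ∑ s, A k s i • D s) -
        ((D k).map (d i) + A i * D k - D k * A i - ∑ s, A i s k • D s) +
        (D k * D i - D i * D k) := by
      rw [this]
      simp only [curv, map_add_derivation]
      noncomm_ring
    rw [hM]; rfl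
  have h2 : ∑ k, (D k * D i) k j = 0 := by
    simp only [Matrix.mul_apply]
    rw [Finset.sum_comm]
    exact Finset.sum_eq_zero fun s _ => by rw [← Finset.sum_mul, htr', zero_mul]
  have h3 : ∑ k, (D i * D k) k j = 0 := by
    have := H.trace_connDiff_mul hS.par i j
    rw [Matrix.trace] at this
    rw [← this]
    refine Finset.sum_congr rfl fun k _ => ?_
    rw [Matrix.diag_apply, Matrix.mul_apply, Matrix.mul_apply]
    exact Finset.sum_congr rfl fun s _ => congrArg _ (hDt k j s)
  have h4 : ∑ k, ((D k).map (d i) + A i * D k - D k * A i - ∑ s, A i s k • D s) k j = 0 := by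
    have e1 : ∑ k, (D k).map (d i) k j = 0 := by
      simp only [Matrix.map_apply]; rw [← map_sum, htr', map_zero]
    have e2 : ∑ k, (A i * D k) k j = ∑ k, (∑ s, A i s k • D s) k j := by
      simp only [Matrix.mul_apply, Matrix.sum_apply, Matrix.smul_apply, smul_eq_mul]
      rw [Finset.sum_comm]
    have e3 : ∑ k, (D k * A i) k j = 0 := by
      simp only [Matrix.mul_apply]
      rw [Finset.sum_comm]
      exact Finset.sum_eq_zero fun s _ => by rw [← Finset.sum_mul, htr', zero_mul]
    simp only [Matrix.sub_apply, Matrix.add_apply, Finset.sum_sub_distrib,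
      Finset.sum_add_distrib, e1, e2, e3]
    ring
  -- The metric is parallel, so the index of D may be lowered under the covariant derivative and
  -- raised again. This allows the Koszul expression for `G * D` to be differentiated.
  have h5 : ∀ k, (D i).map (d k) + A k * D i - D i * A k - ∑ s, A k s i • D s =
      G' * cov3 d A (fun s => G * D s) k i := by
    intro k
    have hcomp : (A k)ᵀ * G = G.map (d k) - G * A k := by rw [H.compat k]; abel
    have : cov3 d A (fun s => G * D s) k i =
        G * ((D i).map (d k) + A k * D i - D i * A k - ∑ s, A k s i • D s) := by
      rw [cov3, map_mul_derivation, ← Matrix.mul_assoc (A k)ᵀ, hcomp, Matrix.mul_sub G _ (∑ s, _),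
        Matrix.mul_sum]
      simp only [Matrix.mul_smul]
      noncomm_ring
    rw [this, ← Matrix.mul_assoc, H.inv', Matrix.one_mul]
  have h6 : ∀ k s, cov3 d A (fun s => G * D s) k i s j = (1 / 2 : ℝ) •
      (cov3 d A (cov d A S) k i j s + cov3 d A (cov d A S) k j i s -
        cov3 d A (cov d A S) k s i j) := by
    intro k s
    have hm : ∀ i k j, (G * D i) k j =
      (1 / 2 : ℝ) • (cov d A S i k j + cov d A S j i k - cov d A S k i j) := fun i k j =>
        H.mul_connDiff hS i k j
    have hs := H.cov_entry_symm hS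
    simp only [cov3, Matrix.sub_apply, Matrix.map_apply, Matrix.sum_apply, Matrix.smul_apply,
      Matrix.mul_apply (M := (A k)ᵀ), Matrix.mul_apply (N := A k), Matrix.transpose_apply,
      smul_eq_mul, hm]
    simp only [Derivation.map_smul, mul_smul_comm, smul_mul_assoc, ← Finset.smul_sum, ← smul_sub]
    congr 1
    simp only [map_add, map_sub, mul_add, mul_sub, add_mul, sub_mul, Finset.sum_add_distrib,
      Finset.sum_sub_distrib, mul_comm _ (A k _ _)]
    simp only [fun m => hs i m j, fun m => hs i s m, fun m => hs m s j]
    ring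
  have h7 : ∑ k, (G' * cov3 d A (fun s => G * D s) k i) k j =
      -((1 / 2 : ℝ) • boxMat d A G' S i j) := by
    simp only [Matrix.mul_apply, h6, mul_smul_comm, ← Finset.smul_sum, mul_add, mul_sub,
      Finset.sum_add_distrib, Finset.sum_sub_distrib, H.sum_mul_cov3 hflat hS]
    rw [add_zero, zero_sub, smul_neg]
    simp [boxMat, Matrix.sum_apply]
  rw [Matrix.sub_apply, Matrix.smul_apply, ricMat, Matrix.of_apply,
    Finset.sum_congr rfl fun k _ => h1 k, Finset.sum_add_distrib, Finset.sum_sub_distrib,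
    Finset.sum_sub_distrib, Finset.sum_add_distrib, h2, h3, h4]
  simp only [h5, h7, ricMat, Matrix.of_apply]
  ring

end NullFrame

end Perturbation

/-! ### The Ricci tensor of an ambient metric -/

section Ambient

variable {ι R : Type*} [Fintype ι] [DecidableEq ι] [CommRing R] [Algebra ℝ R]

/-- The derivations `dd` behave like the coordinate derivations of the coordinates `(t, x, ρ)`;
`t'` is the inverse of `t`. -/
structure AmbientCoords (dd : Fin 1 ⊕ (ι ⊕ Fin 1) → Derivation ℝ R R) (t t' ρ : R) : Prop where
  comm : ∀ i j f, dd i (dd j f) = dd j (dd i f)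
  inv : t * t' = 1
  dt_t : dd (Sum.inl 0) t = 1
  dx_t : ∀ i, dd (Sum.inr (Sum.inl i)) t = 0
  dr_t : dd (Sum.inr (Sum.inr 0)) t = 0
  dt_r : dd (Sum.inl 0) ρ = 0
  dx_r : ∀ i, dd (Sum.inr (Sum.inl i)) ρ = 0
  dr_r : dd (Sum.inr (Sum.inr 0)) ρ = 1

/-- The matrix of `2 ρ dt² + 2 t dt dρ + t² G`. -/
def ambMat (t ρ : R) (G : Matrix ι ι R) : Matrix (Fin 1 ⊕ (ι ⊕ Fin 1)) (Fin 1 ⊕ (ι ⊕ Fin 1)) R :=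
  Matrix.of fun a b =>
    match a, b with
    | Sum.inl _, Sum.inl _ => 2 * ρ
    | Sum.inl _, Sum.inr (Sum.inr _) => t
    | Sum.inr (Sum.inr _), Sum.inl _ => t
    | Sum.inr (Sum.inl i), Sum.inr (Sum.inl j) => t ^ 2 * G i j
    | _, _ => 0

/-- The inverse of `ambMat`. -/
def ambInv (t' ρ : R) (G' : Matrix ι ι R) :
    Matrix (Fin 1 ⊕ (ι ⊕ Fin 1)) (Fin 1 ⊕ (ι ⊕ Fin 1)) R :=
  Matrix.of fun a b =>
    match a, b with
    | Sum.inr (Sum.inr _), Sum.inr (Sum.inr _) => -(2 * ρ * t' ^ 2)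
    | Sum.inl _, Sum.inr (Sum.inr _) => t'
    | Sum.inr (Sum.inr _), Sum.inl _ => t'
    | Sum.inr (Sum.inl i), Sum.inr (Sum.inl j) => t' ^ 2 * G' i j
    | _, _ => 0

/-- The Levi-Civita connection of `ambMat`, where `A` is that of `G`, `Q = ∂ρ G / 2` and
`P = G⁻¹ Q`. -/
def ambConn (t t' ρ : R) (A : ι → Matrix ι ι R) (G Q P : Matrix ι ι R) :
    Fin 1 ⊕ (ι ⊕ Fin 1) → Matrix (Fin 1 ⊕ (ι ⊕ Fin 1)) (Fin 1 ⊕ (ι ⊕ Fin 1)) R := fun c =>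
  Matrix.of fun a b =>
    match c, a, b with
    | Sum.inr (Sum.inl i), Sum.inl _, Sum.inr (Sum.inl j) => -(t * Q i j)
    | Sum.inl _, Sum.inr (Sum.inl k), Sum.inr (Sum.inl j) => if k = j then t' else 0
    | Sum.inr (Sum.inl i), Sum.inr (Sum.inl k), Sum.inl _ => if k = i then t' else 0
    | Sum.inr (Sum.inl i), Sum.inr (Sum.inl k), Sum.inr (Sum.inl j) => A i k j
    | Sum.inr (Sum.inl i), Sum.inr (Sum.inl k), Sum.inr (Sum.inr _) => P k i
    | Sum.inr (Sum.inr _), Sum.inr (Sum.inl k), Sum.inr (Sum.inl j) => P k j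
    | Sum.inr (Sum.inl i), Sum.inr (Sum.inr _), Sum.inr (Sum.inl j) => -G i j + 2 * ρ * Q i j
    | Sum.inl _, Sum.inr (Sum.inr _), Sum.inr (Sum.inr _) => t'
    | Sum.inr (Sum.inr _), Sum.inr (Sum.inr _), Sum.inl _ => t'
    | _, _, _ => 0

theorem ambMat_symm {t ρ : R} {G : Matrix ι ι R} (hG : Gᵀ = G) :
    (ambMat t ρ G)ᵀ = ambMat t ρ G := by
  have hs : ∀ a b, G a b = G b a := fun a b => congrFun (congrFun hG b) a
  ext a b
  rcases a with a | a | a <;> rcases b with b | b | b <;> simp [ambMat]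
  rw [hs]

theorem ambMat_mul_ambInv {t t' ρ : R} (ht : t * t' = 1) {G G' : Matrix ι ι R} (h : G * G' = 1) :
    ambMat t ρ G * ambInv t' ρ G' = 1 := by
  have h' : ∀ a b, ∑ k, G a k * G' k b = if a = b then 1 else 0 := fun a b => by
    rw [← Matrix.mul_apply, h, Matrix.one_apply]
  ext a b
  rcases a with a | a | a <;> rcases b with b | b | b <;>
    simp [ambMat, ambInv, Matrix.mul_apply, Matrix.one_apply, ht]
  · exact fun h => (h (Subsingleton.elim a b)).elim
  · linear_combination (-2 * ρ * t') * ht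
  · have : ∀ x, t ^ 2 * G a x * (t' ^ 2 * G' x b) = (t * t') ^ 2 * (G a x * G' x b) := by
      intro x; ring
    simp only [this, ← Finset.mul_sum, ht, h']; simp
  · exact fun h => (h (Subsingleton.elim a b)).elim

theorem ricMat_apply' {ι R : Type*} [Fintype ι] [DecidableEq ι] [CommRing R] [Algebra ℝ R]
    (d : ι → Derivation ℝ R R) (C : ι → Matrix ι ι R) (a b : ι) :
    ricMat d C a b = ∑ c, d c (C a c b) - d a (∑ c, C c c b) + ∑ c, ∑ e, C c c e * C a e b -
      ∑ c, ∑ e, C a c e * C c e b := by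
  simp only [ricMat, curv, Matrix.of_apply, Matrix.sub_apply, Matrix.add_apply, Matrix.map_apply,
    Matrix.mul_apply, Finset.sum_sub_distrib, Finset.sum_add_distrib, map_sum]

variable {dd : Fin 1 ⊕ (ι ⊕ Fin 1) → Derivation ℝ R R} {t t' ρ : R} {A : ι → Matrix ι ι R}
  {G Q P : Matrix ι ι R}

namespace AmbientCoords

theorem d_inv (H : AmbientCoords dd t t' ρ) (a : Fin 1 ⊕ (ι ⊕ Fin 1)) :
    dd a t' = -(t' ^ 2 * dd a t) := by
  have h := congrArg (dd a) H.inv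
  rw [Derivation.leibniz, Derivation.map_one_eq_zero, smul_eq_mul, smul_eq_mul] at h
  linear_combination t' * h - dd a t' * H.inv

theorem ambConn_torsionFree (hG : Gᵀ = G) (hQ : Qᵀ = Q) (hA : TorsionFree A) :
    TorsionFree (ambConn t t' ρ A G Q P) := by
  have hs : ∀ a b, G a b = G b a := fun a b => congrFun (congrFun hG b) a
  have hq : ∀ a b, Q a b = Q b a := fun a b => congrFun (congrFun hQ b) a
  intro i j k
  rcases i with i | i | i <;> rcases j with j | j | j <;> rcases k with k | k | k <;>
    simp [ambConn]
  · rw [hq]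
  · exact hA _ _ _
  · rw [hq, hs]

theorem ambConn_metricCompat (H : AmbientCoords dd t t' ρ) (hG : Gᵀ = G) (hQ : Qᵀ = Q)
    (hGQ : G.map (dd (Sum.inr (Sum.inr 0))) = Q + Q) (hG0 : G.map (dd (Sum.inl 0)) = 0)
    (hP : G * P = Q)
    (hc : MetricCompat (fun i => dd (Sum.inr (Sum.inl i))) A G) :
    MetricCompat dd (ambConn t t' ρ A G Q P) (ambMat t ρ G) := by
  have hs : ∀ a b, G a b = G b a := fun a b => congrFun (congrFun hG b) a
  have hq : ∀ a b, Q a b = Q b a := fun a b => congrFun (congrFun hQ b) a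
  have hp : ∀ a b, ∑ k, G a k * P k b = Q a b := fun a b => by
    rw [← Matrix.mul_apply, ← hP]
  have hp' : ∀ a b, ∑ k, P k a * G k b = Q a b := fun a b => by
    rw [hq, ← hp]; exact Finset.sum_congr rfl fun k _ => by rw [mul_comm, hs]
  have hgb : ∀ a b, dd (Sum.inr (Sum.inr 0)) (G a b) = Q a b + Q a b := fun a b =>
    congrFun (congrFun hGQ a) b
  have hg0 : ∀ a b, dd (Sum.inl 0) (G a b) = 0 := fun a b => congrFun (congrFun hG0 a) b
  have hcc : ∀ k a b, dd (Sum.inr (Sum.inl k)) (G a b) =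
      ∑ l, A k l a * G l b + ∑ l, G a l * A k l b := fun k a b => by
    have := congrFun (congrFun (hc k) a) b
    simpa [Matrix.mul_apply] using this
  have e1 : ∀ (c : R) (f g : ι → R), ∑ x, f x * (c * g x) = c * ∑ x, f x * g x := by
    intro c f g; rw [Finset.mul_sum]; exact Finset.sum_congr rfl fun x _ => by ring
  have e2 : ∀ (c : R) (f g : ι → R), ∑ x, c * f x * g x = c * ∑ x, f x * g x := by
    intro c f g; rw [Finset.mul_sum]; exact Finset.sum_congr rfl fun x _ => by ring
  have hr : ∀ a, dd a (2 * ρ) = 2 * dd a ρ := fun a => by rw [two_mul, map_add, two_mul]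
  have hsq : ∀ a g, dd a (t ^ 2 * g) = 2 * t * dd a t * g + t ^ 2 * dd a g := fun a g => by
    simp only [pow_two, Derivation.leibniz, smul_eq_mul]; ring
  have ht := H.inv
  intro c
  rcases c with c | c | c
  all_goals
    ext a b
    rcases a with a | a | a <;> rcases b with b | b | b <;>
    simp only [ambConn, ambMat, Matrix.add_apply, Matrix.mul_apply, Matrix.transpose_apply,
      Matrix.map_apply, Matrix.of_apply, Fintype.sum_sum_type, Finset.univ_unique,
      Finset.sum_singleton, Fin.fin_one_eq_zero, mul_zero, zero_mul, add_zero, zero_add,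
      Finset.sum_const_zero, map_zero, Fin.default_eq_zero, hr, hsq, H.dt_t, H.dx_t, H.dr_t,
      H.dt_r, H.dx_r, H.dr_r, hgb, hg0, hcc, e1, e2, hp, hp', ite_mul, mul_ite,
      Finset.sum_ite_eq, Finset.sum_ite_eq', Finset.mem_univ, if_true, ht, mul_comm t' t]
  · linear_combination (-2 * t * G a b) * ht
  · rw [hs c b]; linear_combination (-t * G b c) * ht
  · rw [hs c a]; linear_combination (-t * G a c) * ht
  all_goals try (rw [hq a c])
  all_goals ring

/-- With Q = ġ/2 and P = g⁻¹ġ/2 this is the tangential part of the Fefferman-Graham equation. Its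
nonlinear terms in ġ all contain tr P or the product QP. -/
theorem ric_xx (H : AmbientCoords dd t t' ρ) (hGQ : G.map (dd (Sum.inr (Sum.inr 0))) = Q + Q)
    (hQ0 : Q.map (dd (Sum.inl 0)) = 0) (hG : Gᵀ = G) (hQ : Qᵀ = Q) (hP : G * P = Q)
    (hPQ : Pᵀ * Q = Q * P) (i j : ι) :
    ricMat dd (ambConn t t' ρ A G Q P) (Sum.inr (Sum.inl i)) (Sum.inr (Sum.inl j)) =
      ricMat (fun i => dd (Sum.inr (Sum.inl i))) A i j +
        2 * ρ * dd (Sum.inr (Sum.inr 0)) (Q i j) + (2 - (Fintype.card ι : R)) * Q i j +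
        P.trace * (2 * ρ * Q i j - G i j) - 4 * ρ * (Q * P) i j := by
  rw [ricMat_apply', ricMat_apply']
  simp only [ambConn, Matrix.of_apply, Fintype.sum_sum_type, Finset.univ_unique,
    Finset.sum_singleton, Fin.fin_one_eq_zero, mul_zero, zero_mul, add_zero, zero_add,
    Finset.sum_const_zero, map_zero, Fin.default_eq_zero, ite_mul, mul_ite,
    Finset.sum_ite_eq, Finset.sum_ite_eq', Finset.mem_univ, if_true, Finset.sum_add_distrib]
  have h0 : dd (Sum.inl 0) (-(t * Q i j)) = -Q i j := by
    have : dd (Sum.inl 0) (Q i j) = 0 := congrFun (congrFun hQ0 i) j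
    rw [map_neg, Derivation.leibniz, this, H.dt_t]; simp
  have h1 : dd (Sum.inr (Sum.inr 0)) (-G i j + 2 * ρ * Q i j) =
      2 * ρ * dd (Sum.inr (Sum.inr 0)) (Q i j) := by
    have : dd (Sum.inr (Sum.inr 0)) (G i j) = Q i j + Q i j := congrFun (congrFun hGQ i) j
    rw [map_add, map_neg, this, mul_assoc, two_mul, map_add, Derivation.leibniz, H.dr_r,
      smul_eq_mul, smul_eq_mul]
    ring
  have h2 : ∑ x, (-G i x + 2 * ρ * Q i x) * P x j = -Q i j + 2 * ρ * (Q * P) i j := by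
    have : Q i j = (G * P) i j := by rw [hP]
    rw [this, Matrix.mul_apply, Matrix.mul_apply, Finset.mul_sum, ← Finset.sum_neg_distrib,
      ← Finset.sum_add_distrib]
    exact Finset.sum_congr rfl fun x _ => by ring
  have h3 : ∑ x, P x i * (-G x j + 2 * ρ * Q x j) = -Q i j + 2 * ρ * (Q * P) i j := by
    have : Q i j = (Pᵀ * G) i j := by
      have : Pᵀ * G = (G * P)ᵀ := by rw [Matrix.transpose_mul, hG]
      rw [this, hP, hQ]
    rw [this, ← hPQ, Matrix.mul_apply, Matrix.mul_apply, Finset.mul_sum, ← Finset.sum_neg_distrib,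
      ← Finset.sum_add_distrib]
    exact Finset.sum_congr rfl fun x _ => by rw [Matrix.transpose_apply]; ring
  have h4 : ∑ x : ι, t' * -(t * Q i j) = -((Fintype.card ι : R) * Q i j) := by
    rw [Finset.sum_const, Finset.card_univ, nsmul_eq_mul]
    linear_combination (-(Fintype.card ι : R) * Q i j) * H.inv
  rw [h0, h1, h2, h3, h4, ← Finset.sum_mul, Matrix.trace]
  simp only [Matrix.diag_apply]
  linear_combination Q i j * H.inv

theorem ric_xr (hA : TorsionFree A) (j : ι) :
    ricMat dd (ambConn t t' ρ A G Q P) (Sum.inr (Sum.inl j)) (Sum.inr (Sum.inr 0)) =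
      ∑ k, (P.map (dd (Sum.inr (Sum.inl k))) + A k * P - P * A k) k j -
        dd (Sum.inr (Sum.inl j)) P.trace := by
  rw [ricMat_apply']
  simp only [ambConn, Matrix.of_apply, Fintype.sum_sum_type, Finset.univ_unique,
    Finset.sum_singleton, Fin.fin_one_eq_zero, mul_zero, zero_mul, add_zero, zero_add,
    Finset.sum_const_zero, map_zero, Fin.default_eq_zero, ite_mul, mul_ite,
    Finset.sum_ite_eq, Finset.sum_ite_eq', Finset.mem_univ, if_true, Finset.sum_add_distrib]
  simp only [Matrix.sub_apply, Matrix.add_apply, Matrix.map_apply, Finset.sum_sub_distrib,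
    Finset.sum_add_distrib, Matrix.mul_apply, Matrix.trace, Matrix.diag_apply]
  have : ∑ x, ∑ y, A j x y * P y x = ∑ x, ∑ y, P x y * A x y j := by
    rw [Finset.sum_comm]
    exact Finset.sum_congr rfl fun x _ => Finset.sum_congr rfl fun y _ => by
      rw [hA j x y, mul_comm]
  rw [this]; ring

theorem ric_rr :
    ricMat dd (ambConn t t' ρ A G Q P) (Sum.inr (Sum.inr 0)) (Sum.inr (Sum.inr 0)) =
      -dd (Sum.inr (Sum.inr 0)) P.trace - (P * P).trace := by
  rw [ricMat_apply']
  simp only [ambConn, Matrix.of_apply, Fintype.sum_sum_type, Finset.univ_unique,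
    Finset.sum_singleton, Fin.fin_one_eq_zero, mul_zero, zero_mul, add_zero, zero_add,
    Finset.sum_const_zero, map_zero, Fin.default_eq_zero, ite_mul, mul_ite,
    Finset.sum_ite_eq, Finset.sum_ite_eq', Finset.mem_univ, if_true, Finset.sum_add_distrib]
  simp only [Matrix.mul_apply, Matrix.trace, Matrix.diag_apply]
  ring

theorem ric_tx (H : AmbientCoords dd t t' ρ) (j : ι)
    (hA : dd (Sum.inl 0) (∑ x, A x x j) = 0) :
    ricMat dd (ambConn t t' ρ A G Q P) (Sum.inl 0) (Sum.inr (Sum.inl j)) = 0 := by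
  rw [ricMat_apply']
  simp only [ambConn, Matrix.of_apply, Fintype.sum_sum_type, Finset.univ_unique,
    Finset.sum_singleton, Fin.fin_one_eq_zero, mul_zero, zero_mul, add_zero, zero_add,
    Finset.sum_const_zero, map_zero, Fin.default_eq_zero, ite_mul, mul_ite,
    Finset.sum_ite_eq, Finset.sum_ite_eq', Finset.mem_univ, if_true, Finset.sum_add_distrib]
  have h : ∀ x, dd (Sum.inr (Sum.inl x)) (if x = j then t' else 0) = 0 := by
    intro x
    split_ifs
    · rw [H.d_inv, H.dx_t]; ring
    · exact map_zero _
  simp only [h, hA, ← Finset.mul_sum, ← Finset.sum_mul, Finset.sum_const_zero]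
  ring

theorem ric_tt (H : AmbientCoords dd t t' ρ) :
    ricMat dd (ambConn t t' ρ A G Q P) (Sum.inl 0) (Sum.inl 0) = 0 := by
  rw [ricMat_apply']
  simp only [ambConn, Matrix.of_apply, Fintype.sum_sum_type, Finset.univ_unique,
    Finset.sum_singleton, Fin.fin_one_eq_zero, mul_zero, zero_mul, add_zero, zero_add,
    Finset.sum_const_zero, map_zero, Fin.default_eq_zero, ite_mul, mul_ite,
    Finset.sum_ite_eq, Finset.sum_ite_eq', Finset.mem_univ, if_true, Finset.sum_add_distrib]
  simp only [Finset.sum_const, map_add, map_nsmul, H.d_inv, H.dt_t]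
  simp only [nsmul_eq_mul]
  ring

theorem ric_tr (H : AmbientCoords dd t t' ρ) (hP : dd (Sum.inl 0) P.trace = 0) :
    ricMat dd (ambConn t t' ρ A G Q P) (Sum.inl 0) (Sum.inr (Sum.inr 0)) = 0 := by
  rw [ricMat_apply']
  simp only [ambConn, Matrix.of_apply, Fintype.sum_sum_type, Finset.univ_unique,
    Finset.sum_singleton, Fin.fin_one_eq_zero, mul_zero, zero_mul, add_zero, zero_add,
    Finset.sum_const_zero, map_zero, Fin.default_eq_zero, ite_mul, mul_ite,
    Finset.sum_ite_eq, Finset.sum_ite_eq', Finset.mem_univ, if_true, Finset.sum_add_distrib]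
  have h : dd (Sum.inl 0) (∑ x, P x x) = 0 := hP
  rw [h, H.d_inv, H.dr_t, ← Finset.sum_mul, ← Finset.mul_sum]
  ring

end AmbientCoords

end Ambient

/-! ### Ambient metrics of adapted tensors -/

section AdaptedAmbient

variable {ι κ R : Type*} [Fintype ι] [DecidableEq ι] [Fintype κ] [DecidableEq κ]
  [CommRing R] [Algebra ℝ R] {dd : Fin 1 ⊕ (ι ⊕ Fin 1) → Derivation ℝ R R} {t t' ρ : R}
  {A : ι → Matrix ι ι R} {G G' : Matrix ι ι R} {X : Matrix ι κ R} {L : Matrix κ ι R}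
  {θ : ι → Matrix κ κ R}

theorem frameConn_map_comm {d : ι → Derivation ℝ R R} {δ : Derivation ℝ R R}
    (hd : ∀ i f, d i (δ f) = δ (d i f)) (hθ : ∀ i, (θ i).map δ = 0) (i : ι) (f : Matrix κ κ R) :
    frameConn d θ i (f.map δ) = (frameConn d θ i f).map δ := by
  have h : (f.map δ).map (d i) = (f.map (d i)).map δ := by ext; simp [hd]
  simp only [frameConn_apply, map_add_derivation, map_mul_derivation, map_transpose_derivation,
    hθ, h]
  simp

/-- Used for ∂_ρ: the metric, the frame and the induced connection do not depend on ρ, so the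
conditions can be differentiated. -/
theorem FrameTensor.map_derivation {d : ι → Derivation ℝ R R} {δ : Derivation ℝ R R}
    (hd : ∀ i f, d i (δ f) = δ (d i f)) (hθ : ∀ i, (θ i).map δ = 0) (hG : G.map δ = 0)
    (hX : X.map δ = 0) {S : Matrix ι ι R} {f : Matrix κ κ R} (hS : FrameTensor d G X θ S f) :
    FrameTensor d G X θ (S.map δ) (f.map δ) where
  eq := by
    rw [hS.eq]
    simp only [map_mul_derivation, map_transpose_derivation, hG, hX]
    simp
  symm := by rw [← map_transpose_derivation, hS.symm]
  par := by
    intro a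
    have h := congrArg (fun M : Matrix κ κ R => M.map δ) (hS.par a)
    have hX' : ∀ k, δ (X k a) = 0 := fun k => congrFun (congrFun hX k) a
    simp only [map_sum_derivation, map_smul_derivation, map_zero_derivation, hX', zero_smul,
      zero_add] at h
    rw [← h]
    exact Finset.sum_congr rfl fun k _ => by rw [frameConn_map_comm hd hθ]

/-- Data for which the ambient metric of an adapted family is computed: `G`, the frame and the
induced connection do not depend on `t` and `ρ`, and the family `S` does not depend on `t`. -/
structure AdaptedAmbient (dd : Fin 1 ⊕ (ι ⊕ Fin 1) → Derivation ℝ R R) (t t' ρ : R)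
    (A : ι → Matrix ι ι R) (G G' : Matrix ι ι R) (X : Matrix ι κ R) (L : Matrix κ ι R)
    (θ : ι → Matrix κ κ R) (S : Matrix ι ι R) (f : Matrix κ κ R) : Prop where
  coords : AmbientCoords dd t t' ρ
  frame : NullFrame (fun i => dd (Sum.inr (Sum.inl i))) A G G' X L θ
  flat : ∀ a k, ∑ l, X l a • curv (fun i => dd (Sum.inr (Sum.inl i))) θ l k = 0
  tensor : FrameTensor (fun i => dd (Sum.inr (Sum.inl i))) G X θ S f
  dt_G : G.map (dd (Sum.inl 0)) = 0
  dr_G : G.map (dd (Sum.inr (Sum.inr 0))) = 0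
  dr_X : X.map (dd (Sum.inr (Sum.inr 0))) = 0
  dr_θ : ∀ i, (θ i).map (dd (Sum.inr (Sum.inr 0))) = 0
  dt_A : ∀ i, (A i).map (dd (Sum.inl 0)) = 0
  dt_S : S.map (dd (Sum.inl 0)) = 0

namespace AdaptedAmbient

variable {S : Matrix ι ι R} {f : Matrix κ κ R}

theorem tensor_dr (H : AdaptedAmbient dd t t' ρ A G G' X L θ S f) :
    FrameTensor (fun i => dd (Sum.inr (Sum.inl i))) G X θ (S.map (dd (Sum.inr (Sum.inr 0))))
      (f.map (dd (Sum.inr (Sum.inr 0)))) :=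
  FrameTensor.map_derivation (d := fun i => dd (Sum.inr (Sum.inl i)))
    (fun _ _ => H.coords.comm _ _ _) H.dr_θ H.dr_G H.dr_X H.tensor

/-- Because `S` kills the distribution, the index of ∂_ρ S may be raised with `G` in place of `G +
S`. This gives the closed form of P in the statement. -/
theorem ambConn_eq (H : AdaptedAmbient dd t t' ρ A G G' X L θ S f) :
    conn dd (ambMat t ρ (G + S)) (ambInv t' ρ (G' - X * f * Xᵀ)) =
      ambConn t t' ρ (fun i => A i + connDiff (fun i => dd (Sum.inr (Sum.inl i))) G G' X θ f i)
        (G + S) ((1 / 2 : ℝ) • S.map (dd (Sum.inr (Sum.inr 0))))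
        (X * ((1 / 2 : ℝ) • f.map (dd (Sum.inr (Sum.inr 0))) * (G * X)ᵀ)) := by
  have hSt : Sᵀ = S := by
    rw [H.tensor.eq]; simp only [Matrix.transpose_mul, Matrix.transpose_transpose, H.tensor.symm,
      Matrix.mul_assoc]
  have hSt' : ((1 / 2 : ℝ) • S.map (dd (Sum.inr (Sum.inr 0))))ᵀ =
      (1 / 2 : ℝ) • S.map (dd (Sum.inr (Sum.inr 0))) := by
    rw [Matrix.transpose_smul, ← map_transpose_derivation, hSt]
  have hGS : (G + S)ᵀ = G + S := by rw [Matrix.transpose_add, H.frame.symm, hSt]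
  have hinv : (G + S) * (G' - X * f * Xᵀ) = 1 := by
    rw [H.tensor.eq]; exact H.frame.perturbed_inv f
  have hc := H.frame.perturbed_conn H.tensor
  have htf : TorsionFree (fun i => A i +
      connDiff (fun i => dd (Sum.inr (Sum.inl i))) G G' X θ f i) := by
    rw [← hc]; exact conn_torsionFree _ _ hGS
  refine conn_unique dd (ambMat_symm hGS)
    (mul_eq_one_comm.mp (ambMat_mul_ambInv H.coords.inv hinv))
    (AmbientCoords.ambConn_torsionFree hGS hSt' htf)
    (H.coords.ambConn_metricCompat hGS hSt' ?_ ?_ ?_ ?_)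
  · rw [map_add_derivation, H.dr_G, ← add_smul]; norm_num
  · rw [map_add_derivation, H.dt_G, H.dt_S, add_zero]
  · have h1 : S * X = 0 := by
      rw [H.tensor.eq, Matrix.mul_assoc, H.frame.lower_transpose_mul, Matrix.mul_zero]
    rw [← Matrix.mul_assoc, Matrix.add_mul, h1, add_zero, H.tensor_dr.eq]
    simp only [Matrix.smul_mul, Matrix.mul_smul, Matrix.mul_assoc]
  · rw [← hc]; exact conn_metricCompat _ hGS hinv

theorem trace_half (H : AdaptedAmbient dd t t' ρ A G G' X L θ S f) (M : Matrix κ ι R)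
    (hM : M * X = 0) : (X * M).trace = 0 := by
  rw [Matrix.trace_mul_comm, hM, Matrix.trace_zero]

theorem half_mul (H : AdaptedAmbient dd t t' ρ A G G' X L θ S f) (F : Matrix κ κ R) :
    (F * (G * X)ᵀ) * X = 0 := by
  rw [Matrix.mul_assoc, H.frame.lower_transpose_mul, Matrix.mul_zero]

/-- Both tr P and QP vanish since the lowered frame kills the frame. The general formula then
becomes linear, and `perturbed_ric` supplies the Ricci tensor of the slice. -/
theorem ric_xx (H : AdaptedAmbient dd t t' ρ A G G' X L θ S f) (i j : ι) :
    ricMat dd (conn dd (ambMat t ρ (G + S)) (ambInv t' ρ (G' - X * f * Xᵀ)))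
      (Sum.inr (Sum.inl i)) (Sum.inr (Sum.inl j)) =
    (1 / 2 : ℝ) • (2 * ρ * dd (Sum.inr (Sum.inr 0)) (dd (Sum.inr (Sum.inr 0)) (S i j)) +
      (2 - (Fintype.card ι : ℝ)) • dd (Sum.inr (Sum.inr 0)) (S i j) -
      boxMat (fun i => dd (Sum.inr (Sum.inl i))) A G' S i j +
      2 * ricMat (fun i => dd (Sum.inr (Sum.inl i))) A i j) := by
  have hSt : Sᵀ = S := by
    rw [H.tensor.eq]; simp only [Matrix.transpose_mul, Matrix.transpose_transpose, H.tensor.symm,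
      Matrix.mul_assoc]
  have hQP : ((1 / 2 : ℝ) • S.map (dd (Sum.inr (Sum.inr 0)))) *
      (X * ((1 / 2 : ℝ) • f.map (dd (Sum.inr (Sum.inr 0))) * (G * X)ᵀ)) = 0 := by
    rw [H.tensor_dr.eq, Matrix.smul_mul, ← Matrix.mul_assoc, Matrix.mul_assoc _ _ X,
      H.frame.lower_transpose_mul]; simp
  have hSt' : ((1 / 2 : ℝ) • S.map (dd (Sum.inr (Sum.inr 0))))ᵀ =
      (1 / 2 : ℝ) • S.map (dd (Sum.inr (Sum.inr 0))) := by
    rw [Matrix.transpose_smul, ← map_transpose_derivation, hSt]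
  have hSX : S * X = 0 := by
    rw [H.tensor.eq, Matrix.mul_assoc, H.frame.lower_transpose_mul, Matrix.mul_zero]
  rw [H.ambConn_eq, H.coords.ric_xx, hQP, trace_half H _ (H.half_mul _),
    H.frame.perturbed_ric H.flat H.tensor]
  · have e : (2 - (Fintype.card ι : R)) = algebraMap ℝ R (2 - (Fintype.card ι : ℝ)) := by
      rw [map_sub, map_natCast, map_ofNat]
    simp only [Matrix.sub_apply, Matrix.smul_apply, Matrix.map_apply, Derivation.map_smul,
      Matrix.zero_apply, e]
    simp only [Algebra.smul_def]
    have h2 : algebraMap ℝ R (1 / 2) * 2 = 1 := by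
      have : (2 : R) = algebraMap ℝ R 2 := (map_ofNat _ 2).symm
      rw [this, ← map_mul]; norm_num
    linear_combination -(ricMat (fun i => dd (Sum.inr (Sum.inl i))) A i j) * h2
  · rw [map_add_derivation, H.dr_G, ← add_smul]; norm_num
  · rw [map_real_smul_derivation]
    have : (S.map (dd (Sum.inr (Sum.inr 0)))).map (dd (Sum.inl 0)) =
        (S.map (dd (Sum.inl 0))).map (dd (Sum.inr (Sum.inr 0))) := by
      ext a b; simp [H.coords.comm (Sum.inl 0)]
    rw [this, H.dt_S, map_zero_derivation, smul_zero]
  · rw [Matrix.transpose_add, H.frame.symm, hSt]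
  · exact hSt'
  · rw [← Matrix.mul_assoc, Matrix.add_mul, hSX, add_zero, H.tensor_dr.eq]
    simp only [Matrix.smul_mul, Matrix.mul_smul, Matrix.mul_assoc]
  · have := congrArg Matrix.transpose hQP
    rw [Matrix.transpose_mul, hSt', Matrix.transpose_zero] at this
    rw [this, hQP]

/-- The components with a t index vanish for every metric in normal form, as its data do not depend
on t. The ρρ component contains only tr P and tr P². The xρ component is the divergence of P minus
d(tr P), and the ρ-derivative of an adapted family is again divergence free. -/
theorem ric_other (H : AdaptedAmbient dd t t' ρ A G G' X L θ S f)
    (a b : Fin 1 ⊕ (ι ⊕ Fin 1))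
    (hab : ∀ i j, ¬(a = Sum.inr (Sum.inl i) ∧ b = Sum.inr (Sum.inl j))) :
    ricMat dd (conn dd (ambMat t ρ (G + S)) (ambInv t' ρ (G' - X * f * Xᵀ))) a b = 0 := by
  have hSt : Sᵀ = S := by
    rw [H.tensor.eq]; simp only [Matrix.transpose_mul, Matrix.transpose_transpose, H.tensor.symm,
      Matrix.mul_assoc]
  have hGS : (G + S)ᵀ = G + S := by rw [Matrix.transpose_add, H.frame.symm, hSt]
  have hinv : (G + S) * (G' - X * f * Xᵀ) = 1 := by
    rw [H.tensor.eq]; exact H.frame.perturbed_inv f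
  have hsymm : ∀ a b, ricMat dd (conn dd (ambMat t ρ (G + S)) (ambInv t' ρ (G' - X * f * Xᵀ))) a b
      = ricMat dd (conn dd (ambMat t ρ (G + S)) (ambInv t' ρ (G' - X * f * Xᵀ))) b a := by
    intro a b
    have hi := ambMat_mul_ambInv (ρ := ρ) H.coords.inv hinv
    have := ricMat_symm H.coords.comm (conn_torsionFree dd _ (ambMat_symm hGS))
      (conn_metricCompat dd (ambMat_symm hGS) hi) hi
    exact congrFun (congrFun this b) a
  have htr := trace_half H _ (H.half_mul ((1 / 2 : ℝ) • f.map (dd (Sum.inr (Sum.inr 0)))))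
  have htt : ricMat dd (conn dd (ambMat t ρ (G + S)) (ambInv t' ρ (G' - X * f * Xᵀ)))
      (Sum.inl 0) (Sum.inl 0) = 0 := by rw [H.ambConn_eq, H.coords.ric_tt]
  have htx : ∀ j, ricMat dd (conn dd (ambMat t ρ (G + S)) (ambInv t' ρ (G' - X * f * Xᵀ)))
      (Sum.inl 0) (Sum.inr (Sum.inl j)) = 0 := by
    intro j
    rw [H.ambConn_eq, H.coords.ric_tx]
    have h1 : ∀ x, connDiff (fun i => dd (Sum.inr (Sum.inl i))) G G' X θ f x x j =
        connDiff (fun i => dd (Sum.inr (Sum.inl i))) G G' X θ f j x x := fun x =>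
      H.frame.connDiff_torsionFree H.tensor _ _ _
    have h2 := H.frame.trace_connDiff H.tensor.par j
    rw [Matrix.trace] at h2
    simp only [Matrix.diag_apply] at h2
    simp only [Matrix.add_apply, Finset.sum_add_distrib, h1, h2, add_zero, map_sum]
    exact Finset.sum_eq_zero fun x _ => congrFun (congrFun (H.dt_A x) x) j
  have htr' : ricMat dd (conn dd (ambMat t ρ (G + S)) (ambInv t' ρ (G' - X * f * Xᵀ)))
      (Sum.inl 0) (Sum.inr (Sum.inr 0)) = 0 := by
    rw [H.ambConn_eq, H.coords.ric_tr (by rw [htr, map_zero])]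
  have hrr : ricMat dd (conn dd (ambMat t ρ (G + S)) (ambInv t' ρ (G' - X * f * Xᵀ)))
      (Sum.inr (Sum.inr 0)) (Sum.inr (Sum.inr 0)) = 0 := by
    have h1 : (X * ((1 / 2 : ℝ) • f.map (dd (Sum.inr (Sum.inr 0))) * (G * X)ᵀ)) *
        (X * ((1 / 2 : ℝ) • f.map (dd (Sum.inr (Sum.inr 0))) * (G * X)ᵀ)) = 0 := by
      rw [Matrix.mul_assoc X, ← Matrix.mul_assoc _ X, H.half_mul]; simp
    rw [H.ambConn_eq, AmbientCoords.ric_rr, htr, h1]; simp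
  have hxr : ∀ j, ricMat dd (conn dd (ambMat t ρ (G + S)) (ambInv t' ρ (G' - X * f * Xᵀ)))
      (Sum.inr (Sum.inl j)) (Sum.inr (Sum.inr 0)) = 0 := by
    intro j
    have htf : TorsionFree (fun i => A i +
        connDiff (fun i => dd (Sum.inr (Sum.inl i))) G G' X θ f i) := by
      rw [← H.frame.perturbed_conn H.tensor]; exact conn_torsionFree _ _ hGS
    rw [H.ambConn_eq, AmbientCoords.ric_xr htf, htr, map_zero, sub_zero]
    set D := connDiff (fun i => dd (Sum.inr (Sum.inl i))) G G' X θ f with hD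
    set F := (1 / 2 : ℝ) • f.map (dd (Sum.inr (Sum.inr 0))) with hF
    set P := X * (F * (G * X)ᵀ) with hP
    have hDt : TorsionFree D := H.frame.connDiff_torsionFree H.tensor
    -- Together with the next step, this shows that passing from `A` to `A + D` does not change the
    -- divergence of P: D is traceless, and P D = 0 since D has its image in 𝒩^⊥.
    have h1 : ∑ k, (D k * P) k j = 0 := by
      simp only [Matrix.mul_apply]
      rw [Finset.sum_comm]
      refine Finset.sum_eq_zero fun s _ => ?_
      rw [← Finset.sum_mul]
      have : ∑ k, D k k s = 0 := by
        have h2 := H.frame.trace_connDiff H.tensor.par s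
        rw [Matrix.trace] at h2
        rw [← h2]; exact Finset.sum_congr rfl fun k _ => hDt _ _ _
      rw [this, zero_mul]
    have h2 : ∑ k, (P * D k) k j = 0 := by
      have h3 : P * D j = 0 := by
        rw [hP, Matrix.mul_assoc, Matrix.mul_assoc, hD, H.frame.lower_mul_connDiff H.tensor.par]
        simp
      have h4 : (P * D j).trace = 0 := by rw [h3, Matrix.trace_zero]
      rw [← h4, Matrix.trace]
      refine Finset.sum_congr rfl fun k _ => ?_
      rw [Matrix.diag_apply, Matrix.mul_apply, Matrix.mul_apply]
      exact Finset.sum_congr rfl fun s _ => congrArg _ (hDt _ _ _)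
    have h5 : ∀ k, P.map (dd (Sum.inr (Sum.inl k))) + A k * P - P * A k =
        X * (frameConn (fun i => dd (Sum.inr (Sum.inl i))) θ k F * (G * X)ᵀ) := by
      intro k
      have hX : X.map (dd (Sum.inr (Sum.inl k))) = X * θ k - A k * X := by
        rw [← H.frame.par k]; abel
      rw [hP, map_mul_derivation, map_mul_derivation, map_transpose_derivation,
        H.frame.map_lower, hX, frameConn_apply]
      generalize G * X = Y
      simp only [Matrix.transpose_add, Matrix.transpose_mul, Matrix.transpose_transpose,
        Matrix.mul_add, Matrix.add_mul, Matrix.mul_sub, Matrix.sub_mul, Matrix.mul_assoc]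
      abel
    have h6 : ∀ k, P.map (dd (Sum.inr (Sum.inl k))) + (A k + D k) * P - P * (A k + D k) =
        (P.map (dd (Sum.inr (Sum.inl k))) + A k * P - P * A k) + (D k * P - P * D k) := by
      intro k; noncomm_ring
    have h7 : ∑ k, (X * (frameConn (fun i => dd (Sum.inr (Sum.inl i))) θ k F * (G * X)ᵀ)) k j
        = 0 := by
      have hF' : ∀ a, ∑ k, X k a • frameConn (fun i => dd (Sum.inr (Sum.inl i))) θ k F = 0 := by
        intro a
        have h8 : ∀ k, frameConn (fun i => dd (Sum.inr (Sum.inl i))) θ k F = (1 / 2 : ℝ) •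
            frameConn (fun i => dd (Sum.inr (Sum.inl i))) θ k
              (f.map (dd (Sum.inr (Sum.inr 0)))) := by
          intro k
          simp only [hF, frameConn_apply, map_real_smul_derivation, Matrix.mul_smul,
            Matrix.smul_mul, smul_add]
        simp only [h8, smul_comm _ (1 / 2 : ℝ), ← Finset.smul_sum, H.tensor_dr.par, smul_zero]
      have h9 := NullFrame.sum_div_frame _ hF'
      simp only [← Matrix.mul_assoc, Matrix.mul_apply (N := (G * X)ᵀ)]
      rw [Finset.sum_comm]
      refine Finset.sum_eq_zero fun b _ => ?_
      rw [← Finset.sum_mul]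
      have := h9 b
      simp only [← Matrix.mul_apply] at this
      rw [this, zero_mul]
    simp only [h6, h5]
    simp only [Matrix.add_apply, Matrix.sub_apply, Finset.sum_add_distrib,
      Finset.sum_sub_distrib, h1, h2, h7]
    simp
  rcases a with a | a | a <;> rcases b with b | b | b
  · rw [Subsingleton.elim a 0, Subsingleton.elim b 0]; exact htt
  · rw [Subsingleton.elim a 0]; exact htx b
  · rw [Subsingleton.elim a 0, Subsingleton.elim b 0]; exact htr'
  · rw [hsymm, Subsingleton.elim b 0]; exact htx a
  · exact (hab a b ⟨rfl, rfl⟩).elim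
  · rw [Subsingleton.elim b 0]; exact hxr a
  · rw [hsymm, Subsingleton.elim a 0, Subsingleton.elim b 0]; exact htr'
  · rw [hsymm, Subsingleton.elim a 0]; exact hxr b
  · rw [Subsingleton.elim a 0, Subsingleton.elim b 0]; exact hrr

end AdaptedAmbient

end AdaptedAmbient

/-! ### Behaviour under changes of coordinates -/

section Naturality

variable {ι R R' : Type*} [Fintype ι] [DecidableEq ι] [CommRing R] [Algebra ℝ R]
  [CommRing R'] [Algebra ℝ R']

/-- `ψ` is the pullback of functions by a change of coordinates with Jacobian matrix `J`, whose
inverse is `K`. -/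
structure CoordChange (d : ι → Derivation ℝ R R) (δ : ι → Derivation ℝ R' R') (ψ : R →+* R')
    (J K : Matrix ι ι R') : Prop where
  comm : ∀ i j f, δ i (δ j f) = δ j (δ i f)
  chain : ∀ a f, δ a (ψ f) = ∑ k, J k a * ψ (d k f)
  closed : ∀ a b k, δ a (J k b) = δ b (J k a)
  inv : J * K = 1

/-- The pullback of a `(0,2)`-tensor. -/
def pull (ψ : R →+* R') (J : Matrix ι ι R') (S : Matrix ι ι R) : Matrix ι ι R' :=
  Jᵀ * S.map ψ * J

/-- The pullback of a connection. -/
def pullConn (δ : ι → Derivation ℝ R' R') (ψ : R →+* R') (J K : Matrix ι ι R')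
    (A : ι → Matrix ι ι R) (a : ι) : Matrix ι ι R' :=
  K * ((∑ k, J k a • (A k).map ψ) * J + J.map (δ a))

variable {d : ι → Derivation ℝ R R} {δ : ι → Derivation ℝ R' R'} {ψ : R →+* R'}
  {J K : Matrix ι ι R'} {A : ι → Matrix ι ι R} {G G' S : Matrix ι ι R}

theorem pull_sum {σ : Type*} (s : Finset σ) (S : σ → Matrix ι ι R) :
    pull ψ J (∑ a ∈ s, S a) = ∑ a ∈ s, pull ψ J (S a) := by
  have : (∑ a ∈ s, S a).map ψ = ∑ a ∈ s, (S a).map ψ := by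
    ext; simp [Matrix.sum_apply]
  rw [pull, this, Matrix.mul_sum, Matrix.sum_mul]; rfl

theorem pull_smul (r : R) (S : Matrix ι ι R) : pull ψ J (r • S) = ψ r • pull ψ J S := by
  have : (r • S).map ψ = ψ r • S.map ψ := by ext; simp
  rw [pull, this, Matrix.mul_smul, Matrix.smul_mul]; rfl

theorem pull_sub (S T : Matrix ι ι R) : pull ψ J (S - T) = pull ψ J S - pull ψ J T := by
  rw [pull, Matrix.map_sub _ (map_sub ψ), Matrix.mul_sub, Matrix.sub_mul]; rfl

namespace CoordChange

theorem inv' (H : CoordChange d δ ψ J K) : K * J = 1 := mul_eq_one_comm.mp H.inv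

theorem mul_pullConn (H : CoordChange d δ ψ J K) (A : ι → Matrix ι ι R) (a : ι) :
    J * pullConn δ ψ J K A a = (∑ k, J k a • (A k).map ψ) * J + J.map (δ a) := by
  rw [pullConn, ← Matrix.mul_assoc, H.inv, Matrix.one_mul]

theorem map_chain (H : CoordChange d δ ψ J K) (M : Matrix ι ι R) (a : ι) :
    (M.map ψ).map (δ a) = ∑ k, J k a • (M.map (d k)).map ψ := by
  ext i j
  simp [Matrix.sum_apply, H.chain]

theorem pullConn_torsionFree (H : CoordChange d δ ψ J K) (hA : TorsionFree A) :
    TorsionFree (pullConn δ ψ J K A) := by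
  intro a b c
  rw [pullConn, pullConn, Matrix.mul_apply, Matrix.mul_apply]
  refine Finset.sum_congr rfl fun m _ => ?_
  congr 1
  rw [Matrix.add_apply, Matrix.add_apply, Matrix.map_apply, Matrix.map_apply, H.closed]
  congr 1
  simp only [Matrix.mul_apply, Matrix.sum_apply, Matrix.smul_apply, Matrix.map_apply, smul_eq_mul,
    Finset.sum_mul]
  rw [Finset.sum_comm]
  exact Finset.sum_congr rfl fun x _ => Finset.sum_congr rfl fun y _ => by
    rw [hA x y m]; ring

/-- The inhomogeneous term `J.map (δ a)` of the pulled-back connection cancels the derivatives of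
the two factors `J` in the pulled-back tensor. -/
theorem cov_pull (H : CoordChange d δ ψ J K) (S : Matrix ι ι R) (a : ι) :
    cov δ (pullConn δ ψ J K A) (pull ψ J S) a = ∑ k, J k a • pull ψ J (cov d A S k) := by
  have h1 := H.mul_pullConn A a
  have h2 : pull ψ J S * pullConn δ ψ J K A a =
      Jᵀ * S.map ψ * (J * pullConn δ ψ J K A a) := by rw [pull, Matrix.mul_assoc]
  have h3 : (pullConn δ ψ J K A a)ᵀ * pull ψ J S =
      (J * pullConn δ ψ J K A a)ᵀ * S.map ψ * J := by
    rw [pull, Matrix.transpose_mul]; simp only [Matrix.mul_assoc]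
  have h4 : ∑ k, J k a • pull ψ J (cov d A S k) = Jᵀ * ((S.map ψ).map (δ a) -
      (∑ k, J k a • (A k).map ψ)ᵀ * S.map ψ - S.map ψ * (∑ k, J k a • (A k).map ψ)) * J := by
    rw [H.map_chain, Matrix.transpose_sum, Matrix.sum_mul, Matrix.mul_sum (s := Finset.univ)
      (f := fun k => J k a • (A k).map ψ), ← Finset.sum_sub_distrib, ← Finset.sum_sub_distrib,
      Matrix.mul_sum, Matrix.sum_mul]
    refine Finset.sum_congr rfl fun k _ => ?_
    have : (cov d A S k).map ψ = (S.map (d k)).map ψ - ((A k).map ψ)ᵀ * S.map ψ -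
        S.map ψ * (A k).map ψ := by
      rw [cov, Matrix.map_sub _ (map_sub ψ), Matrix.map_sub _ (map_sub ψ), Matrix.map_mul,
        Matrix.map_mul]; rfl
    rw [pull, this, Matrix.transpose_smul, Matrix.smul_mul, Matrix.mul_smul, ← smul_sub,
      ← smul_sub, Matrix.mul_smul, Matrix.smul_mul]
  rw [cov, h2, h3, h1, h4, pull, map_mul_derivation, map_mul_derivation, map_transpose_derivation,
    Matrix.transpose_add, Matrix.transpose_mul]
  noncomm_ring

theorem metricCompat_pull (H : CoordChange d δ ψ J K) (hc : MetricCompat d A G) :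
    MetricCompat δ (pullConn δ ψ J K A) (pull ψ J G) := by
  intro a
  have h0 : ∀ k, cov d A G k = 0 := fun k => by rw [cov, hc k]; abel
  have h := H.cov_pull (A := A) G a
  simp only [h0] at h
  have h1 : pull ψ J (0 : Matrix ι ι R) = 0 := by simp [pull]
  rw [h1, cov] at h
  simp only [smul_zero, Finset.sum_const_zero] at h
  rw [← sub_eq_zero, ← h]; abel

theorem cov3_pull (H : CoordChange d δ ψ J K) (T : ι → Matrix ι ι R) (b a : ι) :
    cov3 δ (pullConn δ ψ J K A) (fun a => ∑ k, J k a • pull ψ J (T k)) b a =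
      ∑ l, ∑ k, (J l b * J k a) • pull ψ J (cov3 d A T l k) := by
  have h1 : ∀ k, (pull ψ J (T k)).map (δ b) = ∑ l, J l b • pull ψ J (cov d A (T k) l) +
      (pullConn δ ψ J K A b)ᵀ * pull ψ J (T k) + pull ψ J (T k) * pullConn δ ψ J K A b := by
    intro k; rw [← H.cov_pull, cov]; abel
  have h2 : ∑ m, pullConn δ ψ J K A b m a • ∑ k, J k m • pull ψ J (T k) =
      ∑ k, ((∑ l, J l b • (A l).map ψ) * J + J.map (δ b)) k a • pull ψ J (T k) := by
    rw [← H.mul_pullConn]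
    simp only [Matrix.mul_apply, Finset.smul_sum, Finset.sum_smul, smul_smul]
    rw [Finset.sum_comm]
    exact Finset.sum_congr rfl fun k _ => Finset.sum_congr rfl fun m _ => by rw [mul_comm]
  have h3 : ∀ l k, pull ψ J (cov3 d A T l k) = pull ψ J (cov d A (T k) l) -
      ∑ m, ψ (A l m k) • pull ψ J (T m) := by
    intro l k
    have : cov3 d A T l k = cov d A (T k) l - ∑ m, A l m k • T m := by rw [cov3, cov]; abel
    rw [this, pull_sub, pull_sum]
    simp only [pull_smul]
  have h4 : ∑ l, ∑ k, (J l b * J k a) • ∑ m, ψ (A l m k) • pull ψ J (T m) =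
      ∑ k, ((∑ l, J l b • (A l).map ψ) * J) k a • pull ψ J (T k) := by
    simp only [Matrix.mul_apply, Matrix.sum_apply, Matrix.smul_apply, Matrix.map_apply,
      smul_eq_mul, Finset.smul_sum, Finset.sum_smul, Finset.sum_mul, smul_smul]
    calc ∑ l, ∑ k, ∑ m, (J l b * J k a * ψ (A l m k)) • pull ψ J (T m)
        = ∑ l, ∑ m, ∑ k, (J l b * J k a * ψ (A l m k)) • pull ψ J (T m) :=
          Finset.sum_congr rfl fun _ _ => Finset.sum_comm
      _ = ∑ m, ∑ l, ∑ k, (J l b * J k a * ψ (A l m k)) • pull ψ J (T m) := Finset.sum_comm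
      _ = _ := Finset.sum_congr rfl fun m _ => by
          rw [Finset.sum_comm]
          exact Finset.sum_congr rfl fun _ _ => Finset.sum_congr rfl fun _ _ => by
            congr 1; ring
  rw [cov3, h2, map_sum_derivation]
  simp only [map_smul_derivation, h1, h3, smul_sub, Finset.sum_sub_distrib, h4, smul_add,
    Finset.sum_add_distrib, Matrix.add_apply, add_smul, Matrix.map_apply, Matrix.mul_sum,
    Matrix.sum_mul, Matrix.mul_smul, Matrix.smul_mul]
  have h5 : ∑ k, J k a • ∑ l, J l b • pull ψ J (cov d A (T k) l) =
      ∑ l, ∑ k, (J l b * J k a) • pull ψ J (cov d A (T k) l) := by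
    simp only [Finset.smul_sum, smul_smul]
    rw [Finset.sum_comm]
    exact Finset.sum_congr rfl fun _ _ => Finset.sum_congr rfl fun _ _ => by rw [mul_comm]
  rw [h5]; abel

theorem boxMat_pull (H : CoordChange d δ ψ J K) (S : Matrix ι ι R) :
    boxMat δ (pullConn δ ψ J K A) (K * G'.map ψ * Kᵀ) (pull ψ J S) =
      pull ψ J (boxMat d A G' S) := by
  have h1 : cov δ (pullConn δ ψ J K A) (pull ψ J S) =
      fun a => ∑ k, J k a • pull ψ J (cov d A S k) := funext fun a => H.cov_pull S a
  rw [boxMat, h1]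
  simp only [H.cov3_pull, Finset.smul_sum, smul_smul]
  have h2 : ∀ l k, ∑ b, ∑ a, (K * G'.map ψ * Kᵀ) b a * (J l b * J k a) = ψ (G' l k) := by
    intro l k
    have : J * (K * G'.map ψ * Kᵀ) * Jᵀ = G'.map ψ := by
      have e : Kᵀ * Jᵀ = 1 := by rw [← Matrix.transpose_mul, H.inv, Matrix.transpose_one]
      rw [← Matrix.mul_assoc, ← Matrix.mul_assoc, H.inv, Matrix.one_mul, Matrix.mul_assoc, e,
        Matrix.mul_one]
    have h := congrFun (congrFun this l) k
    rw [Matrix.map_apply] at h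
    rw [← h, Matrix.mul_apply]
    simp only [Matrix.mul_apply (M := J), Matrix.transpose_apply (M := J), Finset.sum_mul]
    rw [Finset.sum_comm]
    exact Finset.sum_congr rfl fun _ _ => Finset.sum_congr rfl fun _ _ => by ring
  rw [boxMat, pull_sum]
  simp only [pull_sum, pull_smul, ← h2, Finset.sum_smul]
  calc ∑ b, ∑ a, ∑ l, ∑ k, ((K * G'.map ψ * Kᵀ) b a * (J l b * J k a)) •
        pull ψ J (cov3 d A (cov d A S) l k)
      = ∑ b, ∑ l, ∑ k, ∑ a, ((K * G'.map ψ * Kᵀ) b a * (J l b * J k a)) •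
        pull ψ J (cov3 d A (cov d A S) l k) := by
        refine Finset.sum_congr rfl fun b _ => ?_
        rw [Finset.sum_comm]
        exact Finset.sum_congr rfl fun l _ => Finset.sum_comm
    _ = _ := by
        rw [Finset.sum_comm]
        exact Finset.sum_congr rfl fun l _ => Finset.sum_comm

/-- `J` intertwines the pulled-back connection with the connection Σ J_{ka} A_k on the target
bundle, so `curv_intertwine` applies. The derivatives of `J` left in the curvature of the latter
cancel because the rows of `J` are closed. -/
theorem curv_pull (H : CoordChange d δ ψ J K) (a b : ι) :
    J * curv δ (pullConn δ ψ J K A) a b =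
      (∑ k, ∑ l, (J k a * J l b) • (curv d A k l).map ψ) * J := by
  have h1 := curv_intertwine (A := fun a => ∑ k, J k a • (A k).map ψ) (X := J) H.comm
    (fun i => by rw [add_comm]; exact (H.mul_pullConn A i).symm) a b
  rw [← h1]
  congr 1
  have e1 : ∀ a b, (∑ l, J l b • (A l).map ψ).map (δ a) = ∑ l, δ a (J l b) • (A l).map ψ +
      ∑ k, ∑ l, (J k a * J l b) • ((A l).map (d k)).map ψ := by
    intro a b
    simp only [map_sum_derivation, map_smul_derivation, H.map_chain, Finset.sum_add_distrib,
      Finset.smul_sum, smul_smul]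
    rw [Finset.sum_comm]
    congr 1
    exact Finset.sum_congr rfl fun _ _ => Finset.sum_congr rfl fun _ _ => by rw [mul_comm]
  have e2 : ∀ a b, (∑ k, J k a • (A k).map ψ) * (∑ l, J l b • (A l).map ψ) =
      ∑ k, ∑ l, (J k a * J l b) • (A k * A l).map ψ := by
    intro a b
    simp only [Matrix.sum_mul, Matrix.mul_sum, Matrix.smul_mul, Matrix.mul_smul, smul_smul,
      Matrix.map_mul]
    rw [Finset.sum_comm]
    refine Finset.sum_congr rfl fun k _ => ?_
    rw [Finset.smul_sum]
    exact Finset.sum_congr rfl fun l _ => by rw [smul_smul, mul_comm]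
  have e3 : ∀ M : ι → ι → Matrix ι ι R', ∑ k, ∑ l, (J k b * J l a) • M k l =
      ∑ k, ∑ l, (J k a * J l b) • M l k := by
    intro M
    rw [Finset.sum_comm]
    exact Finset.sum_congr rfl fun _ _ => Finset.sum_congr rfl fun _ _ => by rw [mul_comm]
  have e4 : ∑ l, δ a (J l b) • (A l).map ψ = ∑ l, δ b (J l a) • (A l).map ψ :=
    Finset.sum_congr rfl fun l _ => by rw [H.closed]
  have e5 : ∀ k l, (curv d A k l).map ψ = ((A l).map (d k)).map ψ - ((A k).map (d l)).map ψ +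
      (A k * A l).map ψ - (A l * A k).map ψ := by
    intro k l
    rw [curv, Matrix.map_sub _ (map_sub ψ), Matrix.map_add _ (map_add ψ),
      Matrix.map_sub _ (map_sub ψ)]
  rw [curv]
  simp only [e1, e2, e5, smul_add, smul_sub, Finset.sum_add_distrib, Finset.sum_sub_distrib]
  rw [e4, e3 (fun k l => ((A l).map (d k)).map ψ), e3 (fun k l => (A k * A l).map ψ)]
  abel

theorem ricMat_pull (H : CoordChange d δ ψ J K) :
    ricMat δ (pullConn δ ψ J K A) = pull ψ J (ricMat d A) := by
  have h1 : ∀ a b, curv δ (pullConn δ ψ J K A) a b =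
      K * ((∑ k, ∑ l, (J k a * J l b) • (curv d A k l).map ψ) * J) := by
    intro a b
    rw [← H.curv_pull, ← Matrix.mul_assoc, H.inv', Matrix.one_mul]
  ext a b
  simp only [ricMat, Matrix.of_apply, h1]
  have h2 : ∀ m k, ∑ c, K c m * J k c = if k = m then 1 else 0 := by
    intro m k
    rw [← Matrix.one_apply, ← H.inv, Matrix.mul_apply]
    exact Finset.sum_congr rfl fun c _ => mul_comm _ _
  have h3 : ∀ c, (K * ((∑ k, ∑ l, (J k c * J l a) • (curv d A k l).map ψ) * J)) c b =
      ∑ m, ∑ k, ∑ l, ∑ s, (K c m * J k c) * (J l a * ψ (curv d A k l m s) * J s b) := by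
    intro c
    simp only [Matrix.mul_apply, Matrix.sum_apply, Matrix.smul_apply, Matrix.map_apply,
      smul_eq_mul, Finset.sum_mul, Finset.mul_sum]
    refine Finset.sum_congr rfl fun m _ => ?_
    exact Finset.sum_congr rfl fun k _ => Finset.sum_congr rfl fun l _ =>
      Finset.sum_congr rfl fun s _ => by ring
  simp only [h3]
  rw [Finset.sum_comm]
  have h4 : ∀ m, ∑ c, ∑ k, ∑ l, ∑ s, (K c m * J k c) * (J l a * ψ (curv d A k l m s) * J s b) =
      ∑ l, ∑ s, J l a * ψ (curv d A m l m s) * J s b := by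
    intro m
    rw [Finset.sum_comm]
    have : ∀ k, ∑ c, ∑ l, ∑ s, (K c m * J k c) * (J l a * ψ (curv d A k l m s) * J s b) =
        (if k = m then 1 else 0) * ∑ l, ∑ s, J l a * ψ (curv d A k l m s) * J s b := by
      intro k
      rw [← h2, Finset.sum_mul]
      simp only [Finset.mul_sum]
    simp only [this, ite_mul, one_mul, zero_mul, Finset.sum_ite_eq', Finset.mem_univ, if_true]
  simp only [h4]
  rw [Finset.sum_comm]
  simp only [pull, Matrix.mul_apply, Matrix.map_apply, Matrix.transpose_apply, Matrix.of_apply,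
    map_sum, Finset.sum_mul, Finset.mul_sum]
  rw [Finset.sum_comm (s := (Finset.univ : Finset ι)) (t := (Finset.univ : Finset ι))
    (f := fun x y => ∑ z, J y a * ψ (curv d A z y z x) * J x b)]
  refine Finset.sum_congr rfl fun l _ => ?_
  rw [Finset.sum_comm]

theorem conn_pull (H : CoordChange d δ ψ J K) (hG : Gᵀ = G) (h : G * G' = 1) :
    conn δ (pull ψ J G) (K * G'.map ψ * Kᵀ) = pullConn δ ψ J K (conn d G G') := by
  refine conn_unique δ ?_ ?_ (H.pullConn_torsionFree (conn_torsionFree d G' hG))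
    (H.metricCompat_pull (conn_metricCompat d hG h))
  · simp only [pull, Matrix.transpose_mul, Matrix.transpose_transpose, ← Matrix.transpose_map, hG,
      Matrix.mul_assoc]
  · have e : Kᵀ * Jᵀ = 1 := by rw [← Matrix.transpose_mul, H.inv, Matrix.transpose_one]
    have e2 : G'.map ψ * G.map ψ = 1 := by
      rw [← Matrix.map_mul, mul_eq_one_comm.mp h, Matrix.map_one _ (map_zero ψ) (map_one ψ)]
    rw [pull, ← Matrix.mul_assoc, ← Matrix.mul_assoc, Matrix.mul_assoc _ Kᵀ, e, Matrix.mul_one,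
      Matrix.mul_assoc K, e2, Matrix.mul_one, H.inv']

end CoordChange

end Naturality

/-! ### Congruences, and uniqueness of the solution of the Fefferman-Graham equations -/

section Congruence

variable {ι R : Type*} [Fintype ι] [DecidableEq ι] [CommRing R] [Algebra ℝ R]

/-- Entrywise congruence of matrices modulo an ideal. -/
def MatCongr (I : Ideal R) (M N : Matrix ι ι R) : Prop :=
  ∀ i j, Ideal.Quotient.mk I (M i j) = Ideal.Quotient.mk I (N i j)

theorem mk_derivation {I : Ideal R} {δ : Derivation ℝ R R} (h : ∀ f ∈ I, δ f ∈ I) {a b : R}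
    (hab : Ideal.Quotient.mk I a = Ideal.Quotient.mk I b) :
    Ideal.Quotient.mk I (δ a) = Ideal.Quotient.mk I (δ b) := by
  rw [Ideal.Quotient.eq] at hab ⊢
  rw [← map_sub]; exact h _ hab

theorem MatCongr.inv {I : Ideal R} {G G' H H' : Matrix ι ι R} (h : MatCongr I G H)
    (hG : G * G' = 1) (hH : H * H' = 1) : MatCongr I G' H' := by
  intro i j
  rw [Ideal.Quotient.eq]
  have : G' - H' = G' * (H - G) * H' := by
    rw [Matrix.mul_sub, Matrix.sub_mul, mul_eq_one_comm.mp hG, Matrix.mul_assoc, hH]; simp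
  rw [← Matrix.sub_apply, this, Matrix.mul_apply]
  refine Ideal.sum_mem _ fun k _ => I.mul_mem_right _ ?_
  rw [Matrix.mul_apply]
  refine Ideal.sum_mem _ fun l _ => I.mul_mem_left _ ?_
  rw [Matrix.sub_apply, ← Ideal.Quotient.eq]
  exact (h _ _).symm

/-- The Ricci matrix is a polynomial in the metric, its inverse and their derivatives, so it
respects congruence modulo an ideal stable under these derivations. -/
theorem MatCongr.ricMat_conn {d : ι → Derivation ℝ R R} {I : Ideal R}
    (hI : ∀ i, ∀ f ∈ I, d i f ∈ I) {G G' H H' : Matrix ι ι R} (h : MatCongr I G H)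
    (h' : MatCongr I G' H') :
    MatCongr I (ricMat d (conn d G G')) (ricMat d (conn d H H')) := by
  have hd : ∀ i {a b : R}, Ideal.Quotient.mk I a = Ideal.Quotient.mk I b →
      Ideal.Quotient.mk I (d i a) = Ideal.Quotient.mk I (d i b) := fun i => mk_derivation (hI i)
  have hc : ∀ i k j, Ideal.Quotient.mk I (conn d G G' i k j) =
      Ideal.Quotient.mk I (conn d H H' i k j) := by
    intro i k j
    simp only [conn, Matrix.of_apply, Algebra.smul_def, map_mul, map_sum, map_add, map_sub,
      h' _ _, hd _ (h _ _)]
  intro i j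
  rw [ricMat_apply', ricMat_apply']
  have hs : Ideal.Quotient.mk I (d i (∑ c, conn d G G' c c j)) =
      Ideal.Quotient.mk I (d i (∑ c, conn d H H' c c j)) :=
    hd i (by simp only [map_sum, hc])
  have hs' : ∀ c, Ideal.Quotient.mk I (d c (conn d G G' i c j)) =
      Ideal.Quotient.mk I (d c (conn d H H' i c j)) := fun c => hd c (hc _ _ _)
  rw [map_sub, map_sub, map_add, map_add, map_sub, map_sub, hs]
  simp only [map_sum, map_mul, hc, hs']

/-- The ideal of the elements `f` such that `f, δ f, …, δᵏ⁻¹ f` lie in `S`. -/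
def vanishIdeal (δ : Derivation ℝ R R) (S : Ideal R) : ℕ → Ideal R
  | 0 => ⊤
  | k + 1 =>
    { carrier := {f | f ∈ S ∧ f ∈ vanishIdeal δ S k ∧ δ f ∈ vanishIdeal δ S k}
      add_mem' := fun ha hb => ⟨S.add_mem ha.1 hb.1, Ideal.add_mem _ ha.2.1 hb.2.1, by
        rw [map_add]; exact Ideal.add_mem _ ha.2.2 hb.2.2⟩
      zero_mem' := ⟨S.zero_mem, Ideal.zero_mem _, by rw [map_zero]; exact Ideal.zero_mem _⟩
      smul_mem' := fun c f hf => ⟨S.mul_mem_left _ hf.1, Ideal.mul_mem_left _ _ hf.2.1, by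
        rw [smul_eq_mul, Derivation.leibniz]
        exact Ideal.add_mem _ (Ideal.mul_mem_left _ _ hf.2.2) (by
          rw [smul_eq_mul, mul_comm]; exact Ideal.mul_mem_left _ _ hf.2.1)⟩ }

variable {δ : Derivation ℝ R R} {S : Ideal R}

theorem vanishIdeal_succ_le (k : ℕ) : vanishIdeal δ S (k + 1) ≤ vanishIdeal δ S k :=
  fun _ hf => hf.2.1

theorem vanishIdeal_anti {j k : ℕ} (h : j ≤ k) : vanishIdeal δ S k ≤ vanishIdeal δ S j := by
  induction h with
  | refl => exact le_rfl
  | step _ ih => exact (vanishIdeal_succ_le _).trans ih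

theorem mem_vanishIdeal_succ_of {k : ℕ} {f : R} (h0 : f ∈ S) (h1 : δ f ∈ vanishIdeal δ S k) :
    f ∈ vanishIdeal δ S (k + 1) := by
  induction k generalizing f with
  | zero => exact ⟨h0, trivial, h1⟩
  | succ k ih => exact ⟨h0, ih h0 h1.2.1, h1⟩

theorem vanishIdeal_iff {k : ℕ} {f : R} :
    f ∈ vanishIdeal δ S k ↔ ∀ j < k, (δ^[j]) f ∈ S := by
  induction k generalizing f with
  | zero => exact ⟨fun _ j hj => absurd hj (Nat.not_lt_zero _), fun _ => trivial⟩
  | succ k ih =>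
    constructor
    · intro h j hj
      cases j with
      | zero => exact h.1
      | succ j =>
        rw [Function.iterate_succ_apply]
        exact (ih.mp h.2.2) j (by omega)
    · intro h
      exact mem_vanishIdeal_succ_of (h 0 (by omega)) (ih.mpr fun j hj => by
        have := h (j + 1) (by omega)
        rwa [Function.iterate_succ_apply] at this)

theorem vanishIdeal_derivation {d : Derivation ℝ R R} (hd : ∀ f, d (δ f) = δ (d f))
    (hS : ∀ f ∈ S, d f ∈ S) (k : ℕ) : ∀ f ∈ vanishIdeal δ S k, d f ∈ vanishIdeal δ S k := by
  induction k with
  | zero => exact fun _ _ => trivial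
  | succ k ih =>
    intro f hf
    exact ⟨hS _ hf.1, ih _ hf.2.1, by rw [← hd]; exact ih _ hf.2.2⟩

theorem mul_mem_vanishIdeal_succ {k : ℕ} {a f : R} (ha : a ∈ S) (hf : f ∈ vanishIdeal δ S k) :
    a * f ∈ vanishIdeal δ S (k + 1) := by
  induction k generalizing f with
  | zero => exact mem_vanishIdeal_succ_of (S.mul_mem_right _ ha) trivial
  | succ k ih =>
    refine mem_vanishIdeal_succ_of (S.mul_mem_right _ ha) ?_
    rw [Derivation.leibniz, smul_eq_mul, smul_eq_mul]
    exact Ideal.add_mem _ (ih hf.2.2) (Ideal.mul_mem_right _ _ hf)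

/-- The Euler operator ρ∂_ρ multiplies the leading term, of order ρʲ, by j. -/
theorem euler_mem_vanishIdeal {ρ : R} (hρ : ρ ∈ S) (h1 : δ ρ = 1) {j : ℕ} {f : R}
    (hf : f ∈ vanishIdeal δ S j) : ρ * δ f - j * f ∈ vanishIdeal δ S (j + 1) := by
  induction j generalizing f with
  | zero =>
    rw [Nat.cast_zero, zero_mul, sub_zero]
    exact mul_mem_vanishIdeal_succ hρ trivial
  | succ j ih =>
    refine mem_vanishIdeal_succ_of (S.sub_mem (S.mul_mem_right _ hρ) (S.mul_mem_left _ hf.1)) ?_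
    have : δ (ρ * δ f - (j + 1 : ℕ) * f) = ρ * δ (δ f) - j * δ f := by
      rw [map_sub, Derivation.leibniz, Derivation.leibniz, h1, Derivation.map_natCast]
      simp only [smul_eq_mul]; push_cast; ring
    rw [this]; exact ih hf.2.2

theorem real_smul_mem_iff {I : Ideal R} {c : ℝ} (hc : c ≠ 0) {f : R} : c • f ∈ I ↔ f ∈ I := by
  constructor
  · intro h
    have : f = algebraMap ℝ R c⁻¹ * (c • f) := by
      rw [← Algebra.smul_def, smul_smul, inv_mul_cancel₀ hc, one_smul]
    rw [this]; exact I.mul_mem_left _ h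
  · intro h; rw [Algebra.smul_def]; exact I.mul_mem_left _ h

variable {dd : Fin 1 ⊕ (ι ⊕ Fin 1) → Derivation ℝ R R} {t t' ρ : R}

/-- The tangential part of the Ricci tensor of `ambMat`. -/
theorem AmbientCoords.ricMat_ambMat (H : AmbientCoords dd t t' ρ) {G G' : Matrix ι ι R}
    (hG : Gᵀ = G) (hG' : G * G' = 1) (hG0 : G.map (dd (Sum.inl 0)) = 0) (i j : ι) :
    ricMat dd (conn dd (ambMat t ρ G) (ambInv t' ρ G')) (Sum.inr (Sum.inl i))
      (Sum.inr (Sum.inl j)) =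
    ricMat (fun i => dd (Sum.inr (Sum.inl i))) (conn (fun i => dd (Sum.inr (Sum.inl i))) G G') i j +
      ρ * dd (Sum.inr (Sum.inr 0)) (dd (Sum.inr (Sum.inr 0)) (G i j)) +
      (1 / 2 : ℝ) • ((2 - (Fintype.card ι : ℝ)) • dd (Sum.inr (Sum.inr 0)) (G i j)) +
      (1 / 2 : ℝ) • ((G' * G.map (dd (Sum.inr (Sum.inr 0)))).trace *
        (ρ * dd (Sum.inr (Sum.inr 0)) (G i j) - G i j)) -
      ρ * (G.map (dd (Sum.inr (Sum.inr 0))) * (G' * G.map (dd (Sum.inr (Sum.inr 0))))) i j := by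
  set B := G.map (dd (Sum.inr (Sum.inr 0))) with hB
  have hBt : Bᵀ = B := by rw [hB, ← map_transpose_derivation, hG]
  have hQt : ((1 / 2 : ℝ) • B)ᵀ = (1 / 2 : ℝ) • B := by rw [Matrix.transpose_smul, hBt]
  have hG't := inv_transpose hG hG'
  have hGP : G * (G' * ((1 / 2 : ℝ) • B)) = (1 / 2 : ℝ) • B := by
    rw [← Matrix.mul_assoc, hG', Matrix.one_mul]
  have hBB : B = (1 / 2 : ℝ) • B + (1 / 2 : ℝ) • B := by rw [← add_smul]; norm_num
  have hc : conn dd (ambMat t ρ G) (ambInv t' ρ G') = ambConn t t' ρ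
      (conn (fun i => dd (Sum.inr (Sum.inl i))) G G') G ((1 / 2 : ℝ) • B)
      (G' * ((1 / 2 : ℝ) • B)) :=
    conn_unique dd (ambMat_symm hG) (mul_eq_one_comm.mp (ambMat_mul_ambInv H.inv hG'))
      (AmbientCoords.ambConn_torsionFree hG hQt (conn_torsionFree _ _ hG))
      (H.ambConn_metricCompat hG hQt (hB ▸ hBB) hG0 hGP (conn_metricCompat _ hG hG'))
  rw [hc, H.ric_xx (hB ▸ hBB) _ hG hQt hGP]
  · have e : (2 - (Fintype.card ι : R)) = algebraMap ℝ R (2 - (Fintype.card ι : ℝ)) := by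
      rw [map_sub, map_natCast, map_ofNat]
    have e1 : B i j = dd (Sum.inr (Sum.inr 0)) (G i j) := rfl
    simp only [Matrix.smul_apply, Matrix.mul_smul, Matrix.smul_mul, Matrix.trace_smul,
      Derivation.map_smul, e, e1]
    simp only [Algebra.smul_def]
    have h2 : algebraMap ℝ R (1 / 2) * 2 = 1 := by
      have : (2 : R) = algebraMap ℝ R 2 := (map_ofNat _ 2).symm
      rw [this, ← map_mul]; norm_num
    have h4 : algebraMap ℝ R (1 / 2) * algebraMap ℝ R (1 / 2) * 4 = 1 := by
      linear_combination (algebraMap ℝ R (1 / 2) * 2 + 1) * h2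
    linear_combination (ρ * dd (Sum.inr (Sum.inr 0)) (dd (Sum.inr (Sum.inr 0)) (G i j)) +
      ρ * (G' * B).trace * algebraMap ℝ R (1 / 2) * dd (Sum.inr (Sum.inr 0)) (G i j)) * h2 -
      ρ * (B * (G' * B)) i j * h4
  · rw [Matrix.transpose_mul, hG't, hQt, Matrix.mul_assoc]
  · rw [map_real_smul_derivation]
    have : B.map (dd (Sum.inl 0)) = (G.map (dd (Sum.inl 0))).map (dd (Sum.inr (Sum.inr 0))) := by
      ext a b; simp [hB, H.comm (Sum.inl 0)]
    rw [this, hG0, map_zero_derivation, smul_zero]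

/-- Suppose that two metrics agree modulo ρ^{k+1}. Modulo ρ^{k+1} their slices have the same Ricci
tensor, the terms with a factor ρ times a product of first derivatives agree, and ρ∂_ρ² acts on the
difference as k∂_ρ. With the coefficient 1 - n/2 of ġ this gives k + 1 - n/2. The term -½ tr(g⁻¹ġ)g
contributes the trace part, where the metrics may be replaced by their value at ρ = 0. -/
theorem fg_linearization (H : AmbientCoords dd t t' ρ)
    {G₁ G₁' G₂ G₂' g g' : Matrix ι ι R} (h₁ : G₁ᵀ = G₁) (h₁' : G₁ * G₁' = 1)
    (h₁t : G₁.map (dd (Sum.inl 0)) = 0) (h₂ : G₂ᵀ = G₂) (h₂' : G₂ * G₂' = 1)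
    (h₂t : G₂.map (dd (Sum.inl 0)) = 0) (hg : g * g' = 1) {S : Ideal R} (hρ : ρ ∈ S)
    (hS : ∀ i, ∀ f ∈ S, dd (Sum.inr (Sum.inl i)) f ∈ S) (hg₁ : ∀ i j, G₁ i j - g i j ∈ S)
    {k : ℕ} (hk : ∀ i j, G₁ i j - G₂ i j ∈ vanishIdeal (dd (Sum.inr (Sum.inr 0))) S (k + 1))
    (i j : ι) :
    ricMat dd (conn dd (ambMat t ρ G₁) (ambInv t' ρ G₁')) (Sum.inr (Sum.inl i))
      (Sum.inr (Sum.inl j)) -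
    ricMat dd (conn dd (ambMat t ρ G₂) (ambInv t' ρ G₂')) (Sum.inr (Sum.inl i))
      (Sum.inr (Sum.inl j)) -
    ((k + 1 - (Fintype.card ι : ℝ) / 2) • dd (Sum.inr (Sum.inr 0)) (G₁ i j - G₂ i j) -
      (1 / 2 : ℝ) • ((∑ a, ∑ b, g' a b * dd (Sum.inr (Sum.inr 0)) (G₁ b a - G₂ b a)) * g i j)) ∈
    vanishIdeal (dd (Sum.inr (Sum.inr 0))) S (k + 1) := by
  set δ := dd (Sum.inr (Sum.inr 0)) with hδ
  set I := vanishIdeal δ S (k + 1) with hI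
  have hmk : ∀ i j, Ideal.Quotient.mk I (G₁ i j) = Ideal.Quotient.mk I (G₂ i j) := fun i j =>
    Ideal.Quotient.eq.mpr (hk i j)
  have hmk' := MatCongr.inv (I := I) hmk h₁' h₂'
  have hric := MatCongr.ricMat_conn (d := fun i => dd (Sum.inr (Sum.inl i)))
    (fun i => vanishIdeal_derivation (fun f => H.comm _ _ f) (hS i) (k + 1)) hmk hmk' i j
  have hD : ∀ i j, δ (G₁ i j - G₂ i j) ∈ vanishIdeal δ S k := fun i j => (hk i j).2.2
  have hmS : ∀ {a : R}, a ∈ S → ∀ i j, Ideal.Quotient.mk I (a * δ (G₁ i j)) =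
      Ideal.Quotient.mk I (a * δ (G₂ i j)) := by
    intro a ha i j
    rw [Ideal.Quotient.eq, ← mul_sub, ← map_sub]
    exact mul_mem_vanishIdeal_succ ha (hD i j)
  have hρδ := hmS hρ
  have hE : Ideal.Quotient.mk I (ρ * δ (δ (G₁ i j - G₂ i j))) =
      Ideal.Quotient.mk I ((k : ℝ) • δ (G₁ i j - G₂ i j)) := by
    rw [Ideal.Quotient.eq]
    have := euler_mem_vanishIdeal (j := k) hρ H.dr_r (hD i j)
    rwa [Algebra.smul_def, map_natCast]
  set B₁ := G₁.map δ with hB₁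
  set B₂ := G₂.map δ with hB₂
  -- The two factors ġ are replaced one at a time: the factor ρ is first attached to the right one
  -- and then to the left one, and each replacement is a congruence because ρ raises the order by
  -- one.
  have hBB : ∀ i j, Ideal.Quotient.mk I (ρ * (B₁ * (G₁' * B₁)) i j) =
      Ideal.Quotient.mk I (ρ * (B₂ * (G₂' * B₂)) i j) := by
    intro i j
    have e : ∀ (B G' : Matrix ι ι R), ρ * (B * (G' * B)) i j =
        ∑ x, (∑ y, B i x * G' x y * (ρ * B y j)) := by
      intro B G'
      simp only [Matrix.mul_apply, Finset.mul_sum]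
      exact Finset.sum_congr rfl fun _ _ => Finset.sum_congr rfl fun _ _ => by ring
    have e' : ∀ (B G' : Matrix ι ι R), ρ * (B * (G' * B)) i j =
        ∑ x, (∑ y, (ρ * B i x) * G' x y * (B y j)) := by
      intro B G'
      simp only [Matrix.mul_apply, Finset.mul_sum]
      exact Finset.sum_congr rfl fun _ _ => Finset.sum_congr rfl fun _ _ => by ring
    have h1 : Ideal.Quotient.mk I (ρ * (B₁ * (G₁' * B₁)) i j) =
        Ideal.Quotient.mk I (∑ x, (∑ y, B₁ i x * G₂' x y * (ρ * B₂ y j))) := by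
      rw [e, map_sum, map_sum]
      refine Finset.sum_congr rfl fun x _ => ?_
      rw [map_sum, map_sum]
      refine Finset.sum_congr rfl fun y _ => ?_
      rw [map_mul, map_mul, hmk' x y, hB₁, Matrix.map_apply, Matrix.map_apply, hρδ y j, hB₂,
        Matrix.map_apply, ← map_mul, ← map_mul]
    rw [h1, e', map_sum, map_sum]
    refine Finset.sum_congr rfl fun x _ => ?_
    rw [map_sum, map_sum]
    refine Finset.sum_congr rfl fun y _ => ?_
    have h3 : B₁ i x * G₂' x y * (ρ * B₂ y j) = (ρ * δ (G₁ i x)) * (G₂' x y * B₂ y j) := by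
      rw [hB₁, Matrix.map_apply]; ring
    have h4 : (ρ * B₂ i x) * G₂' x y * (B₂ y j) = (ρ * δ (G₂ i x)) * (G₂' x y * B₂ y j) := by
      rw [hB₂, Matrix.map_apply]; ring
    rw [h3, h4, map_mul, hρδ, ← map_mul]
  have htrS : ∀ {a : R}, a ∈ S → Ideal.Quotient.mk I (a * (G₁' * B₁).trace) =
      Ideal.Quotient.mk I (a * (G₂' * B₂).trace) := by
    intro a ha
    simp only [Matrix.trace, Matrix.diag_apply, Matrix.mul_apply, Finset.mul_sum, map_sum]
    refine Finset.sum_congr rfl fun x _ => Finset.sum_congr rfl fun y _ => ?_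
    rw [mul_left_comm, map_mul, hmk' x y, hB₁, Matrix.map_apply, hmS ha, ← map_mul,
      ← mul_left_comm, hB₂, Matrix.map_apply]
  have hT : Ideal.Quotient.mk I ((G₁' * B₁).trace * G₁ i j) -
      Ideal.Quotient.mk I ((G₂' * B₂).trace * G₂ i j) =
      Ideal.Quotient.mk I ((∑ a, ∑ b, g' a b * δ (G₁ b a - G₂ b a)) * g i j) := by
    have hgk : ∀ i j, Ideal.Quotient.mk S (G₁ i j) = Ideal.Quotient.mk S (g i j) := fun i j =>
      Ideal.Quotient.eq.mpr (hg₁ i j)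
    have hgk' := MatCongr.inv (I := S) hgk h₁' hg
    have h1 : Ideal.Quotient.mk I (G₂' * B₂).trace =
        Ideal.Quotient.mk I (G₁' * B₂).trace := by
      simp only [Matrix.trace, Matrix.diag_apply, Matrix.mul_apply, map_sum, map_mul, hmk' _ _]
    have h2 : Ideal.Quotient.mk I ((G₁' * B₁).trace - (G₁' * B₂).trace) =
        Ideal.Quotient.mk I (∑ a, ∑ b, g' a b * δ (G₁ b a - G₂ b a)) := by
      simp only [Matrix.trace, Matrix.diag_apply, Matrix.mul_apply]
      rw [← Finset.sum_sub_distrib, map_sum, map_sum]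
      refine Finset.sum_congr rfl fun a _ => ?_
      rw [← Finset.sum_sub_distrib, map_sum, map_sum]
      refine Finset.sum_congr rfl fun b _ => ?_
      rw [Ideal.Quotient.eq, hB₁, hB₂, Matrix.map_apply, Matrix.map_apply, ← mul_sub, ← map_sub,
        ← sub_mul]
      exact mul_mem_vanishIdeal_succ (Ideal.Quotient.eq.mp (hgk' a b)) (hD b a)
    have h3 : Ideal.Quotient.mk I ((∑ a, ∑ b, g' a b * δ (G₁ b a - G₂ b a)) * G₁ i j) =
        Ideal.Quotient.mk I ((∑ a, ∑ b, g' a b * δ (G₁ b a - G₂ b a)) * g i j) := by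
      rw [Ideal.Quotient.eq, ← mul_sub, mul_comm]
      exact mul_mem_vanishIdeal_succ (hg₁ i j) (Ideal.sum_mem _ fun a _ => Ideal.sum_mem _
        fun b _ => Ideal.mul_mem_left _ _ (hD b a))
    rw [← h3, map_mul, map_mul, map_mul, h1, ← hmk, ← h2, map_sub, sub_mul]
  rw [← Ideal.Quotient.eq, H.ricMat_ambMat h₁ h₁' h₁t, H.ricMat_ambMat h₂ h₂' h₂t]
  have hA : ∀ (c : ℝ) (x : R), Ideal.Quotient.mk I (c • x) =
      Ideal.Quotient.mk I (algebraMap ℝ R c) * Ideal.Quotient.mk I x := fun c x => by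
    rw [Algebra.smul_def, map_mul]
  have htr2 : Ideal.Quotient.mk I ((G₁' * B₁).trace * (ρ * δ (G₁ i j))) =
      Ideal.Quotient.mk I ((G₂' * B₂).trace * (ρ * δ (G₂ i j))) := by
    rw [map_mul, hρδ, ← map_mul, mul_left_comm, ← mul_assoc, map_mul, htrS hρ, ← map_mul,
      mul_assoc, mul_left_comm]
  have hck : algebraMap ℝ R (k + 1 - (Fintype.card ι : ℝ) / 2) =
      algebraMap ℝ R k + algebraMap ℝ R (1 / 2) *
      algebraMap ℝ R (2 - (Fintype.card ι : ℝ)) := by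
    rw [← map_mul, ← map_add]
    congr 1; ring
  have hBij := hBB i j
  simp only [← hδ, ← hB₁, ← hB₂, Algebra.smul_def, hck] at hE ⊢
  generalize algebraMap ℝ R (2 - (Fintype.card ι : ℝ)) = c₂ at *
  generalize algebraMap ℝ R (1 / 2) = c₁ at *
  generalize algebraMap ℝ R k = c₀ at *
  generalize ∑ a, ∑ b, g' a b * δ (G₁ b a - G₂ b a) = τ at *
  simp only [map_mul, map_sub, map_add, mul_sub] at hE htr2 hT hBij hric ⊢
  linear_combination hE + Ideal.Quotient.mk I c₁ * htr2 -
    Ideal.Quotient.mk I c₁ * hT + hric - hBij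

end Congruence

/-! ### Comparison of two ambient metrics order by order -/

section Uniqueness

variable {ι R : Type*} [Fintype ι] [DecidableEq ι] [CommRing R] [Algebra ℝ R]
  {dd : Fin 1 ⊕ (ι ⊕ Fin 1) → Derivation ℝ R R} {t t' ρ : R}

theorem sum_inverse_mul {g g' : Matrix ι ι R} (hg : g * g' = 1) :
    ∑ a, ∑ b, g' a b * g b a = (Fintype.card ι : R) := by
  have : (g' * g).trace = (Fintype.card ι : R) := by
    rw [mul_eq_one_comm.mp hg, Matrix.trace_one]
  rw [← this]; simp only [Matrix.trace, Matrix.diag_apply, Matrix.mul_apply]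

/-- The tangential Ricci tensors of two formal solutions of the Fefferman-Graham equations agree
to the next order. -/
theorem fg_unique (H : AmbientCoords dd t t' ρ)
    {G₁ G₁' G₂ G₂' g g' : Matrix ι ι R} (h₁ : G₁ᵀ = G₁) (h₁' : G₁ * G₁' = 1)
    (h₁t : G₁.map (dd (Sum.inl 0)) = 0) (h₂ : G₂ᵀ = G₂) (h₂' : G₂ * G₂' = 1)
    (h₂t : G₂.map (dd (Sum.inl 0)) = 0) (hg : g * g' = 1) {S : Ideal R} (hρ : ρ ∈ S)
    (hS : ∀ i, ∀ f ∈ S, dd (Sum.inr (Sum.inl i)) f ∈ S) (hg₁ : ∀ i j, G₁ i j - g i j ∈ S)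
    (hg₂ : ∀ i j, G₂ i j - g i j ∈ S) {m : ℕ} (hm : Fintype.card ι = 2 * (m + 1))
    {E₁ E₂ : Matrix ι ι R}
    (hE₁ : ∀ i j, ricMat dd (conn dd (ambMat t ρ G₁) (ambInv t' ρ G₁')) (Sum.inr (Sum.inl i))
      (Sum.inr (Sum.inl j)) = E₁ i j)
    (hE₂ : ∀ i j, ricMat dd (conn dd (ambMat t ρ G₂) (ambInv t' ρ G₂')) (Sum.inr (Sum.inl i))
      (Sum.inr (Sum.inl j)) = E₂ i j)
    (hR₁ : ∀ i j, E₁ i j ∈ vanishIdeal (dd (Sum.inr (Sum.inr 0))) S m)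
    (hR₂ : ∀ i j, E₂ i j ∈ vanishIdeal (dd (Sum.inr (Sum.inr 0))) S m)
    (hT₁ : ∑ a, ∑ b, g' a b * E₁ b a ∈ vanishIdeal (dd (Sum.inr (Sum.inr 0))) S (m + 1))
    (hT₂ : ∑ a, ∑ b, g' a b * E₂ b a ∈ vanishIdeal (dd (Sum.inr (Sum.inr 0))) S (m + 1))
    (i j : ι) : E₁ i j - E₂ i j ∈ vanishIdeal (dd (Sum.inr (Sum.inr 0))) S (m + 1) := by
  set δ := dd (Sum.inr (Sum.inr 0)) with hδ
  have hcard : (Fintype.card ι : ℝ) = 2 * (m + 1) := by rw [hm]; push_cast; ring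
  have hlin : ∀ k, (∀ i j, G₁ i j - G₂ i j ∈ vanishIdeal δ S (k + 1)) → ∀ i j,
      E₁ i j - E₂ i j - ((k + 1 - (Fintype.card ι : ℝ) / 2) • δ (G₁ i j - G₂ i j) -
        (1 / 2 : ℝ) • ((∑ a, ∑ b, g' a b * δ (G₁ b a - G₂ b a)) * g i j)) ∈
      vanishIdeal δ S (k + 1) := by
    intro k hk i j
    rw [← hE₁, ← hE₂]
    exact fg_linearization H h₁ h₁' h₁t h₂ h₂' h₂t hg hρ hS hg₁ hk i j
  set τ := ∑ a, ∑ b, g' a b * δ (G₁ b a - G₂ b a) with hτ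
  -- Taking the trace of the linearised equation gives (k + 1 - n/2)τ - (n/2)τ = (k + 1 - n)τ. The
  -- coefficient is negative for k ≤ m, since n = 2(m + 1).
  have htr : ∀ k, k ≤ m → (∀ i j, G₁ i j - G₂ i j ∈ vanishIdeal δ S (k + 1)) →
      ∑ a, ∑ b, g' a b * (E₁ b a - E₂ b a) ∈ vanishIdeal δ S (k + 1) →
      τ ∈ vanishIdeal δ S (k + 1) := by
    intro k hkm hk hE
    have h1 : ∑ a, ∑ b, g' a b * (E₁ b a - E₂ b a - ((k + 1 - (Fintype.card ι : ℝ) / 2) •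
        δ (G₁ b a - G₂ b a) - (1 / 2 : ℝ) • (τ * g b a))) ∈ vanishIdeal δ S (k + 1) :=
      Ideal.sum_mem _ fun a _ => Ideal.sum_mem _ fun b _ => Ideal.mul_mem_left _ _ (hlin k hk b a)
    have h2 : ∑ a, ∑ b, g' a b * (E₁ b a - E₂ b a - ((k + 1 - (Fintype.card ι : ℝ) / 2) •
        δ (G₁ b a - G₂ b a) - (1 / 2 : ℝ) • (τ * g b a))) =
        ∑ a, ∑ b, g' a b * (E₁ b a - E₂ b a) - (k + 1 - (Fintype.card ι : ℝ)) • τ := by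
      have e : ∀ a b, g' a b * (E₁ b a - E₂ b a - ((k + 1 - (Fintype.card ι : ℝ) / 2) •
          δ (G₁ b a - G₂ b a) - (1 / 2 : ℝ) • (τ * g b a))) =
          g' a b * (E₁ b a - E₂ b a) - algebraMap ℝ R (k + 1 - (Fintype.card ι : ℝ) / 2) *
          (g' a b * δ (G₁ b a - G₂ b a)) + algebraMap ℝ R (1 / 2) * τ * (g' a b * g b a) := by
        intro a b; simp only [Algebra.smul_def]; ring
      simp only [e, Finset.sum_add_distrib, Finset.sum_sub_distrib, ← Finset.mul_sum]
      rw [sum_inverse_mul hg, ← hτ, Algebra.smul_def]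
      have : (Fintype.card ι : R) = algebraMap ℝ R (Fintype.card ι : ℝ) := (map_natCast _ _).symm
      rw [this]
      have h3 : algebraMap ℝ R (k + 1 - (Fintype.card ι : ℝ)) =
          algebraMap ℝ R (k + 1 - (Fintype.card ι : ℝ) / 2) -
            algebraMap ℝ R (1 / 2) * algebraMap ℝ R (Fintype.card ι : ℝ) := by
        rw [← map_mul, ← map_sub]; congr 1; ring
      rw [h3]; ring
    rw [h2] at h1
    have h3 := Ideal.sub_mem _ hE h1
    rw [sub_sub_cancel] at h3
    refine (real_smul_mem_iff ?_).mp h3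
    rw [hcard]
    have : (k : ℝ) ≤ m := by exact_mod_cast hkm
    have : (0 : ℝ) ≤ m := m.cast_nonneg
    intro h0; linarith
  -- Once the trace is known, the coefficient k + 1 - n/2 = k - m is nonzero for k < m, so the next
  -- Taylor coefficients agree. The induction stops at order n/2.
  have hind : ∀ k, k ≤ m → ∀ i j, G₁ i j - G₂ i j ∈ vanishIdeal δ S (k + 1) := by
    intro k
    induction k with
    | zero =>
      intro _ i j
      have := S.sub_mem (hg₁ i j) (hg₂ i j)
      rw [sub_sub_sub_cancel_right] at this
      exact mem_vanishIdeal_succ_of this trivial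
    | succ k ih =>
      intro hk i j
      have ih := ih (by omega)
      have hE : ∀ i j, E₁ i j - E₂ i j ∈ vanishIdeal δ S (k + 1) := fun i j =>
        vanishIdeal_anti hk (Ideal.sub_mem _ (hR₁ i j) (hR₂ i j))
      have hτm := htr k (by omega) ih (Ideal.sum_mem _ fun a _ => Ideal.sum_mem _
        fun b _ => Ideal.mul_mem_left _ _ (hE b a))
      have h1 := Ideal.sub_mem _ (hE i j) (hlin k ih i j)
      rw [sub_sub_cancel] at h1
      have h2 : (1 / 2 : ℝ) • (τ * g i j) ∈ vanishIdeal δ S (k + 1) := by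
        rw [Algebra.smul_def]; exact Ideal.mul_mem_left _ _ (Ideal.mul_mem_right _ _ hτm)
      have h3 := Ideal.add_mem _ h1 h2
      rw [sub_add_cancel] at h3
      refine mem_vanishIdeal_succ_of ?_ ((real_smul_mem_iff ?_).mp h3)
      · exact (ih i j).1
      · rw [hcard]
        have : (k : ℝ) + 1 ≤ m := by exact_mod_cast hk
        intro h0; linarith
  have hD := hind m le_rfl
  have hτm := htr m le_rfl hD (by
    simp only [mul_sub, Finset.sum_sub_distrib]
    exact Ideal.sub_mem _ hT₁ hT₂)
  have h1 := hlin m hD i j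
  -- The critical order: the difference of the metrics enters the Ricci tensors only through its
  -- trace, which `hτm` has disposed of.
  have h0 : (m : ℝ) + 1 - (Fintype.card ι : ℝ) / 2 = 0 := by rw [hcard]; ring
  rw [h0, zero_smul, zero_sub, sub_neg_eq_add] at h1
  refine (Ideal.add_mem_iff_left _ ?_).mp h1
  rw [Algebra.smul_def]; exact Ideal.mul_mem_left _ _ (Ideal.mul_mem_right _ _ hτm)

end Uniqueness

/-! ### The ring of smooth functions on an open subset of a coordinate space -/

section SmoothRing

open TopologicalSpace (Opens)

variable {ι ι' : Type*} [Fintype ι] [DecidableEq ι] [Fintype ι'] [DecidableEq ι']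

/-- The smooth real functions on `U`. -/
def smoothRing (U : Opens (EuclideanSpace ℝ ι)) : Subalgebra ℝ (U → ℝ) where
  carrier := {f | ∃ F : EuclideanSpace ℝ ι → ℝ, ContDiffOn ℝ ∞ F U ∧ ∀ y : U, F y = f y}
  mul_mem' := by
    rintro _ _ ⟨F, hF, h⟩ ⟨F', hF', h'⟩
    exact ⟨F * F', hF.mul hF', fun y => by simp [h, h']⟩
  add_mem' := by
    rintro _ _ ⟨F, hF, h⟩ ⟨F', hF', h'⟩
    exact ⟨F + F', hF.add hF', fun y => by simp [h, h']⟩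
  algebraMap_mem' r := ⟨fun _ => r, contDiffOn_const, fun _ => rfl⟩

variable {U : Opens (EuclideanSpace ℝ ι)} {U' : Opens (EuclideanSpace ℝ ι')}

/-- The element `f` of the ring of smooth functions is the restriction of `F`. -/
def Rep (F : EuclideanSpace ℝ ι → ℝ) (f : smoothRing U) : Prop := ∀ y : U, F y = f.1 y

/-- The restriction of a smooth function. -/
def ofFun (F : EuclideanSpace ℝ ι → ℝ) (hF : ContDiffOn ℝ ∞ F U) : smoothRing U :=
  ⟨fun y => F y, F, hF, fun _ => rfl⟩

theorem rep_ofFun (F : EuclideanSpace ℝ ι → ℝ) (hF : ContDiffOn ℝ ∞ F U) :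
    Rep F (ofFun F hF) := fun _ => rfl

theorem Rep.unique {F : EuclideanSpace ℝ ι → ℝ} {f f' : smoothRing U} (h : Rep F f)
    (h' : Rep F f') : f = f' := Subtype.ext (funext fun y => by rw [← h y, ← h' y])

theorem Rep.congr {F F' : EuclideanSpace ℝ ι → ℝ} {f : smoothRing U} (h : Rep F f)
    (h' : ∀ y ∈ U, F' y = F y) : Rep F' f := fun y => by rw [h' y y.2, h y]

theorem Rep.eq_on {F F' : EuclideanSpace ℝ ι → ℝ} {f : smoothRing U} (h : Rep F f)
    (h' : Rep F' f) : ∀ y ∈ U, F y = F' y := fun y hy => by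
  rw [h ⟨y, hy⟩, h' ⟨y, hy⟩]

/-- A smooth extension by arbitrary values. -/
def lift (f : smoothRing U) : EuclideanSpace ℝ ι → ℝ := f.2.choose

theorem lift_contDiffOn (f : smoothRing U) : ContDiffOn ℝ ∞ (lift f) U := f.2.choose_spec.1

theorem rep_lift (f : smoothRing U) : Rep (lift f) f := f.2.choose_spec.2

theorem Rep.contDiffOn {F : EuclideanSpace ℝ ι → ℝ} {f : smoothRing U} (h : Rep F f) :
    ContDiffOn ℝ ∞ F U :=
  (lift_contDiffOn f).congr fun y hy => h.eq_on (rep_lift f) y hy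

theorem Rep.contDiffAt {F : EuclideanSpace ℝ ι → ℝ} {f : smoothRing U} (h : Rep F f)
    {y : EuclideanSpace ℝ ι} (hy : y ∈ U) : ContDiffAt ℝ ∞ F y :=
  h.contDiffOn.contDiffAt (U.isOpen.mem_nhds hy)

theorem Rep.differentiableAt {F : EuclideanSpace ℝ ι → ℝ} {f : smoothRing U} (h : Rep F f)
    {y : EuclideanSpace ℝ ι} (hy : y ∈ U) : DifferentiableAt ℝ F y :=
  (h.contDiffAt hy).differentiableAt (by simp)

theorem Rep.add {F F' : EuclideanSpace ℝ ι → ℝ} {f f' : smoothRing U} (h : Rep F f)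
    (h' : Rep F' f') : Rep (fun y => F y + F' y) (f + f') := fun y => by simp [h y, h' y]

theorem Rep.sub {F F' : EuclideanSpace ℝ ι → ℝ} {f f' : smoothRing U} (h : Rep F f)
    (h' : Rep F' f') : Rep (fun y => F y - F' y) (f - f') := fun y => by simp [h y, h' y]

theorem Rep.mul {F F' : EuclideanSpace ℝ ι → ℝ} {f f' : smoothRing U} (h : Rep F f)
    (h' : Rep F' f') : Rep (fun y => F y * F' y) (f * f') := fun y => by simp [h y, h' y]

theorem Rep.smul {F : EuclideanSpace ℝ ι → ℝ} {f : smoothRing U} (c : ℝ) (h : Rep F f) :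
    Rep (fun y => c * F y) (c • f) := fun y => by simp [h y]

theorem Rep.zero : Rep (fun _ => 0) (0 : smoothRing U) := fun y => rfl

theorem Rep.sum {σ : Type*} (s : Finset σ) {F : σ → EuclideanSpace ℝ ι → ℝ}
    {f : σ → smoothRing U} (h : ∀ a, Rep (F a) (f a)) :
    Rep (fun y => ∑ a ∈ s, F a y) (∑ a ∈ s, f a) := by
  classical
  induction s using Finset.induction_on with
  | empty => simpa using Rep.zero
  | insert a s ha ih => simp only [Finset.sum_insert ha]; exact (h a).add ih

/-- Evaluation at a point. -/
def evalAt (y : U) : smoothRing U →ₐ[ℝ] ℝ := (Pi.evalAlgHom ℝ (fun _ : U => ℝ) y).comp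
  (smoothRing U).val

theorem Rep.evalAt {F : EuclideanSpace ℝ ι → ℝ} {f : smoothRing U} (h : Rep F f) (y : U) :
    evalAt y f = F y := (h y).symm

theorem ext_evalAt {f f' : smoothRing U} (h : ∀ y : U, evalAt y f = evalAt y f') : f = f' :=
  Subtype.ext (funext h)

theorem contDiffOn_pd {F : EuclideanSpace ℝ ι → ℝ} (hF : ContDiffOn ℝ ∞ F U) (i : ι) :
    ContDiffOn ℝ ∞ (pd i F) U :=
  (hF.fderiv_of_isOpen U.isOpen (by simp)).clm_apply contDiffOn_const

/-- The partial derivatives, as derivations of the ring of smooth functions. -/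
def pdR (U : Opens (EuclideanSpace ℝ ι)) (i : ι) : Derivation ℝ (smoothRing U) (smoothRing U) :=
  Derivation.mk'
    { toFun := fun f => ofFun (pd i (lift f)) (contDiffOn_pd (lift_contDiffOn f) i)
      map_add' := fun f f' => Subtype.ext <| funext fun y => by
        have e : lift (f + f') =ᶠ[nhds (y : EuclideanSpace ℝ ι)] fun z => lift f z + lift f' z :=
          Filter.eventuallyEq_of_mem (U.isOpen.mem_nhds y.2)
            ((rep_lift (f + f')).eq_on ((rep_lift f).add (rep_lift f')))
        change pd i _ y = pd i _ y + pd i _ y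
        rw [pd, e.fderiv_eq, fderiv_fun_add ((rep_lift f).differentiableAt y.2)
          ((rep_lift f').differentiableAt y.2)]
        rfl
      map_smul' := fun c f => Subtype.ext <| funext fun y => by
        have e : lift (c • f) =ᶠ[nhds (y : EuclideanSpace ℝ ι)] fun z => c * lift f z :=
          Filter.eventuallyEq_of_mem (U.isOpen.mem_nhds y.2)
            ((rep_lift (c • f)).eq_on ((rep_lift f).smul c))
        change pd i _ y = c * pd i _ y
        rw [pd, e.fderiv_eq, fderiv_const_mul ((rep_lift f).differentiableAt y.2)]
        rfl }
    fun f f' => Subtype.ext <| funext fun y => by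
      have e : lift (f * f') =ᶠ[nhds (y : EuclideanSpace ℝ ι)] fun z => lift f z * lift f' z :=
        Filter.eventuallyEq_of_mem (U.isOpen.mem_nhds y.2)
          ((rep_lift (f * f')).eq_on ((rep_lift f).mul (rep_lift f')))
      change pd i _ y = f.1 y * pd i _ y + f'.1 y * pd i _ y
      rw [pd, e.fderiv_eq, fderiv_fun_mul ((rep_lift f).differentiableAt y.2)
        ((rep_lift f').differentiableAt y.2), ← rep_lift f y, ← rep_lift f' y]
      rfl

/-- Derivatives are local, so the values of `F` outside the open set `U` are irrelevant. This
matters because components in a chart are meaningless off its target. -/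
theorem Rep.pd {F : EuclideanSpace ℝ ι → ℝ} {f : smoothRing U} (h : Rep F f) (i : ι) :
    Rep (pd i F) (pdR U i f) := fun y => by
  have e : F =ᶠ[nhds (y : EuclideanSpace ℝ ι)] lift f :=
    Filter.eventuallyEq_of_mem (U.isOpen.mem_nhds y.2) (h.eq_on (rep_lift f))
  change NullRicciWalker.pd i F y = NullRicciWalker.pd i (lift f) y
  rw [NullRicciWalker.pd, NullRicciWalker.pd, e.fderiv_eq]

theorem pd_comm {F : EuclideanSpace ℝ ι → ℝ} {y : EuclideanSpace ℝ ι} (hF : ContDiffAt ℝ ∞ F y)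
    (i j : ι) : pd i (pd j F) y = pd j (pd i F) y := by
  have h1 : DifferentiableAt ℝ (fderiv ℝ F) y :=
    (hF.fderiv_right (m := ∞) (by simp)).differentiableAt (by simp)
  have h2 : ∀ i j, pd i (pd j F) y = fderiv ℝ (fderiv ℝ F) y (EuclideanSpace.single i 1)
      (EuclideanSpace.single j 1) := by
    intro i j
    have : pd j F = fun z => fderiv ℝ F z (EuclideanSpace.single j 1) := rfl
    rw [pd, this, fderiv_clm_apply h1 (by fun_prop)]
    simp
  rw [h2, h2]
  exact (hF.isSymmSndFDerivAt (by
    rw [minSmoothness_of_isRCLikeNormedField]; exact WithTop.coe_le_coe.mpr le_top)) _ _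

theorem pdR_comm (i j : ι) (f : smoothRing U) : pdR U i (pdR U j f) = pdR U j (pdR U i f) :=
  ext_evalAt fun y => by
    rw [(((rep_lift f).pd j).pd i).evalAt, (((rep_lift f).pd i).pd j).evalAt]
    exact pd_comm ((rep_lift f).contDiffAt y.2) i j

theorem isUnit_of_forall_ne_zero {f : smoothRing U} (h : ∀ y : U, evalAt y f ≠ 0) : IsUnit f := by
  have hF : ContDiffOn ℝ ∞ (fun y => (lift f y)⁻¹) U := (lift_contDiffOn f).inv fun y hy => by
    have := h ⟨y, hy⟩
    rwa [(rep_lift f).evalAt] at this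
  refine IsUnit.of_mul_eq_one (ofFun _ hF) (ext_evalAt fun y => ?_)
  rw [map_mul, (rep_ofFun _ hF).evalAt, (rep_lift f).evalAt, map_one]
  refine mul_inv_cancel₀ ?_
  have := h y
  rwa [(rep_lift f).evalAt] at this

/-- A matrix over the ring of smooth functions is the restriction of a matrix-valued function. -/
def RepM {μ ν : Type*} (M : EuclideanSpace ℝ ι → Matrix μ ν ℝ) (m : Matrix μ ν (smoothRing U)) :
    Prop := ∀ a b, Rep (fun y => M y a b) (m a b)

theorem RepM.map_evalAt {μ ν : Type*} {M : EuclideanSpace ℝ ι → Matrix μ ν ℝ}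
    {m : Matrix μ ν (smoothRing U)} (h : RepM M m) (y : U) : m.map (evalAt y) = M y := by
  ext a b; exact (h a b).evalAt y

theorem repM_of_map_evalAt {μ ν : Type*} {M : EuclideanSpace ℝ ι → Matrix μ ν ℝ}
    {m : Matrix μ ν (smoothRing U)} (h : ∀ y : U, m.map (evalAt y) = M y) : RepM M m :=
  fun a b y => (congrFun (congrFun (h y) a) b).symm

theorem exists_repM {μ ν : Type*} {M : EuclideanSpace ℝ ι → Matrix μ ν ℝ}
    (h : ∀ a b, ContDiffOn ℝ ∞ (fun y => M y a b) U) :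
    ∃ m : Matrix μ ν (smoothRing U), RepM M m :=
  ⟨Matrix.of fun a b => ofFun _ (h a b), fun _ _ _ => rfl⟩

theorem RepM.unique {μ ν : Type*} {M : EuclideanSpace ℝ ι → Matrix μ ν ℝ}
    {m m' : Matrix μ ν (smoothRing U)} (h : RepM M m) (h' : RepM M m') : m = m' := by
  ext1 a b; exact (h a b).unique (h' a b)

theorem matrix_ext_evalAt {μ ν : Type*} {m m' : Matrix μ ν (smoothRing U)}
    (h : ∀ y : U, m.map (evalAt y) = m'.map (evalAt y)) : m = m' := by
  ext1 a b; exact ext_evalAt fun y => congrFun (congrFun (h y) a) b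

theorem mul_inv_of_forall {μ : Type*} [Fintype μ] [DecidableEq μ] {m : Matrix μ μ (smoothRing U)}
    (h : ∀ y : U, IsUnit (m.map (evalAt y)).det) : m * m⁻¹ = 1 := by
  refine Matrix.mul_nonsing_inv m (isUnit_of_forall_ne_zero fun y => ?_)
  rw [AlgHom.map_det]
  exact (h y).ne_zero

theorem RepM.inv {μ : Type*} [Fintype μ] [DecidableEq μ]
    {M : EuclideanSpace ℝ ι → Matrix μ μ ℝ} {m m' : Matrix μ μ (smoothRing U)} (h : RepM M m)
    (hm : m * m' = 1) : RepM (fun y => (M y)⁻¹) m' :=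
  repM_of_map_evalAt fun y => by
    have := congrArg (fun N : Matrix μ μ (smoothRing U) => N.map (evalAt y)) hm
    simp only [Matrix.map_mul, h.map_evalAt y] at this
    rw [Matrix.map_one _ (map_zero _) (map_one _)] at this
    exact (Matrix.inv_eq_right_inv this).symm

/-- Composition with a smooth map. -/
def comapHom (φ : EuclideanSpace ℝ ι → EuclideanSpace ℝ ι') (hφ : ContDiffOn ℝ ∞ φ U)
    (hU : ∀ y ∈ U, φ y ∈ U') : smoothRing U' →ₐ[ℝ] smoothRing U where
  toFun f := ⟨fun y => f.1 ⟨φ y, hU y y.2⟩, fun y => lift f (φ y),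
    (lift_contDiffOn f).comp hφ hU, fun y => rep_lift f ⟨φ y, hU y y.2⟩⟩
  map_one' := rfl
  map_mul' _ _ := rfl
  map_zero' := rfl
  map_add' _ _ := rfl
  commutes' _ := rfl

variable {φ : EuclideanSpace ℝ ι → EuclideanSpace ℝ ι'} (hφ : ContDiffOn ℝ ∞ φ U)
  (hU : ∀ y ∈ U, φ y ∈ U')

theorem evalAt_comapHom (y : U) (f : smoothRing U') :
    evalAt y (comapHom φ hφ hU f) = evalAt ⟨φ y, hU y y.2⟩ f := rfl

theorem Rep.comap {F : EuclideanSpace ℝ ι' → ℝ} {f : smoothRing U'} (h : Rep F f) :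
    Rep (fun y => F (φ y)) (comapHom φ hφ hU f) := fun y => h ⟨φ y, hU y y.2⟩

theorem RepM.comap {μ ν : Type*} {M : EuclideanSpace ℝ ι' → Matrix μ ν ℝ}
    {m : Matrix μ ν (smoothRing U')} (h : RepM M m) :
    RepM (fun y => M (φ y)) (m.map (comapHom φ hφ hU)) := fun a b => (h a b).comap hφ hU

theorem pd_comp {F : EuclideanSpace ℝ ι' → ℝ} {y : EuclideanSpace ℝ ι}
    (hF : DifferentiableAt ℝ F (φ y)) (hφ : DifferentiableAt ℝ φ y) (a : ι) :
    pd a (fun y => F (φ y)) y = ∑ k, pd a (fun y => φ y k) y * pd k F (φ y) := by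
  have h1 : ∀ k, pd a (fun y => φ y k) y = fderiv ℝ φ y (EuclideanSpace.single a 1) k := by
    intro k
    have := ((EuclideanSpace.proj (𝕜 := ℝ) k : EuclideanSpace ℝ ι' →L[ℝ] ℝ).hasFDerivAt.comp y
      hφ.hasFDerivAt).fderiv
    rw [pd]
    change fderiv ℝ ((EuclideanSpace.proj (𝕜 := ℝ) k : EuclideanSpace ℝ ι' →L[ℝ] ℝ) ∘ φ) y _ = _
    rw [this]; rfl
  have h2 : fderiv ℝ φ y (EuclideanSpace.single a 1) =
      ∑ k, fderiv ℝ φ y (EuclideanSpace.single a 1) k • EuclideanSpace.single k (1 : ℝ) := by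
    ext j
    simp [Pi.single_apply]
  have h3 : fderiv ℝ (fun y => F (φ y)) y = (fderiv ℝ F (φ y)).comp (fderiv ℝ φ y) :=
    fderiv_comp y hF hφ
  rw [pd, h3, ContinuousLinearMap.comp_apply, h2, map_sum]
  simp only [map_smul, smul_eq_mul, h1]
  rfl

theorem contDiffOn_coord (hφ : ContDiffOn ℝ ∞ φ U) (k : ι') :
    ContDiffOn ℝ ∞ (fun y => φ y k) U :=
  (EuclideanSpace.proj (𝕜 := ℝ) k : EuclideanSpace ℝ ι' →L[ℝ] ℝ).contDiff.comp_contDiffOn hφ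

/-- The Jacobian matrix of a smooth map. -/
def jacobian (φ : EuclideanSpace ℝ ι → EuclideanSpace ℝ ι') (hφ : ContDiffOn ℝ ∞ φ U) :
    Matrix ι' ι (smoothRing U) :=
  Matrix.of fun k a => pdR U a (ofFun (fun y => φ y k) (contDiffOn_coord hφ k))

theorem pdR_comapHom (a : ι) (f : smoothRing U') :
    pdR U a (comapHom φ hφ hU f) = ∑ k, jacobian φ hφ k a * comapHom φ hφ hU (pdR U' k f) := by
  refine ext_evalAt fun y => ?_
  rw [(((rep_lift f).comap hφ hU).pd a).evalAt, map_sum,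
    pd_comp ((rep_lift f).differentiableAt (hU y y.2))
      ((hφ.contDiffAt (U.isOpen.mem_nhds y.2)).differentiableAt (by simp))]
  refine Finset.sum_congr rfl fun k _ => ?_
  rw [map_mul, evalAt_comapHom, ((rep_lift f).pd k).evalAt, jacobian, Matrix.of_apply,
    ((rep_ofFun _ (contDiffOn_coord hφ k)).pd a).evalAt]

theorem jacobian_closed (a b : ι) (k : ι') :
    pdR U a (jacobian φ hφ k b) = pdR U b (jacobian φ hφ k a) := pdR_comm _ _ _

theorem coordChange_comapHom {φ : EuclideanSpace ℝ ι → EuclideanSpace ℝ ι}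
    {U' : Opens (EuclideanSpace ℝ ι)} (hφ : ContDiffOn ℝ ∞ φ U)
    (hU : ∀ y ∈ U, φ y ∈ U') {K : Matrix ι ι (smoothRing U)} (hK : jacobian φ hφ * K = 1) :
    CoordChange (pdR U') (pdR U) (comapHom φ hφ hU : smoothRing U' →+* smoothRing U)
      (jacobian φ hφ) K where
  comm := pdR_comm
  chain := pdR_comapHom hφ hU
  closed := jacobian_closed hφ
  inv := hK

end SmoothRing

/-! ### Coordinate expressions as elements of the ring of smooth functions -/

section Bridge

open TopologicalSpace (Opens)

variable {ι : Type*} [Fintype ι] [DecidableEq ι] {U : Opens (EuclideanSpace ℝ ι)}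
  {G S : EuclideanSpace ℝ ι → Matrix ι ι ℝ} {m m' s : Matrix ι ι (smoothRing U)}

theorem rep_christoffel (hG : RepM G m) (hm : m * m' = 1) (k i j : ι) :
    Rep (christoffel G k i j) (conn (pdR U) m m' i k j) :=
  Rep.smul (1 / 2) (Rep.sum _ fun l => (hG.inv hm k l).mul
    ((((hG j l).pd i).add ((hG i l).pd j)).sub ((hG i j).pd l)))

theorem rep_riemUp (hG : RepM G m) (hm : m * m' = 1) (l k i j : ι) :
    Rep (riemUp G l k i j) (curv (pdR U) (conn (pdR U) m m') i j l k) := by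
  have hc := rep_christoffel hG hm
  have e : curv (pdR U) (conn (pdR U) m m') i j l k =
      pdR U i (conn (pdR U) m m' j l k) - pdR U j (conn (pdR U) m m' i l k) +
        ∑ q, (conn (pdR U) m m' i l q * conn (pdR U) m m' j q k -
          conn (pdR U) m m' j l q * conn (pdR U) m m' i q k) := by
    simp only [curv, Matrix.sub_apply, Matrix.add_apply, Matrix.map_apply, Matrix.mul_apply,
      Finset.sum_sub_distrib]
    ring
  rw [e]
  exact (((hc _ _ _).pd i).sub ((hc _ _ _).pd j)).add (Rep.sum _ fun q =>
    ((hc _ _ _).mul (hc _ _ _)).sub ((hc _ _ _).mul (hc _ _ _)))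

theorem rep_riem (hG : RepM G m) (hm : m * m' = 1) (i j k l : ι) :
    Rep (riem G i j k l) ((m * curv (pdR U) (conn (pdR U) m m') i j) k l) := by
  rw [Matrix.mul_apply]
  exact Rep.sum _ fun q => (hG k q).mul (rep_riemUp hG hm _ _ _ _)

theorem repM_ric (hG : RepM G m) (hm : m * m' = 1) :
    RepM (ric G) (ricMat (pdR U) (conn (pdR U) m m')) := fun i j =>
  Rep.sum _ fun k => rep_riemUp hG hm _ _ _ _

theorem rep_scal (hG : RepM G m) (hm : m * m' = 1) :
    Rep (scal G) (scalMat (pdR U) (conn (pdR U) m m') m') :=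
  Rep.sum _ fun i => Rep.sum _ fun j => (hG.inv hm i j).mul (repM_ric hG hm i j)

theorem repM_schouten (hG : RepM G m) (hm : m * m' = 1) :
    RepM (schouten G) (schoutenMat (pdR U) (conn (pdR U) m m') m m') := fun i j => by
  refine Rep.smul _ ((repM_ric hG hm i j).sub ?_)
  refine Rep.congr (Rep.mul (Rep.smul _ (rep_scal hG hm)) (hG i j)) fun y _ => ?_
  simp only [Matrix.smul_apply, smul_eq_mul]
  ring

theorem rep_cov2 (hG : RepM G m) (hm : m * m' = 1) (hS : RepM S s) (k i j : ι) :
    Rep (cov2 G S k i j) (cov (pdR U) (conn (pdR U) m m') s k i j) := by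
  have hc := rep_christoffel hG hm
  have e : cov (pdR U) (conn (pdR U) m m') s k i j = pdR U k (s i j) -
      ∑ l, (conn (pdR U) m m' k l i * s l j + conn (pdR U) m m' k l j * s i l) := by
    simp only [cov, Matrix.sub_apply, Matrix.map_apply, Matrix.mul_apply, Matrix.transpose_apply,
      Finset.sum_add_distrib, mul_comm (s i _)]
    ring
  rw [e]
  exact ((hS i j).pd k).sub (Rep.sum _ fun l => ((hc _ _ _).mul (hS _ _)).add
    ((hc _ _ _).mul (hS _ _)))

theorem rep_cov2cov2 (hG : RepM G m) (hm : m * m' = 1) (hS : RepM S s) (l k i j : ι) :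
    Rep (cov2cov2 G S l k i j) (cov3 (pdR U) (conn (pdR U) m m')
      (cov (pdR U) (conn (pdR U) m m') s) l k i j) := by
  have hc := rep_christoffel hG hm
  have hs := rep_cov2 hG hm hS
  have e : cov3 (pdR U) (conn (pdR U) m m') (cov (pdR U) (conn (pdR U) m m') s) l k i j =
      pdR U l (cov (pdR U) (conn (pdR U) m m') s k i j) -
      ∑ q, (conn (pdR U) m m' l q k * cov (pdR U) (conn (pdR U) m m') s q i j +
        conn (pdR U) m m' l q i * cov (pdR U) (conn (pdR U) m m') s k q j +
        conn (pdR U) m m' l q j * cov (pdR U) (conn (pdR U) m m') s k i q) := by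
    simp only [cov3, Matrix.sub_apply, Matrix.map_apply, Matrix.mul_apply, Matrix.transpose_apply,
      Finset.sum_add_distrib, mul_comm (cov _ _ _ k i _), Matrix.sum_apply, Matrix.smul_apply,
      smul_eq_mul]
    ring
  rw [e]
  exact ((hs k i j).pd l).sub (Rep.sum _ fun q => (((hc _ _ _).mul (hs _ _ _)).add
    ((hc _ _ _).mul (hs _ _ _))).add ((hc _ _ _).mul (hs _ _ _)))

theorem repM_box (hG : RepM G m) (hm : m * m' = 1) (hS : RepM S s) :
    RepM (box G S) (boxMat (pdR U) (conn (pdR U) m m') m' s) := fun i j => by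
  have e : boxMat (pdR U) (conn (pdR U) m m') m' s i j = ∑ l, ∑ k, m' l k *
      cov3 (pdR U) (conn (pdR U) m m') (cov (pdR U) (conn (pdR U) m m') s) l k i j := by
    simp only [boxMat, Matrix.sum_apply, Matrix.smul_apply, smul_eq_mul]
  rw [e]
  exact Rep.sum _ fun l => Rep.sum _ fun k => (hG.inv hm l k).mul (rep_cov2cov2 hG hm hS _ _ _ _)

theorem rep_divergence (hG : RepM G m) (hm : m * m' = 1) (hS : RepM S s) (j : ι) :
    Rep (divergence G S j) (∑ k, ∑ l, m' l k * cov (pdR U) (conn (pdR U) m m') s l k j) :=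
  Rep.sum _ fun k => Rep.sum _ fun l => (hG.inv hm l k).mul (rep_cov2 hG hm hS _ _ _)

theorem rep_curvTerm (hG : RepM G m) (hm : m * m' = 1) (hS : RepM S s) (i j : ι) :
    Rep (curvTerm G S i j) (∑ k, ∑ l, (m * curv (pdR U) (conn (pdR U) m m') k i) j l *
      (m' * s * m') k l) := by
  refine Rep.sum _ fun k => Rep.sum _ fun l => (rep_riem hG hm _ _ _ _).mul ?_
  refine repM_of_map_evalAt (M := fun y => (G y)⁻¹ * S y * (G y)⁻¹) (fun y => ?_) k l
  rw [Matrix.map_mul, Matrix.map_mul, hS.map_evalAt, (hG.inv hm).map_evalAt]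

theorem rep_lieDer (hS : RepM S s) {X : EuclideanSpace ℝ ι → EuclideanSpace ℝ ι}
    {ξ : ι → smoothRing U} (hX : ∀ k, Rep (fun y => X y k) (ξ k)) (i j : ι) :
    Rep (lieDer X S i j) (∑ k, (ξ k * pdR U k (s i j) + pdR U i (ξ k) * s k j +
      pdR U j (ξ k) * s i k)) :=
  Rep.sum _ fun k => (((hX k).mul ((hS i j).pd k)).add (((hX k).pd i).mul (hS k j))).add
    (((hX k).pd j).mul (hS i k))

theorem rep_covVec (hG : RepM G m) (hm : m * m' = 1)
    {X : EuclideanSpace ℝ ι → EuclideanSpace ℝ ι} {ξ : ι → smoothRing U}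
    (hX : ∀ k, Rep (fun y => X y k) (ξ k)) (i k : ι) :
    Rep (fun y => covVec G X i y k) (pdR U i (ξ k) + ∑ l, conn (pdR U) m m' i k l * ξ l) :=
  ((hX k).pd i).add (Rep.sum _ fun l => (rep_christoffel hG hm _ _ _).mul (hX l))

/-- The Lie derivative along `X` in terms of a torsion-free connection. -/
theorem lie_eq_cov {R : Type*} [CommRing R] [Algebra ℝ R] {d : ι → Derivation ℝ R R}
    {A : ι → Matrix ι ι R} (hA : TorsionFree A) (S : Matrix ι ι R) (ξ : ι → R) (i j : ι) :
    ∑ k, (ξ k * d k (S i j) + d i (ξ k) * S k j + d j (ξ k) * S i k) =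
      ∑ k, ξ k * cov d A S k i j + ∑ k, (d i (ξ k) + ∑ l, A i k l * ξ l) * S k j +
        ∑ k, (d j (ξ k) + ∑ l, A j k l * ξ l) * S i k := by
  have e1 : ∀ k, ξ k * cov d A S k i j = ξ k * d k (S i j) - ∑ l, ξ k * A k l i * S l j -
      ∑ l, ξ k * A k l j * S i l := by
    intro k
    simp only [cov, Matrix.sub_apply, Matrix.map_apply, Matrix.mul_apply, Matrix.transpose_apply,
      mul_sub, Finset.mul_sum]
    congr 1
    · congr 1; exact Finset.sum_congr rfl fun l _ => by ring
    · exact Finset.sum_congr rfl fun l _ => by ring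
  have e2 : ∀ i j, ∑ k, (∑ l, A i k l * ξ l) * S k j = ∑ k, ∑ l, ξ k * A k l i * S l j := by
    intro i j
    simp only [Finset.sum_mul]
    rw [Finset.sum_comm]
    exact Finset.sum_congr rfl fun k _ => Finset.sum_congr rfl fun l _ => by rw [hA i k l]; ring
  have e3 : ∑ k, (∑ l, A j k l * ξ l) * S i k = ∑ k, ∑ l, ξ k * A k l j * S i l := by
    simp only [Finset.sum_mul]
    rw [Finset.sum_comm]
    exact Finset.sum_congr rfl fun k _ => Finset.sum_congr rfl fun l _ => by rw [hA j k l]; ring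
  simp only [e1, add_mul, Finset.sum_add_distrib, Finset.sum_sub_distrib, e2, e3]
  ring

end Bridge

/-! ### Null Ricci Walker metrics in coordinates -/

section WalkerCoordinates

open TopologicalSpace (Opens)

variable {ι κ : Type*} [Fintype ι] [DecidableEq ι] [Fintype κ] [DecidableEq κ]
  {U : Opens (EuclideanSpace ℝ ι)} {G S : EuclideanSpace ℝ ι → Matrix ι ι ℝ}
  {D : EuclideanSpace ℝ ι → Submodule ℝ (EuclideanSpace ℝ ι)}
  {Y : κ → EuclideanSpace ℝ ι → EuclideanSpace ℝ ι}

theorem sharp_single (G S : Matrix ι ι ℝ) (k b : ι) :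
    sharp G S (EuclideanSpace.single b 1) k = (G⁻¹ * S) k b := by
  simp [sharp, Matrix.mulVec_mulVec]
  rfl

theorem lieDer_eq (hG : ∀ i j, ContDiffOn ℝ ∞ (fun y => G y i j) U)
    (hsymm : ∀ y ∈ U, (G y)ᵀ = G y) (hinv : ∀ y ∈ U, IsUnit (G y).det)
    (hS : ∀ i j, ContDiffOn ℝ ∞ (fun y => S y i j) U)
    {X : EuclideanSpace ℝ ι → EuclideanSpace ℝ ι} (hX : ContDiffOn ℝ ∞ X U)
    {y : EuclideanSpace ℝ ι} (hy : y ∈ U) (i j : ι) :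
    lieDer X S i j y = ∑ k, X y k * cov2 G S k i j y + ∑ k, covVec G X i y k * S y k j +
      ∑ k, covVec G X j y k * S y i k := by
  obtain ⟨m, hm⟩ := exists_repM hG
  obtain ⟨s, hs⟩ := exists_repM hS
  have hi : m * m⁻¹ = 1 := mul_inv_of_forall fun y => by rw [hm.map_evalAt]; exact hinv y y.2
  have hmt : mᵀ = m := matrix_ext_evalAt fun y => by
    rw [Matrix.transpose_map, hm.map_evalAt, hsymm y y.2]
  have hξ : ∀ k, Rep (fun y => X y k) (ofFun _ (contDiffOn_coord hX k)) := fun k => rep_ofFun _ _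
  refine Rep.eq_on (F' := fun y => ∑ k, X y k * cov2 G S k i j y +
    ∑ k, covVec G X i y k * S y k j + ∑ k, covVec G X j y k * S y i k)
    (rep_lieDer hs hξ i j) ?_ y hy
  rw [lie_eq_cov (conn_torsionFree (pdR U) m⁻¹ hmt)]
  exact ((Rep.sum _ fun k => (hξ k).mul (rep_cov2 hm hi hs k i j)).add
    (Rep.sum _ fun k => (rep_covVec hm hi hξ i k).mul (hs k j))).add
    (Rep.sum _ fun k => (rep_covVec hm hi hξ j k).mul (hs i k))

/-- A parallel null distribution `D` on `U`, spanned by the vector fields `Y`, that contains the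
image of the Schouten tensor of `G`. -/
structure IsWalkerFrame (U : Opens (EuclideanSpace ℝ ι)) (G : EuclideanSpace ℝ ι → Matrix ι ι ℝ)
    (D : EuclideanSpace ℝ ι → Submodule ℝ (EuclideanSpace ℝ ι))
    (Y : κ → EuclideanSpace ℝ ι → EuclideanSpace ℝ ι) : Prop where
  smooth : ∀ i j, ContDiffOn ℝ ∞ (fun y => G y i j) U
  symm : ∀ y ∈ U, (G y)ᵀ = G y
  inv : ∀ y ∈ U, IsUnit (G y).det
  smooth_frame : ∀ a, ContDiffOn ℝ ∞ (Y a) U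
  indep : ∀ y ∈ U, LinearIndependent ℝ fun a => Y a y
  span : ∀ y ∈ U, Submodule.span ℝ (Set.range fun a => Y a y) = D y
  null : ∀ y ∈ U, ∀ v ∈ D y, ∀ w ∈ D y, ∑ i, ∑ j, v i * G y i j * w j = 0
  parallel : ∀ a, ∀ y ∈ U, ∀ i, covVec G (Y a) i y ∈ D y
  schouten : ∀ y ∈ U, ∀ v, sharp (G y) (schouten G y) v ∈ D y

/-- The algebraic data of a null Ricci Walker metric on `U`. -/
structure WalkerData (U : Opens (EuclideanSpace ℝ ι)) (G : EuclideanSpace ℝ ι → Matrix ι ι ℝ)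
    (D : EuclideanSpace ℝ ι → Submodule ℝ (EuclideanSpace ℝ ι))
    (m m' : Matrix ι ι (smoothRing U)) (X : Matrix ι κ (smoothRing U))
    (L : Matrix κ ι (smoothRing U)) (θ : ι → Matrix κ κ (smoothRing U)) : Prop where
  rep : RepM G m
  frame : NullFrame (pdR U) (conn (pdR U) m m') m m' X L θ
  mem : ∀ (y : U) (v : EuclideanSpace ℝ ι),
    v ∈ D y ↔ ∃ c : κ → ℝ, v.ofLp = X.map (evalAt y) *ᵥ c
  flat : ∀ a k, ∑ l, X l a • curv (pdR U) θ l k = 0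
  ric : ∃ r : Matrix κ κ (smoothRing U), FrameTensor (pdR U) m X θ (ricMat (pdR U) (conn (pdR U) m m')) r

/-- The Gram determinant of a frame for the Euclidean product of the coordinates. It makes (XᵀX)⁻¹Xᵀ
a smooth left inverse of the frame. -/
theorem det_transpose_mul_self_ne_zero {M : Matrix ι κ ℝ} (h : ∀ c, M *ᵥ c = 0 → c = 0) :
    (Mᵀ * M).det ≠ 0 := by
  intro h0
  obtain ⟨c, hc, h1⟩ := Matrix.exists_mulVec_eq_zero_iff.mpr h0
  refine hc (h c ?_)
  have h2 : c ⬝ᵥ ((Mᵀ * M) *ᵥ c) = 0 := by rw [h1, dotProduct_zero]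
  rw [← Matrix.mulVec_mulVec, Matrix.dotProduct_mulVec, Matrix.vecMul_transpose] at h2
  exact dotProduct_self_eq_zero.mp h2

/-- `X * L` is a projection onto the span of the frame. Membership in the span at each point thus
becomes a factorisation with smooth coefficients. -/
theorem eq_mul_of_columns {μ : Type*} {X : Matrix ι κ (smoothRing U)}
    {L : Matrix κ ι (smoothRing U)} (hL : L * X = 1) {N : Matrix ι μ (smoothRing U)}
    (h : ∀ (y : U) b, ∃ c : κ → ℝ, (fun k => evalAt y (N k b)) = X.map (evalAt y) *ᵥ c) :
    N = X * (L * N) := by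
  refine Matrix.ext fun k b => ext_evalAt fun y => ?_
  obtain ⟨c, hc⟩ := h y b
  have hL' : L.map (evalAt y) * X.map (evalAt y) = 1 := by
    rw [← Matrix.map_mul, hL, Matrix.map_one _ (map_zero _) (map_one _)]
  have h1 : (fun k => evalAt y (N k b)) = (X.map (evalAt y) * L.map (evalAt y)) *ᵥ
      fun k => evalAt y (N k b) := by
    rw [hc, Matrix.mulVec_mulVec, Matrix.mul_assoc, hL', Matrix.mul_one]
  have h2 : evalAt y (N k b) = _ := congrFun h1 k
  rw [h2, ← Matrix.mul_assoc, ← Matrix.map_mul, Matrix.mul_apply, map_sum]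
  exact Finset.sum_congr rfl fun i _ => by rw [map_mul]; rfl

/-- The left inverse is L = (XᵀX)⁻¹Xᵀ. The induced connection must be θ = L∇X, and parallelism of
the distribution says that ∇X = Xθ. -/
theorem IsWalkerFrame.exists_nullFrame (H : IsWalkerFrame U G D Y) :
    ∃ (m m' : Matrix ι ι (smoothRing U)) (X : Matrix ι κ (smoothRing U))
      (L : Matrix κ ι (smoothRing U)) (θ : ι → Matrix κ κ (smoothRing U)), RepM G m ∧
      NullFrame (pdR U) (conn (pdR U) m m') m m' X L θ ∧
      ∀ (y : U) (v : EuclideanSpace ℝ ι),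
        v ∈ D y ↔ ∃ c : κ → ℝ, v.ofLp = X.map (evalAt y) *ᵥ c := by
  obtain ⟨m, hm⟩ := exists_repM H.smooth
  have hi : m * m⁻¹ = 1 := mul_inv_of_forall fun y => by rw [hm.map_evalAt]; exact H.inv y y.2
  have hmt : mᵀ = m := matrix_ext_evalAt fun y => by
    rw [Matrix.transpose_map, hm.map_evalAt, H.symm y y.2]
  obtain ⟨X, hX⟩ := exists_repM (U := U) (M := fun y => Matrix.of fun k a => Y a y k)
    fun k a => contDiffOn_coord (H.smooth_frame a) k
  have hXv : ∀ (y : U) c, X.map (evalAt y) *ᵥ c = (∑ a, c a • Y a y).ofLp := by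
    intro y c
    rw [hX.map_evalAt]
    ext k
    simp [Matrix.mulVec, dotProduct, mul_comm]
  have hmem : ∀ (y : U) (v : EuclideanSpace ℝ ι),
      v ∈ D y ↔ ∃ c : κ → ℝ, v.ofLp = X.map (evalAt y) *ᵥ c := by
    intro y v
    rw [← H.span y y.2, Submodule.mem_span_range_iff_exists_fun]
    refine exists_congr fun c => ?_
    rw [hXv]
    exact ⟨fun h => by rw [h], fun h => (WithLp.ofLp_injective 2 h).symm⟩
  have hunit : (Xᵀ * X)⁻¹ * (Xᵀ * X) = 1 :=
    mul_eq_one_comm.mp <| mul_inv_of_forall fun y => by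
      rw [Matrix.map_mul, Matrix.transpose_map, isUnit_iff_ne_zero]
      refine det_transpose_mul_self_ne_zero fun c hc => ?_
      rw [hXv] at hc
      have := Fintype.linearIndependent_iff.mp (H.indep y y.2) c (WithLp.ofLp_injective 2 hc)
      exact funext this
  have hL : (Xᵀ * X)⁻¹ * Xᵀ * X = 1 := by rw [Matrix.mul_assoc, hunit]
  refine ⟨m, m⁻¹, X, (Xᵀ * X)⁻¹ * Xᵀ, fun i => (Xᵀ * X)⁻¹ * Xᵀ *
    (X.map (pdR U i) + conn (pdR U) m m⁻¹ i * X), hm, ?_, hmem⟩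
  refine ⟨pdR_comm, hmt, hi, conn_torsionFree _ _ hmt, conn_metricCompat _ hmt hi, ?_, hL, ?_⟩
  · refine matrix_ext_evalAt fun y => ?_
    rw [Matrix.map_mul, Matrix.map_mul, Matrix.transpose_map, hm.map_evalAt, hX.map_evalAt]
    ext a b
    have hY : ∀ a, Y a y ∈ D y := fun a => by
      rw [← H.span y y.2]; exact Submodule.subset_span ⟨a, rfl⟩
    have := H.null y y.2 _ (hY a) _ (hY b)
    rw [Finset.sum_comm] at this
    simp only [Matrix.mul_apply, Matrix.transpose_apply, Matrix.of_apply, Finset.sum_mul,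
      Matrix.map_apply, Matrix.zero_apply, map_zero]
    exact this
  · intro i
    refine eq_mul_of_columns hL fun y a => ?_
    have h1 := (hmem y _).mp (H.parallel a y y.2 i)
    refine h1.imp fun c hc => ?_
    rw [← hc]
    ext k
    exact (rep_covVec hm hi (ξ := fun k => X k a) (fun k => hX k a) i k).evalAt y

/-- The only place where the two alternative hypotheses are separated. Both yield flatness of the
induced connection along the distribution and an adapted Ricci tensor, and nothing else of them is
used later. -/
theorem WalkerData.of_frame {m m' : Matrix ι ι (smoothRing U)} {X : Matrix ι κ (smoothRing U)}
    {L : Matrix κ ι (smoothRing U)} {θ : ι → Matrix κ κ (smoothRing U)} (hm : RepM G m)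
    (H : NullFrame (pdR U) (conn (pdR U) m m') m m' X L θ)
    (hmem : ∀ (y : U) (v : EuclideanSpace ℝ ι),
        v ∈ D y ↔ ∃ c : κ → ℝ, v.ofLp = X.map (evalAt y) *ᵥ c)
    (hn : 3 ≤ Fintype.card ι)
    (hP : ∀ y ∈ U, ∀ v, sharp (G y) (schouten G y) v ∈ D y)
    (h : Subsingleton κ ∨ ∀ y ∈ U, ∀ v ∈ D y, ∀ j k l, ∑ i, v i * riem G i j k l y = 0) :
    WalkerData U G D m m' X L θ := by
  have hsch : m' * schoutenMat (pdR U) (conn (pdR U) m m') m m' =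
      X * (L * (m' * schoutenMat (pdR U) (conn (pdR U) m m') m m')) := by
    refine eq_mul_of_columns H.left fun y b => ?_
    obtain ⟨c, hc⟩ := (hmem y _).mp (hP y y.2 (EuclideanSpace.single b 1))
    refine ⟨c, ?_⟩
    rw [← hc]
    have h1 : (m' * schoutenMat (pdR U) (conn (pdR U) m m') m m').map (evalAt y) =
        (G y)⁻¹ * schouten G y := by
      rw [Matrix.map_mul, (hm.inv H.inv).map_evalAt, (repM_schouten hm H.inv).map_evalAt]
    ext k
    have h2 := congrFun (congrFun h1 k) b
    rw [Matrix.map_apply] at h2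
    rw [h2, sharp_single]
  obtain ⟨r, hr⟩ := H.ric_of_schouten hn hsch
  rcases h with h | h
  · exact ⟨hm, H, hmem, H.flat_of_subsingleton (H.ric_mul hr), r,
      H.ric_frameTensor_of_subsingleton hr⟩
  · have hcv : ∀ a j, ∑ i, X i a • curv (pdR U) (conn (pdR U) m m') i j = 0 := by
      intro a j
      have h1 : m * ∑ i, X i a • curv (pdR U) (conn (pdR U) m m') i j = 0 := by
        refine Matrix.ext fun k l => ext_evalAt fun y => ?_
        have hXa : (WithLp.toLp 2 fun i => evalAt y (X i a) : EuclideanSpace ℝ ι) ∈ D y := by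
          refine (hmem y _).mpr ⟨Pi.single a 1, ?_⟩
          ext k; simp
        have h2 := h y y.2 _ hXa j k l
        rw [Matrix.mul_sum, Matrix.sum_apply, map_sum, Matrix.zero_apply, map_zero, ← h2]
        refine Finset.sum_congr rfl fun i _ => ?_
        rw [Matrix.mul_smul, Matrix.smul_apply, smul_eq_mul, map_mul,
          (rep_riem hm H.inv i j k l).evalAt]
      have := congrArg (fun N => m' * N) h1
      simpa only [← Matrix.mul_assoc, H.inv', Matrix.one_mul, Matrix.mul_zero] using this
    exact ⟨hm, H, hmem, H.flat_of_curv hcv, r, H.ric_frameTensor_of_curv hr hcv⟩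

namespace WalkerData

variable {m m' : Matrix ι ι (smoothRing U)} {X : Matrix ι κ (smoothRing U)}
    {L : Matrix κ ι (smoothRing U)} {θ : ι → Matrix κ κ (smoothRing U)}
    {s : Matrix ι ι (smoothRing U)} {f : Matrix κ κ (smoothRing U)}

theorem ric_mul (H : WalkerData U G D m m' X L θ) :
    ricMat (pdR U) (conn (pdR U) m m') * X = 0 :=
  let ⟨_, hr⟩ := H.ric
  H.frame.ric_mul hr.eq

theorem box (H : WalkerData U G D m m' X L θ) (hS : FrameTensor (pdR U) m X θ s f) :
    ∃ f', FrameTensor (pdR U) m X θ (boxMat (pdR U) (conn (pdR U) m m') m' s) f' :=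
  ⟨_, H.frame.box_frameTensor H.flat H.ric_mul hS⟩

theorem frame_mem (H : WalkerData U G D m m' X L θ) (y : U) (a : κ) :
    (WithLp.toLp 2 fun i => evalAt y (X i a) : EuclideanSpace ℝ ι) ∈ D y := by
  refine (H.mem y _).mpr ⟨Pi.single a 1, ?_⟩
  ext k; simp

theorem mulVec_eq_zero (H : WalkerData U G D m m' X L θ) (hS : RepM S s) (hX : s * X = 0)
    {y : EuclideanSpace ℝ ι} (hy : y ∈ U) {v : EuclideanSpace ℝ ι} (hv : v ∈ D y) (i : ι) :
    ∑ k, S y i k * v k = 0 := by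
  obtain ⟨c, hc⟩ := (H.mem ⟨y, hy⟩ v).mp hv
  have h1 : S y *ᵥ v.ofLp = 0 := by
    rw [hc, ← hS.map_evalAt ⟨y, hy⟩, Matrix.mulVec_mulVec, ← Matrix.map_mul, hX]
    ext; simp [Matrix.mulVec, dotProduct]
  exact congrFun h1 i

theorem mul_frame_eq_zero (H : WalkerData U G D m m' X L θ) (hs : sᵀ = s) (hS : RepM S s)
    (hI : ∀ y ∈ U, ∀ v, sharp (G y) (S y) v ∈ D y) : m' * s = X * (L * (m' * s)) := by
  refine eq_mul_of_columns H.frame.left fun y b => ?_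
  obtain ⟨c, hc⟩ := (H.mem y _).mp (hI y y.2 (EuclideanSpace.single b 1))
  refine ⟨c, ?_⟩
  rw [← hc]
  have h1 : (m' * s).map (evalAt y) = (G y)⁻¹ * S y := by
    rw [Matrix.map_mul, (H.rep.inv H.frame.inv).map_evalAt, hS.map_evalAt]
  ext k
  have h2 := congrFun (congrFun h1 k) b
  rw [Matrix.map_apply] at h2
  rw [h2, sharp_single]

/-- A symmetric tensor with image in `D` is a frame tensor when it is Lie invariant. -/
theorem frameTensor_of_lie (H : WalkerData U G D m m' X L θ) (hS : RepM S s)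
    (hs : ∀ y ∈ U, (S y)ᵀ = S y) (hI : ∀ y ∈ U, ∀ v, sharp (G y) (S y) v ∈ D y)
    (hL : ∀ Z : EuclideanSpace ℝ ι → EuclideanSpace ℝ ι, ContDiffOn ℝ ∞ Z U →
      (∀ y ∈ U, Z y ∈ D y) → ∀ y ∈ U, ∀ i j, lieDer Z S i j y = 0) :
    ∃ f, FrameTensor (pdR U) m X θ s f := by
  have hst : sᵀ = s := matrix_ext_evalAt fun y => by
    rw [Matrix.transpose_map, hS.map_evalAt, hs y y.2]
  have hZ := H.mul_frame_eq_zero hst hS hI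
  have hX := H.frame.mul_eq_zero_of_image hst hZ
  have heq := H.frame.eq_frame hst hZ
  refine ⟨_, heq, H.frame.frame_symm hst heq, fun a => (H.frame.parallel_iff heq a).mp ?_⟩
  have hξ : ∀ k, Rep (fun y => (WithLp.toLp 2 fun i => lift (X i a) y : EuclideanSpace ℝ ι) k)
      (X k a) := fun k => rep_lift _
  have hcov : ∀ i, (X.map (pdR U i) + conn (pdR U) m m' i * X) = X * θ i := H.frame.par
  refine Matrix.ext fun i j => ext_evalAt fun y => ?_
  have h0 := hL (fun y => WithLp.toLp 2 fun i => lift (X i a) y)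
    ((PiLp.contDiff_toLp).comp_contDiffOn (contDiffOn_pi.mpr fun k => lift_contDiffOn _))
    (fun y hy => by
      have : (fun i => lift (X i a) y) = fun i => evalAt (⟨y, hy⟩ : U) (X i a) :=
        funext fun i => ((rep_lift (X i a)).evalAt ⟨y, hy⟩).symm
      rw [this]; exact H.frame_mem ⟨y, hy⟩ a) y y.2 i j
  -- ℒ_X S = ∇_X S + S(∇X, ·) + S(·, ∇X). The last two terms vanish because ∇X lies in the
  -- distribution, which `S` kills.
  rw [← (rep_lieDer hS hξ i j).evalAt y, lie_eq_cov (H.frame.torsion)] at h0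
  have h1 : ∀ i k, pdR U i (X k a) + ∑ l, conn (pdR U) m m' i k l * X l a = (X * θ i) k a := by
    intro i k
    rw [← hcov i]; rfl
  have h2 : ∀ i j, ∑ k, (X * θ i) k a * s k j = 0 := by
    intro i j
    have h3 : (s * (X * θ i)) j a = 0 := by
      rw [← Matrix.mul_assoc, hX, Matrix.zero_mul]; rfl
    rw [Matrix.mul_apply] at h3
    rw [← h3]
    refine Finset.sum_congr rfl fun k _ => ?_
    have h4 : s k j = s j k := congrFun (congrFun hst j) k
    rw [h4, mul_comm]
  have h2' : ∀ i j, ∑ k, (X * θ i) k a * s j k = 0 := by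
    intro i j
    rw [← h2 i j]
    exact Finset.sum_congr rfl fun k _ => congrArg _ (congrFun (congrFun hst k) j)
  simp only [h1, h2, h2', add_zero] at h0
  simpa [Matrix.sum_apply] using h0

theorem frameTensor_mul (H : WalkerData U G D m m' X L θ) (hF : FrameTensor (pdR U) m X θ s f) :
    s * X = 0 := by
  rw [hF.eq, Matrix.mul_assoc, H.frame.lower_transpose_mul, Matrix.mul_zero]

theorem image_of_frameTensor (H : WalkerData U G D m m' X L θ) (hS : RepM S s)
    (hF : FrameTensor (pdR U) m X θ s f) :
    ∀ y ∈ U, ∀ v, sharp (G y) (S y) v ∈ D y := by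
  intro y hy v
  refine (H.mem ⟨y, hy⟩ _).mpr ⟨((f * (m * X)ᵀ).map (evalAt ⟨y, hy⟩)) *ᵥ v.ofLp, ?_⟩
  have h1 : m' * s = X * (f * (m * X)ᵀ) := by
    rw [hF.eq]
    simp only [← Matrix.mul_assoc, H.frame.inv', Matrix.one_mul]
  have h2 := congrArg (fun N : Matrix ι ι (smoothRing U) => N.map (evalAt ⟨y, hy⟩)) h1
  simp only [Matrix.map_mul] at h2
  rw [(H.rep.inv H.frame.inv).map_evalAt, hS.map_evalAt] at h2
  rw [sharp, Matrix.mulVec_mulVec, Matrix.mulVec_mulVec, Matrix.map_mul, h2]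

theorem parallel_of_frameTensor (H : WalkerData U G D m m' X L θ) (hS : RepM S s)
    (hF : FrameTensor (pdR U) m X θ s f) :
    ∀ y ∈ U, ∀ v ∈ D y, ∀ i j, ∑ k, v k * cov2 G S k i j y = 0 := by
  intro y hy v hv i j
  obtain ⟨c, hc⟩ := (H.mem ⟨y, hy⟩ v).mp hv
  have h0 : ∀ a, ∑ k, evalAt ⟨y, hy⟩ (X k a) * cov2 G S k i j y = 0 := by
    intro a
    have h1 := congrArg (evalAt ⟨y, hy⟩)
      (congrFun (congrFun ((H.frame.parallel_iff hF.eq a).mpr (hF.par a)) i) j)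
    rw [Matrix.sum_apply, map_sum, Matrix.zero_apply, map_zero] at h1
    rw [← h1]
    refine Finset.sum_congr rfl fun k _ => ?_
    rw [Matrix.smul_apply, smul_eq_mul, map_mul, (rep_cov2 H.rep H.frame.inv hS k i j).evalAt]
  have h2 : ∀ k, v k = ∑ a, evalAt ⟨y, hy⟩ (X k a) * c a := fun k => congrFun hc k
  simp only [h2, Finset.sum_mul]
  rw [Finset.sum_comm]
  refine Finset.sum_eq_zero fun a _ => ?_
  have h3 : ∀ k, evalAt ⟨y, hy⟩ (X k a) * c a * cov2 G S k i j y =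
      c a * (evalAt ⟨y, hy⟩ (X k a) * cov2 G S k i j y) := fun k => by ring
  simp only [h3, ← Finset.mul_sum, h0, mul_zero]

theorem divergence_of_frameTensor (H : WalkerData U G D m m' X L θ) (hS : RepM S s)
    (hF : FrameTensor (pdR U) m X θ s f) : ∀ y ∈ U, ∀ j, divergence G S j y = 0 := by
  intro y hy j
  have h0 : ∑ k, ∑ l, m' l k * cov (pdR U) (conn (pdR U) m m') s l k j = 0 := by
    have hst : sᵀ = s := by
      rw [hF.eq]; simp only [Matrix.transpose_mul, Matrix.transpose_transpose, hF.symm,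
        Matrix.mul_assoc]
    have h1 : ∀ l k, cov (pdR U) (conn (pdR U) m m') s l k j =
        cov (pdR U) (conn (pdR U) m m') s l j k := fun l k => by
      have h2 : (cov (pdR U) (conn (pdR U) m m') s l)ᵀ =
          cov (pdR U) (conn (pdR U) m m') s l := by
        simp only [cov, Matrix.transpose_sub, Matrix.transpose_mul, Matrix.transpose_transpose,
          hst, ← map_transpose_derivation]
        abel
      exact congrFun (congrFun h2 j) k
    simp only [h1]
    rw [Finset.sum_comm, H.frame.sum_div_eq hF.eq j]
    refine Finset.sum_eq_zero fun a _ => ?_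
    have hsy : ∀ i, (frameConn (pdR U) θ i f)ᵀ = frameConn (pdR U) θ i f := fun i => by
      rw [frameConn_transpose, hF.symm]
    have h3 := NullFrame.sum_div_frame (X := X) (fun i => frameConn (pdR U) θ i f) hF.par a
    have h4 : ∑ i, ∑ b, frameConn (pdR U) θ i f a b * X i b = 0 := by
      refine Eq.trans ?_ h3
      refine Finset.sum_congr rfl fun i _ => Finset.sum_congr rfl fun b _ => ?_
      rw [mul_comm]
      exact congrArg _ (congrFun (congrFun (hsy i) b) a)
    rw [h4, mul_zero]
  rw [← (rep_divergence H.rep H.frame.inv hS j).evalAt ⟨y, hy⟩, h0, map_zero]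

/-- The raised tensor is XfXᵀ. One factor X turns the curvature of the metric into that of `θ`, and
the other inserts a vector of the distribution, where the curvature of `θ` vanishes. -/
theorem curvTerm_of_frameTensor (H : WalkerData U G D m m' X L θ) (hS : RepM S s)
    (hF : FrameTensor (pdR U) m X θ s f) : ∀ y ∈ U, ∀ i j, curvTerm G S i j y = 0 := by
  intro y hy i j
  rw [← (rep_curvTerm H.rep H.frame.inv hS i j).evalAt ⟨y, hy⟩]
  have h1 : m' * s * m' = X * f * Xᵀ := by
    rw [hF.eq]
    have := H.frame.lower_transpose_mul_inv
    calc m' * (m * X * f * (m * X)ᵀ) * m' = (m' * (m * X)) * f * ((m * X)ᵀ * m') := by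
          simp only [Matrix.mul_assoc]
      _ = _ := by rw [this, H.frame.inv_mul_lower]
  have h2 : ∑ k, ∑ l, (m * curv (pdR U) (conn (pdR U) m m') k i) j l * (m' * s * m') k l = 0 := by
    rw [h1]
    have h3 : ∀ k, ∑ l, (m * curv (pdR U) (conn (pdR U) m m') k i) j l * (X * f * Xᵀ) k l =
        ∑ a, X k a * ∑ b, f a b * (m * (X * curv (pdR U) θ k i)) j b := by
      intro k
      rw [← H.frame.curv_mul, ← Matrix.mul_assoc]
      generalize m * curv (pdR U) (conn (pdR U) m m') k i = N
      simp only [Matrix.mul_apply, Matrix.transpose_apply, Finset.mul_sum, Finset.sum_mul]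
      rw [Finset.sum_comm]
      conv_rhs => rw [Finset.sum_comm]
      refine Finset.sum_congr rfl fun b _ => ?_
      rw [Finset.sum_comm]
      exact Finset.sum_congr rfl fun a _ => Finset.sum_congr rfl fun l _ => by ring
    simp only [h3]
    rw [Finset.sum_comm]
    refine Finset.sum_eq_zero fun a _ => ?_
    have h4 : ∑ k, X k a • (m * (X * curv (pdR U) θ k i)) = 0 := by
      simp only [← Matrix.mul_smul, ← Matrix.mul_sum, H.flat, Matrix.mul_zero]
    have h5 : ∀ k, X k a * ∑ b, f a b * (m * (X * curv (pdR U) θ k i)) j b =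
        ∑ b, f a b * (X k a • (m * (X * curv (pdR U) θ k i))) j b := by
      intro k
      rw [Finset.mul_sum]
      exact Finset.sum_congr rfl fun b _ => by rw [Matrix.smul_apply, smul_eq_mul]; ring
    simp only [h5]
    rw [Finset.sum_comm]
    refine Finset.sum_eq_zero fun b _ => ?_
    rw [← Finset.mul_sum, ← Matrix.sum_apply, h4, Matrix.zero_apply, mul_zero]
  rw [h2, map_zero]

end WalkerData

end WalkerCoordinates

/-! ### Changes of coordinates -/

section Transformation

open TopologicalSpace (Opens)

variable {ι : Type*} [Fintype ι] [DecidableEq ι] {U U' : Opens (EuclideanSpace ℝ ι)}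
  {φ : EuclideanSpace ℝ ι → EuclideanSpace ℝ ι}
  {G S H T : EuclideanSpace ℝ ι → Matrix ι ι ℝ}

/-- The Jacobian matrix at a point. -/
def jac {ι ι' : Type*} [Fintype ι] [DecidableEq ι] [Fintype ι'] [DecidableEq ι']
    (φ : EuclideanSpace ℝ ι → EuclideanSpace ℝ ι') (y : EuclideanSpace ℝ ι) : Matrix ι' ι ℝ :=
  Matrix.of fun k a => pd a (fun y => φ y k) y

theorem repM_jac {ι' : Type*} [Fintype ι'] [DecidableEq ι']
    {φ : EuclideanSpace ℝ ι → EuclideanSpace ℝ ι'} (hφ : ContDiffOn ℝ ∞ φ U) :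
    RepM (jac φ) (jacobian φ hφ) := fun k a => (rep_ofFun _ (contDiffOn_coord hφ k)).pd a

theorem repM_pull (hφ : ContDiffOn ℝ ∞ φ U) (hU : ∀ y ∈ U, φ y ∈ U')
    (hS : ∀ y ∈ U, S y = (jac φ y)ᵀ * T (φ y) * jac φ y) {τ : Matrix ι ι (smoothRing U')}
    (hT : RepM T τ) :
    RepM S (pull (comapHom φ hφ hU : smoothRing U' →+* smoothRing U) (jacobian φ hφ) τ) :=
  repM_of_map_evalAt fun y => by
    rw [hS y y.2, pull, Matrix.map_mul, Matrix.map_mul, Matrix.transpose_map,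
      (repM_jac hφ).map_evalAt]
    congr 2
    exact (hT.comap hφ hU).map_evalAt y

theorem repM_ric_box_transform (hφ : ContDiffOn ℝ ∞ φ U) (hU : ∀ y ∈ U, φ y ∈ U')
    (hJ : ∀ y ∈ U, IsUnit (jac φ y).det)
    (hH : ∀ i j, ContDiffOn ℝ ∞ (fun y => H y i j) U') (hsymm : ∀ y ∈ U', (H y)ᵀ = H y)
    (hinv : ∀ y ∈ U', IsUnit (H y).det)
    (hG : ∀ y ∈ U, G y = (jac φ y)ᵀ * H (φ y) * jac φ y) :
    (∀ y ∈ U, NullRicciWalker.ric G y = (jac φ y)ᵀ * NullRicciWalker.ric H (φ y) * jac φ y) ∧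
      ∀ S T, (∀ i j, ContDiffOn ℝ ∞ (fun y => T y i j) U') →
        (∀ y ∈ U, S y = (jac φ y)ᵀ * T (φ y) * jac φ y) →
        ∀ y ∈ U, NullRicciWalker.box G S y =
          (jac φ y)ᵀ * NullRicciWalker.box H T (φ y) * jac φ y := by
  obtain ⟨m, hm⟩ := exists_repM hH
  have hi : m * m⁻¹ = 1 := mul_inv_of_forall fun y => by rw [hm.map_evalAt]; exact hinv y y.2
  have hmt : mᵀ = m := matrix_ext_evalAt fun y => by
    rw [Matrix.transpose_map, hm.map_evalAt, hsymm y y.2]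
  have hK : jacobian φ hφ * (jacobian φ hφ)⁻¹ = 1 := mul_inv_of_forall fun y => by
    rw [(repM_jac hφ).map_evalAt]; exact hJ y y.2
  have C := coordChange_comapHom hφ hU hK
  have hp := repM_pull hφ hU hG hm
  have hpi : pull (comapHom φ hφ hU : smoothRing U' →+* smoothRing U) (jacobian φ hφ) m *
      ((jacobian φ hφ)⁻¹ * m⁻¹.map (comapHom φ hφ hU : smoothRing U' →+* smoothRing U) *
        ((jacobian φ hφ)⁻¹)ᵀ) = 1 := by
    have e1 : (jacobian φ hφ)ᵀ * ((jacobian φ hφ)⁻¹)ᵀ = 1 := by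
      rw [← Matrix.transpose_mul, mul_eq_one_comm.mp hK, Matrix.transpose_one]
    have e2 : m.map (comapHom φ hφ hU : smoothRing U' →+* smoothRing U) *
        m⁻¹.map (comapHom φ hφ hU : smoothRing U' →+* smoothRing U) = 1 := by
      rw [← Matrix.map_mul, hi, Matrix.map_one _ (map_zero _) (map_one _)]
    generalize (jacobian φ hφ)⁻¹ = K at *
    rw [pull]
    calc _ = (jacobian φ hφ)ᵀ * (m.map (comapHom φ hφ hU : smoothRing U' →+* smoothRing U) *
          ((jacobian φ hφ * K) * m⁻¹.map (comapHom φ hφ hU : smoothRing U' →+* smoothRing U))) *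
          Kᵀ := by simp only [Matrix.mul_assoc]
      _ = 1 := by rw [hK, Matrix.one_mul, e2, Matrix.mul_one, e1]
  have hev : ∀ (τ : Matrix ι ι (smoothRing U')) (T : EuclideanSpace ℝ ι → Matrix ι ι ℝ),
      RepM T τ → ∀ y (hy : y ∈ U), (jac φ y)ᵀ * T (φ y) * jac φ y =
      (pull (comapHom φ hφ hU : smoothRing U' →+* smoothRing U) (jacobian φ hφ) τ).map
        (evalAt (⟨y, hy⟩ : U)) := fun τ T hT y hy =>
    ((repM_pull hφ hU (S := fun y => (jac φ y)ᵀ * T (φ y) * jac φ y) (fun _ _ => rfl)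
      hT).map_evalAt ⟨y, hy⟩).symm
  constructor
  · intro y hy
    rw [hev _ _ (repM_ric hm hi) y hy, ← C.ricMat_pull, ← C.conn_pull hmt hi,
      (repM_ric hp hpi).map_evalAt]
  · intro S T hT hS y hy
    obtain ⟨τ, hτ⟩ := exists_repM hT
    rw [hev _ _ (repM_box hm hi hτ) y hy, ← C.boxMat_pull, ← C.conn_pull hmt hi,
      (repM_box hp hpi (repM_pull hφ hU hS hτ)).map_evalAt]

theorem contDiffOn_ric_box (hH : ∀ i j, ContDiffOn ℝ ∞ (fun y => H y i j) U)
    (hinv : ∀ y ∈ U, IsUnit (H y).det) :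
    (∀ i j, ContDiffOn ℝ ∞ (fun y => NullRicciWalker.ric H y i j) U) ∧
      ∀ T, (∀ i j, ContDiffOn ℝ ∞ (fun y => T y i j) U) →
        ∀ i j, ContDiffOn ℝ ∞ (fun y => NullRicciWalker.box H T y i j) U := by
  obtain ⟨m, hm⟩ := exists_repM hH
  have hi : m * m⁻¹ = 1 := mul_inv_of_forall fun y => by rw [hm.map_evalAt]; exact hinv y y.2
  refine ⟨fun i j => (repM_ric hm hi i j).contDiffOn, fun T hT i j => ?_⟩
  obtain ⟨τ, hτ⟩ := exists_repM hT
  exact (repM_box hm hi hτ i j).contDiffOn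

end Transformation

/-! ### Charts and tensor fields -/

section Charts

open TopologicalSpace (Opens)

universe u

variable {n : ℕ} {M : Type u} [TopologicalSpace M] [ChartedSpace (EuclideanSpace ℝ (Fin n)) M]
  [IsManifold (𝓡 n) ∞ M] {e e' : OpenPartialHomeomorph M (EuclideanSpace ℝ (Fin n))}

theorem mdifferentiable_of_mem_charts (he : e ∈ charts n M) : e.MDifferentiable (𝓡 n) (𝓡 n) :=
  ⟨(contMDiffOn_of_mem_maximalAtlas he).mdifferentiableOn (by simp),
    (contMDiffOn_symm_of_mem_maximalAtlas he).mdifferentiableOn (by simp)⟩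

/-- The domain of the change of coordinates from `e` to `e'`. -/
def overlap (e e' : OpenPartialHomeomorph M (EuclideanSpace ℝ (Fin n))) :
    Opens (EuclideanSpace ℝ (Fin n)) :=
  ⟨e.target ∩ e.symm ⁻¹' e'.source, e.isOpen_inter_preimage_symm e'.open_source⟩

/-- The change of coordinates from `e` to `e'`. -/
def transition (e e' : OpenPartialHomeomorph M (EuclideanSpace ℝ (Fin n)))
    (y : EuclideanSpace ℝ (Fin n)) : EuclideanSpace ℝ (Fin n) := e' (e.symm y)

theorem transition_mem {y : EuclideanSpace ℝ (Fin n)} (hy : y ∈ overlap e e') :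
    transition e e' y ∈ overlap e' e := by
  refine ⟨e'.map_source hy.2, ?_⟩
  change e'.symm (e' (e.symm y)) ∈ e.source
  rw [e'.left_inv hy.2]; exact e.map_target hy.1

theorem symm_transition {y : EuclideanSpace ℝ (Fin n)} (hy : y ∈ overlap e e') :
    e'.symm (transition e e' y) = e.symm y := e'.left_inv hy.2

theorem transition_transition {y : EuclideanSpace ℝ (Fin n)} (hy : y ∈ overlap e e') :
    transition e' e (transition e e' y) = y := by
  rw [transition, symm_transition hy, e.right_inv hy.1]

theorem contDiffOn_transition (he : e ∈ charts n M) (he' : e' ∈ charts n M) :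
    ContDiffOn ℝ ∞ (transition e e') (overlap e e') := by
  rw [← contMDiffOn_iff_contDiffOn]
  exact (contMDiffOn_of_mem_maximalAtlas he').comp
    ((contMDiffOn_symm_of_mem_maximalAtlas he).mono fun y hy => hy.1) fun y hy => hy.2

theorem differentiableAt_transition (he : e ∈ charts n M) (he' : e' ∈ charts n M)
    {y : EuclideanSpace ℝ (Fin n)} (hy : y ∈ overlap e e') :
    DifferentiableAt ℝ (transition e e') y :=
  ((contDiffOn_transition he he').contDiffAt ((overlap e e').isOpen.mem_nhds hy)).differentiableAt
    (by simp)

/-- The derivative of the inverse of a chart. -/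
def chartDeriv (e : OpenPartialHomeomorph M (EuclideanSpace ℝ (Fin n)))
    (y : EuclideanSpace ℝ (Fin n)) : EuclideanSpace ℝ (Fin n) →L[ℝ] EuclideanSpace ℝ (Fin n) :=
  mfderiv (𝓡 n) (𝓡 n) e.symm y

theorem chartDeriv_transition (he : e ∈ charts n M) (he' : e' ∈ charts n M)
    {y : EuclideanSpace ℝ (Fin n)} (hy : y ∈ overlap e e') :
    chartDeriv e y = (chartDeriv e' (transition e e' y)).comp (fderiv ℝ (transition e e') y) := by
  have h1 : e.symm =ᶠ[nhds y] e'.symm ∘ transition e e' :=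
    Filter.eventuallyEq_of_mem ((overlap e e').isOpen.mem_nhds hy)
      fun z hz => (symm_transition hz).symm
  have h2 := mfderiv_comp y (I := 𝓡 n) (I' := 𝓡 n) (I'' := 𝓡 n)
    ((mdifferentiable_of_mem_charts he').mdifferentiableAt_symm (transition_mem hy).1)
    (differentiableAt_transition he he' hy).mdifferentiableAt
  rw [mfderiv_eq_fderiv] at h2
  rw [chartDeriv, h1.mfderiv_eq]
  exact h2

theorem chartDeriv_bijective (he : e ∈ charts n M) {y : EuclideanSpace ℝ (Fin n)}
    (hy : y ∈ e.target) : Function.Bijective (chartDeriv e y) :=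
  (mdifferentiable_of_mem_charts he).symm.mfderiv_bijective hy

theorem sum_smul_single (v : EuclideanSpace ℝ (Fin n)) :
    v = ∑ k, v k • EuclideanSpace.single k (1 : ℝ) := by
  ext j
  simp [Pi.single_apply]

theorem fderiv_apply_eq_jac {φ : EuclideanSpace ℝ (Fin n) → EuclideanSpace ℝ (Fin n)}
    {y : EuclideanSpace ℝ (Fin n)} (hφ : DifferentiableAt ℝ φ y)
    (v : EuclideanSpace ℝ (Fin n)) : (fderiv ℝ φ y v).ofLp = jac φ y *ᵥ v.ofLp := by
  have h1 : ∀ k, fderiv ℝ (fun y => φ y k) y v = fderiv ℝ φ y v k := by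
    intro k
    have := ((EuclideanSpace.proj (𝕜 := ℝ) k :
      EuclideanSpace ℝ (Fin n) →L[ℝ] ℝ).hasFDerivAt.comp y hφ.hasFDerivAt).fderiv
    change fderiv ℝ ((EuclideanSpace.proj (𝕜 := ℝ) k :
      EuclideanSpace ℝ (Fin n) →L[ℝ] ℝ) ∘ φ) y _ = _
    rw [this]; rfl
  ext k
  rw [← h1 k]
  conv_lhs => rw [sum_smul_single v]
  simp only [map_sum, map_smul, smul_eq_mul, Matrix.mulVec, dotProduct, jac, Matrix.of_apply, pd]
  exact Finset.sum_congr rfl fun a _ => mul_comm _ _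

theorem jac_mul_jac (he : e ∈ charts n M) (he' : e' ∈ charts n M)
    {y : EuclideanSpace ℝ (Fin n)} (hy : y ∈ overlap e e') :
    jac (transition e' e) (transition e e' y) * jac (transition e e') y = 1 := by
  have h1 : (fun z => transition e' e (transition e e' z)) =ᶠ[nhds y] id :=
    Filter.eventuallyEq_of_mem ((overlap e e').isOpen.mem_nhds hy)
      fun z hz => transition_transition hz
  have h2 := fderiv_comp y (differentiableAt_transition he' he (transition_mem hy))
    (differentiableAt_transition he he' hy)
  have h3 : fderiv ℝ (transition e' e ∘ transition e e') y = ContinuousLinearMap.id ℝ _ := by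
    rw [← fderiv_id (x := y)]; exact h1.fderiv_eq
  rw [h3] at h2
  refine Matrix.ext_of_mulVec_single fun a => ?_
  have h4 := congrArg (fun L : EuclideanSpace ℝ (Fin n) →L[ℝ] EuclideanSpace ℝ (Fin n) =>
    (L (EuclideanSpace.single a 1)).ofLp) h2
  simp only [ContinuousLinearMap.comp_apply] at h4
  rw [fderiv_apply_eq_jac (differentiableAt_transition he' he (transition_mem hy)),
    fderiv_apply_eq_jac (differentiableAt_transition he he' hy), Matrix.mulVec_mulVec] at h4
  rw [Matrix.one_mulVec]
  exact h4.symm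

theorem isUnit_jac (he : e ∈ charts n M) (he' : e' ∈ charts n M)
    {y : EuclideanSpace ℝ (Fin n)} (hy : y ∈ overlap e e') :
    IsUnit (jac (transition e e') y).det :=
  Matrix.isUnit_det_of_left_inverse (jac_mul_jac he he' hy)

/-- The value of a field of bilinear forms, as a bilinear form on the coordinate space. -/
def formAt (b : BilinField n M) (x : M) :
    EuclideanSpace ℝ (Fin n) →L[ℝ] EuclideanSpace ℝ (Fin n) →L[ℝ] ℝ := b x

theorem formAt_chartDeriv (b : BilinField n M) (y v w : EuclideanSpace ℝ (Fin n)) :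
    formAt b (e.symm y) (chartDeriv e y v) (chartDeriv e y w) =
      ∑ i, ∑ j, v i * comp e b y i j * w j := by
  conv_lhs => rw [sum_smul_single v, sum_smul_single w]
  simp only [map_sum, map_smul, sum_apply, smul_apply,
    smul_eq_mul, Finset.mul_sum]
  refine Eq.trans Finset.sum_comm
    (Finset.sum_congr rfl fun i _ => Finset.sum_congr rfl fun j _ => ?_)
  have : comp e b y i j = formAt b (e.symm y) (chartDeriv e y (EuclideanSpace.single i 1))
    (chartDeriv e y (EuclideanSpace.single j 1)) := rfl
  rw [this]; ring

theorem sum_mul_mul_eq (A : Matrix (Fin n) (Fin n) ℝ) (v w : Fin n → ℝ) :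
    ∑ i, ∑ j, v i * A i j * w j = v ⬝ᵥ (A *ᵥ w) := by
  simp only [dotProduct, Matrix.mulVec, Finset.mul_sum, mul_assoc]

theorem comp_transition (he : e ∈ charts n M) (he' : e' ∈ charts n M) (b : BilinField n M)
    {y : EuclideanSpace ℝ (Fin n)} (hy : y ∈ overlap e e') :
    comp e b y = (jac (transition e e') y)ᵀ * comp e' b (transition e e' y) *
      jac (transition e e') y := by
  have h : ∀ v w : EuclideanSpace ℝ (Fin n), v.ofLp ⬝ᵥ (comp e b y *ᵥ w.ofLp) =
      v.ofLp ⬝ᵥ (((jac (transition e e') y)ᵀ * comp e' b (transition e e' y) *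
      jac (transition e e') y) *ᵥ w.ofLp) := by
    intro v w
    rw [← sum_mul_mul_eq, ← formAt_chartDeriv, chartDeriv_transition he he' hy,
      ← symm_transition hy]
    simp only [ContinuousLinearMap.comp_apply]
    rw [formAt_chartDeriv, sum_mul_mul_eq,
      fderiv_apply_eq_jac (differentiableAt_transition he he' hy),
      fderiv_apply_eq_jac (differentiableAt_transition he he' hy), Matrix.mulVec_mulVec,
      Matrix.mul_assoc, ← Matrix.mulVec_mulVec _ (jac (transition e e') y)ᵀ,
      Matrix.dotProduct_mulVec _ (jac (transition e e') y)ᵀ, Matrix.vecMul_transpose]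
  ext i j
  have := h (EuclideanSpace.single i 1) (EuclideanSpace.single j 1)
  simpa using this

theorem comp_transpose {b : BilinField n M} (hb : ∀ x v w, b x v w = b x w v)
    (e : OpenPartialHomeomorph M (EuclideanSpace ℝ (Fin n))) (y : EuclideanSpace ℝ (Fin n)) :
    (comp e b y)ᵀ = comp e b y := by
  ext i j; exact hb _ _ _

theorem isUnit_comp {b : BilinField n M} {y : EuclideanSpace ℝ (Fin n)}
    (hb : ∀ v w, b (e.symm y) v w = b (e.symm y) w v)
    (hnd : ∀ v, (∀ w, b (e.symm y) v w = 0) → v = 0) (he : e ∈ charts n M)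
    (hy : y ∈ e.target) : IsUnit (comp e b y).det := by
  rw [isUnit_iff_ne_zero]
  intro h0
  obtain ⟨v, hv, h1⟩ := Matrix.exists_mulVec_eq_zero_iff.mpr h0
  have hbij := chartDeriv_bijective he hy
  refine hv ?_
  have h2 : chartDeriv e y (WithLp.toLp 2 v) = 0 := by
    refine hnd _ fun w => ?_
    obtain ⟨w', rfl⟩ := hbij.2 w
    refine (hb _ _).trans ?_
    change formAt b (e.symm y) (chartDeriv e y w') (chartDeriv e y (WithLp.toLp 2 v)) = 0
    rw [formAt_chartDeriv, sum_mul_mul_eq]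
    change _ ⬝ᵥ (_ *ᵥ v) = 0
    rw [h1, dotProduct_zero]
  have h3 := hbij.1 (h2.trans (map_zero _).symm)
  exact congrArg WithLp.ofLp h3

theorem eq_zero_of_isUnit_comp {b : BilinField n M} (he : e ∈ charts n M) {x : M}
    (hx : x ∈ e.source) (h : IsUnit (comp e b (e x)).det) (v : TangentSpace (𝓡 n) x)
    (hv : ∀ w, b x w v = 0) : v = 0 := by
  have hy := e.map_source hx
  have hxe := e.left_inv hx
  have hbij := chartDeriv_bijective he hy
  obtain ⟨v', hv'⟩ := hbij.2 v
  have h1 : comp e b (e x) *ᵥ v'.ofLp = 0 := by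
    refine dotProduct_eq_zero _ fun w => ?_
    have h2 : formAt b x (chartDeriv e (e x) (WithLp.toLp 2 w)) (chartDeriv e (e x) v') = 0 := by
      rw [hv']; exact hv _
    have h3 := formAt_chartDeriv (e := e) b (e x) (WithLp.toLp 2 w) v'
    rw [hxe, h2, sum_mul_mul_eq] at h3
    rw [dotProduct_comm]
    exact h3.symm
  have h2 : v'.ofLp = 0 := by
    have := congrArg (fun u => (comp e b (e x))⁻¹ *ᵥ u) h1
    simpa [Matrix.mulVec_mulVec, Matrix.nonsing_inv_mul _ h] using this
  have h3 : v' = 0 := WithLp.ofLp_injective 2 h2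
  rw [h3, map_zero] at hv'
  exact hv'.symm

theorem mem_compSub {N : SubspaceField n M} {y v : EuclideanSpace ℝ (Fin n)} :
    v ∈ compSub e N y ↔ chartDeriv e y v ∈ N (e.symm y) := Iff.rfl

theorem mem_compSub_transition (he : e ∈ charts n M) (he' : e' ∈ charts n M)
    (N : SubspaceField n M) {y : EuclideanSpace ℝ (Fin n)} (hy : y ∈ overlap e e')
    (v : EuclideanSpace ℝ (Fin n)) :
    v ∈ compSub e N y ↔ fderiv ℝ (transition e e') y v ∈ compSub e' N (transition e e' y) := by
  rw [mem_compSub, mem_compSub, symm_transition hy, chartDeriv_transition he he' hy]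
  rfl

/-- The bilinear form with a given matrix. -/
def formOf (A : Matrix (Fin n) (Fin n) ℝ) :
    EuclideanSpace ℝ (Fin n) →L[ℝ] EuclideanSpace ℝ (Fin n) →L[ℝ] ℝ :=
  ∑ i, ∑ j, A i j • (EuclideanSpace.proj (𝕜 := ℝ) i :
    EuclideanSpace ℝ (Fin n) →L[ℝ] ℝ).smulRight
      (EuclideanSpace.proj (𝕜 := ℝ) j : EuclideanSpace ℝ (Fin n) →L[ℝ] ℝ)

theorem formOf_single (A : Matrix (Fin n) (Fin n) ℝ) (i j : Fin n) :
    formOf A (EuclideanSpace.single i 1) (EuclideanSpace.single j 1) = A i j := by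
  simp [formOf, sum_apply, Finset.sum_ite_eq, Pi.single_apply]

/-- At a point x the form is defined by the preferred chart at x. The transformation law then makes
its components right in every chart, so smoothness is not needed for the gluing. -/
theorem exists_bilinField
    (F : OpenPartialHomeomorph M (EuclideanSpace ℝ (Fin n)) → EuclideanSpace ℝ (Fin n) →
      Matrix (Fin n) (Fin n) ℝ)
    (hF : ∀ e ∈ charts n M, ∀ e' ∈ charts n M, ∀ y ∈ overlap e e', F e y =
      (jac (transition e e') y)ᵀ * F e' (transition e e' y) * jac (transition e e') y) :
    ∃ b : BilinField n M, ∀ e ∈ charts n M, ∀ y ∈ e.target, comp e b y = F e y := by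
  let D : (x : M) → EuclideanSpace ℝ (Fin n) →L[ℝ] EuclideanSpace ℝ (Fin n) := fun x =>
    mfderiv (𝓡 n) (𝓡 n) (chartAt (EuclideanSpace ℝ (Fin n)) x) x
  let b : BilinField n M := fun x => (formOf (F (chartAt (EuclideanSpace ℝ (Fin n)) x)
    (chartAt (EuclideanSpace ℝ (Fin n)) x x))).bilinearComp (D x) (D x)
  refine ⟨b, fun e he y hy => ?_⟩
  set e' := chartAt (EuclideanSpace ℝ (Fin n)) (e.symm y) with he'
  have hec : e' ∈ charts n M := IsManifold.chart_mem_maximalAtlas _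
  have hyo : y ∈ overlap e e' := ⟨hy, mem_chart_source _ _⟩
  rw [comp_transition he hec b hyo, hF e he e' hec y hyo]
  congr 2
  ext i j
  have h1 : comp e' b (transition e e' y) i j = formAt b (e'.symm (transition e e' y))
    (chartDeriv e' (transition e e' y) (EuclideanSpace.single i 1))
    (chartDeriv e' (transition e e' y) (EuclideanSpace.single j 1)) := rfl
  have h2 : ∀ v, D (e.symm y) (chartDeriv e' (transition e e' y) v) = v := by
    intro v
    have h3 := (mdifferentiable_of_mem_charts hec).comp_symm_deriv (transition_mem hyo).1
    rw [symm_transition hyo] at h3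
    exact congrArg (fun L : EuclideanSpace ℝ (Fin n) →L[ℝ] EuclideanSpace ℝ (Fin n) => L v) h3
  rw [h1, symm_transition hyo]
  change formOf (F e' (e' (e.symm y))) (D (e.symm y) _) (D (e.symm y) _) = _
  rw [h2, h2, formOf_single]
  rfl

end Charts

/-! ### Null Ricci Walker metrics in charts -/

section WalkerCharts

open TopologicalSpace (Opens)

universe u

variable {n p : ℕ} {M : Type u} [TopologicalSpace M] [ChartedSpace (EuclideanSpace ℝ (Fin n)) M]
  [IsManifold (𝓡 n) ∞ M] {e e' : OpenPartialHomeomorph M (EuclideanSpace ℝ (Fin n))}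
  {g b b' : BilinField n M} {N : SubspaceField n M}

theorem isUnit_metric (hg : IsPseudoRiemannian g) (he : e ∈ charts n M)
    {y : EuclideanSpace ℝ (Fin n)} (hy : y ∈ e.target) : IsUnit (comp e g y).det :=
  isUnit_comp (hg.symm _) (hg.nondegenerate _) he hy

theorem mulVec_jac_transition (he : e ∈ charts n M) (he' : e' ∈ charts n M)
    {y : EuclideanSpace ℝ (Fin n)} (hy : y ∈ overlap e e') (v : EuclideanSpace ℝ (Fin n)) :
    fderiv ℝ (transition e' e) (transition e e' y) (fderiv ℝ (transition e e') y v) = v := by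
  refine WithLp.ofLp_injective 2 ?_
  rw [fderiv_apply_eq_jac (differentiableAt_transition he' he (transition_mem hy)),
    fderiv_apply_eq_jac (differentiableAt_transition he he' hy), Matrix.mulVec_mulVec,
    jac_mul_jac he he' hy, Matrix.one_mulVec]

/-- The definition of a distribution provides a frame in one suitable chart near each point. It is
carried to the given chart by the derivative of the transition map, on the overlap. -/
theorem exists_isWalkerFrame (H : IsNullRicciWalker p g N) (he : e ∈ charts n M)
    {y₀ : EuclideanSpace ℝ (Fin n)} (hy₀ : y₀ ∈ e.target) :
    ∃ U : Opens (EuclideanSpace ℝ (Fin n)), y₀ ∈ U ∧ (∀ y ∈ U, y ∈ e.target) ∧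
      ∃ Y : Fin p → EuclideanSpace ℝ (Fin n) → EuclideanSpace ℝ (Fin n),
        IsWalkerFrame U (comp e g) (compSub e N) Y := by
  obtain ⟨e₀, he₀, hx, Y, hY, hspan⟩ := H.distribution (e.symm y₀)
  have hUt : ∀ y ∈ overlap e e₀, y ∈ e.target := fun y hy => hy.1
  have hφ := contDiffOn_transition he he₀
  have hmaps : ∀ y ∈ overlap e e₀, transition e e₀ y ∈ e₀.target := fun y hy =>
    (transition_mem hy).1
  have hsm : ∀ a, ContDiffOn ℝ ∞ (fun y => fderiv ℝ (transition e₀ e) (transition e e₀ y)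
      (Y a (transition e e₀ y))) (overlap e e₀) := fun a => by
    have h1 : ContDiffOn ℝ ∞ (fderiv ℝ (transition e₀ e)) (overlap e₀ e) :=
      (contDiffOn_transition he₀ he).fderiv_of_isOpen (overlap e₀ e).isOpen (by simp)
    exact (h1.comp hφ fun y hy => transition_mem hy).clm_apply ((hY a).comp hφ hmaps)
  have hsp : ∀ y ∈ overlap e e₀, Submodule.span ℝ (Set.range fun a =>
      fderiv ℝ (transition e₀ e) (transition e e₀ y) (Y a (transition e e₀ y))) =
      compSub e N y := by
    intro y hy
    have h1 : (Set.range fun a => fderiv ℝ (transition e₀ e) (transition e e₀ y)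
        (Y a (transition e e₀ y))) = (fderiv ℝ (transition e₀ e) (transition e e₀ y)).toLinearMap ''
        (Set.range fun a => Y a (transition e e₀ y)) := by
      rw [← Set.range_comp]; rfl
    rw [h1, Submodule.span_image, (hspan _ (hmaps y hy)).2]
    ext v
    rw [Submodule.mem_map, mem_compSub_transition he he₀ N hy]
    constructor
    · rintro ⟨w, hw, rfl⟩
      have h2 := mulVec_jac_transition he₀ he (transition_mem hy) w
      rw [transition_transition hy] at h2
      rw [ContinuousLinearMap.coe_coe, h2]; exact hw
    · intro hv
      exact ⟨_, hv, mulVec_jac_transition he he₀ hy v⟩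
  refine ⟨overlap e e₀, ⟨hy₀, hx⟩, hUt, fun a y => fderiv ℝ (transition e₀ e) (transition e e₀ y)
    (Y a (transition e e₀ y)), ?_⟩
  refine ⟨fun i j => (H.metric.smooth e he i j).mono hUt,
    fun y _ => comp_transpose H.metric.symm e y,
    fun y hy => isUnit_metric H.metric he (hUt y hy), hsm, ?_, hsp, ?_, ?_,
    fun y hy v => H.schouten_image e he y (hUt y hy) v⟩
  · intro y hy
    refine (hspan _ (hmaps y hy)).1.map' (fderiv ℝ (transition e₀ e)
      (transition e e₀ y)).toLinearMap (LinearMap.ker_eq_bot.mpr ?_)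
    refine Function.LeftInverse.injective
      (g := fun v => fderiv ℝ (transition e e₀) y v) fun w => ?_
    have h2 := mulVec_jac_transition he₀ he (transition_mem hy) w
    rwa [transition_transition hy] at h2
  · intro y hy v hv w hw
    rw [← formAt_chartDeriv]
    exact H.null _ _ hv _ hw
  · intro a y hy i
    refine H.parallel e he (overlap e e₀) _ ⟨(overlap e e₀).isOpen, hUt, hsm a, fun z hz => ?_⟩
      y hy i
    rw [← hsp z hz]
    exact Submodule.subset_span ⟨a, rfl⟩

theorem exists_walkerData (hn : 3 ≤ n) (H : IsNullRicciWalker p g N)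
    (hp : p = 1 ∨ CurvatureAnnihilated g N) (he : e ∈ charts n M)
    {y₀ : EuclideanSpace ℝ (Fin n)} (hy₀ : y₀ ∈ e.target) :
    ∃ U : Opens (EuclideanSpace ℝ (Fin n)), y₀ ∈ U ∧ (∀ y ∈ U, y ∈ e.target) ∧
      ∃ (m m' : Matrix (Fin n) (Fin n) (smoothRing U)) (X : Matrix (Fin n) (Fin p) (smoothRing U))
        (L : Matrix (Fin p) (Fin n) (smoothRing U))
        (θ : Fin n → Matrix (Fin p) (Fin p) (smoothRing U)),
        WalkerData U (comp e g) (compSub e N) m m' X L θ := by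
  obtain ⟨U, hyU, hUt, Y, hY⟩ := exists_isWalkerFrame H he hy₀
  obtain ⟨m, m', X, L, θ, hm, hF, hmem⟩ := hY.exists_nullFrame
  refine ⟨U, hyU, hUt, m, m', X, L, θ, WalkerData.of_frame hm hF hmem (by simpa using hn)
    hY.schouten ?_⟩
  rcases hp with rfl | hp
  · exact Or.inl inferInstance
  · exact Or.inr fun y hy v hv j k l => hp e he y (hUt y hy) v hv j k l

/-- `b` is, in terms of any local frame of `N`, a symmetric section of `N ⊗ N` parallel along
`N`. -/
def IsFrameField (p : ℕ) (g : BilinField n M) (N : SubspaceField n M) (b : BilinField n M) : Prop :=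
  ∀ e ∈ charts n M, ∀ U : Opens (EuclideanSpace ℝ (Fin n)), (∀ y ∈ U, y ∈ e.target) →
    ∀ (m m' : Matrix (Fin n) (Fin n) (smoothRing U)) (X : Matrix (Fin n) (Fin p) (smoothRing U))
      (L : Matrix (Fin p) (Fin n) (smoothRing U))
      (θ : Fin n → Matrix (Fin p) (Fin p) (smoothRing U)),
      WalkerData U (comp e g) (compSub e N) m m' X L θ →
      ∃ (s : Matrix (Fin n) (Fin n) (smoothRing U)) (f : Matrix (Fin p) (Fin p) (smoothRing U)),
        RepM (comp e b) s ∧ FrameTensor (pdR U) m X θ s f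

theorem FrameTensor.add {ι κ R : Type*} [Fintype ι] [DecidableEq ι] [Fintype κ] [DecidableEq κ]
    [CommRing R] [Algebra ℝ R] {d : ι → Derivation ℝ R R} {G : Matrix ι ι R} {X : Matrix ι κ R}
    {θ : ι → Matrix κ κ R} {S S' : Matrix ι ι R} {f f' : Matrix κ κ R}
    (h : FrameTensor d G X θ S f) (h' : FrameTensor d G X θ S' f') :
    FrameTensor d G X θ (S + S') (f + f') where
  eq := by rw [h.eq, h'.eq, Matrix.mul_add, Matrix.add_mul]
  symm := by rw [Matrix.transpose_add, h.symm, h'.symm]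
  par a := by simp only [map_add, smul_add, Finset.sum_add_distrib, h.par, h'.par, add_zero]

theorem FrameTensor.real_smul {ι κ R : Type*} [Fintype ι] [DecidableEq ι] [Fintype κ]
    [DecidableEq κ] [CommRing R] [Algebra ℝ R] {d : ι → Derivation ℝ R R} {G : Matrix ι ι R}
    {X : Matrix ι κ R} {θ : ι → Matrix κ κ R} {S : Matrix ι ι R} {f : Matrix κ κ R}
    (h : FrameTensor d G X θ S f) (c : ℝ) : FrameTensor d G X θ (c • S) (c • f) where
  eq := by rw [h.eq, Matrix.mul_smul, Matrix.smul_mul]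
  symm := by rw [Matrix.transpose_smul, h.symm]
  par a := by
    have : ∀ k, frameConn d θ k (c • f) = c • frameConn d θ k f := fun k => by
      simp only [frameConn_apply, map_real_smul_derivation, Matrix.mul_smul, Matrix.smul_mul,
        smul_add]
    simp only [this, smul_comm _ c, ← Finset.smul_sum, h.par, smul_zero]

theorem comp_add (e : OpenPartialHomeomorph M (EuclideanSpace ℝ (Fin n))) (b b' : BilinField n M)
    (y : EuclideanSpace ℝ (Fin n)) : comp e (b + b') y = comp e b y + comp e b' y := by
  ext; rfl

theorem comp_smul (e : OpenPartialHomeomorph M (EuclideanSpace ℝ (Fin n))) (c : ℝ)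
    (b : BilinField n M) (y : EuclideanSpace ℝ (Fin n)) : comp e (c • b) y = c • comp e b y := by
  ext; rfl

theorem comp_zero (e : OpenPartialHomeomorph M (EuclideanSpace ℝ (Fin n)))
    (y : EuclideanSpace ℝ (Fin n)) : comp e (0 : BilinField n M) y = 0 := by
  ext; rfl

theorem eq_of_comp_eq (h : ∀ e ∈ charts n M, ∀ y ∈ e.target, comp e b y = comp e b' y) :
    b = b' := by
  funext x
  set e := chartAt (EuclideanSpace ℝ (Fin n)) x with he
  have hec : e ∈ charts n M := IsManifold.chart_mem_maximalAtlas _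
  have hy := e.map_source (mem_chart_source _ x)
  have hxe := e.left_inv (mem_chart_source _ x)
  have hbij := chartDeriv_bijective hec hy
  have key : formAt b x = formAt b' x := by
    ext v w
    obtain ⟨v, rfl⟩ := hbij.2 v
    obtain ⟨w, rfl⟩ := hbij.2 w
    have h1 := formAt_chartDeriv (e := e) b (e x) v w
    have h2 := formAt_chartDeriv (e := e) b' (e x) v w
    rw [hxe] at h1 h2
    rw [h1, h2, h e hec _ hy]
  exact key

theorem comp_sum {σ : Type*} (s : Finset σ) (e : OpenPartialHomeomorph M (EuclideanSpace ℝ (Fin n)))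
    (b : σ → BilinField n M) (y : EuclideanSpace ℝ (Fin n)) :
    comp e (∑ a ∈ s, b a) y = ∑ a ∈ s, comp e (b a) y := by
  classical
  induction s using Finset.induction_on with
  | empty => simp [comp_zero]
  | insert a s ha ih => rw [Finset.sum_insert ha, Finset.sum_insert ha, comp_add, ih]

namespace IsFrameField

theorem add (h : IsFrameField p g N b) (h' : IsFrameField p g N b') :
    IsFrameField p g N (b + b') := by
  intro e he U hU m m' X L θ H
  obtain ⟨s, f, hs, hf⟩ := h e he U hU m m' X L θ H
  obtain ⟨s', f', hs', hf'⟩ := h' e he U hU m m' X L θ H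
  refine ⟨s + s', f + f', fun i j => ?_, hf.add hf'⟩
  simp only [comp_add]
  exact (hs i j).add (hs' i j)

theorem smul (h : IsFrameField p g N b) (c : ℝ) : IsFrameField p g N (c • b) := by
  intro e he U hU m m' X L θ H
  obtain ⟨s, f, hs, hf⟩ := h e he U hU m m' X L θ H
  refine ⟨c • s, c • f, fun i j => ?_, hf.real_smul c⟩
  simp only [comp_smul]
  exact (hs i j).smul c

theorem zero : IsFrameField p g N (0 : BilinField n M) := by
  intro e he U hU m m' X L θ H
  refine ⟨0, 0, fun i j => ?_, by simp, by simp, by simp⟩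
  simp only [comp_zero]
  exact Rep.zero

theorem sum {σ : Type*} (t : Finset σ) {b : σ → BilinField n M}
    (h : ∀ a, IsFrameField p g N (b a)) : IsFrameField p g N (∑ a ∈ t, b a) := by
  classical
  induction t using Finset.induction_on with
  | empty => simpa using zero
  | insert a t ha ih => rw [Finset.sum_insert ha]; exact (h a).add ih

theorem symm (hn : 3 ≤ n) (H : IsNullRicciWalker p g N)
    (hp : p = 1 ∨ CurvatureAnnihilated g N) (h : IsFrameField p g N b) (x : M) (v w : TangentSpace (𝓡 n) x) :
    b x v w = b x w v := by
  set e := chartAt (EuclideanSpace ℝ (Fin n)) x with he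
  have hec : e ∈ charts n M := IsManifold.chart_mem_maximalAtlas _
  have hy := e.map_source (mem_chart_source _ x)
  have hxe := e.left_inv (mem_chart_source _ x)
  have hbij := chartDeriv_bijective hec hy
  obtain ⟨U, hyU, hUt, m, m', X, L, θ, W⟩ := exists_walkerData hn H hp hec hy
  obtain ⟨s, f, hs, hf⟩ := h e hec U hUt m m' X L θ W
  have hst : (comp e b (e x))ᵀ = comp e b (e x) := by
    rw [← hs.map_evalAt ⟨_, hyU⟩, ← Matrix.transpose_map, hf.eq]
    simp only [Matrix.transpose_mul, Matrix.transpose_transpose, hf.symm, Matrix.mul_assoc]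
  change formAt b x v w = formAt b x w v
  obtain ⟨v', hv⟩ := hbij.2 v
  obtain ⟨w', hw⟩ := hbij.2 w
  have h1 := formAt_chartDeriv (e := e) b (e x) v' w'
  have h2 := formAt_chartDeriv (e := e) b (e x) w' v'
  rw [hxe, hv, hw, sum_mul_mul_eq] at h1 h2
  rw [h1, h2, Matrix.dotProduct_mulVec, dotProduct_comm, ← Matrix.mulVec_transpose, hst]

theorem imageIn (hn : 3 ≤ n) (H : IsNullRicciWalker p g N)
    (hp : p = 1 ∨ CurvatureAnnihilated g N) (h : IsFrameField p g N b) : ImageIn g N b := by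
  intro e he y hy v
  obtain ⟨U, hyU, hUt, m, m', X, L, θ, W⟩ := exists_walkerData hn H hp he hy
  obtain ⟨s, f, hs, hf⟩ := h e he U hUt m m' X L θ W
  exact W.image_of_frameTensor hs hf y hyU v

theorem divergenceFree (hn : 3 ≤ n) (H : IsNullRicciWalker p g N)
    (hp : p = 1 ∨ CurvatureAnnihilated g N) (h : IsFrameField p g N b) : DivergenceFree g b := by
  intro e he y hy j
  obtain ⟨U, hyU, hUt, m, m', X, L, θ, W⟩ := exists_walkerData hn H hp he hy
  obtain ⟨s, f, hs, hf⟩ := h e he U hUt m m' X L θ W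
  exact W.divergence_of_frameTensor hs hf y hyU j

theorem parallelAlong (hn : 3 ≤ n) (H : IsNullRicciWalker p g N)
    (hp : p = 1 ∨ CurvatureAnnihilated g N) (h : IsFrameField p g N b) : ParallelAlong g N b := by
  intro e he y hy v hv i j
  obtain ⟨U, hyU, hUt, m, m', X, L, θ, W⟩ := exists_walkerData hn H hp he hy
  obtain ⟨s, f, hs, hf⟩ := h e he U hUt m m' X L θ W
  exact W.parallel_of_frameTensor hs hf y hyU v hv i j

theorem curvTerm_eq_zero (hn : 3 ≤ n) (H : IsNullRicciWalker p g N)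
    (hp : p = 1 ∨ CurvatureAnnihilated g N) (h : IsFrameField p g N b) (he : e ∈ charts n M)
    {y : EuclideanSpace ℝ (Fin n)} (hy : y ∈ e.target) (i j : Fin n) :
    curvTerm (comp e g) (comp e b) i j y = 0 := by
  obtain ⟨U, hyU, hUt, m, m', X, L, θ, W⟩ := exists_walkerData hn H hp he hy
  obtain ⟨s, f, hs, hf⟩ := h e he U hUt m m' X L θ W
  exact W.curvTerm_of_frameTensor hs hf y hyU i j

/-- A section of 𝒩 has its covariant derivatives in 𝒩. The terms by which the Lie derivative differs
from the covariant derivative are thus killed by `b`. -/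
theorem lieInvariant (hn : 3 ≤ n) (H : IsNullRicciWalker p g N)
    (hp : p = 1 ∨ CurvatureAnnihilated g N) (h : IsFrameField p g N b) : LieInvariant N b := by
  intro e he V Z hZ y hy i j
  have hyt := hZ.2.1 hy
  obtain ⟨U, hyU, hUt, m, m', X, L, θ, W⟩ := exists_walkerData hn H hp he hyt
  obtain ⟨s, f, hs, hf⟩ := h e he U hUt m m' X L θ W
  have hsX := W.frameTensor_mul hf
  let V' : Opens (EuclideanSpace ℝ (Fin n)) := ⟨V ∩ U, hZ.1.inter U.isOpen⟩
  have hyV : y ∈ V' := ⟨hy, hyU⟩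
  have hVt : ∀ z ∈ V', z ∈ e.target := fun z hz => hUt z hz.2
  rw [lieDer_eq (U := V') (G := comp e g) (fun i j => (H.metric.smooth e he i j).mono hVt)
    (fun z _ => comp_transpose H.metric.symm e z)
    (fun z hz => isUnit_metric H.metric he (hVt z hz))
    (fun i j => (hs i j).contDiffOn.mono fun z hz => hz.2)
    (hZ.2.2.1.mono fun z hz => hz.1) hyV,
    W.parallel_of_frameTensor hs hf y hyU (Z y) (hZ.2.2.2 y hy)]
  have h1 : ∀ i, covVec (comp e g) Z i y ∈ compSub e N y := fun i =>
    H.parallel e he V Z hZ y hy i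
  have h2 := fun i j => W.mulVec_eq_zero hs hsX hyU (h1 i) j
  have hsy : ∀ k j, comp e b y k j = comp e b y j k := fun k j =>
    congrFun (congrFun (comp_transpose (IsFrameField.symm hn H hp h) e y) j) k
  have h3 : ∀ i j, ∑ k, covVec (comp e g) Z i y k * comp e b y k j = 0 := fun i j => by
    rw [← h2 i j]
    exact Finset.sum_congr rfl fun k _ => by rw [hsy k j, mul_comm]
  have h4 : ∀ i j, ∑ k, covVec (comp e g) Z j y k * comp e b y i k = 0 := fun i j => by
    rw [← h2 j i]
    exact Finset.sum_congr rfl fun k _ => mul_comm _ _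
  rw [h3, h4]; simp

theorem of_lie (hs : ∀ e ∈ charts n M, ∀ i j, ContDiffOn ℝ ∞ (fun y => comp e b y i j) e.target)
    (hsymm : ∀ x v w, b x v w = b x w v) (hI : ImageIn g N b) (hL : LieInvariant N b) :
    IsFrameField p g N b := by
  intro e he U hU m m' X L θ W
  obtain ⟨s, hS⟩ := exists_repM (U := U) (M := comp e b) fun i j => (hs e he i j).mono hU
  obtain ⟨f, hf⟩ := W.frameTensor_of_lie hS (fun y _ => comp_transpose hsymm e y)
    (fun y hy => hI e he y (hU y hy))
    (fun Z hZ hZN y hy => hL e he U Z ⟨U.isOpen, hU, hZ, hZN⟩ y hy)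
  exact ⟨s, f, hS, hf⟩

end IsFrameField

/-- The iterated Laplacians of the Ricci tensor in coordinates. -/
def boxRic {ι : Type*} [Fintype ι] [DecidableEq ι] (G : EuclideanSpace ℝ ι → Matrix ι ι ℝ)
    (k : ℕ) : EuclideanSpace ℝ ι → Matrix ι ι ℝ := (box G)^[k] (ric G)

theorem boxRic_succ {ι : Type*} [Fintype ι] [DecidableEq ι]
    (G : EuclideanSpace ℝ ι → Matrix ι ι ℝ) (k : ℕ) : boxRic G (k + 1) = box G (boxRic G k) :=
  Function.iterate_succ_apply' _ _ _

theorem contDiffOn_boxRic (hg : IsPseudoRiemannian g) (he : e ∈ charts n M) (k : ℕ) (i j : Fin n) :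
    ContDiffOn ℝ ∞ (fun y => boxRic (comp e g) k y i j) e.target := by
  have h := contDiffOn_ric_box (U := ⟨e.target, e.open_target⟩) (H := comp e g)
    (hg.smooth e he) (fun y hy => isUnit_metric hg he hy)
  induction k generalizing i j with
  | zero => exact h.1 i j
  | succ k ih => rw [boxRic_succ]; exact h.2 _ ih i j

theorem boxRic_transition (hg : IsPseudoRiemannian g) (he : e ∈ charts n M) (he' : e' ∈ charts n M)
    (k : ℕ) : ∀ y ∈ overlap e e', boxRic (comp e g) k y = (jac (transition e e') y)ᵀ *
      boxRic (comp e' g) k (transition e e' y) * jac (transition e e') y := by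
  have h := repM_ric_box_transform (U := overlap e e') (U' := ⟨e'.target, e'.open_target⟩)
    (G := comp e g) (H := comp e' g) (contDiffOn_transition he he')
    (fun y hy => (transition_mem hy).1) (fun y hy => isUnit_jac he he' hy) (hg.smooth e' he')
    (fun y _ => comp_transpose hg.symm e' y) (fun y hy => isUnit_metric hg he' hy)
    (fun y hy => comp_transition he he' g hy)
  induction k with
  | zero => exact h.1
  | succ k ih =>
    simp only [boxRic_succ]
    exact h.2 _ _ (contDiffOn_boxRic hg he' k) ih

theorem exists_boxRic_field (hg : IsPseudoRiemannian g) (k : ℕ) : ∃ b : BilinField n M,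
    ∀ e ∈ charts n M, ∀ y ∈ e.target, comp e b y = boxRic (comp e g) k y :=
  exists_bilinField (fun e => boxRic (comp e g) k) fun e he e' he' =>
    boxRic_transition hg he he' k

/-- Induction on `k`: the Ricci tensor is adapted, and the Laplacian preserves adapted tensors. -/
theorem isFrameField_boxRic {k : ℕ}
    (hb : ∀ e ∈ charts n M, ∀ y ∈ e.target, comp e b y = boxRic (comp e g) k y) :
    IsFrameField p g N b := by
  intro e he U hU m m' X L θ W
  have h : ∃ (s : Matrix (Fin n) (Fin n) (smoothRing U))
      (f : Matrix (Fin p) (Fin p) (smoothRing U)), RepM (boxRic (comp e g) k) s ∧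
      FrameTensor (pdR U) m X θ s f := by
    clear hb
    induction k with
    | zero =>
      obtain ⟨r, hr⟩ := W.ric
      exact ⟨_, r, repM_ric W.rep W.frame.inv, hr⟩
    | succ k ih =>
      obtain ⟨s, f, hs, hf⟩ := ih
      obtain ⟨f', hf'⟩ := W.box hf
      exact ⟨_, f', by rw [boxRic_succ]; exact repM_box W.rep W.frame.inv hs, hf'⟩
  obtain ⟨s, f, hs, hf⟩ := h
  exact ⟨s, f, fun i j => (hs i j).congr fun y hy => by rw [hb e he y (hU y hy)], hf⟩

end WalkerCharts

/-! ### Smooth functions on the ambient space -/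

section AmbientRing

open TopologicalSpace (Opens)

variable {n : ℕ}

/-- The component `x` of the point `(t, x, ρ)`. -/
def ambX (z : EuclideanSpace ℝ (AmbIdx n)) : EuclideanSpace ℝ (Fin n) :=
  WithLp.toLp 2 fun k => z (Sum.inr (Sum.inl k))

theorem contDiff_coord (a : AmbIdx n) :
    ContDiff ℝ ∞ (fun z : EuclideanSpace ℝ (AmbIdx n) => z a) :=
  (EuclideanSpace.proj (𝕜 := ℝ) a : EuclideanSpace ℝ (AmbIdx n) →L[ℝ] ℝ).contDiff

theorem contDiff_ambX : ContDiff ℝ ∞ (ambX (n := n)) :=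
  PiLp.contDiff_toLp.comp (contDiff_pi.mpr fun k => contDiff_coord _)

/-- The open set of the points `(t, x, ρ)` with `t > 0`, `x ∈ U` and `|ρ| < ε`. -/
def ambOpen (U : Opens (EuclideanSpace ℝ (Fin n))) (ε : ℝ) :
    Opens (EuclideanSpace ℝ (AmbIdx n)) :=
  ⟨{z | 0 < z (Sum.inl 0) ∧ ambX z ∈ U ∧ z (Sum.inr (Sum.inr 0)) ∈ Set.Ioo (-ε) ε},
    (isOpen_lt continuous_const (contDiff_coord _).continuous).inter
      ((U.isOpen.preimage contDiff_ambX.continuous).inter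
        (isOpen_Ioo.preimage (contDiff_coord _).continuous))⟩

theorem ambPoint_mem {U : Opens (EuclideanSpace ℝ (Fin n))} {ε t ρ : ℝ}
    {y : EuclideanSpace ℝ (Fin n)} (ht : 0 < t) (hy : y ∈ U) (hρ : ρ ∈ Set.Ioo (-ε) ε) :
    ambPoint t y ρ ∈ ambOpen U ε := ⟨ht, hy, hρ⟩

theorem ambPoint_ambX (z : EuclideanSpace ℝ (AmbIdx n)) :
    ambPoint (z (Sum.inl 0)) (ambX z) (z (Sum.inr (Sum.inr 0))) = z := by
  ext a
  rcases a with a | a | a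
  · rw [Subsingleton.elim a 0]; rfl
  · rfl
  · rw [Subsingleton.elim a 0]; rfl

theorem pd_coord {ι : Type*} [Fintype ι] [DecidableEq ι] (a b : ι) (z : EuclideanSpace ℝ ι) :
    pd a (fun z => z b) z = if b = a then 1 else 0 := by
  have : (fun z : EuclideanSpace ℝ ι => z b) =
      (EuclideanSpace.proj (𝕜 := ℝ) b : EuclideanSpace ℝ ι →L[ℝ] ℝ) := rfl
  rw [pd, this, ContinuousLinearMap.fderiv]
  simp [Pi.single_apply]

variable {U : Opens (EuclideanSpace ℝ (Fin n))} {ε : ℝ}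

/-- A function of `x`, considered as a function of `(t, x, ρ)`. -/
def fromBase (U : Opens (EuclideanSpace ℝ (Fin n))) (ε : ℝ) :
    smoothRing U →ₐ[ℝ] smoothRing (ambOpen U ε) :=
  comapHom ambX contDiff_ambX.contDiffOn fun _ hz => hz.2.1

theorem jacobian_apply_evalAt {ι ι' : Type*} [Fintype ι] [DecidableEq ι] [Fintype ι']
    [DecidableEq ι'] {U : Opens (EuclideanSpace ℝ ι)}
    {φ : EuclideanSpace ℝ ι → EuclideanSpace ℝ ι'} (hφ : ContDiffOn ℝ ∞ φ U) (k : ι') (a : ι)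
    (y : U) : evalAt y (jacobian φ hφ k a) = pd a (fun y => φ y k) y :=
  ((rep_ofFun _ (contDiffOn_coord hφ k)).pd a).evalAt y

theorem jacobian_fromBase (k : Fin n) (a : AmbIdx n) :
    jacobian (U := ambOpen U ε) ambX contDiff_ambX.contDiffOn k a =
      if Sum.inr (Sum.inl k) = a then 1 else 0 := by
  refine ext_evalAt fun z => ?_
  rw [jacobian_apply_evalAt]
  change pd a (fun z => z (Sum.inr (Sum.inl k))) _ = _
  rw [pd_coord]
  split_ifs <;> simp

theorem dx_fromBase (i : Fin n) (f : smoothRing U) :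
    pdR (ambOpen U ε) (Sum.inr (Sum.inl i)) (fromBase U ε f) = fromBase U ε (pdR U i f) := by
  rw [fromBase, pdR_comapHom]
  simp [jacobian_fromBase]

theorem dt_fromBase (f : smoothRing U) :
    pdR (ambOpen U ε) (Sum.inl 0) (fromBase U ε f) = 0 := by
  rw [fromBase, pdR_comapHom]
  simp [jacobian_fromBase]

theorem dr_fromBase (f : smoothRing U) :
    pdR (ambOpen U ε) (Sum.inr (Sum.inr 0)) (fromBase U ε f) = 0 := by
  rw [fromBase, pdR_comapHom]
  simp [jacobian_fromBase]

theorem ambPoint_eq (t : ℝ) (y : EuclideanSpace ℝ (Fin n)) (ρ : ℝ) :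
    ambPoint t y ρ = ambPoint t y 0 + ρ • EuclideanSpace.single (Sum.inr (Sum.inr 0)) 1 := by
  ext a
  rcases a with a | a | a
  · simp [ambPoint]
  · simp [ambPoint]
  · rw [Subsingleton.elim a 0]; simp [ambPoint]

theorem contDiff_ambPoint (t ρ : ℝ) :
    ContDiff ℝ ∞ (fun y : EuclideanSpace ℝ (Fin n) => ambPoint t y ρ) := by
  refine PiLp.contDiff_toLp.comp (contDiff_pi.mpr fun a => ?_)
  rcases a with a | a | a
  · exact contDiff_const
  · exact (EuclideanSpace.proj (𝕜 := ℝ) a : EuclideanSpace ℝ (Fin n) →L[ℝ] ℝ).contDiff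
  · exact contDiff_const

/-- The restriction to the slice with given `t` and `ρ`. -/
def slice (U : Opens (EuclideanSpace ℝ (Fin n))) (ε : ℝ) {t ρ : ℝ} (ht : 0 < t)
    (hρ : ρ ∈ Set.Ioo (-ε) ε) : smoothRing (ambOpen U ε) →ₐ[ℝ] smoothRing U :=
  comapHom (fun y => ambPoint t y ρ) (contDiff_ambPoint t ρ).contDiffOn
    fun _ hy => ambPoint_mem ht hy hρ

variable {t ρ : ℝ} (ht : 0 < t) (hρ : ρ ∈ Set.Ioo (-ε) ε)

theorem evalAt_slice (y : U) (f : smoothRing (ambOpen U ε)) :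
    evalAt y (slice U ε ht hρ f) = evalAt ⟨ambPoint t y ρ, ambPoint_mem ht y.2 hρ⟩ f := rfl

theorem slice_fromBase (f : smoothRing U) : slice U ε ht hρ (fromBase U ε f) = f := rfl

/-- Identities on the ambient space without t- or ρ-derivatives are checked on the slices of
constant t and ρ, where the hypotheses on `h ρ` are available. -/
theorem ext_slice {f f' : smoothRing (ambOpen U ε)}
    (h : ∀ (t ρ : ℝ) (ht : 0 < t) (hρ : ρ ∈ Set.Ioo (-ε) ε),
      slice U ε ht hρ f = slice U ε ht hρ f') : f = f' := by
  refine ext_evalAt fun z => ?_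
  have h1 := congrArg (evalAt ⟨ambX z, z.2.2.1⟩) (h _ _ z.2.1 z.2.2.2)
  rw [evalAt_slice, evalAt_slice] at h1
  simp only [ambPoint_ambX] at h1
  exact h1

theorem matrix_ext_slice {μ ν : Type*} {f f' : Matrix μ ν (smoothRing (ambOpen U ε))}
    (h : ∀ (t ρ : ℝ) (ht : 0 < t) (hρ : ρ ∈ Set.Ioo (-ε) ε),
      f.map (slice U ε ht hρ) = f'.map (slice U ε ht hρ)) : f = f' :=
  Matrix.ext fun a b => ext_slice fun t ρ ht hρ => congrFun (congrFun (h t ρ ht hρ) a) b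

theorem pdR_slice (i : Fin n) (f : smoothRing (ambOpen U ε)) :
    pdR U i (slice U ε ht hρ f) =
      slice U ε ht hρ (pdR (ambOpen U ε) (Sum.inr (Sum.inl i)) f) := by
  rw [slice, pdR_comapHom]
  have h : ∀ a, jacobian (U := U) (fun y : EuclideanSpace ℝ (Fin n) => ambPoint t y ρ)
      (contDiff_ambPoint t ρ).contDiffOn a i =
      if a = Sum.inr (Sum.inl i) then 1 else 0 := by
    intro a
    refine ext_evalAt fun z => ?_
    rw [jacobian_apply_evalAt]
    rcases a with a | a | a
    · change pd i (fun _ => t) _ = _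
      simp [pd]
    · change pd i (fun z => z a) _ = _
      rw [pd_coord]
      by_cases h : a = i <;> simp [h]
    · change pd i (fun _ => ρ) _ = _
      simp [pd]
  simp only [h, ite_mul, one_mul, zero_mul, Finset.sum_ite_eq', Finset.mem_univ, if_true]

/-- Only the derivations in the x directions take part, so restriction to a slice is formally a
change of coordinates with identity Jacobian. Naturality then shows that the Laplacian commutes with
it. -/
theorem coordChange_slice : CoordChange (fun i => pdR (ambOpen U ε) (Sum.inr (Sum.inl i)))
    (pdR U) (slice U ε ht hρ : smoothRing (ambOpen U ε) →+* smoothRing U) 1 1 where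
  comm := pdR_comm
  chain a f := by
    simp only [Matrix.one_apply, ite_mul, one_mul, zero_mul, Finset.sum_ite_eq', Finset.mem_univ,
      if_true]
    exact pdR_slice ht hρ a f
  closed a b k := by
    simp only [Matrix.one_apply]
    split_ifs <;> simp
  inv := Matrix.one_mul 1

theorem pull_one {ι R R' : Type*} [Fintype ι] [DecidableEq ι] [CommRing R] [CommRing R']
    [Algebra ℝ R] [Algebra ℝ R'] (ψ : R →+* R') (S : Matrix ι ι R) : pull ψ 1 S = S.map ψ := by
  rw [pull, Matrix.transpose_one, Matrix.one_mul, Matrix.mul_one]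

theorem pullConn_one {ι R R' : Type*} [Fintype ι] [DecidableEq ι] [CommRing R] [CommRing R']
    [Algebra ℝ R] [Algebra ℝ R'] (δ : ι → Derivation ℝ R' R') (ψ : R →+* R')
    (A : ι → Matrix ι ι R) : pullConn δ ψ 1 1 A = fun a => (A a).map ψ := by
  funext a
  rw [pullConn, map_one_derivation, Matrix.one_mul, Matrix.mul_one, add_zero]
  simp [Matrix.one_apply]

theorem hasDerivAt_line {t ρ : ℝ} (ht : 0 < t) (hρ : ρ ∈ Set.Ioo (-ε) ε)
    {F : EuclideanSpace ℝ (AmbIdx n) → ℝ} {f : smoothRing (ambOpen U ε)}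
    (hF : Rep F f) {y : EuclideanSpace ℝ (Fin n)} (hy : y ∈ U) :
    HasDerivAt (fun r => F (ambPoint t y r)) (pd (Sum.inr (Sum.inr 0)) F (ambPoint t y ρ)) ρ := by
  have h1 : HasDerivAt (fun r : ℝ => ambPoint t y r)
      (EuclideanSpace.single (Sum.inr (Sum.inr 0)) 1) ρ := by
    have e : (fun r : ℝ => ambPoint t y r) = fun r => ambPoint t y 0 +
        r • EuclideanSpace.single (Sum.inr (Sum.inr 0)) 1 := funext fun r => ambPoint_eq t y r
    rw [e]
    simpa using ((hasDerivAt_id ρ).smul_const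
      (EuclideanSpace.single (Sum.inr (Sum.inr 0)) (1 : ℝ))).const_add (ambPoint t y 0)
  exact (hF.differentiableAt (ambPoint_mem ht hy hρ)).hasFDerivAt.comp_hasDerivAt ρ h1

/-- Derivatives with respect to `ρ` along lines. -/
theorem iteratedDeriv_line {F : EuclideanSpace ℝ (AmbIdx n) → ℝ} {f : smoothRing (ambOpen U ε)}
    (hF : Rep F f) {y : EuclideanSpace ℝ (Fin n)} (hy : y ∈ U) (k : ℕ) :
    iteratedDeriv k (fun r => F (ambPoint t y r)) ρ =
      evalAt ⟨ambPoint t y ρ, ambPoint_mem ht hy hρ⟩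
        ((pdR (ambOpen U ε) (Sum.inr (Sum.inr 0)))^[k] f) := by
  induction k generalizing ρ with
  | zero => rw [iteratedDeriv_zero, Function.iterate_zero_apply, hF.evalAt]
  | succ k ih =>
    set f' := (pdR (ambOpen U ε) (Sum.inr (Sum.inr 0)))^[k] f with hf'
    have h1 : iteratedDeriv k (fun r => F (ambPoint t y r)) =ᶠ[nhds ρ]
        fun r => lift f' (ambPoint t y r) := by
      refine Filter.eventuallyEq_of_mem (isOpen_Ioo.mem_nhds hρ) fun r hr => ?_
      rw [ih hr, (rep_lift f').evalAt]
    rw [iteratedDeriv_succ, h1.deriv_eq, (hasDerivAt_line ht hρ (rep_lift f') hy).deriv,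
      Function.iterate_succ_apply', ← ((rep_lift f').pd _).evalAt ⟨_, ambPoint_mem ht hy hρ⟩]

theorem dt_eq_zero {F : EuclideanSpace ℝ (AmbIdx n) → ℝ} {f : smoothRing (ambOpen U ε)}
    (hF : Rep F f) (h : ∀ t t' y ρ, F (ambPoint t y ρ) = F (ambPoint t' y ρ)) :
    pdR (ambOpen U ε) (Sum.inl 0) f = 0 := by
  refine ext_evalAt fun z => ?_
  rw [(hF.pd _).evalAt, map_zero]
  have h1 : HasDerivAt (fun r : ℝ => (z : EuclideanSpace ℝ (AmbIdx n)) +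
      r • EuclideanSpace.single (Sum.inl 0) 1) (EuclideanSpace.single (Sum.inl 0) 1) 0 := by
    simpa using ((hasDerivAt_id (0 : ℝ)).smul_const
      (EuclideanSpace.single (Sum.inl 0) (1 : ℝ))).const_add (z : EuclideanSpace ℝ (AmbIdx n))
  have h2 : HasFDerivAt F (fderiv ℝ F z) ((z : EuclideanSpace ℝ (AmbIdx n)) +
      (0 : ℝ) • EuclideanSpace.single (Sum.inl 0) 1) := by
    rw [zero_smul, add_zero]; exact (hF.differentiableAt z.2).hasFDerivAt
  have h3 := h2.comp_hasDerivAt (0 : ℝ) h1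
  have h4 : (F ∘ fun r : ℝ => (z : EuclideanSpace ℝ (AmbIdx n)) +
      r • EuclideanSpace.single (Sum.inl 0) 1) = fun _ => F z := by
    funext r
    rw [Function.comp_apply, ← ambPoint_ambX (z : EuclideanSpace ℝ (AmbIdx n)),
      ← ambPoint_ambX (_ + _), h _ ((z : EuclideanSpace ℝ (AmbIdx n)) (Sum.inl 0))]
    congr 1
    ext a
    rcases a with a | a | a
    · simp [ambPoint]
    · simp [ambPoint, ambX]
    · simp [ambPoint]
  rw [h4] at h3
  exact h3.unique (hasDerivAt_const _ _)

/-- The coordinate function `t` of the ambient space. -/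
def tFun (U : Opens (EuclideanSpace ℝ (Fin n))) (ε : ℝ) : smoothRing (ambOpen U ε) :=
  ofFun (fun z => z (Sum.inl 0)) (contDiff_coord _).contDiffOn

/-- The inverse of the coordinate function `t`. -/
def tInv (U : Opens (EuclideanSpace ℝ (Fin n))) (ε : ℝ) : smoothRing (ambOpen U ε) :=
  ofFun (fun z => (z (Sum.inl 0))⁻¹) ((contDiff_coord _).contDiffOn.inv fun _ hz => hz.1.ne')

/-- The coordinate function `ρ`. -/
def rFun (U : Opens (EuclideanSpace ℝ (Fin n))) (ε : ℝ) : smoothRing (ambOpen U ε) :=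
  ofFun (fun z => z (Sum.inr (Sum.inr 0))) (contDiff_coord _).contDiffOn

theorem ambientCoords (U : Opens (EuclideanSpace ℝ (Fin n))) (ε : ℝ) :
    AmbientCoords (pdR (ambOpen U ε)) (tFun U ε) (tInv U ε) (rFun U ε) := by
  have h : ∀ (a b : AmbIdx n), pdR (ambOpen U ε) a
      (ofFun (fun z => z b) (contDiff_coord _).contDiffOn) = if b = a then 1 else 0 := by
    intro a b
    refine ext_evalAt fun z => ?_
    rw [((rep_ofFun _ _).pd a).evalAt, pd_coord]
    split_ifs <;> simp
  refine ⟨pdR_comm, ?_, ?_, fun i => ?_, ?_, ?_, fun i => ?_, ?_⟩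
  · refine ext_evalAt fun z => ?_
    rw [map_mul, tFun, tInv, (rep_ofFun _ _).evalAt, (rep_ofFun _ _).evalAt, map_one]
    exact mul_inv_cancel₀ z.2.1.ne'
  all_goals simp [tFun, rFun, h]

end AmbientRing

/-! ### Ricci tensors of ambient metrics of adapted families -/

section AmbientRicci

open TopologicalSpace (Opens)

/-! ### Frames and curvature under homomorphisms of rings with derivations -/

section Map

variable {ι κ R R' : Type*} [Fintype ι] [DecidableEq ι] [Fintype κ] [DecidableEq κ]
  [CommRing R] [Algebra ℝ R] [CommRing R'] [Algebra ℝ R'] {d : ι → Derivation ℝ R R}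
  {d' : ι → Derivation ℝ R' R'} (σ : R →ₐ[ℝ] R') {A : ι → Matrix ι ι R} {G G' S : Matrix ι ι R}
  {X : Matrix ι κ R} {L : Matrix κ ι R} {θ : ι → Matrix κ κ R} {f : Matrix κ κ R}

theorem map_map_derivation {μ ν : Type*} (hσ : ∀ i f, d' i (σ f) = σ (d i f)) (M : Matrix μ ν R)
    (i : ι) : (M.map σ).map (d' i) = (M.map (d i)).map σ := by
  ext; simp [hσ]

theorem curv_map (hσ : ∀ i f, d' i (σ f) = σ (d i f)) (θ : ι → Matrix κ κ R) (i j : ι) :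
    curv d' (fun i => (θ i).map σ) i j = (curv d θ i j).map σ := by
  simp only [curv, map_map_derivation σ hσ]
  rw [Matrix.map_sub _ (map_sub σ), Matrix.map_add _ (map_add σ), Matrix.map_sub _ (map_sub σ),
    Matrix.map_mul, Matrix.map_mul]

theorem ricMat_map (hσ : ∀ i f, d' i (σ f) = σ (d i f)) (A : ι → Matrix ι ι R) :
    ricMat d' (fun i => (A i).map σ) = (ricMat d A).map σ := by
  ext i j
  simp only [ricMat, Matrix.of_apply, Matrix.map_apply, map_sum, curv_map σ hσ]

theorem NullFrame.map (H : NullFrame d A G G' X L θ) (hσ : ∀ i f, d' i (σ f) = σ (d i f))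
    (hd : ∀ i j f, d' i (d' j f) = d' j (d' i f)) :
    NullFrame d' (fun i => (A i).map σ) (G.map σ) (G'.map σ) (X.map σ) (L.map σ)
      (fun i => (θ i).map σ) where
  comm := hd
  symm := by rw [← Matrix.transpose_map, H.symm]
  inv := by rw [← Matrix.map_mul, H.inv, Matrix.map_one _ (map_zero σ) (map_one σ)]
  torsion i j k := congrArg σ (H.torsion i j k)
  compat k := by
    rw [map_map_derivation σ hσ, H.compat k, Matrix.map_add _ (map_add σ), Matrix.map_mul,
      Matrix.map_mul, Matrix.transpose_map]
  null := by
    rw [← Matrix.transpose_map, ← Matrix.map_mul, ← Matrix.map_mul, H.null]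
    ext; simp
  left := by rw [← Matrix.map_mul, H.left, Matrix.map_one _ (map_zero σ) (map_one σ)]
  par i := by
    rw [map_map_derivation σ hσ, ← Matrix.map_mul, ← Matrix.map_mul, ← H.par i,
      Matrix.map_add _ (map_add σ)]

theorem NullFrame.frame_eq (H : NullFrame d A G G' X L θ) (hS : S = G * X * f * (G * X)ᵀ) :
    f = L * G' * S * (L * G')ᵀ := by
  have h1 := H.left_lower
  have h2 : (G * X)ᵀ * (L * G')ᵀ = 1 := by
    rw [← Matrix.transpose_mul, h1, Matrix.transpose_one]
  calc f = (L * G' * (G * X)) * f * ((G * X)ᵀ * (L * G')ᵀ) := by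
        rw [h1, h2, Matrix.one_mul, Matrix.mul_one]
    _ = _ := by rw [hS]; simp only [Matrix.mul_assoc]

theorem frameConn_map (hσ : ∀ i f, d' i (σ f) = σ (d i f)) (i : ι) (f : Matrix κ κ R) :
    frameConn d' (fun i => (θ i).map σ) i (f.map σ) = (frameConn d θ i f).map σ := by
  rw [frameConn_apply, frameConn_apply, map_map_derivation σ hσ, Matrix.map_add _ (map_add σ),
    Matrix.map_add _ (map_add σ), Matrix.map_mul, Matrix.map_mul, Matrix.transpose_map]

end Map

variable {n p : ℕ} {U : Opens (EuclideanSpace ℝ (Fin n))} {ε : ℝ}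
  {G : EuclideanSpace ℝ (Fin n) → Matrix (Fin n) (Fin n) ℝ}
  {h : ℝ → EuclideanSpace ℝ (Fin n) → Matrix (Fin n) (Fin n) ℝ}
  {D : EuclideanSpace ℝ (Fin n) → Submodule ℝ (EuclideanSpace ℝ (Fin n))}
  {m m' : Matrix (Fin n) (Fin n) (smoothRing U)} {X : Matrix (Fin n) (Fin p) (smoothRing U)}
  {L : Matrix (Fin p) (Fin n) (smoothRing U)} {θ : Fin n → Matrix (Fin p) (Fin p) (smoothRing U)}
  {s : Matrix (Fin n) (Fin n) (smoothRing (ambOpen U ε))}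

theorem exists_repM_family
    (hs : ∀ i j, ContDiffOn ℝ ∞ (fun q : ℝ × EuclideanSpace ℝ (Fin n) => h q.1 q.2 i j)
      (Set.Ioo (-ε) ε ×ˢ (U : Set (EuclideanSpace ℝ (Fin n))))) :
    ∃ s : Matrix (Fin n) (Fin n) (smoothRing (ambOpen U ε)),
      RepM (fun z => h (z (Sum.inr (Sum.inr 0))) (ambX z)) s :=
  exists_repM fun i j => (hs i j).comp
    ((contDiff_coord _).prodMk contDiff_ambX).contDiffOn fun _ hz => ⟨hz.2.2, hz.2.1⟩

theorem family_dt (hs : RepM (fun z => h (z (Sum.inr (Sum.inr 0))) (ambX z)) s) :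
    s.map (pdR (ambOpen U ε) (Sum.inl 0)) = 0 :=
  Matrix.ext fun i j => dt_eq_zero (hs i j) fun _ _ _ _ => rfl

theorem repM_slice (hs : RepM (fun z => h (z (Sum.inr (Sum.inr 0))) (ambX z)) s) {t ρ : ℝ}
    (ht : 0 < t) (hρ : ρ ∈ Set.Ioo (-ε) ε) : RepM (h ρ) (s.map (slice U ε ht hρ)) := fun i j y =>
  hs i j ⟨ambPoint t y ρ, ambPoint_mem ht y.2 hρ⟩

theorem repM_ambMetric (hm : RepM G m)
    (hs : RepM (fun z => h (z (Sum.inr (Sum.inr 0))) (ambX z)) s) :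
    RepM (ambMetric fun r z => G z + h r z)
      (ambMat (tFun U ε) (rFun U ε) (m.map (fromBase U ε) + s)) := by
  intro a b z
  have hz : G (ambX z) = m.map (evalAt ⟨ambX z, z.2.2.1⟩) := (hm.map_evalAt ⟨ambX z, z.2.2.1⟩).symm
  have hs' := hs.map_evalAt z
  rcases a with a | a | a <;> rcases b with b | b | b <;> try rfl
  change (z : EuclideanSpace ℝ (AmbIdx n)) (Sum.inl 0) ^ 2 *
    (G (ambX z) a b + h _ (ambX z) a b) = _
  rw [hz]
  dsimp only at hs'
  rw [← hs']
  rfl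

theorem ric_ambMetric (hm : RepM G m)
    (hs : RepM (fun z => h (z (Sum.inr (Sum.inr 0))) (ambX z)) s)
    {S' : Matrix (Fin n) (Fin n) (smoothRing (ambOpen U ε))}
    (hS' : (m.map (fromBase U ε) + s) * S' = 1) (a b : AmbIdx n) :
    Rep (fun z => ric (ambMetric fun r z => G z + h r z) z a b)
      (ricMat (pdR (ambOpen U ε)) (conn (pdR (ambOpen U ε))
        (ambMat (tFun U ε) (rFun U ε) (m.map (fromBase U ε) + s))
        (ambInv (tInv U ε) (rFun U ε) S')) a b) :=
  repM_ric (repM_ambMetric hm hs) (ambMat_mul_ambInv (ambientCoords U ε).inv hS') a b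

/-- The coefficient matrix is given separately for every ρ. It is determined by the tensor
(`NullFrame.frame_eq`), hence smooth in all variables together, and its properties can be verified
slice by slice. -/
theorem exists_adaptedAmbient (W : WalkerData U G D m m' X L θ)
    (hs : RepM (fun z => h (z (Sum.inr (Sum.inr 0))) (ambX z)) s)
    (hF : ∀ (t ρ : ℝ) (ht : 0 < t) (hρ : ρ ∈ Set.Ioo (-ε) ε), ∃ f,
      FrameTensor (pdR U) m X θ (s.map (slice U ε ht hρ)) f) :
    ∃ f, AdaptedAmbient (pdR (ambOpen U ε)) (tFun U ε) (tInv U ε) (rFun U ε)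
      (fun i => (conn (pdR U) m m' i).map (fromBase U ε)) (m.map (fromBase U ε))
      (m'.map (fromBase U ε)) (X.map (fromBase U ε)) (L.map (fromBase U ε))
      (fun i => (θ i).map (fromBase U ε)) s f := by
  have hN := W.frame.map (fromBase U ε)
    (d' := fun i => pdR (ambOpen U ε) (Sum.inr (Sum.inl i))) dx_fromBase fun _ _ _ => pdR_comm _ _ _
  have hsl : ∀ {t ρ : ℝ} (ht : 0 < t) (hρ : ρ ∈ Set.Ioo (-ε) ε) {μ ν : Type}
      (M : Matrix μ ν (smoothRing U)), (M.map (fromBase U ε)).map (slice U ε ht hρ) = M := by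
    intros; rfl
  set f := (L.map (fromBase U ε) * m'.map (fromBase U ε)) * s *
    (L.map (fromBase U ε) * m'.map (fromBase U ε))ᵀ with hf
  have hfs : ∀ (t ρ : ℝ) (ht : 0 < t) (hρ : ρ ∈ Set.Ioo (-ε) ε),
      FrameTensor (pdR U) m X θ (s.map (slice U ε ht hρ)) (f.map (slice U ε ht hρ)) := by
    intro t ρ ht hρ
    obtain ⟨f', hf'⟩ := hF t ρ ht hρ
    have h1 : f.map (slice U ε ht hρ) = f' := by
      rw [W.frame.frame_eq hf'.eq, hf]
      simp only [Matrix.map_mul, Matrix.transpose_map, hsl]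
    rwa [h1]
  have hzero : ∀ {μ ν : Type} (δ : AmbIdx n) (M : Matrix μ ν (smoothRing U)),
      (∀ f, pdR (ambOpen U ε) δ (fromBase U ε f) = 0) →
      (M.map (fromBase U ε)).map (pdR (ambOpen U ε) δ) = 0 := by
    intro μ ν δ M h
    ext1 a b
    exact h _
  refine ⟨f, ambientCoords U ε, hN, fun a k => ?_, ?_, hzero _ _ dt_fromBase,
    hzero _ _ dr_fromBase, hzero _ _ dr_fromBase, fun i => hzero _ _ dr_fromBase,
    fun i => hzero _ _ dt_fromBase, family_dt hs⟩
  · have h1 := congrArg (fun N : Matrix (Fin p) (Fin p) (smoothRing U) =>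
      N.map (fromBase U ε)) (W.flat a k)
    simp only [curv_map (fromBase U ε)
      (d' := fun i => pdR (ambOpen U ε) (Sum.inr (Sum.inl i))) dx_fromBase]
    ext b c
    have h2 := congrFun (congrFun h1 b) c
    simp only [Matrix.map_apply, Matrix.sum_apply, Matrix.smul_apply, smul_eq_mul, map_sum,
      map_mul, Matrix.zero_apply, map_zero] at h2 ⊢
    rw [h2]
  · refine ⟨?_, ?_, fun a => ?_⟩
    · refine matrix_ext_slice fun t ρ ht hρ => ?_
      simp only [Matrix.map_mul, Matrix.transpose_map, hsl]
      exact (hfs t ρ ht hρ).eq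
    · refine matrix_ext_slice fun t ρ ht hρ => ?_
      rw [Matrix.transpose_map]
      exact (hfs t ρ ht hρ).symm
    · refine matrix_ext_slice fun t ρ ht hρ => ?_
      have h1 : ∀ k, (frameConn (fun i => pdR (ambOpen U ε) (Sum.inr (Sum.inl i)))
          (fun i => (θ i).map (fromBase U ε)) k f).map (slice U ε ht hρ) =
          frameConn (pdR U) θ k (f.map (slice U ε ht hρ)) := by
        intro k
        rw [← frameConn_map (slice U ε ht hρ)
          (d := fun i => pdR (ambOpen U ε) (Sum.inr (Sum.inl i))) (pdR_slice ht hρ)]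
        rfl
      have h2 := (hfs t ρ ht hρ).par a
      simp only [← h1] at h2
      ext b c
      have h3 := congrFun (congrFun h2 b) c
      simp only [Matrix.map_apply, Matrix.sum_apply, Matrix.smul_apply, smul_eq_mul, map_sum,
        map_mul, Matrix.zero_apply, map_zero] at h3 ⊢
      rw [← h3]
      rfl

theorem boxMat_slice {t ρ : ℝ} (ht : 0 < t) (hρ : ρ ∈ Set.Ioo (-ε) ε)
    (A : Fin n → Matrix (Fin n) (Fin n) (smoothRing U)) :
    (boxMat (fun i => pdR (ambOpen U ε) (Sum.inr (Sum.inl i)))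
      (fun i => (A i).map (fromBase U ε)) (m'.map (fromBase U ε)) s).map (slice U ε ht hρ) =
      boxMat (pdR U) A m' (s.map (slice U ε ht hρ)) := by
  have h1 := (coordChange_slice (U := U) ht hρ).boxMat_pull
    (A := fun i => (A i).map (fromBase U ε)) (G' := m'.map (fromBase U ε)) s
  rw [pullConn_one, pull_one, pull_one, Matrix.one_mul, Matrix.transpose_one,
    Matrix.mul_one] at h1
  exact h1.symm

end AmbientRicci

/-! ### The Fefferman-Graham equations for adapted families -/

section AdaptedEquations

open TopologicalSpace (Opens)

theorem NullFrame.sum_inv_mul_frame {ι κ R : Type*} [Fintype ι] [DecidableEq ι] [Fintype κ]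
    [DecidableEq κ] [CommRing R] [Algebra ℝ R] {d : ι → Derivation ℝ R R} {A : ι → Matrix ι ι R}
    {G G' : Matrix ι ι R} {X : Matrix ι κ R} {L : Matrix κ ι R} {θ : ι → Matrix κ κ R}
    (H : NullFrame d A G G' X L θ) {S : Matrix ι ι R} {f : Matrix κ κ R}
    (hS : S = G * X * f * (G * X)ᵀ) : ∑ i, ∑ j, G' i j * S i j = 0 := by
  have h1 : (G' * Sᵀ).trace = 0 := by
    have : Sᵀ = G * X * fᵀ * (G * X)ᵀ := by
      rw [hS]; simp only [Matrix.transpose_mul, Matrix.transpose_transpose, Matrix.mul_assoc]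
    rw [this, H.trace_frame]
  rw [← h1]
  simp only [Matrix.trace, Matrix.diag_apply, Matrix.mul_apply, Matrix.transpose_apply]

theorem iterate_derivation_sum {ι R : Type*} [Fintype ι] [CommRing R] [Algebra ℝ R]
    {δ : Derivation ℝ R R} {c u : Matrix ι ι R} (hc : ∀ i j, δ (c i j) = 0) (k : ℕ) :
    δ^[k] (∑ i, ∑ j, c i j * u i j) = ∑ i, ∑ j, c i j * δ^[k] (u i j) := by
  induction k with
  | zero => rfl
  | succ k ih =>
    simp only [Function.iterate_succ_apply', ih, map_sum, Derivation.leibniz, smul_eq_mul, hc,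
      mul_zero, add_zero]

theorem iterate_derivation_zero {R : Type*} [CommRing R] [Algebra ℝ R]
    {δ : Derivation ℝ R R} (k : ℕ) : δ^[k] 0 = 0 := by
  induction k with
  | zero => rfl
  | succ k ih => rw [Function.iterate_succ_apply', ih, map_zero]

universe u

variable {n p : ℕ} {M : Type u} [TopologicalSpace M] [ChartedSpace (EuclideanSpace ℝ (Fin n)) M]
  [IsManifold (𝓡 n) ∞ M] {e : OpenPartialHomeomorph M (EuclideanSpace ℝ (Fin n))}
  {g : BilinField n M} {N : SubspaceField n M} {ε : ℝ} {h : ℝ → BilinField n M}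

/-- The algebraic formulas for the ambient Ricci tensor, read at a point. The last clause makes the
trace condition of ambient metrics automatic for adapted families. -/
theorem ambRic_of_adapted (hn : 3 ≤ n) (H : IsNullRicciWalker p g N)
    (hp : p = 1 ∨ CurvatureAnnihilated g N) (hper : IsPerturbation ε h)
    (hF : ∀ ρ ∈ Set.Ioo (-ε) ε, IsFrameField p g N (h ρ)) (he : e ∈ charts n M)
    {y : EuclideanSpace ℝ (Fin n)} (hy : y ∈ e.target) :
    (∀ t > 0, ∀ ρ ∈ Set.Ioo (-ε) ε, ∀ i j,
      ambRic g h e t y ρ (Sum.inr (Sum.inl i)) (Sum.inr (Sum.inl j)) =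
        1 / 2 * (opA (comp e g) (fun r => comp e (h r)) i j ρ y + 2 * ric (comp e g) y i j)) ∧
    (∀ t > 0, ∀ ρ ∈ Set.Ioo (-ε) ε, ∀ a b,
      (∀ i j, ¬(a = Sum.inr (Sum.inl i) ∧ b = Sum.inr (Sum.inl j))) →
        ambRic g h e t y ρ a b = 0) ∧
    (∀ ρ ∈ Set.Ioo (-ε) ε, IsUnit (comp e g y + comp e (h ρ) y).det) ∧
    ∀ t > 0, ∀ k, ∑ i, ∑ j, (comp e g y)⁻¹ i j * iteratedDeriv k
      (fun ρ => ambRic g h e t y ρ (Sum.inr (Sum.inl i)) (Sum.inr (Sum.inl j))) 0 = 0 := by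
  obtain ⟨U, hyU, hUt, m, m', X, L, θ, W⟩ := exists_walkerData hn H hp he hy
  obtain ⟨s, hs⟩ := exists_repM_family (U := U) (h := fun r => comp e (h r)) (ε := ε)
    fun i j => (hper.smooth e he i j).mono (Set.prod_mono le_rfl hUt)
  obtain ⟨f, AA⟩ := exists_adaptedAmbient (h := fun r => comp e (h r)) W hs fun t ρ ht hρ => by
    obtain ⟨s', f, hs', hf⟩ := hF ρ hρ e he U hUt m m' X L θ W
    rw [(repM_slice (h := fun r => comp e (h r)) hs ht hρ).unique hs']
    exact ⟨f, hf⟩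
  have hinv : (m.map (fromBase U ε) + s) * (m'.map (fromBase U ε) - X.map (fromBase U ε) * f *
      (X.map (fromBase U ε))ᵀ) = 1 := by
    rw [AA.tensor.eq]; exact AA.frame.perturbed_inv f
  have hric : ∀ t (ht : 0 < t) ρ (hρ : ρ ∈ Set.Ioo (-ε) ε) a b, ambRic g h e t y ρ a b =
      evalAt ⟨ambPoint t y ρ, ambPoint_mem ht hyU hρ⟩ (ricMat (pdR (ambOpen U ε))
        (conn (pdR (ambOpen U ε)) (ambMat (tFun U ε) (rFun U ε) (m.map (fromBase U ε) + s))
        (ambInv (tInv U ε) (rFun U ε) (m'.map (fromBase U ε) - X.map (fromBase U ε) * f *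
          (X.map (fromBase U ε))ᵀ))) a b) := fun t ht ρ hρ a b =>
    ((ric_ambMetric (h := fun r => comp e (h r)) W.rep hs hinv a b).evalAt ⟨ambPoint t y ρ, ambPoint_mem ht hyU hρ⟩).symm
  have hricx : ricMat (fun i => pdR (ambOpen U ε) (Sum.inr (Sum.inl i)))
      (fun i => (conn (pdR U) m m' i).map (fromBase U ε)) =
      (ricMat (pdR U) (conn (pdR U) m m')).map (fromBase U ε) :=
    ricMat_map (fromBase U ε) (d' := fun i => pdR (ambOpen U ε) (Sum.inr (Sum.inl i)))
      dx_fromBase _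
  refine ⟨fun t ht ρ hρ i j => ?_, fun t ht ρ hρ a b hab => ?_, fun ρ hρ => ?_,
    fun t ht k => ?_⟩
  · have hcv : curvTerm (comp e g) (comp e (h ρ)) i j y = 0 :=
      IsFrameField.curvTerm_eq_zero hn H hp (hF ρ hρ) he hy i j
    have h2 := iteratedDeriv_line ht hρ (hs i j) hyU 2
    have h1 := iteratedDeriv_line ht hρ (hs i j) hyU 1
    rw [iteratedDeriv_one] at h1
    have hb : evalAt ⟨ambPoint t y ρ, ambPoint_mem ht hyU hρ⟩
        (boxMat (fun i => pdR (ambOpen U ε) (Sum.inr (Sum.inl i)))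
          (fun i => (conn (pdR U) m m' i).map (fromBase U ε)) (m'.map (fromBase U ε)) s i j) =
        box (comp e g) (comp e (h ρ)) y i j := by
      rw [← evalAt_slice ht hρ ⟨y, hyU⟩]
      have h3 := congrFun (congrFun (boxMat_slice (s := s) (m' := m') ht hρ
        (conn (pdR U) m m')) i) j
      rw [Matrix.map_apply] at h3
      rw [h3]
      exact (repM_box W.rep W.frame.inv (repM_slice (h := fun r => comp e (h r)) hs ht hρ) i j).evalAt ⟨y, hyU⟩
    have hr : evalAt ⟨ambPoint t y ρ, ambPoint_mem ht hyU hρ⟩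
        (ricMat (fun i => pdR (ambOpen U ε) (Sum.inr (Sum.inl i)))
          (fun i => (conn (pdR U) m m' i).map (fromBase U ε)) i j) = ric (comp e g) y i j := by
      rw [hricx, ← evalAt_slice ht hρ ⟨y, hyU⟩, Matrix.map_apply, slice_fromBase]
      exact (repM_ric W.rep W.frame.inv i j).evalAt ⟨y, hyU⟩
    rw [hric t ht ρ hρ, AA.ric_xx, map_smul, map_add, map_sub, map_add, map_mul, map_mul, map_smul,
      map_mul, hb, hr, smul_eq_mul, smul_eq_mul]
    have h2' : evalAt ⟨ambPoint t y ρ, ambPoint_mem ht hyU hρ⟩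
        (pdR (ambOpen U ε) (Sum.inr (Sum.inr 0)) (pdR (ambOpen U ε) (Sum.inr (Sum.inr 0)) (s i j)))
        = iteratedDeriv 2 (fun r => comp e (h r) y i j) ρ := h2.symm
    have h1' : evalAt ⟨ambPoint t y ρ, ambPoint_mem ht hyU hρ⟩
        (pdR (ambOpen U ε) (Sum.inr (Sum.inr 0)) (s i j))
        = deriv (fun r => comp e (h r) y i j) ρ := h1.symm
    have hr' : evalAt ⟨ambPoint t y ρ, ambPoint_mem ht hyU hρ⟩ (rFun U ε) = ρ := rfl
    rw [h2', h1', hr', opA, hcv, map_ofNat]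
    ring
  · rw [hric t ht ρ hρ, AA.ric_other a b hab, map_zero]
  · have h1 := congrArg (fun Q : Matrix (Fin n) (Fin n) (smoothRing (ambOpen U ε)) =>
      Q.map (evalAt ⟨ambPoint 1 y ρ, ambPoint_mem one_pos hyU hρ⟩)) hinv
    simp only [Matrix.map_mul] at h1
    rw [Matrix.map_one _ (map_zero _) (map_one _), Matrix.map_add _ (map_add _),
      hs.map_evalAt ⟨ambPoint 1 y ρ, ambPoint_mem one_pos hyU hρ⟩] at h1
    have h2 : (m.map (fromBase U ε)).map
        (evalAt ⟨ambPoint 1 y ρ, ambPoint_mem one_pos hyU hρ⟩) = comp e g y :=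
      W.rep.map_evalAt ⟨y, hyU⟩
    rw [h2] at h1
    exact Matrix.isUnit_det_of_right_inverse h1
  · have h0 : (0 : ℝ) ∈ Set.Ioo (-ε) ε := ⟨neg_lt_zero.mpr hper.eps_pos, hper.eps_pos⟩
    set E : Matrix (Fin n) (Fin n) (smoothRing (ambOpen U ε)) := Matrix.of fun i j =>
      ricMat (pdR (ambOpen U ε)) (conn (pdR (ambOpen U ε)) (ambMat (tFun U ε) (rFun U ε)
        (m.map (fromBase U ε) + s)) (ambInv (tInv U ε) (rFun U ε) (m'.map (fromBase U ε) -
          X.map (fromBase U ε) * f * (X.map (fromBase U ε))ᵀ)))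
        (Sum.inr (Sum.inl i)) (Sum.inr (Sum.inl j)) with hE
    obtain ⟨r, hr⟩ := W.ric
    have hr' : ricMat (fun i => pdR (ambOpen U ε) (Sum.inr (Sum.inl i)))
        (fun i => (conn (pdR U) m m' i).map (fromBase U ε)) =
        m.map (fromBase U ε) * X.map (fromBase U ε) * r.map (fromBase U ε) *
          (m.map (fromBase U ε) * X.map (fromBase U ε))ᵀ := by
      rw [hricx, hr.eq]
      simp only [Matrix.map_mul, Matrix.transpose_map]
    have hbox := AA.frame.box_frameTensor AA.flat (AA.frame.ric_mul hr') AA.tensor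
    have hdd := AA.tensor_dr.map_derivation (d := fun i => pdR (ambOpen U ε) (Sum.inr (Sum.inl i)))
      (δ := pdR (ambOpen U ε) (Sum.inr (Sum.inr 0))) (fun _ _ => pdR_comm _ _ _) AA.dr_θ AA.dr_G
      AA.dr_X
    -- Each summand of the tangential Ricci tensor (the ρ-derivatives of h, its Laplacian and Ric)
    -- is a tensor with values in the null distribution, hence trace free.
    have htr : ∑ i, ∑ j, m'.map (fromBase U ε) i j * E i j = 0 := by
      have h1 := AA.frame.sum_inv_mul_frame hdd.eq
      have h2 := AA.frame.sum_inv_mul_frame AA.tensor_dr.eq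
      have h3 := AA.frame.sum_inv_mul_frame hbox.eq
      have h4 := AA.frame.sum_inv_mul_frame hr'
      have h5 : ∀ i j, m'.map (fromBase U ε) i j * E i j =
          (1 / 2 : ℝ) • (2 * rFun U ε * (m'.map (fromBase U ε) i j * (s.map (pdR (ambOpen U ε)
            (Sum.inr (Sum.inr 0)))).map (pdR (ambOpen U ε) (Sum.inr (Sum.inr 0))) i j) +
          (2 - (Fintype.card (Fin n) : ℝ)) • (m'.map (fromBase U ε) i j *
            s.map (pdR (ambOpen U ε) (Sum.inr (Sum.inr 0))) i j) -
          m'.map (fromBase U ε) i j * boxMat (fun i => pdR (ambOpen U ε) (Sum.inr (Sum.inl i)))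
            (fun i => (conn (pdR U) m m' i).map (fromBase U ε)) (m'.map (fromBase U ε)) s i j +
          2 * (m'.map (fromBase U ε) i j * ricMat (fun i => pdR (ambOpen U ε) (Sum.inr (Sum.inl i)))
            (fun i => (conn (pdR U) m m' i).map (fromBase U ε)) i j)) := by
        intro i j
        rw [hE, Matrix.of_apply, AA.ric_xx]
        simp only [Matrix.map_apply, Algebra.smul_def]
        ring
      simp only [h5, ← Finset.smul_sum, Finset.sum_add_distrib, Finset.sum_sub_distrib,
        ← Finset.mul_sum, h1, h2, h3, h4]
      simp
    have hk := congrArg (evalAt ⟨ambPoint t y 0, ambPoint_mem ht hyU h0⟩)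
      (iterate_derivation_sum (δ := pdR (ambOpen U ε) (Sum.inr (Sum.inr 0)))
        (c := m'.map (fromBase U ε)) (u := E) (fun i j => dr_fromBase _) k)
    rw [htr, iterate_derivation_zero, map_zero, map_sum] at hk
    refine Eq.trans ?_ hk.symm
    refine Finset.sum_congr rfl fun i _ => ?_
    rw [map_sum]
    refine Finset.sum_congr rfl fun j _ => ?_
    rw [map_mul]
    congr 1
    · exact ((W.rep.inv W.frame.inv i j).evalAt ⟨y, hyU⟩).symm
    · exact iteratedDeriv_line ht h0 (ric_ambMetric (h := fun r => comp e (h r)) W.rep hs hinv (Sum.inr (Sum.inl i))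
        (Sum.inr (Sum.inl j))) hyU k

theorem vanishesToOrder_congr {m : ℕ∞} {f f' : ℝ → ℝ} (hε : 0 < ε)
    (hf : ∀ ρ ∈ Set.Ioo (-ε) ε, f ρ = f' ρ) : VanishesToOrder m f ↔ VanishesToOrder m f' := by
  have h1 : f =ᶠ[nhds 0] f' := Filter.eventuallyEq_of_mem
    (Ioo_mem_nhds (neg_lt_zero.mpr hε) hε) hf
  simp only [VanishesToOrder, h1.iteratedDeriv_eq]

theorem vanishesToOrder_const_mul {m : ℕ∞} {f : ℝ → ℝ} {c : ℝ} (hc : c ≠ 0) :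
    VanishesToOrder m (fun ρ => c * f ρ) ↔ VanishesToOrder m f := by
  simp only [VanishesToOrder, iteratedDeriv_const_mul_field, mul_eq_zero, hc, false_or]

theorem isFrameField_of_adapted (hper : IsPerturbation ε h)
    (hA : IsAdapted g N ε h) : ∀ ρ ∈ Set.Ioo (-ε) ε, IsFrameField p g N (h ρ) := fun ρ hρ =>
  IsFrameField.of_lie (fun e he i j => (hper.smooth e he i j).comp
      (contDiff_const.prodMk contDiff_id).contDiffOn fun _ hy => ⟨hρ, hy⟩)
    (hper.symm ρ hρ) (hA ρ hρ).2.1 (hA ρ hρ).2.2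

/-- The Ricci condition reduces to the tangential components, which are half of the linear system.
Nondegeneracy holds because the inverse of g + h(ρ) is explicit, and the trace condition holds at
every order. -/
theorem isAmbientMetric_iff (hn : 3 ≤ n) (H : IsNullRicciWalker p g N)
    (hp : p = 1 ∨ CurvatureAnnihilated g N) (hper : IsPerturbation ε h)
    (hF : ∀ ρ ∈ Set.Ioo (-ε) ε, IsFrameField p g N (h ρ)) :
    IsAmbientMetric g ε h ↔ SolvesLinearSystem g h := by
  constructor
  · intro hA e he y hy i j
    have h1 := hA.ricci e he y hy 1 one_pos (Sum.inr (Sum.inl i)) (Sum.inr (Sum.inl j))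
    rw [vanishesToOrder_congr hper.eps_pos fun ρ hρ =>
      (ambRic_of_adapted hn H hp hper hF he hy).1 1 one_pos ρ hρ i j,
      vanishesToOrder_const_mul (by norm_num)] at h1
    exact h1
  · intro hL
    refine ⟨hper, fun ρ hρ x v hv => ?_, fun e he y hy t ht a b => ?_, fun _ e he y hy t ht => ?_⟩
    · have hec : chartAt (EuclideanSpace ℝ (Fin n)) x ∈ charts n M :=
        IsManifold.chart_mem_maximalAtlas _
      have hx := mem_chart_source (EuclideanSpace ℝ (Fin n)) x
      refine eq_zero_of_isUnit_comp (b := g + h ρ) hec hx ?_ v fun w => ?_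
      · rw [comp_add]
        exact (ambRic_of_adapted hn H hp hper hF hec
          ((chartAt (EuclideanSpace ℝ (Fin n)) x).map_source hx)).2.2.1 ρ hρ
      · refine Eq.trans ?_ (hv w)
        change g x w v + h ρ x w v = _
        rw [H.metric.symm x w v, hper.symm ρ hρ x w v]
    · have hAR := ambRic_of_adapted hn H hp hper hF he hy
      by_cases hab : ∃ i j, a = Sum.inr (Sum.inl i) ∧ b = Sum.inr (Sum.inl j)
      · obtain ⟨i, j, rfl, rfl⟩ := hab
        rw [vanishesToOrder_congr hper.eps_pos fun ρ hρ => hAR.1 t ht ρ hρ i j,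
          vanishesToOrder_const_mul (by norm_num)]
        exact hL e he y hy i j
      · push Not at hab
        rw [vanishesToOrder_congr (f' := fun _ => 0) hper.eps_pos fun ρ hρ =>
          hAR.2.1 t ht ρ hρ a b fun i j => fun h => hab i j h.1 h.2]
        intro k _
        simp
    · have hAR := (ambRic_of_adapted hn H hp hper hF he hy).2.2.2 t ht (n / 2 - 1)
      simp only [ambRicCoeff, leadingCoeff, mul_div_assoc', ← Finset.sum_div]
      rw [hAR, zero_div]

end AdaptedEquations

/-! ### Borel summation -/

section Borel

variable {E : Type*} [NormedAddCommGroup E] [NormedSpace ℝ E]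

theorem exists_bound_iteratedFDeriv {f : E → ℝ} (hf : ContDiff ℝ ∞ f) (hc : HasCompactSupport f)
    (m : ℕ) : ∃ B, ∀ x, ‖iteratedFDeriv ℝ m f x‖ ≤ B :=
  (hc.iteratedFDeriv m).exists_bound_of_continuous
    (hf.continuous_iteratedFDeriv (mod_cast le_top))

/-- A compactly supported function that coincides with `ρ ^ (k + 1)` near `0` and whose derivatives
up to order `k` are small. -/
structure IsCutPower (η : ℝ) (k : ℕ) (u : ℝ → ℝ) : Prop where
  smooth : ContDiff ℝ ∞ u
  compact : HasCompactSupport u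
  small : ∀ ρ, u ρ ≠ 0 → |ρ| ≤ η
  eq_pow : u =ᶠ[nhds 0] fun ρ => ρ ^ (k + 1)
  bound : ∀ m ≤ k, ∀ ρ, ‖iteratedDeriv m u ρ‖ ≤ η

/-- Rescale one fixed cut-off monomial w: the m-th derivative of ε^{k+1}w(ρ/ε) is
ε^{k+1-m}w⁽ᵐ⁾(ρ/ε), which is small with ε as long as m ≤ k. -/
theorem exists_isCutPower (k : ℕ) {η : ℝ} (hη : 0 < η) : ∃ u, IsCutPower η k u := by
  let χ : ContDiffBump (0 : ℝ) := ⟨1, 2, one_pos, one_lt_two⟩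
  set w : ℝ → ℝ := fun s => s ^ (k + 1) * χ s with hw
  have hws : ContDiff ℝ ∞ w := (contDiff_id.pow _).mul χ.contDiff
  have hwc : HasCompactSupport w := χ.hasCompactSupport.mul_left
  choose B hB using exists_bound_iteratedFDeriv hws hwc
  have hB0 : ∀ m, 0 ≤ B m := fun m => (norm_nonneg _).trans (hB m 0)
  set C := ∑ m ∈ Finset.range (k + 1), B m with hC
  have hC0 : 0 ≤ C := Finset.sum_nonneg fun m _ => hB0 m
  -- The support has radius 2ε, and for ε ≤ 1 the derivatives up to order `k` are at most ε times
  -- their common bound `C`.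
  obtain ⟨ε, hε, hε1, hε2, hε3⟩ : ∃ ε : ℝ, 0 < ε ∧ ε ≤ 1 ∧ 2 * ε ≤ η ∧ ε * C ≤ η := by
    refine ⟨min 1 (η / (2 + C)), lt_min one_pos (by positivity), min_le_left _ _, ?_, ?_⟩
    · have h1 : η / (2 + C) ≤ η / 2 := by gcongr; linarith
      linarith [min_le_right 1 (η / (2 + C))]
    · calc min 1 (η / (2 + C)) * C ≤ η / (2 + C) * (2 + C) := by
            gcongr
            · exact min_le_right _ _
            · linarith
        _ = η := by field_simp
  refine ⟨fun ρ => ε ^ (k + 1) * w (ε⁻¹ * ρ),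
    contDiff_const.mul (hws.comp (contDiff_const.mul contDiff_id)), ?_, fun ρ hρ => ?_, ?_,
    fun m hm ρ => ?_⟩
  · have h1 : HasCompactSupport fun ρ => w (ε⁻¹ * ρ) :=
      hwc.comp_homeomorph (Homeomorph.mulLeft₀ ε⁻¹ (inv_ne_zero hε.ne'))
    exact h1.mul_left
  · by_contra hlt
    apply hρ
    have h1 : χ (ε⁻¹ * ρ) = 0 := by
      refine χ.zero_of_le_dist ?_
      change 2 ≤ _
      rw [Real.dist_eq, sub_zero, abs_mul, abs_of_pos (inv_pos.mpr hε), ← div_eq_inv_mul,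
        le_div_iff₀ hε]
      linarith
    simp [hw, h1]
  · have h1 : Filter.Tendsto (fun ρ => ε⁻¹ * ρ) (nhds 0) (nhds 0) := by
      have : Continuous fun ρ => ε⁻¹ * ρ := by fun_prop
      simpa using this.tendsto 0
    filter_upwards [h1.eventually χ.eventuallyEq_one] with ρ hρ
    change ε ^ (k + 1) * ((ε⁻¹ * ρ) ^ (k + 1) * χ (ε⁻¹ * ρ)) = _
    rw [hρ, Pi.one_apply, mul_one, ← mul_pow, mul_inv_cancel_left₀ hε.ne']
  · rw [iteratedDeriv_const_mul_field, iteratedDeriv_comp_const_mul (hws.of_le (mod_cast le_top))]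
    have h1 := hB m (ε⁻¹ * ρ)
    rw [norm_iteratedFDeriv_eq_norm_iteratedDeriv] at h1
    have h2 : B m ≤ C := Finset.single_le_sum (fun m _ => hB0 m) (by simpa using hm)
    have h3 : ε ^ (k + 1) * (ε⁻¹ ^ m * iteratedDeriv m w (ε⁻¹ * ρ)) =
        ε ^ (k + 1 - m) * iteratedDeriv m w (ε⁻¹ * ρ) := by
      rw [pow_sub₀ _ hε.ne' (by omega), inv_pow]
      ring
    rw [h3, norm_mul, norm_pow, Real.norm_of_nonneg hε.le]
    calc ε ^ (k + 1 - m) * ‖iteratedDeriv m w (ε⁻¹ * ρ)‖ ≤ ε * C := by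
          gcongr
          · exact pow_le_of_le_one hε.le hε1 (by omega)
          · exact h1.trans h2
      _ ≤ η := hε3

theorem iteratedDeriv_tsum_real {f : ℕ → ℝ → ℝ} {v : ℕ → ℕ → ℝ} (hf : ∀ k, ContDiff ℝ ∞ (f k))
    (hv : ∀ m, Summable (v m)) (hb : ∀ m k ρ, ‖iteratedDeriv m (f k) ρ‖ ≤ v m k) (m : ℕ) :
    iteratedDeriv m (fun ρ => ∑' k, f k ρ) = fun ρ => ∑' k, iteratedDeriv m (f k) ρ := by
  induction m with
  | zero => simp only [iteratedDeriv_zero]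
  | succ m ih =>
    rw [iteratedDeriv_succ, ih]
    simp only [iteratedDeriv_succ]
    refine deriv_tsum (u := v (m + 1)) (y₀ := 0) (hv _)
      (fun k => (hf k).differentiable_iteratedDeriv m (mod_cast WithTop.coe_lt_top _))
      (fun k ρ => ?_) (Summable.of_norm_bounded (hv m) fun k => hb m k 0)
    rw [← iteratedDeriv_succ]
    exact hb _ _ _

variable {η : ℕ → ℝ} {u : ℕ → ℝ → ℝ}

theorem iteratedDeriv_cutPower_tsum (hu : ∀ k, IsCutPower (η k) k (u k)) {c : ℕ → ℝ}
    (hc : Summable fun k => η k * c k) (m : ℕ) :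
    iteratedDeriv m (fun ρ => ∑' k, u k ρ * c k) 0 =
      m.factorial * (if m = 0 then 0 else c (m - 1)) := by
  have hη : ∀ k, 0 ≤ η k := fun k => (norm_nonneg _).trans ((hu k).bound 0 (Nat.zero_le _) 0)
  choose B hB using fun k => exists_bound_iteratedFDeriv (hu k).smooth (hu k).compact
  have hder : ∀ m k ρ, iteratedDeriv m (fun ρ => u k ρ * c k) ρ = iteratedDeriv m (u k) ρ * c k := by
    intro m k ρ
    simp only [mul_comm _ (c k)]
    rw [iteratedDeriv_const_mul_field]
  -- The smallness of u_k controls the derivatives of order m only for k ≥ m. The finitely many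
  -- remaining terms get the crude bounds `B`, which do not affect summability.
  rw [iteratedDeriv_tsum_real (f := fun k ρ => u k ρ * c k)
    (v := fun m k => if m ≤ k then |η k * c k| else B k m * |c k|)
    (fun k => (hu k).smooth.mul contDiff_const) (fun m => ?_) (fun m k ρ => ?_)]
  -- Near 0 the function u_k is ρ^{k+1}, so only k = m - 1 contributes to the m-th derivative at 0.
  · have h1 : ∀ k, iteratedDeriv m (fun ρ => u k ρ * c k) 0 =
        if m = k + 1 then (m.factorial : ℝ) * c k else 0 := by
      intro k
      rw [hder, (hu k).eq_pow.iteratedDeriv_eq, iteratedDeriv_fun_pow_zero]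
      split_ifs with h
      · rw [h]
      · rw [Nat.cast_zero, zero_mul]
    simp only [h1]
    rcases m with _ | m
    · simp
    · rw [tsum_eq_single m]
      · simp
      · intro k hk
        rw [if_neg]
        omega
  · refine (summable_congr_cofinite ?_).mpr hc.abs
    rw [Nat.cofinite_eq_atTop]
    filter_upwards [Filter.eventually_ge_atTop m] with k hk
    rw [if_pos hk]
  · rw [hder, norm_mul]
    split_ifs with h
    · rw [abs_mul, abs_of_nonneg (hη k)]
      exact mul_le_mul_of_nonneg_right ((hu k).bound m h ρ) (abs_nonneg _)
    · refine mul_le_mul_of_nonneg_right ?_ (abs_nonneg _)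
      rw [← norm_iteratedFDeriv_eq_norm_iteratedDeriv]
      exact hB k m ρ

theorem norm_iteratedFDeriv_comp_fst_le {u : ℝ → ℝ} (hu : ContDiff ℝ ∞ u) (m : ℕ) (q : ℝ × E) :
    ‖iteratedFDeriv ℝ m (fun q : ℝ × E => u q.1) q‖ ≤ ‖iteratedDeriv m u q.1‖ := by
  have h1 := (ContinuousLinearMap.fst ℝ ℝ E).iteratedFDeriv_comp_right hu q
    (i := m) (mod_cast le_top)
  have h2 : (u ∘ (ContinuousLinearMap.fst ℝ ℝ E)) = fun q : ℝ × E => u q.1 := rfl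
  rw [h2] at h1
  rw [h1, ← norm_iteratedFDeriv_eq_norm_iteratedDeriv]
  refine (ContinuousMultilinearMap.norm_compContinuousLinearMap_le _ _).trans ?_
  refine mul_le_of_le_one_right (norm_nonneg _) (Finset.prod_le_one (fun _ _ => norm_nonneg _)
    fun _ _ => ContinuousLinearMap.norm_fst_le ℝ ℝ E)

theorem norm_iteratedFDeriv_comp_snd_le {f : E → ℝ} (hf : ContDiff ℝ ∞ f) (m : ℕ) (q : ℝ × E) :
    ‖iteratedFDeriv ℝ m (fun q : ℝ × E => f q.2) q‖ ≤ ‖iteratedFDeriv ℝ m f q.2‖ := by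
  have h1 := (ContinuousLinearMap.snd ℝ ℝ E).iteratedFDeriv_comp_right hf q
    (i := m) (mod_cast le_top)
  have h2 : (f ∘ (ContinuousLinearMap.snd ℝ ℝ E)) = fun q : ℝ × E => f q.2 := rfl
  rw [h2] at h1
  rw [h1]
  refine (ContinuousMultilinearMap.norm_compContinuousLinearMap_le _ _).trans ?_
  refine mul_le_of_le_one_right (norm_nonneg _) (Finset.prod_le_one (fun _ _ => norm_nonneg _)
    fun _ _ => ContinuousLinearMap.norm_snd_le ℝ ℝ E)

/-- Borel's lemma for countably many sequences of compactly supported functions, with the same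
cut-off for all of them. -/
theorem exists_borel_scale {J : Type*} [Countable J] {F : J → ℕ → E → ℝ}
    (hF : ∀ j k, ContDiff ℝ ∞ (F j k)) (hc : ∀ j k, HasCompactSupport (F j k)) :
    ∃ η : ℕ → ℝ, (∀ k, 0 < η k) ∧ Filter.Tendsto η Filter.atTop (nhds 0) ∧
      (∀ j y, Summable fun k => η k * F j k y) ∧
      ∀ u : ℕ → ℝ → ℝ, (∀ k, IsCutPower (η k) k (u k)) → ∀ j,
        ContDiff ℝ ∞ fun q : ℝ × E => ∑' k, u k q.1 * F j k q.2 := by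
  obtain ⟨code, hcode⟩ := exists_injective_nat J
  choose B hB using fun j k => exists_bound_iteratedFDeriv (hF j k) (hc j k)
  have hB0 : ∀ j k m, 0 ≤ B j k m := fun j k m => (norm_nonneg _).trans (hB j k m 0)
  -- A diagonal choice: at stage k only the finitely many indices with code at most k are taken into
  -- account. Each index is included from some stage on, which suffices for convergence.
  let S : ℕ → Finset J := fun k => ((Set.finite_Iic k).preimage hcode.injOn).toFinset
  set C : ℕ → ℝ := fun k => ∑ j ∈ S k, ∑ i ∈ Finset.range (k + 1), B j k i with hC
  have hC0 : ∀ k, 0 ≤ C k := fun k =>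
    Finset.sum_nonneg fun j _ => Finset.sum_nonneg fun i _ => hB0 j k i
  have hBC : ∀ j k i, code j ≤ k → i ≤ k → B j k i ≤ C k := fun j k i hj hi =>
    (Finset.single_le_sum (f := fun i => B j k i) (fun i _ => hB0 j k i)
      (Finset.mem_range.mpr (Nat.lt_succ_of_le hi))).trans
    (Finset.single_le_sum (f := fun j => ∑ i ∈ Finset.range (k + 1), B j k i)
      (fun j _ => Finset.sum_nonneg fun i _ => hB0 j k i) (by simpa [S] using hj))
  -- The factor (1/2)ᵏ gives summability. The divisor 2ᵏ absorbs the sum 2ᵐ ≤ 2ᵏ of the binomial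
  -- coefficients in the Leibniz formula, and 1 + C_k absorbs the derivatives of the coefficients.
  set η : ℕ → ℝ := fun k => (1 / 2) ^ k / (2 ^ k * (1 + C k)) with hη
  have hη0 : ∀ k, 0 < η k := fun k => by
    have := hC0 k
    simp only [hη]; positivity
  have hη1 : ∀ k, 2 ^ k * (η k * C k) ≤ (1 / 2) ^ k := fun k => by
    have := hC0 k
    calc 2 ^ k * (η k * C k) ≤ 2 ^ k * (η k * (1 + C k)) := by gcongr; linarith [hη0 k]
      _ = (1 / 2) ^ k := by simp only [hη]; field_simp
  have hη2 : ∀ k, η k ≤ (1 / 2) ^ k := fun k => by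
    refine div_le_self (by positivity) ?_
    exact one_le_mul_of_one_le_of_one_le (one_le_pow₀ one_le_two) (by linarith [hC0 k])
  refine ⟨η, hη0, ?_, fun j y => ?_, fun u hu j => ?_⟩
  · exact squeeze_zero (fun k => (hη0 k).le) hη2
      (tendsto_pow_atTop_nhds_zero_of_lt_one (by norm_num) (by norm_num))
  · refine Summable.of_norm_bounded_eventually_nat (g := fun k => (1 / 2 : ℝ) ^ k)
      summable_geometric_two ?_
    filter_upwards [Filter.eventually_ge_atTop (code j)] with k hk
    have h1 := hB j k 0 y
    rw [norm_iteratedFDeriv_zero] at h1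
    rw [norm_mul, Real.norm_of_nonneg (hη0 k).le]
    calc η k * ‖F j k y‖ ≤ 1 * (η k * C k) := by
          rw [one_mul]
          exact mul_le_mul_of_nonneg_left (h1.trans (hBC j k 0 hk (Nat.zero_le _))) (hη0 k).le
      _ ≤ 2 ^ k * (η k * C k) := by
          refine mul_le_mul_of_nonneg_right (one_le_pow₀ one_le_two)
            (mul_nonneg (hη0 k).le (hC0 k))
      _ ≤ _ := hη1 k
  · refine contDiff_tsum_of_eventually (N := ⊤) (v := fun _ k => (1 / 2 : ℝ) ^ k)
      (fun k => ((hu k).smooth.comp contDiff_fst).mul ((hF j k).comp contDiff_snd))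
      (fun _ _ => summable_geometric_two) fun m _ => ?_
    rw [Nat.cofinite_eq_atTop]
    filter_upwards [Filter.eventually_ge_atTop (max (code j) m)] with k hk q
    have hk1 : code j ≤ k := (le_max_left _ _).trans hk
    have hk2 : m ≤ k := (le_max_right _ _).trans hk
    refine (norm_iteratedFDeriv_mul_le (N := ∞) ((hu k).smooth.comp contDiff_fst)
      ((hF j k).comp contDiff_snd) q (mod_cast le_top)).trans ?_
    calc _ ≤ ∑ i ∈ Finset.range (m + 1), (m.choose i : ℝ) * (η k * C k) := by
          refine Finset.sum_le_sum fun i hi => ?_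
          have hi' : i ≤ m := Nat.lt_succ_iff.mp (Finset.mem_range.mp hi)
          rw [mul_assoc]
          refine mul_le_mul_of_nonneg_left (mul_le_mul ?_ ?_ (norm_nonneg _) (hη0 k).le)
            (Nat.cast_nonneg _)
          · exact (norm_iteratedFDeriv_comp_fst_le (hu k).smooth i q).trans
              ((hu k).bound i (hi'.trans hk2) q.1)
          · exact (norm_iteratedFDeriv_comp_snd_le (hF j k) (m - i) q).trans
              ((hB j k (m - i) q.2).trans (hBC j k _ hk1 ((Nat.sub_le _ _).trans hk2)))
      _ = 2 ^ m * (η k * C k) := by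
          rw [← Finset.sum_mul]
          congr 1
          exact_mod_cast Nat.sum_range_choose m
      _ ≤ 2 ^ k * (η k * C k) := by
          refine mul_le_mul_of_nonneg_right (pow_le_pow_right₀ one_le_two hk2)
            (mul_nonneg (hη0 k).le (hC0 k))
      _ ≤ _ := hη1 k

end Borel

/-! ### Families with prescribed Taylor coefficients -/

section BorelFamily

open TopologicalSpace (Opens)

universe u

variable {n : ℕ} {M : Type u} [TopologicalSpace M] [ChartedSpace (EuclideanSpace ℝ (Fin n)) M]
  [IsManifold (𝓡 n) ∞ M]

theorem contDiff_bump_mul {c : EuclideanSpace ℝ (Fin n)} (ψ : ContDiffBump c)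
    {U : Set (EuclideanSpace ℝ (Fin n))} (hU : IsOpen U) (hψ : Metric.closedBall c ψ.rOut ⊆ U)
    {f : EuclideanSpace ℝ (Fin n) → ℝ} (hf : ContDiffOn ℝ ∞ f U) :
    ContDiff ℝ ∞ fun y => ψ y * f y := by
  rw [contDiff_iff_contDiffAt]
  intro y
  by_cases hy : y ∈ U
  · exact ψ.contDiff.contDiffAt.mul (hf.contDiffAt (hU.mem_nhds hy))
  · have h1 : y ∉ tsupport ψ := fun h => hy (hψ (ψ.tsupport_eq ▸ h))
    have h2 : (fun y => ψ y * f y) =ᶠ[nhds y] fun _ => 0 := by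
      filter_upwards [notMem_tsupport_iff_eventuallyEq.mp h1] with z hz
      rw [hz, Pi.zero_apply, zero_mul]
    exact contDiffAt_const.congr_of_eventuallyEq h2

theorem exists_bump_cover [SecondCountableTopology M] :
    ∃ (s : Set M) (_ : s.Countable) (c : M → EuclideanSpace ℝ (Fin n))
      (ψ : (x : M) → ContDiffBump (c x)),
      (∀ x, Metric.closedBall (c x) (ψ x).rOut ⊆
        (chartAt (EuclideanSpace ℝ (Fin n)) x).target) ∧
      ∀ x : M, ∃ z ∈ s, x ∈ (chartAt (EuclideanSpace ℝ (Fin n)) z).source ∧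
        chartAt (EuclideanSpace ℝ (Fin n)) z x ∈ Metric.ball (c z) (ψ z).rIn := by
  let c : M → EuclideanSpace ℝ (Fin n) := fun x => chartAt (EuclideanSpace ℝ (Fin n)) x x
  have hr : ∀ x, ∃ r > 0, Metric.closedBall (c x) r ⊆
      (chartAt (EuclideanSpace ℝ (Fin n)) x).target := fun x =>
    Metric.nhds_basis_closedBall.mem_iff.mp ((chartAt (EuclideanSpace ℝ (Fin n)) x).open_target.mem_nhds
      (mem_chart_target _ x))
  choose r hr0 hr using hr
  let ψ : (x : M) → ContDiffBump (c x) := fun x => ⟨r x / 2, r x, half_pos (hr0 x), half_lt_self (hr0 x)⟩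
  obtain ⟨s, hs, hcov⟩ := TopologicalSpace.countable_cover_nhds
    (f := fun x : M => (chartAt (EuclideanSpace ℝ (Fin n)) x).source ∩
      chartAt (EuclideanSpace ℝ (Fin n)) x ⁻¹' Metric.ball (c x) (ψ x).rIn) fun x =>
    ((chartAt (EuclideanSpace ℝ (Fin n)) x).isOpen_inter_preimage Metric.isOpen_ball).mem_nhds
      ⟨mem_chart_source _ x, Metric.mem_ball_self (ψ x).rIn_pos⟩
  refine ⟨s, hs, c, ψ, hr, fun x => ?_⟩
  have hx : x ∈ ⋃ z ∈ s, _ := hcov ▸ Set.mem_univ x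
  simp only [Set.mem_iUnion] at hx
  obtain ⟨z, hz, hx⟩ := hx
  exact ⟨z, hz, hx⟩

theorem transpose_mul_mul_apply (J B : Matrix (Fin n) (Fin n) ℝ) (i j : Fin n) :
    (Jᵀ * B * J) i j = ∑ a, ∑ b, J a i * J b j * B a b := by
  simp only [Matrix.mul_apply, Matrix.transpose_apply, Finset.sum_mul]
  rw [Finset.sum_comm]
  exact Finset.sum_congr rfl fun a _ => Finset.sum_congr rfl fun b _ => by ring

/-- The cut-offs depend on ρ only, with scales chosen for all charts of a countable cover at once.
Hence each h(ρ) is a finite linear combination of the `T k` with constant coefficients, and linear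
conditions on the `T k` pass to it. Bump functions in x occur only in the estimates. -/
theorem exists_borel_family [SecondCountableTopology M] {T : ℕ → BilinField n M}
    (hT : ∀ k, ∀ e ∈ charts n M, ∀ i j, ContDiffOn ℝ ∞ (fun y => comp e (T k) y i j) e.target) :
    ∃ h : ℝ → BilinField n M,
      (∀ ρ, ∃ (t : Finset ℕ) (a : ℕ → ℝ), h ρ = ∑ k ∈ t, a k • T k) ∧ h 0 = 0 ∧
      (∀ e ∈ charts n M, ∀ i j,
        ContDiffOn ℝ ∞ (fun q : ℝ × EuclideanSpace ℝ (Fin n) => comp e (h q.1) q.2 i j)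
          (Set.univ ×ˢ e.target)) ∧
      ∀ e ∈ charts n M, ∀ y ∈ e.target, ∀ i j m,
        iteratedDeriv m (fun ρ => comp e (h ρ) y i j) 0 =
          m.factorial * (if m = 0 then 0 else comp e (T (m - 1)) y i j) := by
  obtain ⟨s, hs, c, ψ, hψ, hcov⟩ := exists_bump_cover (n := n) (M := M)
  have := hs.to_subtype
  set E : M → OpenPartialHomeomorph M (EuclideanSpace ℝ (Fin n)) :=
    fun x => chartAt (EuclideanSpace ℝ (Fin n)) x with hE
  have hEc : ∀ x, E x ∈ charts n M := fun x => IsManifold.chart_mem_maximalAtlas x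
  let F : s × Fin n × Fin n → ℕ → EuclideanSpace ℝ (Fin n) → ℝ := fun J k y =>
    ψ J.1 y * comp (E J.1) (T k) y J.2.1 J.2.2
  obtain ⟨η, hη, hη0, hηs, hηF⟩ := exists_borel_scale (F := F)
    (fun J k => contDiff_bump_mul (ψ J.1) (E J.1).open_target (hψ J.1)
      (hT k (E J.1) (hEc J.1) J.2.1 J.2.2))
    (fun J k => (ψ J.1).hasCompactSupport.mul_right)
  choose u hu using fun k => exists_isCutPower k (hη k)
  -- The supports shrink to 0, so only finitely many terms survive at ρ ≠ 0. At ρ = 0 every u_k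
  -- vanishes, since it is ρ^{k+1} there.
  have hfin : ∀ ρ, {k | u k ρ ≠ 0}.Finite := by
    intro ρ
    rcases eq_or_ne ρ 0 with rfl | hρ
    · convert Set.finite_empty (α := ℕ)
      ext k
      simp [(hu k).eq_pow.eq_of_nhds]
    · obtain ⟨K, hK⟩ := Filter.eventually_atTop.mp (hη0.eventually_lt_const (abs_pos.mpr hρ))
      refine (Set.finite_lt_nat K).subset fun k hk => ?_
      by_contra hlt
      exact absurd (hK k (not_lt.mp hlt)) (not_lt.mpr ((hu k).small ρ hk))
  set h : ℝ → BilinField n M := fun ρ => ∑ k ∈ (hfin ρ).toFinset, u k ρ • T k with hh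
  have hcomp : ∀ e y i j ρ, comp e (h ρ) y i j = ∑' k, u k ρ * comp e (T k) y i j := by
    intro e y i j ρ
    rw [tsum_eq_sum (s := (hfin ρ).toFinset), hh]
    · simp only [comp_sum, comp_smul, Matrix.sum_apply, Matrix.smul_apply, smul_eq_mul]
    · intro k hk
      have : u k ρ = 0 := by simpa using hk
      rw [this, zero_mul]
  -- On the inner balls, which cover the manifold, the bump functions are 1 and the truncated
  -- coefficients are the true components.
  have hF1 : ∀ z : s, ∀ y ∈ Metric.ball (c z) (ψ z).rIn, ∀ a b k,
      F (z, a, b) k y = comp (E z) (T k) y a b := fun z y hy a b k => by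
    change ψ z y * _ = _
    rw [(ψ z).one_of_mem_closedBall (Metric.ball_subset_closedBall hy), one_mul]
  refine ⟨h, fun ρ => ⟨_, _, rfl⟩, ?_, fun e he i j => ?_, fun e he y hy i j m => ?_⟩
  · have : (hfin 0).toFinset = ∅ := by
      ext k
      simp [(hu k).eq_pow.eq_of_nhds]
    rw [hh]
    simp only [this, Finset.sum_empty]
  · rintro ⟨ρ, y⟩ ⟨-, hy⟩
    obtain ⟨z, hz, hx1, hx2⟩ := hcov (e.symm y)
    have hyo : y ∈ overlap e (E z) := ⟨hy, hx1⟩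
    have ht := contDiffOn_transition he (hEc z)
    have hV : {q : ℝ × EuclideanSpace ℝ (Fin n) | q.2 ∈ overlap e (E z) ∧
        transition e (E z) q.2 ∈ Metric.ball (c z) (ψ z).rIn} ∈ nhds (ρ, y) := by
      have h1 : ∀ᶠ y' in nhds y, y' ∈ overlap e (E z) ∧
          transition e (E z) y' ∈ Metric.ball (c z) (ψ z).rIn := by
        refine Filter.Eventually.and ((overlap e (E z)).isOpen.mem_nhds hyo) ?_
        exact (ht.continuousOn.continuousAt ((overlap e (E z)).isOpen.mem_nhds hyo)).eventually
          (Metric.isOpen_ball.mem_nhds hx2)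
      have h2 : Filter.Tendsto Prod.snd (nhds (ρ, y)) (nhds y) := continuous_snd.continuousAt
      exact h2.eventually h1
    have hev : (fun q : ℝ × EuclideanSpace ℝ (Fin n) => comp e (h q.1) q.2 i j) =ᶠ[nhds (ρ, y)]
        fun q => ∑ a, ∑ b, jac (transition e (E z)) q.2 a i * jac (transition e (E z)) q.2 b j *
          ∑' k, u k q.1 * F (⟨z, hz⟩, a, b) k (transition e (E z) q.2) := by
      filter_upwards [hV] with q hq
      rw [comp_transition he (hEc z) _ hq.1, transpose_mul_mul_apply]
      simp only [hcomp, hF1 ⟨z, hz⟩ _ hq.2]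
    have hJ : ∀ a b, ContDiffAt ℝ ∞ (fun y => jac (transition e (E z)) y a b) y := fun a b =>
      ((repM_jac ht a b).contDiffOn).contDiffAt ((overlap e (E z)).isOpen.mem_nhds hyo)
    have htt : ContDiffAt ℝ ∞ (fun q : ℝ × EuclideanSpace ℝ (Fin n) =>
        (q.1, transition e (E z) q.2)) (ρ, y) :=
      contDiffAt_fst.prodMk (ContDiffAt.comp (g := transition e (E z)) (ρ, y)
        (ht.contDiffAt ((overlap e (E z)).isOpen.mem_nhds hyo)) contDiffAt_snd)
    refine ContDiffAt.contDiffWithinAt (ContDiffAt.congr_of_eventuallyEq ?_ hev)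
    refine ContDiffAt.sum fun a _ => ContDiffAt.sum fun b _ => ContDiffAt.mul (ContDiffAt.mul ?_ ?_) ?_
    · exact (hJ a i).comp (ρ, y) contDiffAt_snd
    · exact (hJ b j).comp (ρ, y) contDiffAt_snd
    · exact ((hηF u hu (⟨z, hz⟩, a, b)).contDiffAt).comp (ρ, y) htt
  · obtain ⟨z, hz, hx1, hx2⟩ := hcov (e.symm y)
    have hyo : y ∈ overlap e (E z) := ⟨hy, hx1⟩
    simp only [hcomp]
    refine iteratedDeriv_cutPower_tsum hu ?_ m
    have hc : ∀ k, η k * comp e (T k) y i j = ∑ a, ∑ b, jac (transition e (E z)) y a i *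
        jac (transition e (E z)) y b j * (η k * F (⟨z, hz⟩, a, b) k (transition e (E z) y)) := by
      intro k
      rw [comp_transition he (hEc z) _ hyo, transpose_mul_mul_apply, Finset.mul_sum]
      refine Finset.sum_congr rfl fun a _ => ?_
      rw [Finset.mul_sum]
      refine Finset.sum_congr rfl fun b _ => ?_
      rw [hF1 ⟨z, hz⟩ (transition e (E z) y) hx2]
      ring
    simp only [hc]
    exact summable_sum fun a _ => summable_sum fun b _ => (hηs _ _).mul_left _

end BorelFamily

/-! ### The constructed ambient metric -/

section Jets

variable {ι R : Type*} [Fintype ι] [DecidableEq ι] [CommRing R] [Algebra ℝ R]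
  {d : ι → Derivation ℝ R R} {δ : Derivation ℝ R R}

theorem boxMat_map_derivation (hd : ∀ i f, δ (d i f) = d i (δ f)) {A : ι → Matrix ι ι R}
    {G' : Matrix ι ι R} (hA : ∀ k i j, δ (A k i j) = 0) (hG' : ∀ i j, δ (G' i j) = 0)
    (S : Matrix ι ι R) : (boxMat d A G' S).map δ = boxMat d A G' (S.map δ) := by
  have h1 : ∀ S : Matrix ι ι R, ∀ k, (cov d A S k).map δ = cov d A (S.map δ) k := by
    intro S k
    ext i j
    simp only [cov, Matrix.map_apply, Matrix.sub_apply, Matrix.mul_apply, Matrix.transpose_apply,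
      map_sub, map_sum, Derivation.leibniz, smul_eq_mul, hA, mul_zero, add_zero, zero_add, hd]
    simp only [mul_comm]
  have h2 : ∀ (T : ι → Matrix ι ι R) l k, (cov3 d A T l k).map δ =
      cov3 d A (fun k => (T k).map δ) l k := by
    intro T l k
    ext i j
    simp only [cov3, Matrix.map_apply, Matrix.sub_apply, Matrix.mul_apply, Matrix.transpose_apply,
      Matrix.sum_apply, Matrix.smul_apply, smul_eq_mul,
      map_sub, map_sum, Derivation.leibniz, hA, mul_zero, add_zero, zero_add, hd]
    simp only [mul_comm]
  ext i j
  have h3 : ∀ l k, δ (cov3 d A (cov d A S) l k i j) = cov3 d A (cov d A (S.map δ)) l k i j := by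
    intro l k
    have := congrFun (congrFun (h2 (cov d A S) l k) i) j
    simp only [Matrix.map_apply, h1] at this
    exact this
  simp only [boxMat, Matrix.map_apply, Matrix.sum_apply, Matrix.smul_apply, smul_eq_mul, map_sum,
    Derivation.leibniz, hG', mul_zero, add_zero, h3]

theorem boxMat_map_iterate (hd : ∀ i f, δ (d i f) = d i (δ f)) {A : ι → Matrix ι ι R}
    {G' : Matrix ι ι R} (hA : ∀ k i j, δ (A k i j) = 0) (hG' : ∀ i j, δ (G' i j) = 0)
    (S : Matrix ι ι R) (k : ℕ) : (boxMat d A G' S).map δ^[k] = boxMat d A G' (S.map δ^[k]) := by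
  induction k with
  | zero => simp
  | succ k ih =>
    have h1 : ∀ Q : Matrix ι ι R, Q.map δ^[k + 1] = (Q.map δ^[k]).map δ := fun Q => by
      ext i j; simp only [Matrix.map_apply, Function.iterate_succ_apply']
    rw [h1, h1, ih, boxMat_map_derivation hd hA hG']

theorem box_const_smul (G S : EuclideanSpace ℝ ι → Matrix ι ι ℝ) (c : ℝ) :
    box G (fun z => c • S z) = fun y => c • box G S y := by
  have hpd : ∀ (i : ι) (f : EuclideanSpace ℝ ι → ℝ) y, pd i (fun z => c * f z) y = c * pd i f y := by
    intro i f y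
    have h : (fun z => c * f z) = c • f := rfl
    rw [pd, h, fderiv_const_smul_field]
    rfl
  have h1 : ∀ k i j y, cov2 G (fun z => c • S z) k i j y = c * cov2 G S k i j y := by
    intro k i j y
    simp only [cov2, Matrix.smul_apply, smul_eq_mul, hpd, mul_sub, Finset.mul_sum]
    congr 1
    exact Finset.sum_congr rfl fun l _ => by ring
  have h2 : ∀ l k i j y, cov2cov2 G (fun z => c • S z) l k i j y = c * cov2cov2 G S l k i j y := by
    intro l k i j y
    have h3 : cov2 G (fun z => c • S z) k i j = fun y => c * cov2 G S k i j y :=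
      funext fun y => h1 k i j y
    simp only [cov2cov2, h1, h3, hpd, mul_sub, Finset.mul_sum]
    congr 1
    exact Finset.sum_congr rfl fun l _ => by ring
  funext y
  ext i j
  simp only [box, Matrix.of_apply, Matrix.smul_apply, smul_eq_mul, h2, Finset.mul_sum]
  exact Finset.sum_congr rfl fun l _ => Finset.sum_congr rfl fun k _ => by ring

/-- The Leibniz rule for a linear factor. The truncated subtraction is harmless, as the factor m
vanishes when m = 0. -/
theorem iteratedDeriv_id_mul {f : ℝ → ℝ} (hf : ContDiff ℝ ∞ f) (m : ℕ) :
    iteratedDeriv m (fun ρ => ρ * f ρ) 0 = m * iteratedDeriv (m - 1) f 0 := by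
  have hd : ∀ k, Differentiable ℝ (iteratedDeriv k f) := fun k =>
    hf.differentiable_iteratedDeriv k (mod_cast WithTop.coe_lt_top _)
  have h : ∀ m : ℕ, iteratedDeriv m (fun ρ => ρ * f ρ) = fun ρ =>
      ρ * iteratedDeriv m f ρ + m * iteratedDeriv (m - 1) f ρ := by
    intro m
    induction m with
    | zero => simp
    | succ m ih =>
      rw [iteratedDeriv_succ, ih]
      funext ρ
      have h1 : HasDerivAt (fun ρ => ρ * iteratedDeriv m f ρ)
          (1 * iteratedDeriv m f ρ + ρ * iteratedDeriv (m + 1) f ρ) ρ := by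
        rw [iteratedDeriv_succ]
        exact (hasDerivAt_id ρ).mul (hd m ρ).hasDerivAt
      have h2 : HasDerivAt (fun ρ => (m : ℝ) * iteratedDeriv (m - 1) f ρ)
          (m * iteratedDeriv m f ρ) ρ := by
        rcases m with _ | m
        · simpa using hasDerivAt_const ρ (0 : ℝ)
        · rw [iteratedDeriv_succ (n := m), Nat.add_sub_cancel]
          exact (hd m ρ).hasDerivAt.const_mul _
      rw [(h1.fun_add h2).deriv, Nat.add_sub_cancel]
      push_cast
      ring
  rw [h]
  simp

end Jets

/-- The Taylor coefficients of the solution of the Fefferman-Graham equations. -/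
def fgCoeff (n : ℕ) : ℕ → ℝ
  | 0 => -2
  | k + 1 => fgCoeff n k / ((k + 1) * (2 * (k + 1) - n))

/-- Below the critical order no divisor 2(k + 1) - n is zero. The case k = n/2 - 1 gives the nonzero
constant in the obstruction tensor. -/
theorem fgCoeff_ne_zero {n k : ℕ} (hk : 2 * k < n) : fgCoeff n k ≠ 0 := by
  induction k with
  | zero => norm_num [fgCoeff]
  | succ k ih =>
    refine div_ne_zero (ih (by omega)) (mul_ne_zero (by positivity) ?_)
    have : (2 * (k + 1 : ℕ) : ℝ) < n := by exact_mod_cast hk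
    push_cast at this
    linarith

/-- The left-hand side is the coefficient of ρᵏ □ᵏRic in 𝒜(h) + 2Ric. At the critical order 2(k + 1)
= n the factor in front of c_{k+1} is zero, so -c_k remains whatever c_{k+1} is. As the definition
then divides by zero, the coefficients vanish from there on. -/
theorem fgCoeff_recursion (n k : ℕ) :
    (k + 1) * (2 * (k + 1) - n) * fgCoeff n (k + 1) - fgCoeff n k =
      if 2 * (k + 1) = n then -fgCoeff n k else 0 := by
  split_ifs with h
  · have : (2 * (k + 1) - n : ℝ) = 0 := by
      rw [← h]; push_cast; ring
    rw [this]; ring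
  · have h1 : (2 * (k + 1) - n : ℝ) ≠ 0 := by
      rw [sub_ne_zero]; exact_mod_cast h
    have h2 : (k + 1 : ℝ) ≠ 0 := by positivity
    rw [fgCoeff, mul_div_cancel₀ _ (mul_ne_zero h2 h1), sub_self]

/-! ### The Laplacian of a family and its ρ-derivatives -/

section Family

open TopologicalSpace (Opens)

variable {n : ℕ} {U : Opens (EuclideanSpace ℝ (Fin n))} {ε : ℝ}
  {G : EuclideanSpace ℝ (Fin n) → Matrix (Fin n) (Fin n) ℝ}
  {h : ℝ → EuclideanSpace ℝ (Fin n) → Matrix (Fin n) (Fin n) ℝ}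
  {m m' : Matrix (Fin n) (Fin n) (smoothRing U)}
  {s : Matrix (Fin n) (Fin n) (smoothRing (ambOpen U ε))}

theorem evalAt_box {ρ : ℝ} (hρ : ρ ∈ Set.Ioo (-ε) ε) (hm : RepM G m) (hmm : m * m' = 1)
    {S : EuclideanSpace ℝ (Fin n) → Matrix (Fin n) (Fin n) ℝ}
    (hS : RepM S (s.map (slice U ε one_pos hρ))) {y : EuclideanSpace ℝ (Fin n)} (hy : y ∈ U)
    (i j : Fin n) : evalAt ⟨ambPoint 1 y ρ, ambPoint_mem one_pos hy hρ⟩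
      (boxMat (fun i => pdR (ambOpen U ε) (Sum.inr (Sum.inl i)))
        (fun i => (conn (pdR U) m m' i).map (fromBase U ε)) (m'.map (fromBase U ε)) s i j) =
      box G S y i j := by
  have h3 := congrFun (congrFun (boxMat_slice (s := s) (m' := m') one_pos hρ
    (conn (pdR U) m m')) i) j
  rw [Matrix.map_apply] at h3
  rw [← evalAt_slice one_pos hρ ⟨y, hy⟩, h3]
  exact (repM_box hm hmm hS i j).evalAt ⟨y, hy⟩

theorem box_family_eventuallyEq (hm : RepM G m) (hmm : m * m' = 1)
    (hs : RepM (fun z => h (z (Sum.inr (Sum.inr 0))) (ambX z)) s) {ρ : ℝ}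
    (hρ : ρ ∈ Set.Ioo (-ε) ε) {y : EuclideanSpace ℝ (Fin n)} (hy : y ∈ U) (i j : Fin n) :
    (fun r => box G (h r) y i j) =ᶠ[nhds ρ] fun r => lift
      (boxMat (fun i => pdR (ambOpen U ε) (Sum.inr (Sum.inl i)))
        (fun i => (conn (pdR U) m m' i).map (fromBase U ε)) (m'.map (fromBase U ε)) s i j)
      (ambPoint 1 y r) := by
  refine Filter.eventuallyEq_of_mem (isOpen_Ioo.mem_nhds hρ) fun r hr => ?_
  rw [← evalAt_box hr hm hmm (repM_slice hs one_pos hr) hy]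
  exact (rep_lift _).evalAt ⟨ambPoint 1 y r, ambPoint_mem one_pos hy hr⟩

theorem contDiffAt_box (hm : RepM G m) (hmm : m * m' = 1)
    (hs : RepM (fun z => h (z (Sum.inr (Sum.inr 0))) (ambX z)) s) {ρ : ℝ}
    (hρ : ρ ∈ Set.Ioo (-ε) ε) {y : EuclideanSpace ℝ (Fin n)} (hy : y ∈ U) (i j : Fin n) :
    ContDiffAt ℝ ∞ (fun r => box G (h r) y i j) ρ := by
  refine ContDiffAt.congr_of_eventuallyEq ?_ (box_family_eventuallyEq hm hmm hs hρ hy i j)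
  have h1 : ContDiff ℝ ∞ fun r => ambPoint 1 y r := by
    refine (contDiff_piLp 2).mpr fun a => ?_
    rcases a with a | a | a
    exacts [contDiff_const, contDiff_const, contDiff_id]
  exact ContDiffAt.comp ρ (((rep_lift _).contDiffOn).contDiffAt
    ((ambOpen U ε).isOpen.mem_nhds (ambPoint_mem one_pos hy hρ))) h1.contDiffAt

/-- The background metric does not depend on ρ, so its Laplacian commutes with ∂_ρ. The identity is
proved in the ring of functions on the ambient domain and evaluated at t = 1. -/
theorem iteratedDeriv_box (hm : RepM G m) (hmm : m * m' = 1)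
    (hs : RepM (fun z => h (z (Sum.inr (Sum.inr 0))) (ambX z)) s) {ρ : ℝ}
    (hρ : ρ ∈ Set.Ioo (-ε) ε) {k : ℕ} {S : EuclideanSpace ℝ (Fin n) → Matrix (Fin n) (Fin n) ℝ}
    (hS : ∀ z ∈ U, ∀ i j, S z i j = iteratedDeriv k (fun r => h r z i j) ρ)
    {y : EuclideanSpace ℝ (Fin n)} (hy : y ∈ U) (i j : Fin n) :
    iteratedDeriv k (fun r => box G (h r) y i j) ρ = box G S y i j := by
  rw [(box_family_eventuallyEq hm hmm hs hρ hy i j).iteratedDeriv_eq,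
    iteratedDeriv_line one_pos hρ (rep_lift _) hy]
  have h2 := congrFun (congrFun (boxMat_map_iterate
    (d := fun i => pdR (ambOpen U ε) (Sum.inr (Sum.inl i)))
    (δ := pdR (ambOpen U ε) (Sum.inr (Sum.inr 0)))
    (A := fun i => (conn (pdR U) m m' i).map (fromBase U ε)) (G' := m'.map (fromBase U ε))
    (fun _ _ => pdR_comm _ _ _) (fun _ _ _ => dr_fromBase _) (fun _ _ => dr_fromBase _) s k) i) j
  rw [Matrix.map_apply] at h2
  rw [h2]
  refine evalAt_box hρ hm hmm (fun i j z => ?_) hy i j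
  exact (hS z z.2 i j).trans (iteratedDeriv_line one_pos hρ (hs i j) z.2 k)

end Family

/-! ### The solution built from iterated Laplacians of the Ricci tensor -/

section Existence

open TopologicalSpace (Opens)

universe u

variable {n p : ℕ} {M : Type u} [TopologicalSpace M] [ChartedSpace (EuclideanSpace ℝ (Fin n)) M]
  [IsManifold (𝓡 n) ∞ M] {e : OpenPartialHomeomorph M (EuclideanSpace ℝ (Fin n))}
  {g : BilinField n M} {N : SubspaceField n M} {ε : ℝ} {h : ℝ → BilinField n M}

/-- The Taylor coefficients of `𝒜(h) + 2 Ric` for a family `h` with Taylor coefficients that are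
multiples of the iterated Laplacians of the Ricci tensor. -/
theorem iteratedDeriv_opA (hn : 3 ≤ n) (H : IsNullRicciWalker p g N)
    (hp : p = 1 ∨ CurvatureAnnihilated g N) (hper : IsPerturbation ε h)
    (hF : ∀ ρ, IsFrameField p g N (h ρ))
    (hsm : ∀ e ∈ charts n M, ∀ y ∈ e.target, ∀ i j,
      ContDiff ℝ ∞ fun ρ => comp e (h ρ) y i j)
    (hj : ∀ e ∈ charts n M, ∀ y ∈ e.target, ∀ i j m,
      iteratedDeriv m (fun ρ => comp e (h ρ) y i j) 0 = m.factorial *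
        (if m = 0 then 0 else fgCoeff n m * boxRic (comp e g) (m - 1) y i j))
    (he : e ∈ charts n M) {y : EuclideanSpace ℝ (Fin n)} (hy : y ∈ e.target) (i j : Fin n) (m : ℕ) :
    iteratedDeriv m (fun ρ => opA (comp e g) (fun r => comp e (h r)) i j ρ y +
      2 * ric (comp e g) y i j) 0 =
      if 2 * (m + 1) = n then -(m.factorial * (fgCoeff n m * boxRic (comp e g) m y i j)) else 0 := by
  have h0 : (0 : ℝ) ∈ Set.Ioo (-ε) ε := ⟨neg_lt_zero.mpr hper.eps_pos, hper.eps_pos⟩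
  obtain ⟨U, hyU, hUt, m₀, m', X, L, θ, W⟩ := exists_walkerData hn H hp he hy
  obtain ⟨s, hs⟩ := exists_repM_family (U := U) (h := fun r => comp e (h r)) (ε := ε)
    fun i j => (hper.smooth e he i j).mono (Set.prod_mono le_rfl hUt)
  set f : ℝ → ℝ := fun ρ => comp e (h ρ) y i j with hf
  have hfs : ContDiff ℝ ∞ f := hsm e he y hy i j
  have hfd : ∀ k, ContDiff ℝ ∞ (iteratedDeriv k f) := fun k => by
    rw [iteratedDeriv_eq_iterate]; exact hfs.iterate_deriv k
  have hadd : ∀ k l, iteratedDeriv k (iteratedDeriv l f) = iteratedDeriv (k + l) f := fun k l => by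
    simp only [iteratedDeriv_eq_iterate, Function.iterate_add_apply]
  have hbs : ContDiffAt ℝ ∞ (fun r => box (comp e g) (comp e (h r)) y i j) 0 :=
    contDiffAt_box (h := fun r => comp e (h r)) W.rep W.frame.inv hs h0 hyU i j
  have hb : iteratedDeriv m (fun r => box (comp e g) (comp e (h r)) y i j) 0 =
      m.factorial * (if m = 0 then 0 else fgCoeff n m * boxRic (comp e g) m y i j) := by
    have h1 := iteratedDeriv_box (h := fun r => comp e (h r)) W.rep W.frame.inv hs h0 (k := m)
      (S := fun z => (m.factorial * (if m = 0 then 0 else fgCoeff n m) : ℝ) •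
        boxRic (comp e g) (m - 1) z) (fun z hz i j => by
          rw [hj e he z (hUt z hz) i j m, Matrix.smul_apply, smul_eq_mul]
          split_ifs <;> ring) hyU i j
    rw [h1, box_const_smul]
    simp only [Matrix.smul_apply, smul_eq_mul]
    rcases m with _ | m
    · simp
    · rw [boxRic_succ]; simp [mul_assoc]
  have hop : (fun ρ => opA (comp e g) (fun r => comp e (h r)) i j ρ y + 2 * ric (comp e g) y i j) =
      fun ρ => 2 * (ρ * iteratedDeriv 2 f ρ) + (2 - (n : ℝ)) * iteratedDeriv 1 f ρ -
        box (comp e g) (comp e (h ρ)) y i j + 2 * ric (comp e g) y i j := by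
    funext ρ
    rw [opA, IsFrameField.curvTerm_eq_zero hn H hp (hF ρ) he hy i j, iteratedDeriv_one,
      Fintype.card_fin]
    ring
  have hC : ∀ {q : ℝ → ℝ}, ContDiffAt ℝ ∞ q 0 → ContDiffAt ℝ m q 0 := fun hq =>
    hq.of_le (mod_cast le_top)
  have h2s : ContDiff ℝ ∞ fun ρ => 2 * (ρ * iteratedDeriv 2 f ρ) :=
    contDiff_const.mul (contDiff_id.mul (hfd 2))
  have h1s : ContDiff ℝ ∞ fun ρ => (2 - (n : ℝ)) * iteratedDeriv 1 f ρ :=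
    contDiff_const.mul (hfd 1)
  rw [hop, iteratedDeriv_fun_add (hC ((h2s.add h1s).contDiffAt.sub hbs)) (hC contDiffAt_const),
    iteratedDeriv_fun_sub (hC (h2s.add h1s).contDiffAt) (hC hbs),
    iteratedDeriv_fun_add (hC h2s.contDiffAt) (hC h1s.contDiffAt),
    iteratedDeriv_const_mul_field, iteratedDeriv_const_mul_field, iteratedDeriv_id_mul (hfd 2),
    hadd, hadd, hb, iteratedDeriv_const]
  have hm1 : iteratedDeriv (m + 1) f 0 = (m + 1).factorial *
      (fgCoeff n (m + 1) * boxRic (comp e g) m y i j) := by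
    rw [hf, hj e he y hy, if_neg (Nat.succ_ne_zero m), Nat.add_sub_cancel]
  -- The index m - 1 + 2 equals m + 1 except for m = 0, where the factor m is zero.
  have hm2 : (m : ℝ) * iteratedDeriv (m - 1 + 2) f 0 = m * iteratedDeriv (m + 1) f 0 := by
    rcases m with _ | m
    · simp
    · rfl
  have hrec := fgCoeff_recursion n m
  rw [hm2, hm1]
  -- At order 0 the term 2Ric plays the part of -□h. The initial value c_0 = -2 is chosen so that
  -- the recursion covers this case.
  have hz : (if m = 0 then 2 * ric (comp e g) y i j else 0) -
      (m.factorial : ℝ) * (if m = 0 then 0 else fgCoeff n m * boxRic (comp e g) m y i j) =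
      - m.factorial * (fgCoeff n m * boxRic (comp e g) m y i j) := by
    rcases m with _ | m
    · simp [fgCoeff, boxRic]
    · simp
  have hgoal : 2 * (m * ((m + 1).factorial * (fgCoeff n (m + 1) * boxRic (comp e g) m y i j))) +
      (2 - (n : ℝ)) * ((m + 1).factorial * (fgCoeff n (m + 1) * boxRic (comp e g) m y i j)) -
      m.factorial * (if m = 0 then 0 else fgCoeff n m * boxRic (comp e g) m y i j) +
      (if m = 0 then 2 * ric (comp e g) y i j else 0) =
      m.factorial * boxRic (comp e g) m y i j *
        ((m + 1) * (2 * (m + 1) - n) * fgCoeff n (m + 1) - fgCoeff n m) := by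
    rw [sub_add_eq_add_sub, add_sub_assoc, hz, Nat.factorial_succ]
    push_cast
    ring
  rw [hgoal, hrec]
  split_ifs <;> ring

theorem exists_fg_family [SecondCountableTopology M] (hn : 3 ≤ n) (H : IsNullRicciWalker p g N)
    (hp : p = 1 ∨ CurvatureAnnihilated g N) : ∃ h : ℝ → BilinField n M,
      IsPerturbation 1 h ∧ (∀ ρ, IsFrameField p g N (h ρ)) ∧
      ∀ e ∈ charts n M, ∀ y ∈ e.target, ∀ i j m,
        iteratedDeriv m (fun ρ => opA (comp e g) (fun r => comp e (h r)) i j ρ y +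
          2 * ric (comp e g) y i j) 0 =
        if 2 * (m + 1) = n then -(m.factorial * (fgCoeff n m * boxRic (comp e g) m y i j))
        else 0 := by
  choose T hT using exists_boxRic_field H.metric
  have hTF : ∀ k, IsFrameField p g N (T k) := fun k => isFrameField_boxRic (hT k)
  have hcomp : ∀ k, ∀ e ∈ charts n M, ∀ y ∈ e.target, comp e (fgCoeff n (k + 1) • T k) y =
      fgCoeff n (k + 1) • boxRic (comp e g) k y := fun k e he y hy => by
    rw [comp_smul, hT k e he y hy]
  obtain ⟨h, hcomb, hzero, hsmooth, hjet⟩ := exists_borel_family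
    (T := fun k => fgCoeff n (k + 1) • T k) fun k e he i j => by
      refine (contDiffOn_const.mul (contDiffOn_boxRic H.metric he k i j)).congr
        (f := fun y => fgCoeff n (k + 1) * boxRic (comp e g) k y i j) fun y hy => ?_
      rw [hcomp k e he y hy, Matrix.smul_apply, smul_eq_mul]
  have hF : ∀ ρ, IsFrameField p g N (h ρ) := fun ρ => by
    obtain ⟨t, a, hta⟩ := hcomb ρ
    rw [hta]
    exact IsFrameField.sum t fun k => ((hTF k).smul _).smul _
  have hper : IsPerturbation 1 h := ⟨one_pos, fun e he i j => (hsmooth e he i j).mono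
    (Set.prod_mono (Set.subset_univ _) le_rfl), fun ρ _ => (hF ρ).symm hn H hp, hzero⟩
  refine ⟨h, hper, hF, fun e he y hy i j m => iteratedDeriv_opA hn H hp hper hF
    (fun e he y hy i j => ?_) (fun e he y hy i j m => ?_) he hy i j m⟩
  · rw [← contDiffOn_univ]
    exact (hsmooth e he i j).comp (contDiff_id.prodMk contDiff_const).contDiffOn
      fun ρ _ => ⟨Set.mem_univ _, hy⟩
  · rw [hjet e he y hy i j m]
    rcases m with _ | m
    · simp
    · simp only [Nat.add_eq_zero_iff, one_ne_zero, and_false, if_false, Nat.add_sub_cancel]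
      rw [hcomp m e he y hy, Matrix.smul_apply, smul_eq_mul]

/-- The only order at which the recursion leaves a defect is n/2 - 1, and the equations are imposed
strictly below it. -/
theorem lt_fgOrder {k : ℕ} (hk : (k : ℕ∞) < fgOrder n) : 2 * (k + 1) ≠ n := by
  rintro rfl
  rw [fgOrder, if_pos (by simp)] at hk
  have : k < 2 * (k + 1) / 2 - 1 := by exact_mod_cast hk
  omega

theorem isAdapted_of_isFrameField (hn : 3 ≤ n) (H : IsNullRicciWalker p g N)
    (hp : p = 1 ∨ CurvatureAnnihilated g N) (hF : ∀ ρ, IsFrameField p g N (h ρ)) :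
    IsAdapted g N ε h := fun ρ _ =>
  ⟨(hF ρ).divergenceFree hn H hp, (hF ρ).imageIn hn H hp, (hF ρ).lieInvariant hn H hp⟩

end Existence

/-! ### The obstruction tensor -/

section Obstruction

open TopologicalSpace (Opens)

universe u

variable {n p : ℕ} {M : Type u} [TopologicalSpace M] [ChartedSpace (EuclideanSpace ℝ (Fin n)) M]
  [IsManifold (𝓡 n) ∞ M] {e : OpenPartialHomeomorph M (EuclideanSpace ℝ (Fin n))}
  {g : BilinField n M} {N : SubspaceField n M} {ε : ℝ} {h : ℝ → BilinField n M}

/-- The equations for an ambient metric in the ring of smooth functions on a coordinate domain. -/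
theorem IsAmbientMetric.exists_ring_solution (hg : IsPseudoRiemannian g) {m : ℕ}
    (hm : n = 2 * (m + 1)) (hA : IsAmbientMetric g ε h) (he : e ∈ charts n M)
    {U : Opens (EuclideanSpace ℝ (Fin n))} (hU : ∀ y ∈ U, y ∈ e.target) {δ t : ℝ}
    (hδ : δ ≤ ε) (ht : 0 < t) (h0 : (0 : ℝ) ∈ Set.Ioo (-δ) δ)
    {g₀ g₀' : Matrix (Fin n) (Fin n) (smoothRing U)} (hg₀ : RepM (comp e g) g₀)
    (hg₀' : g₀ * g₀' = 1) : ∃ G G' E : Matrix (Fin n) (Fin n) (smoothRing (ambOpen U δ)),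
      Gᵀ = G ∧ G * G' = 1 ∧ G.map (pdR (ambOpen U δ) (Sum.inl 0)) = 0 ∧
      (∀ i j, G i j - g₀.map (fromBase U δ) i j ∈ RingHom.ker (slice U δ ht h0)) ∧
      (∀ i j, ricMat (pdR (ambOpen U δ)) (conn (pdR (ambOpen U δ)) (ambMat (tFun U δ) (rFun U δ) G)
        (ambInv (tInv U δ) (rFun U δ) G')) (Sum.inr (Sum.inl i)) (Sum.inr (Sum.inl j)) = E i j) ∧
      (∀ i j, E i j ∈ vanishIdeal (pdR (ambOpen U δ) (Sum.inr (Sum.inr 0)))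
        (RingHom.ker (slice U δ ht h0)) m) ∧
      (∑ a, ∑ b, g₀'.map (fromBase U δ) a b * E b a ∈
        vanishIdeal (pdR (ambOpen U δ) (Sum.inr (Sum.inr 0)))
          (RingHom.ker (slice U δ ht h0)) (m + 1)) ∧
      ∀ (y : U) i j k, evalAt ⟨ambPoint t y 0, ambPoint_mem ht y.2 h0⟩
        ((pdR (ambOpen U δ) (Sum.inr (Sum.inr 0)))^[k] (E i j)) =
        iteratedDeriv k (fun ρ => ambRic g h e t y ρ (Sum.inr (Sum.inl i)) (Sum.inr (Sum.inl j))) 0 := by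
  have hsub : Set.Ioo (-δ) δ ⊆ Set.Ioo (-ε) ε := Set.Ioo_subset_Ioo (neg_le_neg hδ) hδ
  have hper := hA.perturbation
  obtain ⟨s, hs⟩ := exists_repM_family (U := U) (h := fun r => comp e (h r)) (ε := δ)
    fun i j => (hper.smooth e he i j).mono (Set.prod_mono hsub hU)
  -- The kernel of the restriction to ρ = 0 for the chosen t serves as the ideal of functions
  -- vanishing to first order in ρ. Fixing t suffices, since the argument needs the ideal to be
  -- stable only under the x-derivatives.
  have hker : ∀ f : smoothRing (ambOpen U δ), f ∈ RingHom.ker (slice U δ ht h0) ↔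
      ∀ y : U, evalAt ⟨ambPoint t y 0, ambPoint_mem ht y.2 h0⟩ f = 0 := fun f => by
    rw [RingHom.mem_ker]
    constructor
    · intro hf y
      rw [← evalAt_slice ht h0 y, hf, map_zero]
    · intro hf
      refine ext_evalAt fun y => ?_
      rw [evalAt_slice, hf y, map_zero]
  set G := g₀.map (fromBase U δ) + s with hG
  have hGe : ∀ z : ambOpen U δ, G.map (evalAt z) =
      comp e (g + h ((z : EuclideanSpace ℝ (AmbIdx n)) (Sum.inr (Sum.inr 0)))) (ambX z) := by
    intro z
    rw [hG, Matrix.map_add _ (map_add _), hs.map_evalAt z, comp_add]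
    congr 1
    exact hg₀.map_evalAt ⟨ambX z, z.2.2.1⟩
  have hGT : Gᵀ = G := by
    refine matrix_ext_evalAt fun z => ?_
    rw [Matrix.transpose_map, hGe]
    refine comp_transpose (fun x v w => ?_) e _
    change g x v w + h _ x v w = g x w v + h _ x w v
    rw [hg.symm x v w, hper.symm _ (hsub z.2.2.2) x v w]
  have hGi : G * G⁻¹ = 1 := mul_inv_of_forall fun z => by
    rw [hGe]
    refine isUnit_comp (fun v w => ?_) (fun v hv => ?_) he (hU _ z.2.2.1)
    · change g _ v w + h _ _ v w = g _ w v + h _ _ w v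
      rw [hg.symm _ v w, hper.symm _ (hsub z.2.2.2) _ v w]
    · exact hA.nondegenerate _ (hsub z.2.2.2) _ v hv
  set E : Matrix (Fin n) (Fin n) (smoothRing (ambOpen U δ)) := Matrix.of fun i j =>
    ricMat (pdR (ambOpen U δ)) (conn (pdR (ambOpen U δ)) (ambMat (tFun U δ) (rFun U δ) G)
      (ambInv (tInv U δ) (rFun U δ) G⁻¹)) (Sum.inr (Sum.inl i)) (Sum.inr (Sum.inl j)) with hE
  have hEv : ∀ (y : U) i j k, evalAt ⟨ambPoint t y 0, ambPoint_mem ht y.2 h0⟩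
      ((pdR (ambOpen U δ) (Sum.inr (Sum.inr 0)))^[k] (E i j)) =
      iteratedDeriv k (fun ρ => ambRic g h e t y ρ (Sum.inr (Sum.inl i)) (Sum.inr (Sum.inl j))) 0 :=
    fun y i j k => (iteratedDeriv_line ht h0 (ric_ambMetric (h := fun r => comp e (h r)) hg₀ hs hGi
      (Sum.inr (Sum.inl i)) (Sum.inr (Sum.inl j))) y.2 k).symm
  have hne : Even n := ⟨m + 1, by omega⟩
  have hnm : n / 2 - 1 = m := by omega
  have hlow : ∀ (y : U) i j, ∀ k < m, iteratedDeriv k (fun ρ => ambRic g h e t y ρ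
      (Sum.inr (Sum.inl i)) (Sum.inr (Sum.inl j))) 0 = 0 := by
    intro y i j k hk
    refine hA.ricci e he y (hU y y.2) t ht _ _ k ?_
    rw [fgOrder, if_pos hne, hnm]
    exact_mod_cast hk
  refine ⟨G, G⁻¹, E, hGT, hGi, ?_, fun i j => ?_, fun _ _ => rfl, fun i j => ?_, ?_, hEv⟩
  · rw [hG, Matrix.map_add _ (map_add _), family_dt (h := fun r => comp e (h r)) hs, add_zero]
    exact Matrix.ext fun i j => dt_fromBase _
  · rw [hG, Matrix.add_apply, add_sub_cancel_left, hker]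
    intro y
    refine ((hs i j).evalAt ⟨ambPoint t y 0, ambPoint_mem ht y.2 h0⟩).trans ?_
    change comp e (h 0) _ i j = 0
    rw [hper.zero, comp_zero]
    rfl
  · rw [vanishIdeal_iff]
    intro k hk
    rw [hker]
    intro y
    rw [hEv, hlow y i j k hk]
  · rw [vanishIdeal_iff]
    intro k hk
    rw [hker]
    intro y
    have hsum : ∑ a, ∑ b, g₀'.map (fromBase U δ) a b * E b a =
        ∑ a, ∑ b, g₀'.map (fromBase U δ) a b * Eᵀ a b := rfl
    have hinv : ∀ a b, evalAt ⟨ambPoint t y 0, ambPoint_mem ht y.2 h0⟩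
        (g₀'.map (fromBase U δ) a b) = (comp e g y)⁻¹ a b := fun a b =>
      (hg₀.inv hg₀' a b).evalAt y
    have hT : ((comp e g y)⁻¹)ᵀ = (comp e g y)⁻¹ := by
      rw [Matrix.transpose_nonsing_inv, comp_transpose hg.symm e y]
    rw [hsum, iterate_derivation_sum (δ := pdR (ambOpen U δ) (Sum.inr (Sum.inr 0)))
      (c := g₀'.map (fromBase U δ)) (u := Eᵀ) (fun _ _ => dr_fromBase _)]
    simp only [map_sum, map_mul, Matrix.transpose_apply, hEv, hinv]
    -- Below order m the trace vanishes with the whole tensor. At order m its vanishing is exactly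
    -- the trace condition in the definition of ambient metrics.
    rcases Nat.lt_succ_iff_lt_or_eq.mp hk with hk | rfl
    · simp only [hlow y _ _ k hk, mul_zero, Finset.sum_const_zero]
    · have h1 := hA.trace hne e he y (hU y y.2) t ht
      simp only [ambRicCoeff, leadingCoeff, hnm, mul_div_assoc', ← Finset.sum_div] at h1
      rw [div_eq_zero_iff, or_iff_left (Nat.cast_ne_zero.mpr (Nat.factorial_ne_zero _))] at h1
      rw [Finset.sum_comm]
      refine Eq.trans ?_ h1
      refine Finset.sum_congr rfl fun a _ => Finset.sum_congr rfl fun b _ => ?_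
      have h2 : (comp e g y)⁻¹ b a = (comp e g y)⁻¹ a b := congrFun (congrFun hT a) b
      rw [h2]

/-- The leading coefficient of the Ricci tensor does not depend on the ambient metric. -/
theorem ambRicCoeff_unique (hn : 3 ≤ n) (hne : Even n) (hg : IsPseudoRiemannian g)
    {ε₁ ε₂ : ℝ} {h₁ h₂ : ℝ → BilinField n M} (hA₁ : IsAmbientMetric g ε₁ h₁)
    (hA₂ : IsAmbientMetric g ε₂ h₂) (he : e ∈ charts n M) {y : EuclideanSpace ℝ (Fin n)}
    (hy : y ∈ e.target) {t : ℝ} (ht : 0 < t) (i j : Fin n) :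
    ambRicCoeff g h₁ e t y i j = ambRicCoeff g h₂ e t y i j := by
  obtain ⟨m, hm⟩ : ∃ m, n = 2 * (m + 1) := by
    obtain ⟨k, hk⟩ := hne
    exact ⟨k - 1, by omega⟩
  have hnm : n / 2 - 1 = m := by omega
  set U : Opens (EuclideanSpace ℝ (Fin n)) := ⟨e.target, e.open_target⟩ with hU
  -- Both metrics are restricted to a common interval in ρ, so that they live over the same ring.
  set δ := min ε₁ ε₂ with hδ
  have hδ0 : 0 < δ := lt_min hA₁.perturbation.eps_pos hA₂.perturbation.eps_pos
  have h0 : (0 : ℝ) ∈ Set.Ioo (-δ) δ := ⟨neg_lt_zero.mpr hδ0, hδ0⟩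
  obtain ⟨g₀, hg₀⟩ := exists_repM (U := U) (M := comp e g) (hg.smooth e he)
  have hg₀' : g₀ * g₀⁻¹ = 1 := mul_inv_of_forall fun z => by
    rw [hg₀.map_evalAt z]; exact isUnit_metric hg he z.2
  have hgB : g₀.map (fromBase U δ) * g₀⁻¹.map (fromBase U δ) = 1 := by
    rw [← Matrix.map_mul, hg₀', Matrix.map_one _ (map_zero _) (map_one _)]
  obtain ⟨G₁, G₁', E₁, hT₁, hi₁, ht₁, hb₁, hE₁, hR₁, htr₁, hev₁⟩ :=
    hA₁.exists_ring_solution hg hm he (U := U) (fun _ h => h) (min_le_left _ _) ht h0 hg₀ hg₀'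
  obtain ⟨G₂, G₂', E₂, hT₂, hi₂, ht₂, hb₂, hE₂, hR₂, htr₂, hev₂⟩ :=
    hA₂.exists_ring_solution hg hm he (U := U) (fun _ h => h) (min_le_right _ _) ht h0 hg₀ hg₀'
  have hρ : rFun U δ ∈ RingHom.ker (slice U δ ht h0) := by
    rw [RingHom.mem_ker]
    refine ext_evalAt fun y => ?_
    rw [evalAt_slice, map_zero]
    rfl
  have hx : ∀ i, ∀ f ∈ RingHom.ker (slice U δ ht h0),
      pdR (ambOpen U δ) (Sum.inr (Sum.inl i)) f ∈ RingHom.ker (slice U δ ht h0) := by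
    intro i f hf
    rw [RingHom.mem_ker] at hf ⊢
    rw [← pdR_slice, hf, map_zero]
  have h1 := fg_unique (ambientCoords U δ) hT₁ hi₁ ht₁ hT₂ hi₂ ht₂ hgB hρ hx hb₁ hb₂
    ((Fintype.card_fin n).trans hm) hE₁ hE₂ hR₁ hR₂ htr₁ htr₂ i j
  have h2 := vanishIdeal_iff.mp h1 m (Nat.lt_succ_self m)
  rw [RingHom.mem_ker] at h2
  have h3 := congrArg (evalAt (⟨y, hy⟩ : U)) h2
  rw [evalAt_slice, iterate_map_sub, map_sub, map_zero, hev₁ ⟨y, hy⟩, hev₂ ⟨y, hy⟩,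
    sub_eq_zero] at h3
  simp only [ambRicCoeff, leadingCoeff, hnm]
  rw [h3]

theorem IsObstructionTensor.unique (hn : 3 ≤ n) (hne : Even n) (hg : IsPseudoRiemannian g) {c : ℝ}
    {O O' : BilinField n M} (hO : IsObstructionTensor c g O) (hO' : IsObstructionTensor c g O') :
    O = O' := by
  obtain ⟨ε, h, hA, hc⟩ := hO
  obtain ⟨ε', h', hA', hc'⟩ := hO'
  refine eq_of_comp_eq fun e he y hy => Matrix.ext fun i j => ?_
  rw [hc e he y hy 1 one_pos, hc' e he y hy 1 one_pos,
    ambRicCoeff_unique hn hne hg hA hA' he hy one_pos]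

/-- The tangential Ricci tensor is half of 𝒜(h) + 2Ric, whose Taylor coefficient at order n/2 - 1 is
the defect -c_{n/2-1} □^{n/2-1}Ric. The factor (n/2 - 1)! from the derivative cancels in
`leadingCoeff`. -/
theorem exists_obstruction [SecondCountableTopology M] (c : ℝ) (hn : 3 ≤ n) (hne : Even n)
    (H : IsNullRicciWalker p g N) (hp : p = 1 ∨ CurvatureAnnihilated g N) :
    ∃ O : BilinField n M, IsObstructionTensor c g O ∧
      (∀ e ∈ charts n M, ∀ y ∈ e.target, comp e O y =
        (-(c * fgCoeff n (n / 2 - 1)) / 2) • boxRic (comp e g) (n / 2 - 1) y) ∧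
      IsFrameField p g N O := by
  obtain ⟨h, hper, hF, hjet⟩ := exists_fg_family hn H hp
  have hA : IsAmbientMetric g 1 h := (isAmbientMetric_iff hn H hp hper fun ρ _ => hF ρ).mpr
    fun e he y hy i j k hk => by rw [hjet e he y hy i j k, if_neg (lt_fgOrder hk)]
  obtain ⟨T, hT⟩ := exists_boxRic_field H.metric (n / 2 - 1)
  have hcomp : ∀ e ∈ charts n M, ∀ y ∈ e.target,
      comp e ((-(c * fgCoeff n (n / 2 - 1)) / 2) • T) y =
        (-(c * fgCoeff n (n / 2 - 1)) / 2) • boxRic (comp e g) (n / 2 - 1) y :=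
    fun e he y hy => by rw [comp_smul, hT e he y hy]
  refine ⟨_, ⟨1, h, hA, fun e he y hy t ht i j => ?_⟩, hcomp, (isFrameField_boxRic hT).smul _⟩
  have h1 : (fun ρ => ambRic g h e t y ρ (Sum.inr (Sum.inl i)) (Sum.inr (Sum.inl j))) =ᶠ[nhds 0]
      fun ρ => 1 / 2 * (opA (comp e g) (fun r => comp e (h r)) i j ρ y +
        2 * ric (comp e g) y i j) :=
    Filter.eventuallyEq_of_mem (Ioo_mem_nhds (by norm_num) one_pos) fun ρ hρ =>
      (ambRic_of_adapted hn H hp hper (fun ρ _ => hF ρ) he hy).1 t ht ρ hρ i j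
  have h2 : 2 * (n / 2 - 1 + 1) = n := by
    obtain ⟨k, rfl⟩ := hne
    omega
  rw [hcomp e he y hy, ambRicCoeff, leadingCoeff, h1.iteratedDeriv_eq,
    iteratedDeriv_const_mul_field, hjet e he y hy, if_pos h2, Matrix.smul_apply, smul_eq_mul]
  have h3 : ((n / 2 - 1).factorial : ℝ) ≠ 0 := Nat.cast_ne_zero.mpr (Nat.factorial_ne_zero _)
  field_simp

end Obstruction

end NullRicciWalker

end

theorem mainTheorem4 (κ : ℕ → ℝ) (hκ : ∀ n, κ n ≠ 0) :
    ∃ c : ℕ → ℝ, (∀ n, c n ≠ 0) ∧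
      ∀ (n p : ℕ), 3 ≤ n →
      ∀ (M : Type*) [TopologicalSpace M] [T2Space M] [SecondCountableTopology M]
        [ChartedSpace (EuclideanSpace ℝ (Fin n)) M] [IsManifold (𝓡 n) ∞ M]
        (g : NullRicciWalker.BilinField n M) (N : NullRicciWalker.SubspaceField n M),
        NullRicciWalker.IsNullRicciWalker p g N →
        (p = 1 ∨ NullRicciWalker.CurvatureAnnihilated g N) →
        (∃ (ε : ℝ) (h : ℝ → NullRicciWalker.BilinField n M),
          NullRicciWalker.IsAmbientMetric g ε h ∧ NullRicciWalker.IsAdapted g N ε h ∧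
          NullRicciWalker.SolvesLinearSystem g h) ∧
        (∀ (ε : ℝ) (h : ℝ → NullRicciWalker.BilinField n M),
          NullRicciWalker.IsPerturbation ε h → NullRicciWalker.IsAdapted g N ε h →
          NullRicciWalker.CurvatureTermVanishes g ε h ∧
          (NullRicciWalker.IsAmbientMetric g ε h ↔ NullRicciWalker.SolvesLinearSystem g h)) ∧
        (Even n → ∃ O : NullRicciWalker.BilinField n M,
          NullRicciWalker.IsObstructionTensor (κ n) g O ∧
          (∀ O' : NullRicciWalker.BilinField n M,
            NullRicciWalker.IsObstructionTensor (κ n) g O' → O' = O) ∧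
          (∀ e ∈ NullRicciWalker.charts n M, ∀ y ∈ e.target,
            NullRicciWalker.comp e O y =
              c n • ((NullRicciWalker.box (NullRicciWalker.comp e g))^[n / 2 - 1]
                (NullRicciWalker.ric (NullRicciWalker.comp e g))) y) ∧
          NullRicciWalker.ImageIn g N O ∧
          NullRicciWalker.ParallelAlong g N O ∧
          NullRicciWalker.LieInvariant N O) := by
  refine ⟨fun n => if 2 < n then -(κ n * NullRicciWalker.fgCoeff n (n / 2 - 1)) / 2 else 1,
    fun n => ?_, fun n p hn M _ _ _ _ _ g N H hp => ⟨?_, fun ε h hper hA => ?_, fun hne => ?_⟩⟩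
  · dsimp only
    split_ifs with h
    · exact div_ne_zero (neg_ne_zero.mpr (mul_ne_zero (hκ n)
        (NullRicciWalker.fgCoeff_ne_zero (by omega)))) two_ne_zero
    · exact one_ne_zero
  · obtain ⟨h, hper, hF, hjet⟩ := NullRicciWalker.exists_fg_family hn H hp
    have hL : NullRicciWalker.SolvesLinearSystem g h := fun e he y hy i j k hk => by
      rw [hjet e he y hy i j k, if_neg (NullRicciWalker.lt_fgOrder hk)]
    exact ⟨1, h, (NullRicciWalker.isAmbientMetric_iff hn H hp hper fun ρ _ => hF ρ).mpr hL,
      NullRicciWalker.isAdapted_of_isFrameField hn H hp hF, hL⟩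
  · have hF := NullRicciWalker.isFrameField_of_adapted (p := p) hper hA
    exact ⟨fun ρ hρ e he y hy i j => (hF ρ hρ).curvTerm_eq_zero hn H hp he hy i j,
      NullRicciWalker.isAmbientMetric_iff hn H hp hper hF⟩
  · obtain ⟨O, hO, hOb, hOF⟩ := NullRicciWalker.exists_obstruction (κ n) hn hne H hp
    refine ⟨O, hO, fun O' hO' => hO'.unique hn hne H.metric hO, fun e he y hy => ?_,
      hOF.imageIn hn H hp, hOF.parallelAlong hn H hp, hOF.lieInvariant hn H hp⟩
    dsimp only
    rw [hOb e he y hy, if_pos (show 2 < n by omega)]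
    rfl
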